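/- **Setting.** Let $p\in(1,\infty)$ and let $\phi:(0,\infty)\times\mathbb R^d\to[0,\infty)$ be convex, with $\phi(\rho,\lambda w)=|\lambda|^p\phi(\rho,w)$ for all $\rho>0$, $\lambda\in\mathbb R$, $w\in\mathbb R^d$, and such that for some $\rho_0>0$ one has $\phi(\rho_0,w)>0$ for all $w\ne0$. Extend $\phi$ by $\phi(0,w)=\sup_{\rho>0}\phi(\rho,w)$ and put $\phi^\infty(\rho,w)=\sup_{c>0}\frac1c\phi(c\rho,cw)$. Let $\gamma$ be a nonnegative Radon measure on $\mathbb R^d$. For a nonnegative Radon measure $\mu$ and an $\mathbb R^d$-valued Radon measure $\nu$, both supported in $\operatorname{supp}\gamma$, with Lebesgue decompositions $\mu=\rho\gamma+\rho^\perp\sigma$, $\nu=w\gamma+w^\perp\sigma$ ($\sigma\perp\gamma$), set $$\Phi(\mu,\nu|\gamma)=\int\phi(\rho,w)\,d\gamma+\int\phi^\infty(\rho^\perp,w^\perp)\,d\sigma ,$$ and $\Phi(\mu,\nu|\gamma)=+\infty$ if $\mu$ or $\nu$ is not supported in $\operatorname{supp}\gamma$. Let $\mathcal{CE}(0,T)$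 be the set of pairs $(\mu,\nu)$ where $t\in[0,T]\mapsto\mu_t$ is a weakly$^*$ continuous curve of nonnegative Radon measures, $(\nu_t)_{t\in(0,T)}$ is a Borel family of $\mathbb R^d$-valued Radon measures with $\int_0^T|\nu_t|(B_R)\,dt<\infty$ for all $R>0$, and $\partial_t\mu_t+\nabla\cdot\nu_t=0$ in the sense of distributions in $\mathbb R^d\times(0,T)$. Set $$\mathcal W_{\phi,\gamma}^p(\mu_0,\mu_1)=\inf\Big\{\int_0^1\Phi(\mu_t,\nu_t|\gamma)\,dt:\ (\mu,\nu)\in\mathcal{CE}(0,1)\text{ joining }\mu_0\text{ to }\mu_1\Big\}\in[0,\infty].$$ A curve $\mu$ of nonnegative Radon measures on $[0,T]$, $T>0$, is absolutely continuous if there is $m\in L^1(0,T)$ with $\mathcal W_{\phi,\gamma}(\mu_{t_1},\mu_{t_0})\le\int_{t_0}^{t_1}m(t)\,dt$ for all $0\le t_0<t_1\le T$. Its metric derivative is $|\mu'_t|=\lim_{h\to0}\mathcal W_{\phi,\gamma}(\mu_{t+h},\mu_t)/|h|$. **Theorem (Absolutely continuous curves and their metric velocity).** Let $t\in[0,T]\mapsto\mu_t$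 be a curve of nonnegative Radon measures on $\mathbb R^d$. 1. $\mu$ is absolutely continuous with respect to $\mathcal W_{\phi,\gamma}$ if and only if there is a Borel family $(\nu_t)_{t\in(0,T)}$ of $\mathbb R^d$-valued Radon measures such that $$(\mu,\nu)\in\mathcal{CE}(0,T)\quad\text{and}\quad\int_0^T\Phi(\mu_t,\nu_t|\gamma)^{1/p}\,dt<\infty.\tag{$*$}$$ 2. In this case $|\mu'_t|$ exists and is finite for a.e. $t\in(0,T)$, and for every $\nu$ satisfying $(*)$ one has $|\mu'_t|^p\le\Phi(\mu_t,\nu_t|\gamma)$ for a.e. $t\in(0,T)$. 3. In this case there is also a Borel family $\tilde\nu$ satisfying $(*)$ such that $|\mu'_t|^p=\Phi(\mu_t,\tilde\nu_t|\gamma)$ for a.e. $t\in(0,T)$. If moreover $\phi$ is strictly convex in $w$, in the sense that $\phi(\rho,\cdot)$ for every $\rho\ge0$ and $\phi^\infty(1,\cdot)$ are strictly convex on the sets where they are finite, then $\tilde\nu$ is unique: every $\nu$ with $(\mu,\nu)\in\mathcal{CE}(0,T)$ and $|\mu'_t|^p=\Phi(\mu_t,\nu_t|\gamma)$ for a.e.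 $t$ satisfies $\nu_t=\tilde\nu_t$ for a.e. $t\in(0,T)$. -/

import Mathlib

open MeasureTheory Filter Topology Set
open scoped ENNReal

noncomputable section

namespace WeightedTransport

/-- Euclidean space `ℝ^d`. -/
abbrev Space (d : ℕ) : Type := EuclideanSpace ℝ (Fin d)

variable {d : ℕ}

/-! ### Radon vector measures -/

/-- An `ℝ^d`-valued Radon measure `ν` on `ℝ^d`, given by its polar decomposition `ν = dir · |ν|`:
its total variation `|ν|` (field `var`), a nonnegative Radon measure, and a Borel vector field
`dir` with Euclidean norm one `|ν|`-almost everywhere. Every Radon vector measure is of this form,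
with a unique `var` and a `var`-a.e. unique `dir`. Two such objects are the same vector measure iff
they have the same values `ν.value B` on bounded Borel sets `B`. -/
structure RadonVectorMeasure (d : ℕ) where
  /-- the total variation measure -/
  var : Measure (Space d)
  /-- the polar density -/
  dir : Space d → Space d
  locallyFinite_var : IsLocallyFiniteMeasure var
  measurable_dir : Measurable dir
  norm_dir : ∀ᵐ x ∂var, ‖dir x‖ = 1

/-- The value `ν(B) = ∫_B dir d|ν| ∈ ℝ^d` on a (bounded Borel) set `B`. -/
def RadonVectorMeasure.value (ν : RadonVectorMeasure d) (B : Set (Space d)) : Space d :=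
  ∫ x in B, ν.dir x ∂ν.var

/-- The pairing `∫ ζ · dν` with a vector field `ζ`. -/
def RadonVectorMeasure.pairing (ν : RadonVectorMeasure d) (ζ : Space d → Space d) : ℝ :=
  ∫ x, inner ℝ (ζ x) (ν.dir x) ∂ν.var

/-- Equality of Radon vector measures as set functions on the bounded Borel sets. -/
def RadonVectorMeasure.SameMeasure (ν ν' : RadonVectorMeasure d) : Prop :=
  ∀ B : Set (Space d), MeasurableSet B → Bornology.IsBounded B → ν.value B = ν'.value B

/-! ### Action densities -/

/-- Admissible action densities `φ : (0,∞) × ℝ^d → [0,∞)` of exponent `p`; only the values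
`φ ρ w` with `ρ > 0` are relevant. -/
structure IsActionDensity (p : ℝ) (φ : ℝ → Space d → ℝ) : Prop where
  nonneg : ∀ ρ : ℝ, 0 < ρ → ∀ w, 0 ≤ φ ρ w
  convex : ConvexOn ℝ (Ioi (0 : ℝ) ×ˢ (univ : Set (Space d))) (fun z => φ z.1 z.2)
  homogeneous : ∀ ρ : ℝ, 0 < ρ → ∀ (c : ℝ) (w : Space d), φ ρ (c • w) = |c| ^ p * φ ρ w
  nondegenerate : ∃ ρ₀ : ℝ, 0 < ρ₀ ∧ ∀ w : Space d, w ≠ 0 → 0 < φ ρ₀ w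

/-- The lower semicontinuous extension of `φ` to `ℝ × ℝ^d`:
`φ(0,w) = sup_{ρ>0} φ(ρ,w)` and `φ(ρ,w) = +∞` for `ρ < 0`. -/
def extDensity (φ : ℝ → Space d → ℝ) (ρ : ℝ) (w : Space d) : ℝ≥0∞ :=
  if 0 < ρ then ENNReal.ofReal (φ ρ w)
  else if ρ = 0 then ⨆ (r : ℝ) (_ : 0 < r), ENNReal.ofReal (φ r w)
  else ⊤

/-- The recession function `φ^∞(ρ,w) = sup_{c>0} φ(cρ,cw)/c`. -/
def recession (φ : ℝ → Space d → ℝ) (ρ : ℝ) (w : Space d) : ℝ≥0∞ :=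
  ⨆ (c : ℝ) (_ : 0 < c), extDensity φ (c * ρ) (c • w) / ENNReal.ofReal c

/-- Strict convexity of an extended-valued function on its effective domain. -/
def StrictlyConvexOnDomain (f : Space d → ℝ≥0∞) : Prop :=
  ∀ w w' : Space d, w ≠ w' → f w < ⊤ → f w' < ⊤ → ∀ a b : ℝ, 0 < a → 0 < b → a + b = 1 →
    f (a • w + b • w') < ENNReal.ofReal a * f w + ENNReal.ofReal b * f w'

/-- `φ` is strictly convex in the flux variable `w`: each `φ(ρ,·)`, `ρ ≥ 0`, and the recession
function `φ^∞(1,·)` are strictly convex on the set where they are finite. -/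
def StrictlyConvexInFlux (φ : ℝ → Space d → ℝ) : Prop :=
  (∀ ρ : ℝ, 0 ≤ ρ → StrictlyConvexOnDomain (extDensity φ ρ)) ∧
    StrictlyConvexOnDomain (recession φ 1)

/-! ### The action functional -/

/-- The measure `σ = μ^⊥ + |ν^⊥|` carrying the parts of `μ` and `ν` singular to `γ`. -/
def singularRef (γ μ : Measure (Space d)) (ν : RadonVectorMeasure d) : Measure (Space d) :=
  μ.singularPart γ + ν.var.singularPart γ

open Classical in
/-- The action functional
`Φ(μ,ν|γ) = ∫ φ(ρ,w) dγ + ∫ φ^∞(ρ^⊥,w^⊥) dσ`, where `μ = ρ γ + ρ^⊥ σ` and `ν = w γ + w^⊥ σ`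
are the Lebesgue decompositions with respect to `γ` (the density of `ν` with respect to a measure
`m` is `(d|ν|/dm) dir`); `Φ(μ,ν|γ) = +∞` if `μ` or `ν` is not supported in `supp γ`. -/
def action (φ : ℝ → Space d → ℝ) (γ μ : Measure (Space d)) (ν : RadonVectorMeasure d) : ℝ≥0∞ :=
  if μ.support ⊆ γ.support ∧ ν.var.support ⊆ γ.support then
    (∫⁻ x, extDensity φ (μ.rnDeriv γ x).toReal ((ν.var.rnDeriv γ x).toReal • ν.dir x) ∂γ) +
    ∫⁻ x, recession φ ((μ.singularPart γ).rnDeriv (singularRef γ μ ν) x).toReal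
      (((ν.var.singularPart γ).rnDeriv (singularRef γ μ ν) x).toReal • ν.dir x)
      ∂(singularRef γ μ ν)
  else ⊤

/-! ### The continuity equation -/

/-- `(μ,ν)` is a solution of the continuity equation `∂ₜμ + ∇·ν = 0` in `ℝ^d × (0,T)`:
`t ∈ [0,T] ↦ μ_t` is a weakly* continuous curve of nonnegative Radon measures, `(ν_t)`,
`t ∈ (0,T)`, is a Borel family of Radon vector measures with locally integrable total variation,
and the equation holds in the sense of distributions. The values of `μ` outside `[0,T]` and of `ν`
outside `(0,T)` are irrelevant. -/
structure ContinuityEq (T : ℝ) (μ : ℝ → Measure (Space d)) (ν : ℝ → RadonVectorMeasure d) :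
    Prop where
  locallyFinite : ∀ t ∈ Icc 0 T, IsLocallyFiniteMeasure (μ t)
  weakStar_continuous : ∀ ζ : Space d → ℝ, Continuous ζ → HasCompactSupport ζ →
    ContinuousOn (fun t => ∫ x, ζ x ∂(μ t)) (Icc 0 T)
  borel : ∀ B : Set (Space d), MeasurableSet B → Bornology.IsBounded B →
    Measurable (fun t : Ioo 0 T => (ν t).value B)
  locally_integrable : ∀ R : ℝ, 0 < R →
    ∫⁻ t in Ioo 0 T, (ν t).var (Metric.ball 0 R) < ⊤
  equation : ∀ ζ : Space d × ℝ → ℝ, ContDiff ℝ 1 ζ → HasCompactSupport ζ →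
    tsupport ζ ⊆ univ ×ˢ Ioo 0 T →
    (∫ t in Ioo 0 T, ∫ x, deriv (fun s => ζ (x, s)) t ∂(μ t)) +
      (∫ t in Ioo 0 T, (ν t).pairing (fun x => gradient (fun y => ζ (y, t)) x)) = 0

/-! ### The weighted Wasserstein distance -/

/-- The `(φ,γ)`-Wasserstein (pseudo-, extended) distance `W_{φ,γ}`: its `p`-th power is the infimum
of `∫₀¹ Φ(μ_t,ν_t|γ) dt` over the solutions of the continuity equation on `[0,1]` joining
`μ₀` to `μ₁` (`+∞` if there is none). -/
def wDist (p : ℝ) (φ : ℝ → Space d → ℝ) (γ μ₀ μ₁ : Measure (Space d)) : ℝ≥0∞ :=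
  (⨅ (μ : ℝ → Measure (Space d)) (ν : ℝ → RadonVectorMeasure d)
    (_ : ContinuityEq 1 μ ν ∧ μ 0 = μ₀ ∧ μ 1 = μ₁),
    ∫⁻ t in Ioo (0 : ℝ) 1, action φ γ (μ t) (ν t)) ^ (1 / p)

/-- `t ∈ [0,T] ↦ μ_t` is absolutely continuous with respect to `W_{φ,γ}`: for some `m ∈ L¹(0,T)`
(which may be taken nonnegative), `W_{φ,γ}(μ_{t₁},μ_{t₀}) ≤ ∫_{t₀}^{t₁} m(t) dt` whenever
`0 ≤ t₀ < t₁ ≤ T`. -/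
def AbsContCurve (p : ℝ) (φ : ℝ → Space d → ℝ) (γ : Measure (Space d)) (T : ℝ)
    (μ : ℝ → Measure (Space d)) : Prop :=
  ∃ m : ℝ → ℝ≥0∞, Measurable m ∧ ∫⁻ t in Ioo 0 T, m t < ⊤ ∧
    ∀ t₀ t₁ : ℝ, 0 ≤ t₀ → t₀ < t₁ → t₁ ≤ T →
      wDist p φ γ (μ t₁) (μ t₀) ≤ ∫⁻ t in Ioo t₀ t₁, m t

/-- The difference quotients `W_{φ,γ}(μ_{t+h},μ_t)/|h|`. -/
def speedQuotient (p : ℝ) (φ : ℝ → Space d → ℝ) (γ : Measure (Space d))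
    (μ : ℝ → Measure (Space d)) (t h : ℝ) : ℝ≥0∞ :=
  wDist p φ γ (μ (t + h)) (μ t) / ENNReal.ofReal |h|

/-- The metric derivative `|μ'_t|`, defined as an upper limit for `h → 0`, `h ≠ 0`; it is the limit
of the difference quotients wherever that limit exists. -/
def metricDeriv (p : ℝ) (φ : ℝ → Space d → ℝ) (γ : Measure (Space d))
    (μ : ℝ → Measure (Space d)) (t : ℝ) : ℝ≥0∞ :=
  limsup (speedQuotient p φ γ μ t) (𝓝[≠] 0)

/-- `∫₀ᵀ Φ(μ_t,ν_t|γ)^{1/p} dt`. -/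
def actionLength (p : ℝ) (φ : ℝ → Space d → ℝ) (γ : Measure (Space d)) (T : ℝ)
    (μ : ℝ → Measure (Space d)) (ν : ℝ → RadonVectorMeasure d) : ℝ≥0∞ :=
  ∫⁻ t in Ioo 0 T, action φ γ (μ t) (ν t) ^ (1 / p)

end WeightedTransport

end

open WeightedTransport

/-!
# Absolutely continuous curves for weighted Wasserstein distances

The action `Φ(μ,ν|γ)` is the integral of one function, the lower semicontinuous perspective function
of `φ`, of the densities of `γ`, `μ` and `ν` with respect to any common reference measure
(`action_eq_lintegral_perspective`). The perspective function is the supremum of the linear forms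
that come from affine minorants of `φ`, and countably many of them suffice. The action is therefore
a countable supremum of functionals that are weakly* continuous in `(μ,ν)`
(`action_eq_iSup_testValue`), so it is lower semicontinuous and depends measurably on time.
Nondegeneracy of `φ` makes the perspective function coercive, which bounds the flux by the action
and by the masses of `γ` and `μ` through Hölder's inequality (`exists_lintegral_var_le`).

From a flux to the curve: changes of time act on solutions of the continuity equation, and `Φ` is
`p`-homogeneous in the flux. Reparametrization with almost constant speed shows that the distance
between the end points of a solution is at most its length `∫ Φ^{1/p} dt` (`wDist_le_length`), so
that `Φ^{1/p}` is a bound for the speed of the curve. Since `W` is symmetric and satisfies the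
triangle inequality, the metric derivative of a curve with integrable speed bound exists almost
everywhere, is the smallest speed bound (`exists_metric_derivative`), and is thus at most `Φ^{1/p}`.

From the curve to a flux: a change of time reduces a curve with speed bound `m` to one with `m ≤ 1`.
Such a curve is interpolated, at equidistant times, by almost optimal solutions
(`IsSpeedBound.exists_isApproximation`), which converge to it weakly* with actions asymptotically
bounded by `m ^ p`. For `|u| ≤ 1` the measures `(|ν_t| + u · ν_t) dt` of the approximations are
positive functionals in space-time, bounded by an `L^q` norm; along an ultrafilter they converge to
measures with a density with respect to `(γ + μ_t) dt` (`exists_density_tendsto_hyperfilter`).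
Taking `u` to be zero and the basis vectors recovers a limit flux, which disintegrates in time
(`IsApproximation.exists_flux`). The continuity equation is linear and passes to the limit; so does
each of the countably many functionals representing the action, whence `Φ(μ_t,ν_t|γ) ≤ m_t ^ p`
almost everywhere (`IsSpeedBound.exists_continuityEqOn`). With the metric derivative as the speed
bound `m`, the flux obtained in this way is optimal.

Uniqueness: the midpoint of two optimal fluxes drives the same curve, so its action is at least the
`p`-th power of the metric derivative. If `φ` is strictly convex in the flux, then so is the
perspective function where it is finite, and the two fluxes agree (`IsMidpoint.sameMeasure`).
-/

noncomputable section

namespace WeightedTransport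

variable {d : ℕ}

/-! ### Action densities as suprema of affine functions -/

/-- The triples `(α, β, ξ)` for which `α + β ρ + ξ · w ≤ φ(ρ,w)` for all `ρ > 0` and all `w`. -/
def affineMinorants (φ : ℝ → Space d → ℝ) : Set (ℝ × ℝ × Space d) :=
  {k | ∀ ρ : ℝ, 0 < ρ → ∀ w : Space d, k.1 + k.2.1 * ρ + inner ℝ k.2.2 w ≤ φ ρ w}

/-- The linear form `(g, r, n) ↦ α g + β r + ξ · n` attached to `k = (α, β, ξ)`. -/
def affineForm (k : ℝ × ℝ × Space d) (g r : ℝ) (n : Space d) : ℝ :=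
  k.1 * g + k.2.1 * r + inner ℝ k.2.2 n

/-- The lower semicontinuous perspective function of `φ`, as the supremum of the linear forms of
the affine minorants of `φ`: it is `g φ(r/g, n/g)` for `g > 0` and `φ^∞(r, n)` for `g = 0`. -/
def perspective (φ : ℝ → Space d → ℝ) (g r : ℝ) (n : Space d) : ℝ≥0∞ :=
  ⨆ k ∈ affineMinorants φ, ENNReal.ofReal (affineForm k g r n)

lemma affineForm_smul (k : ℝ × ℝ × Space d) (c g r : ℝ) (n : Space d) :
    affineForm k (c * g) (c * r) (c • n) = c * affineForm k g r n := by
  simp only [affineForm, inner_smul_right]; ring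

lemma ofReal_affineForm_le {φ : ℝ → Space d → ℝ} {k : ℝ × ℝ × Space d}
    (hk : k ∈ affineMinorants φ) (g r : ℝ) (n : Space d) :
    ENNReal.ofReal (affineForm k g r n) ≤ perspective φ g r n :=
  le_iSup₂_of_le k hk le_rfl

lemma perspective_smul (φ : ℝ → Space d → ℝ) {c : ℝ} (hc : 0 ≤ c) (g r : ℝ) (n : Space d) :
    perspective φ (c * g) (c * r) (c • n) = ENNReal.ofReal c * perspective φ g r n := by
  simp only [perspective, affineForm_smul, ENNReal.ofReal_mul hc, ENNReal.mul_iSup]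

lemma perspective_add_le (φ : ℝ → Space d → ℝ) (g r g' r' : ℝ) (n n' : Space d) :
    perspective φ (g + g') (r + r') (n + n') ≤ perspective φ g r n + perspective φ g' r' n' := by
  refine iSup₂_le fun k hk => ?_
  have : affineForm k (g + g') (r + r') (n + n') = affineForm k g r n + affineForm k g' r' n' := by
    simp only [affineForm, inner_add_right]; ring
  rw [this]
  exact ENNReal.ofReal_add_le.trans
    (add_le_add (ofReal_affineForm_le hk _ _ _) (ofReal_affineForm_le hk _ _ _))

namespace IsActionDensity

variable {p : ℝ} {φ : ℝ → Space d → ℝ}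

lemma apply_zero (hφ : IsActionDensity p φ) (hp : 1 < p) {ρ : ℝ} (hρ : 0 < ρ) : φ ρ 0 = 0 := by
  have := hφ.homogeneous ρ hρ 0 0
  rwa [zero_smul, abs_zero, Real.zero_rpow (by linarith), zero_mul] at this

lemma apply_le_of_convex_combination (hφ : IsActionDensity p φ) (hp : 1 < p) {r R l : ℝ}
    (hr : 0 < r) (hR : 0 < R) (hl : 0 ≤ l) (hl1 : l ≤ 1) (w : Space d) :
    φ ((1 - l) * R + l * r) (l • w) ≤ l * φ r w := by
  have := hφ.convex.2 (x := (R, 0)) (y := (r, w)) ⟨hR, mem_univ _⟩ ⟨hr, mem_univ _⟩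
    (sub_nonneg.2 hl1) hl (by ring)
  simpa [hφ.apply_zero hp hR] using this

/-- An action density is nonincreasing in the mass density: `(ρ', w)` is a convex combination of
`(ρ, w / (1 - l))` and of points `(R, 0)` with `R → ∞` as `l → 0`. -/
lemma antitone (hφ : IsActionDensity p φ) (hp : 1 < p) {r r' : ℝ} (hr : 0 < r) (hrr : r ≤ r')
    (w : Space d) : φ r' w ≤ φ r w := by
  have key : ∀ l : ℝ, l ∈ Ioo (0 : ℝ) 1 → φ r' w ≤ l * (l⁻¹ ^ p * φ r w) := by
    intro l hl
    have hl1 : 0 < 1 - l := by linarith [hl.2]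
    have := hφ.apply_le_of_convex_combination hp (r := r) (R := (r' - l * r) / (1 - l)) (l := l)
      hr (div_pos (by nlinarith [hl.1, hl.2]) hl1) hl.1.le hl.2.le (l⁻¹ • w)
    rw [mul_div_cancel₀ _ hl1.ne', sub_add_cancel, smul_smul, mul_inv_cancel₀ hl.1.ne', one_smul,
      hφ.homogeneous r hr, abs_of_pos (inv_pos.2 hl.1)] at this
    exact this
  have hlim : Tendsto (fun l : ℝ => l * (l⁻¹ ^ p * φ r w)) (𝓝[<] 1) (𝓝 (1 * (1⁻¹ ^ p * φ r w))) := by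
    have : ContinuousAt (fun l : ℝ => l * (l⁻¹ ^ p * φ r w)) 1 := by
      refine continuousAt_id.mul (ContinuousAt.mul ?_ continuousAt_const)
      exact (continuousAt_id.inv₀ one_ne_zero).rpow_const (Or.inr (by linarith))
    exact this.tendsto.mono_left nhdsWithin_le_nhds
  have := ge_of_tendsto hlim (by
    filter_upwards [Ioo_mem_nhdsLT (zero_lt_one' ℝ)] with l hl using key l hl)
  simpa using this

lemma continuousOn (hφ : IsActionDensity p φ) :
    ContinuousOn (fun z : ℝ × Space d => φ z.1 z.2) (Ioi (0 : ℝ) ×ˢ univ) :=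
  hφ.convex.continuousOn (isOpen_Ioi.prod isOpen_univ)

/-- A supporting affine function at an interior point, obtained by separating the point of the
graph from the open strict epigraph. -/
lemma exists_minorant_eq (hφ : IsActionDensity p φ) {r : ℝ} (hr : 0 < r) (w : Space d) :
    ∃ k ∈ affineMinorants φ, k.1 + k.2.1 * r + inner ℝ k.2.2 w = φ r w := by
  set s : Set (ℝ × Space d) := Ioi (0 : ℝ) ×ˢ univ
  have hs : IsOpen s := isOpen_Ioi.prod isOpen_univ
  set A : Set ((ℝ × Space d) × ℝ) := {q | q.1 ∈ s ∧ φ q.1.1 q.1.2 < q.2}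
  -- separation of the point on the graph from the open convex strict epigraph
  have hA : Convex ℝ A := hφ.convex.convex_strict_epigraph
  have hAo : IsOpen A := by
    rw [isOpen_iff_mem_nhds]
    rintro ⟨z, a⟩ ⟨hz, ha⟩
    have h1 : ContinuousAt (fun q : (ℝ × Space d) × ℝ => q.2 - φ q.1.1 q.1.2) (z, a) := by
      refine continuousAt_snd.sub ?_
      exact ContinuousAt.comp (f := Prod.fst) (g := fun z : ℝ × Space d => φ z.1 z.2)
        (hφ.continuousOn.continuousAt (hs.mem_nhds hz)) continuousAt_fst
    filter_upwards [h1.eventually (lt_mem_nhds (sub_pos.2 ha)),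
      continuousAt_fst.preimage_mem_nhds (hs.mem_nhds hz)] with q hq1 hq2
    exact ⟨hq2, sub_pos.1 hq1⟩
  obtain ⟨f, hf⟩ := geometric_hahn_banach_open_point hA hAo
    (x := ((r, w), φ r w)) (fun h => lt_irrefl _ h.2)
  set κ := f ((0, 0), 1)
  set b := f ((1, 0), 0)
  set ℓ : StrongDual ℝ (Space d) := f.comp
    ((ContinuousLinearMap.inl ℝ (ℝ × Space d) ℝ).comp (ContinuousLinearMap.inr ℝ ℝ (Space d)))
  have hfe : ∀ (ρ : ℝ) (v : Space d) (a : ℝ), f ((ρ, v), a) = b * ρ + ℓ v + κ * a := by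
    intro ρ v a
    have : ((ρ, v), a) = ρ • (((1 : ℝ), (0 : Space d)), (0 : ℝ)) + ((0, v), 0)
        + a • (((0 : ℝ), (0 : Space d)), (1 : ℝ)) := by simp
    rw [this, map_add, map_add, map_smul, map_smul, smul_eq_mul, smul_eq_mul]
    simp [b, κ, ℓ, mul_comm]
  have hκ : κ < 0 := by
    have := hf ((r, w), φ r w + 1) ⟨⟨hr, mem_univ _⟩, by simp⟩
    rw [hfe, hfe] at this
    linarith
  have hle : ∀ ρ : ℝ, 0 < ρ → ∀ v : Space d, b * ρ + ℓ v + κ * φ ρ v ≤ b * r + ℓ w + κ * φ r w := by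
    intro ρ hρ v
    refine le_of_forall_pos_le_add fun ε hε => ?_
    have := hf ((ρ, v), φ ρ v + ε / (-κ)) ⟨⟨hρ, mem_univ _⟩, by
      simpa using div_pos hε (neg_pos.2 hκ)⟩
    rw [hfe, hfe, mul_add] at this
    have h2 : κ * (ε / (-κ)) = -ε := by field_simp [hκ.ne]
    linarith
  set ξ := (InnerProductSpace.toDual ℝ (Space d)).symm ℓ
  have hξ : ∀ v, inner ℝ ξ v = ℓ v := fun v => InnerProductSpace.toDual_symm_apply
  have hκ' : 0 < -κ := neg_pos.2 hκ
  refine ⟨(φ r w - (b * r + ℓ w) / (-κ), b / (-κ), (-κ)⁻¹ • ξ), fun ρ hρ v => ?_, ?_⟩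
  · rw [real_inner_smul_left, hξ]
    have := hle ρ hρ v
    rw [← sub_nonneg]
    have e : φ ρ v - (φ r w - (b * r + ℓ w) / -κ + b / -κ * ρ + (-κ)⁻¹ * ℓ v)
      = (b * r + ℓ w + κ * φ r w - (b * ρ + ℓ v + κ * φ ρ v)) / (-κ) := by
        have hκ0 : κ ≠ 0 := hκ.ne
        field_simp
        ring
    rw [e]
    exact div_nonneg (by linarith) hκ'.le
  · rw [real_inner_smul_left, hξ]
    field_simp; ring

/-- Affine minorants are nonpositive at `w = 0`, where `φ` vanishes; `ρ → 0` and `ρ → ∞` then give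
the signs of the two coefficients. -/
lemma minorant_fst_nonpos (hφ : IsActionDensity p φ) (hp : 1 < p) {k : ℝ × ℝ × Space d}
    (hk : k ∈ affineMinorants φ) : k.1 ≤ 0 := by
  have h : ∀ ρ : ℝ, 0 < ρ → k.1 + k.2.1 * ρ ≤ 0 := fun ρ hρ => by
    simpa [hφ.apply_zero hp hρ] using hk ρ hρ 0
  have hlim : Tendsto (fun ρ : ℝ => k.1 + k.2.1 * ρ) (𝓝[>] 0) (𝓝 (k.1 + k.2.1 * 0)) :=
    ((continuous_const.add (continuous_const.mul continuous_id)).tendsto 0).mono_left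
      nhdsWithin_le_nhds
  simpa using le_of_tendsto hlim (by
    filter_upwards [self_mem_nhdsWithin] with ρ hρ using h ρ hρ)

lemma minorant_snd_nonpos (hφ : IsActionDensity p φ) (hp : 1 < p) {k : ℝ × ℝ × Space d}
    (hk : k ∈ affineMinorants φ) : k.2.1 ≤ 0 := by
  by_contra! hpos
  have := hk (1 + |k.1| / k.2.1) (by positivity) 0
  rw [hφ.apply_zero hp (by positivity), inner_zero_right, mul_add, mul_div_cancel₀ _ hpos.ne']
    at this
  linarith [neg_abs_le k.1]

lemma zero_mem_affineMinorants (hφ : IsActionDensity p φ) : (0 : ℝ × ℝ × Space d) ∈ affineMinorants φ :=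
  fun ρ hρ w => by simpa using hφ.nonneg ρ hρ w

lemma perspective_antitone (hφ : IsActionDensity p φ) (hp : 1 < p) {g g' r r' : ℝ} (hg : g ≤ g')
    (hr : r ≤ r') (n : Space d) : perspective φ g' r' n ≤ perspective φ g r n := by
  refine iSup₂_mono fun k hk => ENNReal.ofReal_le_ofReal ?_
  simp only [affineForm]
  nlinarith [hφ.minorant_fst_nonpos hp hk, hφ.minorant_snd_nonpos hp hk]

lemma perspective_le_of_forall_pos (g r : ℝ) (n : Space d) {B : ℝ≥0∞} (a b : ℝ)
    (h : ∀ ε : ℝ, 0 < ε → perspective φ (g + ε * a) (r + ε * b) n ≤ B) :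
    perspective φ g r n ≤ B := by
  refine iSup₂_le fun k hk => ?_
  have hc : Continuous (fun ε : ℝ => ENNReal.ofReal (affineForm k (g + ε * a) (r + ε * b) n)) := by
    refine ENNReal.continuous_ofReal.comp ?_
    unfold affineForm; fun_prop
  have hlim := (hc.tendsto 0).mono_left (nhdsWithin_le_nhds (s := Ioi 0))
  simp only [zero_mul, add_zero] at hlim
  refine le_of_tendsto hlim ?_
  filter_upwards [self_mem_nhdsWithin] with ε hε
  exact (ofReal_affineForm_le hk _ _ _).trans (h ε hε)

/-- On `ρ ≥ 0` the extension of `φ` is the supremum of its affine minorants: for `ρ > 0` by the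
supporting hyperplanes, for `ρ = 0` because `φ(·,w)` is antitone. -/
lemma extDensity_eq_perspective (hφ : IsActionDensity p φ) (hp : 1 < p) {r : ℝ} (hr : 0 ≤ r)
    (w : Space d) : extDensity φ r w = perspective φ 1 r w := by
  have hpos : ∀ r : ℝ, 0 < r → ENNReal.ofReal (φ r w) = perspective φ 1 r w := by
    intro r hr
    refine le_antisymm ?_ (iSup₂_le fun k hk => ENNReal.ofReal_le_ofReal ?_)
    · obtain ⟨k, hk, h⟩ := hφ.exists_minorant_eq hr w
      refine le_iSup₂_of_le k hk (ENNReal.ofReal_le_ofReal ?_)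
      simp only [affineForm]; linarith
    · have := hk r hr w
      simp only [affineForm]; linarith
  rcases hr.lt_or_eq with hr | rfl
  · rw [extDensity, if_pos hr, hpos r hr]
  · rw [extDensity, if_neg (lt_irrefl _), if_pos rfl]
    refine le_antisymm (iSup₂_le fun r hr => ?_) ?_
    · rw [hpos r hr]
      exact hφ.perspective_antitone hp le_rfl hr.le w
    · refine perspective_le_of_forall_pos 1 0 w 0 1 fun ε hε => ?_
      simp only [mul_zero, add_zero, mul_one, zero_add]
      rw [← hpos ε hε]
      exact le_iSup₂_of_le ε hε le_rfl

lemma perspective_of_pos (hφ : IsActionDensity p φ) (hp : 1 < p) {g r : ℝ} (hg : 0 < g)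
    (hr : 0 ≤ r) (n : Space d) :
    perspective φ g r n = ENNReal.ofReal g * extDensity φ (r / g) (g⁻¹ • n) := by
  rw [hφ.extDensity_eq_perspective hp (div_nonneg hr hg.le), ← perspective_smul φ hg.le, mul_one,
    mul_div_cancel₀ _ hg.ne', smul_smul, mul_inv_cancel₀ hg.ne', one_smul]

lemma perspective_zero (hφ : IsActionDensity p φ) (hp : 1 < p) {r : ℝ} (hr : 0 ≤ r) (n : Space d) :
    perspective φ 0 r n = recession φ r n := by
  have key : ∀ c : ℝ, 0 < c →
      extDensity φ (c * r) (c • n) / ENNReal.ofReal c = perspective φ c⁻¹ r n := by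
    intro c hc
    rw [hφ.extDensity_eq_perspective hp (by positivity), div_eq_mul_inv, mul_comm,
      ← ENNReal.ofReal_inv_of_pos hc, ← perspective_smul φ (inv_pos.2 hc).le, mul_one,
      inv_mul_cancel_left₀ hc.ne', smul_smul, inv_mul_cancel₀ hc.ne', one_smul]
  refine le_antisymm ?_ (iSup₂_le fun c hc => ?_)
  · refine perspective_le_of_forall_pos 0 r n 1 0 fun ε hε => ?_
    simp only [mul_zero, add_zero, mul_one, zero_add]
    refine le_iSup₂_of_le ε⁻¹ (inv_pos.2 hε) ?_
    rw [key _ (inv_pos.2 hε), inv_inv]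
  · rw [key c hc]
    exact hφ.perspective_antitone hp (inv_pos.2 hc).le le_rfl n

/-- The perspective function is `p`-homogeneous in the flux, since the rescaling of the flux
permutes the affine minorants. -/
lemma perspective_smul_flux (hφ : IsActionDensity p φ) {c : ℝ} (hc : c ≠ 0)
    (g r : ℝ) (n : Space d) :
    perspective φ g r (c • n) = ENNReal.ofReal (|c| ^ p) * perspective φ g r n := by
  have hle : ∀ (c : ℝ), c ≠ 0 → ∀ n : Space d,
      perspective φ g r (c • n) ≤ ENNReal.ofReal (|c| ^ p) * perspective φ g r n := by
    intro c hc n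
    have hcp : 0 < |c| ^ p := Real.rpow_pos_of_pos (abs_pos.2 hc) p
    refine iSup₂_le fun k hk => ?_
    have hk' : ((|c| ^ p)⁻¹ * k.1, (|c| ^ p)⁻¹ * k.2.1, ((|c| ^ p)⁻¹ * c) • k.2.2)
        ∈ affineMinorants φ := by
      intro ρ hρ w
      have := hk ρ hρ (c • w)
      rw [hφ.homogeneous ρ hρ, inner_smul_right] at this
      rw [real_inner_smul_left]
      have h2 := mul_le_mul_of_nonneg_left this (inv_pos.2 hcp).le
      rw [inv_mul_cancel_left₀ hcp.ne'] at h2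
      refine le_trans (le_of_eq ?_) h2
      ring
    refine le_trans (le_of_eq ?_) (mul_le_mul_right (ofReal_affineForm_le hk' g r n) _)
    rw [← ENNReal.ofReal_mul hcp.le]
    congr 1
    simp only [affineForm, real_inner_smul_left, inner_smul_right]
    field_simp
  refine le_antisymm (hle c hc n) ?_
  have h := hle c⁻¹ (inv_ne_zero hc) (c • n)
  rw [smul_smul, inv_mul_cancel₀ hc, one_smul] at h
  refine (mul_le_mul_right h _).trans (le_of_eq ?_)
  rw [← mul_assoc, ← ENNReal.ofReal_mul (by positivity), ← Real.mul_rpow (by positivity)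
    (by positivity), ← abs_mul, mul_inv_cancel₀ hc]
  simp

/-- Nondegeneracy at one `ρ₀` propagates: `φ(ρ,w) ≥ c |w|^p / (ρ + 1)^(p-1)`. -/
lemma exists_norm_rpow_le (hφ : IsActionDensity p φ) (hp : 1 < p) :
    ∃ C : ℝ, 0 < C ∧ ∀ ρ : ℝ, 0 < ρ → ∀ w : Space d, ‖w‖ ^ p ≤ C * φ ρ w * (ρ + 1) ^ (p - 1) := by
  obtain ⟨ρ₀, hρ₀, hpos⟩ := hφ.nondegenerate
  -- at `ρ₀` the bound holds by homogeneity and compactness of the unit sphere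
  have h1 : ∃ c : ℝ, 0 < c ∧ ∀ w : Space d, c * ‖w‖ ^ p ≤ φ ρ₀ w := by
    have hcont : Continuous (fun w : Space d => φ ρ₀ w) := by
      rw [← continuousOn_univ]
      exact hφ.continuousOn.comp (f := fun w => (ρ₀, w)) (by fun_prop) fun w _ => ⟨hρ₀, mem_univ _⟩
    have hsc : ∃ c : ℝ, 0 < c ∧ ∀ w ∈ Metric.sphere (0 : Space d) 1, c ≤ φ ρ₀ w := by
      rcases (Metric.sphere (0 : Space d) 1).eq_empty_or_nonempty with he | hne
      · exact ⟨1, one_pos, by simp [he]⟩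
      · obtain ⟨w₀, hw₀, hmin⟩ := (isCompact_sphere (0 : Space d) 1).exists_isMinOn hne
          hcont.continuousOn
        exact ⟨φ ρ₀ w₀, hpos _ (Metric.ne_of_mem_sphere hw₀ one_ne_zero), fun w hw => hmin hw⟩
    obtain ⟨c, hc, hcs⟩ := hsc
    refine ⟨c, hc, fun w => ?_⟩
    rcases eq_or_ne w 0 with rfl | hw
    · simp [Real.zero_rpow (by linarith : p ≠ 0), hφ.apply_zero hp hρ₀]
    · have hw' : 0 < ‖w‖ := norm_pos_iff.2 hw
      have := hcs (‖w‖⁻¹ • w) (by simp [norm_smul, hw'.ne'])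
      rw [hφ.homogeneous ρ₀ hρ₀, abs_of_pos (inv_pos.2 hw'), Real.inv_rpow hw'.le] at this
      have hwp := Real.rpow_pos_of_pos hw' p
      rw [inv_mul_eq_div, le_div_iff₀ hwp] at this
      exact this
  obtain ⟨c, hc, hcw⟩ := h1
  set B : ℝ := 2 * (1 + ρ₀) / ρ₀ with hB
  have hBpos : 0 < B := by positivity
  refine ⟨c⁻¹ * B ^ (p - 1), by positivity, fun ρ hρ w => ?_⟩
  -- the weight `l` for which `l (ρ + ρ₀)` is half of `ρ₀`
  set l : ℝ := ρ₀ / (2 * (ρ + ρ₀)) with hl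
  have hl0 : 0 < l := by positivity
  have hl1 : l < 1 := by rw [hl, div_lt_one (by positivity)]; linarith
  have hl2 : l * (ρ + ρ₀) = ρ₀ / 2 := by rw [hl]; field_simp
  have hcomb := hφ.apply_le_of_convex_combination hp (r := ρ + ρ₀) (R := ρ₀ / 2 / (1 - l)) (l := l)
    (by positivity) (div_pos (by positivity) (by linarith)) hl0.le hl1.le w
  rw [mul_div_cancel₀ _ (by linarith : (1 - l) ≠ 0), hl2, add_halves, hφ.homogeneous ρ₀ hρ₀,
    abs_of_pos hl0] at hcomb
  have h3 : l ^ p * (c * ‖w‖ ^ p) ≤ l * φ ρ w :=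
    (mul_le_mul_of_nonneg_left (hcw w) (by positivity)).trans (hcomb.trans
      (mul_le_mul_of_nonneg_left (hφ.antitone hp hρ (by linarith) w) hl0.le))
  have h4 : l ^ p = l ^ (p - 1) * l := by
    rw [← Real.rpow_add_one hl0.ne']; congr 1; ring
  have h5 : l ^ (p - 1) * (c * ‖w‖ ^ p) ≤ φ ρ w := by
    rw [h4, mul_right_comm, mul_comm] at h3
    exact le_of_mul_le_mul_left h3 hl0
  have h6 : l⁻¹ ≤ B * (ρ + 1) := by
    rw [hl, inv_div, hB, div_mul_eq_mul_div]
    refine div_le_div_of_nonneg_right ?_ hρ₀.le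
    nlinarith
  have h7 : (l ^ (p - 1))⁻¹ ≤ B ^ (p - 1) * (ρ + 1) ^ (p - 1) := by
    rw [← Real.inv_rpow hl0.le, ← Real.mul_rpow hBpos.le (by positivity)]
    exact Real.rpow_le_rpow (by positivity) h6 (by linarith)
  have hlp : 0 < l ^ (p - 1) := by positivity
  have hnn := hφ.nonneg ρ hρ w
  calc ‖w‖ ^ p = c⁻¹ * ((l ^ (p - 1))⁻¹ * (l ^ (p - 1) * (c * ‖w‖ ^ p))) := by field_simp
    _ ≤ c⁻¹ * ((l ^ (p - 1))⁻¹ * φ ρ w) := by gcongr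
    _ ≤ c⁻¹ * ((B ^ (p - 1) * (ρ + 1) ^ (p - 1)) * φ ρ w) := by gcongr
    _ = _ := by ring

/-- Coercivity of the perspective function: `|n|^p ≤ C (g + r)^(p-1) perspective`. -/
lemma exists_norm_rpow_le_perspective (hφ : IsActionDensity p φ) (hp : 1 < p) :
    ∃ C : ℝ, 0 < C ∧ ∀ g r : ℝ, 0 ≤ g → 0 ≤ r → ∀ n : Space d, perspective φ g r n ≠ ⊤ →
      ‖n‖ ^ p ≤ C * (perspective φ g r n).toReal * (g + r) ^ (p - 1) := by
  obtain ⟨C, hC, h⟩ := hφ.exists_norm_rpow_le hp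
  refine ⟨C, hC, fun g r hg hr n hfin => ?_⟩
  set P := (perspective φ g r n).toReal
  -- positive arguments `g + ε`, `r + ε` only decrease the perspective function
  have key : ∀ ε : ℝ, 0 < ε → ‖n‖ ^ p ≤ C * P * ((g + ε) + (r + ε)) ^ (p - 1) := by
    intro ε hε
    have hgε : 0 < g + ε := by linarith
    have hrε : 0 < r + ε := by linarith
    have h1 : ENNReal.ofReal ((g + ε) * φ ((r + ε) / (g + ε)) ((g + ε)⁻¹ • n)) ≤
        perspective φ g r n := by
      rw [ENNReal.ofReal_mul hgε.le]
      have := hφ.perspective_of_pos hp hgε hrε.le n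
      rw [extDensity, if_pos (by positivity)] at this
      rw [← this]
      exact hφ.perspective_antitone hp (by linarith) (by linarith) n
    have h2 : (g + ε) * φ ((r + ε) / (g + ε)) ((g + ε)⁻¹ • n) ≤ P := by
      rwa [ENNReal.ofReal_le_iff_le_toReal hfin] at h1
    have h3 := h ((r + ε) / (g + ε)) (by positivity) ((g + ε)⁻¹ • n)
    rw [norm_smul, Real.norm_of_nonneg (inv_pos.2 hgε).le,
      Real.mul_rpow (by positivity) (norm_nonneg _), Real.inv_rpow hgε.le] at h3
    have h4 : (r + ε) / (g + ε) + 1 = ((g + ε) + (r + ε)) / (g + ε) := by field_simp; ring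
    rw [h4, Real.div_rpow (by positivity) hgε.le] at h3
    have hgp : (g + ε) ^ p = (g + ε) ^ (p - 1) * (g + ε) := by
      rw [← Real.rpow_add_one hgε.ne']; congr 1; ring
    have hgq : 0 < (g + ε) ^ (p - 1) := by positivity
    have hS : 0 ≤ ((g + ε) + (r + ε)) ^ (p - 1) := by positivity
    set S := ((g + ε) + (r + ε)) ^ (p - 1)
    set F := φ ((r + ε) / (g + ε)) ((g + ε)⁻¹ • n)
    rw [hgp, inv_mul_eq_div, div_le_iff₀ (by positivity)] at h3
    calc ‖n‖ ^ p ≤ C * F * (S / (g + ε) ^ (p - 1)) * ((g + ε) ^ (p - 1) * (g + ε)) := h3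
      _ = C * ((g + ε) * F) * S := by field_simp
      _ ≤ C * P * S := by gcongr
  have hc : Continuous (fun ε : ℝ => C * P * ((g + ε) + (r + ε)) ^ (p - 1)) := by
    refine continuous_const.mul (Continuous.rpow_const (by fun_prop) fun x => Or.inr (by linarith))
  have hlim := (hc.tendsto 0).mono_left (nhdsWithin_le_nhds (s := Ioi 0))
  simp only [add_zero] at hlim
  exact ge_of_tendsto hlim (by filter_upwards [self_mem_nhdsWithin] with ε hε using key ε hε)

/-- Where neither `γ` nor `μ` charges, finite action forces the flux to vanish. -/
lemma eq_zero_of_perspective_zero_zero (hφ : IsActionDensity p φ) (hp : 1 < p) {n : Space d}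
    (h : perspective φ 0 0 n ≠ ⊤) : n = 0 := by
  obtain ⟨C, -, hC⟩ := hφ.exists_norm_rpow_le_perspective hp
  have := hC 0 0 le_rfl le_rfl n h
  rw [add_zero, Real.zero_rpow (by linarith : p - 1 ≠ 0), mul_zero] at this
  by_contra hn
  exact absurd this (not_le.2 (Real.rpow_pos_of_pos (norm_pos_iff.2 hn) p))

/-- A countable family of affine minorants already has the perspective function as supremum. -/
lemma exists_seq_perspective_eq (hφ : IsActionDensity p φ) :
    ∃ k : ℕ → ℝ × ℝ × Space d, (∀ i, k i ∈ affineMinorants φ) ∧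
      ∀ g r n, perspective φ g r n = ⨆ i, ENNReal.ofReal (affineForm (k i) g r n) := by
  have : Nonempty (affineMinorants φ) := ⟨⟨0, hφ.zero_mem_affineMinorants⟩⟩
  let u := TopologicalSpace.denseSeq (affineMinorants φ)
  have hu : DenseRange u := TopologicalSpace.denseRange_denseSeq _
  refine ⟨fun i => (u i : ℝ × ℝ × Space d), fun i => (u i).2, fun g r n => ?_⟩
  refine le_antisymm (iSup₂_le fun k hk => ?_) (iSup_le fun i => ofReal_affineForm_le (u i).2 _ _ _)
  have hc : Continuous (fun k : affineMinorants φ =>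
      ENNReal.ofReal (affineForm (k : ℝ × ℝ × Space d) g r n)) := by
    refine ENNReal.continuous_ofReal.comp ?_
    unfold affineForm; fun_prop
  have hcl : IsClosed {k : affineMinorants φ | ENNReal.ofReal (affineForm (k : ℝ × ℝ × Space d) g r n)
      ≤ ⨆ i, ENNReal.ofReal (affineForm (u i : ℝ × ℝ × Space d) g r n)} :=
    isClosed_le hc continuous_const
  exact hu.induction_on (p := fun k : affineMinorants φ =>
    ENNReal.ofReal (affineForm (k : ℝ × ℝ × Space d) g r n) ≤
      ⨆ i, ENNReal.ofReal (affineForm (u i : ℝ × ℝ × Space d) g r n)) ⟨k, hk⟩ hcl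
    fun i => le_iSup (fun i => ENNReal.ofReal (affineForm (u i : ℝ × ℝ × Space d) g r n)) i

lemma measurable_perspective (hφ : IsActionDensity p φ) {α : Type*} [MeasurableSpace α]
    {g r : α → ℝ} {n : α → Space d} (hg : Measurable g) (hr : Measurable r) (hn : Measurable n) :
    Measurable fun x => perspective φ (g x) (r x) (n x) := by
  obtain ⟨k, -, hk⟩ := hφ.exists_seq_perspective_eq
  simp only [hk, affineForm]
  fun_prop

/-- Strict convexity in the flux passes to the perspective function. For `g > 0` it comes from
`φ(r/g,·)`, for `g = 0 < r` from `φ^∞(1,·)`, and for `g = r = 0` the flux has to vanish. -/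
lemma perspective_midpoint_lt (hφ : IsActionDensity p φ) (hp : 1 < p) (hs : StrictlyConvexInFlux φ)
    {g r : ℝ} (hg : 0 ≤ g) (hr : 0 ≤ r) {n n' : Space d} (hn : perspective φ g r n ≠ ⊤)
    (hn' : perspective φ g r n' ≠ ⊤) (hne : n ≠ n') :
    perspective φ g r ((1 / 2 : ℝ) • n + (1 / 2 : ℝ) • n') <
      ENNReal.ofReal (1 / 2) * perspective φ g r n + ENNReal.ofReal (1 / 2) * perspective φ g r n' := by
  -- a rescaling by `c > 0` reduces the claim to strict convexity of a single function `F`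
  have scale : ∀ (c : ℝ) (F : Space d → ℝ≥0∞), 0 < c → StrictlyConvexOnDomain F →
      (∀ m, perspective φ g r m = ENNReal.ofReal c * F (c⁻¹ • m)) →
      perspective φ g r ((1 / 2 : ℝ) • n + (1 / 2 : ℝ) • n') <
      ENNReal.ofReal (1 / 2) * perspective φ g r n + ENNReal.ofReal (1 / 2) * perspective φ g r n' := by
    intro c F hc hF hpF
    have hfin : ∀ m, perspective φ g r m ≠ ⊤ → F (c⁻¹ • m) < ⊤ := by
      intro m hm
      rw [hpF] at hm
      refine lt_top_iff_ne_top.2 fun h => hm ?_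
      rw [h, ENNReal.mul_top (by simpa using hc)]
    have := hF (c⁻¹ • n) (c⁻¹ • n') (fun h => hne (smul_right_injective _ (inv_pos.2 hc).ne' h))
      (hfin n hn) (hfin n' hn') (1 / 2) (1 / 2) (by norm_num) (by norm_num) (by norm_num)
    rw [hpF, hpF n, hpF n', mul_left_comm, mul_left_comm _ (ENNReal.ofReal c), ← mul_add]
    refine (ENNReal.mul_lt_mul_iff_right (by simpa using hc) ENNReal.ofReal_ne_top).2 ?_
    rwa [smul_add, smul_comm c⁻¹, smul_comm c⁻¹]
  rcases hg.lt_or_eq with hg | rfl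
  · exact scale g (extDensity φ (r / g)) hg (hs.1 _ (by positivity))
      fun m => hφ.perspective_of_pos hp hg hr m
  rcases hr.lt_or_eq with hr | rfl
  · refine scale r (recession φ 1) hr hs.2 fun m => ?_
    rw [← hφ.perspective_zero hp zero_le_one, ← perspective_smul φ hr.le, mul_zero, mul_one,
      smul_smul, mul_inv_cancel₀ hr.ne', one_smul]
  · exact absurd ((hφ.eq_zero_of_perspective_zero_zero hp hn).trans
      (hφ.eq_zero_of_perspective_zero_zero hp hn').symm) hne

end IsActionDensity

/-! ### Radon vector measures and their densities -/

instance RadonVectorMeasure.instIsLocallyFiniteMeasure (ν : RadonVectorMeasure d) :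
    IsLocallyFiniteMeasure ν.var := ν.locallyFinite_var

instance isLocallyFiniteMeasure_add {X : Type*} [TopologicalSpace X] [MeasurableSpace X]
    (μ ν : Measure X) [IsLocallyFiniteMeasure μ] [IsLocallyFiniteMeasure ν] :
    IsLocallyFiniteMeasure (μ + ν) := by
  refine ⟨fun x => ?_⟩
  obtain ⟨s, hs, h⟩ := μ.finiteAt_nhds x
  obtain ⟨t, ht, h'⟩ := ν.finiteAt_nhds x
  refine ⟨s ∩ t, inter_mem hs ht, ?_⟩
  rw [Measure.add_apply]
  exact ENNReal.add_lt_top.2 ⟨(measure_mono inter_subset_left).trans_lt h,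
    (measure_mono inter_subset_right).trans_lt h'⟩

/-- The vector measure `n · m` with density `n` with respect to `m`. -/
def RadonVectorMeasure.ofDensity (m : Measure (Space d)) (n : Space d → Space d)
    (hn : Measurable n) (hloc : IsLocallyFiniteMeasure (m.withDensity fun x => ‖n x‖ₑ)) :
    RadonVectorMeasure d where
  var := m.withDensity fun x => ‖n x‖ₑ
  dir := fun x => ‖n x‖⁻¹ • n x
  locallyFinite_var := hloc
  measurable_dir := hn.norm.inv.smul hn
  norm_dir := by
    rw [ae_withDensity_iff hn.enorm]
    refine Eventually.of_forall fun x hx => ?_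
    have : ‖n x‖ ≠ 0 := by simpa using hx
    rw [norm_smul, norm_inv, norm_norm, inv_mul_cancel₀ this]

/-- Multiplication of a vector measure by a nonnegative number. -/
def RadonVectorMeasure.scale (c : ℝ) (ν : RadonVectorMeasure d) : RadonVectorMeasure d where
  var := ENNReal.ofReal c • ν.var
  dir := ν.dir
  locallyFinite_var :=
    ⟨fun x => by
      obtain ⟨s, hs, h⟩ := ν.locallyFinite_var.1 x
      exact ⟨s, hs, ENNReal.mul_lt_top ENNReal.ofReal_lt_top h⟩⟩
  measurable_dir := ν.measurable_dir
  norm_dir := Measure.ae_smul_measure ν.norm_dir _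

/-- The opposite of a vector measure. -/
def RadonVectorMeasure.opp (ν : RadonVectorMeasure d) : RadonVectorMeasure d where
  var := ν.var
  dir := fun x => -ν.dir x
  locallyFinite_var := ν.locallyFinite_var
  measurable_dir := ν.measurable_dir.neg
  norm_dir := by simpa using ν.norm_dir

lemma RadonVectorMeasure.pairing_scale {c : ℝ} (hc : 0 ≤ c) (ν : RadonVectorMeasure d)
    (ζ : Space d → Space d) : (ν.scale c).pairing ζ = c * ν.pairing ζ := by
  simp [pairing, scale, integral_smul_measure, ENNReal.toReal_ofReal hc]

lemma RadonVectorMeasure.value_scale {c : ℝ} (hc : 0 ≤ c) (ν : RadonVectorMeasure d)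
    (B : Set (Space d)) : (ν.scale c).value B = c • ν.value B := by
  simp [value, scale, integral_smul_measure, ENNReal.toReal_ofReal hc]

lemma RadonVectorMeasure.pairing_opp (ν : RadonVectorMeasure d)
    (ζ : Space d → Space d) : ν.opp.pairing ζ = -ν.pairing ζ := by
  simp [pairing, opp, integral_neg]

lemma RadonVectorMeasure.value_opp (ν : RadonVectorMeasure d)
    (B : Set (Space d)) : ν.opp.value B = -ν.value B := by
  simp [value, opp, integral_neg]

lemma RadonVectorMeasure.pairing_smul (ν : RadonVectorMeasure d) (c : ℝ)
    (ζ : Space d → Space d) : ν.pairing (fun x => c • ζ x) = c * ν.pairing ζ := by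
  simp only [pairing, real_inner_smul_left, integral_const_mul]

lemma RadonVectorMeasure.integrable_inner (ν : RadonVectorMeasure d) {ζ : Space d → Space d}
    (hζ : Continuous ζ) (hc : HasCompactSupport ζ) :
    Integrable (fun x => inner ℝ (ζ x) (ν.dir x)) ν.var := by
  refine (hζ.integrable_of_hasCompactSupport hc (μ := ν.var)).mono
    ((hζ.measurable.inner ν.measurable_dir).aestronglyMeasurable) ?_
  filter_upwards [ν.norm_dir] with x hx
  simpa [hx] using norm_inner_le_norm (𝕜 := ℝ) (ζ x) (ν.dir x)

lemma RadonVectorMeasure.pairing_sub (ν : RadonVectorMeasure d) {ζ ζ' : Space d → Space d}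
    (hζ : Continuous ζ) (hc : HasCompactSupport ζ) (hζ' : Continuous ζ')
    (hc' : HasCompactSupport ζ') :
    ν.pairing (fun x => ζ x - ζ' x) = ν.pairing ζ - ν.pairing ζ' := by
  simp only [pairing, inner_sub_left]
  exact integral_sub (ν.integrable_inner hζ hc) (ν.integrable_inner hζ' hc')

/-- `|∫ ζ · dν| ≤ ∫ |ζ| d|ν|`, as an inequality in `[0, ∞]`. -/
lemma RadonVectorMeasure.enorm_pairing_le (ν : RadonVectorMeasure d) (ζ : Space d → Space d) :
    ‖ν.pairing ζ‖ₑ ≤ ∫⁻ x, ‖ζ x‖ₑ ∂ν.var := by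
  refine (enorm_integral_le_lintegral_enorm _).trans (lintegral_mono_ae ?_)
  filter_upwards [ν.norm_dir] with x hx
  have := norm_inner_le_norm (𝕜 := ℝ) (ζ x) (ν.dir x)
  rw [hx, mul_one] at this
  exact enorm_le_iff_norm_le.2 this

/-- Densities `g`, `r`, `n` of `γ`, `μ`, `ν` with respect to a common reference measure `m`. -/
structure HasDensities (m γ μ : Measure (Space d)) (ν : RadonVectorMeasure d)
    (g r : Space d → ℝ) (n : Space d → Space d) : Prop where
  measurable_g : Measurable g
  measurable_r : Measurable r
  measurable_n : Measurable n
  g_nonneg : ∀ x, 0 ≤ g x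
  r_nonneg : ∀ x, 0 ≤ r x
  gamma_eq : γ = m.withDensity fun x => ENNReal.ofReal (g x)
  mu_eq : μ = m.withDensity fun x => ENNReal.ofReal (r x)
  var_eq : ν.var = m.withDensity fun x => ‖n x‖ₑ
  dir_eq : ∀ᵐ x ∂m, n x = ‖n x‖ • ν.dir x

lemma withDensity_ofReal_toReal_rnDeriv {m γ : Measure (Space d)} [SigmaFinite m] [SigmaFinite γ]
    (h : γ ≪ m) : γ = m.withDensity fun x => ENNReal.ofReal (γ.rnDeriv m x).toReal := by
  conv_lhs => rw [← Measure.withDensity_rnDeriv_eq γ m h]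
  refine withDensity_congr_ae ?_
  filter_upwards [γ.rnDeriv_lt_top m] with x hx
  rw [ENNReal.ofReal_toReal hx.ne]

lemma exists_vector_density {m : Measure (Space d)} [SigmaFinite m] (ν : RadonVectorMeasure d)
    (h : ν.var ≪ m) : ∃ n : Space d → Space d, Measurable n ∧
      ν.var = m.withDensity (fun x => ‖n x‖ₑ) ∧ ∀ᵐ x ∂m, n x = ‖n x‖ • ν.dir x := by
  have hd : ∀ᵐ x ∂m, ν.var.rnDeriv m x ≠ 0 → ‖ν.dir x‖ = 1 := by
    rw [← ae_withDensity_iff (ν.var.measurable_rnDeriv m), Measure.withDensity_rnDeriv_eq _ _ h]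
    exact ν.norm_dir
  have hn : ∀ᵐ x ∂m, ‖(ν.var.rnDeriv m x).toReal • ν.dir x‖ = (ν.var.rnDeriv m x).toReal := by
    filter_upwards [hd] with x hx
    by_cases h0 : ν.var.rnDeriv m x = 0
    · simp [h0]
    · rw [norm_smul, hx h0, mul_one, Real.norm_of_nonneg ENNReal.toReal_nonneg]
  refine ⟨fun x => (ν.var.rnDeriv m x).toReal • ν.dir x,
    (ν.var.measurable_rnDeriv m).ennreal_toReal.smul ν.measurable_dir, ?_, ?_⟩
  · conv_lhs => rw [withDensity_ofReal_toReal_rnDeriv h]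
    refine withDensity_congr_ae ?_
    filter_upwards [hn] with x hx
    rw [← hx, ofReal_norm, hx]
  · filter_upwards [hn] with x hx
    rw [hx]

lemma exists_hasDensities (m γ μ : Measure (Space d)) (ν : RadonVectorMeasure d) [SigmaFinite m]
    [SigmaFinite γ] [SigmaFinite μ] (hγ : γ ≪ m) (hμ : μ ≪ m) (hν : ν.var ≪ m) :
    ∃ g r n, HasDensities m γ μ ν g r n := by
  obtain ⟨n, hn, h1, h2⟩ := exists_vector_density ν hν
  exact ⟨fun x => (γ.rnDeriv m x).toReal, fun x => (μ.rnDeriv m x).toReal, n,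
    (γ.measurable_rnDeriv m).ennreal_toReal, (μ.measurable_rnDeriv m).ennreal_toReal, hn,
    fun _ => ENNReal.toReal_nonneg, fun _ => ENNReal.toReal_nonneg,
    withDensity_ofReal_toReal_rnDeriv hγ, withDensity_ofReal_toReal_rnDeriv hμ, h1, h2⟩

lemma exists_hasDensities_sum (γ μ : Measure (Space d)) (ν : RadonVectorMeasure d)
    [IsLocallyFiniteMeasure γ] [IsLocallyFiniteMeasure μ] :
    ∃ g r n, HasDensities (γ + μ + ν.var) γ μ ν g r n := by
  refine exists_hasDensities (γ + μ + ν.var) γ μ ν ?_ ?_ ?_ <;>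
  refine Measure.absolutelyContinuous_of_le ?_
  · exact (Measure.le_add_right le_rfl).trans (Measure.le_add_right le_rfl)
  · exact (Measure.le_add_left le_rfl).trans (Measure.le_add_right le_rfl)
  · exact Measure.le_add_left le_rfl

/-- Lebesgue decomposition of `m.withDensity D` with respect to `m.withDensity G`: the absolutely
continuous part lives on `{G ≠ 0}`, the singular part on `{G = 0}`. -/
lemma lebesgue_decomposition_withDensity {m : Measure (Space d)} {D G : Space d → ℝ≥0∞}
    (hD : Measurable D) (hG : Measurable G) (hGtop : ∀ x, G x ≠ ⊤)
    [SigmaFinite (m.withDensity G)] :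
    (m.withDensity D).rnDeriv (m.withDensity G) =ᵐ[m.withDensity G] (fun x => D x / G x) ∧
    (m.withDensity D).singularPart (m.withDensity G) =
      m.withDensity ((G ⁻¹' {0}).indicator D) := by
  have hZ : MeasurableSet (G ⁻¹' {0}) := hG (measurableSet_singleton 0)
  have hs : m.withDensity ((G ⁻¹' {0}).indicator D) ⟂ₘ m.withDensity G := by
    refine ⟨(G ⁻¹' {0})ᶜ, hZ.compl, ?_, ?_⟩
    · rw [withDensity_apply _ hZ.compl, lintegral_indicator hZ, Measure.restrict_restrict hZ]
      simp
    · rw [compl_compl, withDensity_apply _ hZ]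
      refine (setLIntegral_congr_fun hZ (g := fun _ => 0) fun x hx => hx).trans (by simp)
  have hadd : m.withDensity D = m.withDensity ((G ⁻¹' {0}).indicator D) +
      (m.withDensity G).withDensity (fun x => D x / G x) := by
    change m.withDensity D = m.withDensity ((G ⁻¹' {0}).indicator D) +
      (m.withDensity G).withDensity (D / G)
    rw [← withDensity_mul _ hG (hD.div hG), ← withDensity_add_left (hD.indicator hZ)]
    congr 1
    ext x
    simp only [Pi.add_apply, Pi.mul_apply, Pi.div_apply]
    by_cases hx : G x = 0
    · simp [indicator, hx]
    · simp [indicator, hx, ENNReal.mul_div_cancel hx (hGtop x)]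
  exact ⟨(Measure.eq_rnDeriv (hD.div hG) hs hadd).symm,
    (Measure.eq_singularPart (hD.div hG) hs hadd).symm⟩

/-- The action is the integral of the perspective function of the densities, for any choice of the
reference measure. -/
theorem action_eq_lintegral_perspective {p : ℝ} {φ : ℝ → Space d → ℝ} (hφ : IsActionDensity p φ)
    (hp : 1 < p) {m γ μ : Measure (Space d)} {ν : RadonVectorMeasure d}
    [IsLocallyFiniteMeasure γ] [IsLocallyFiniteMeasure μ]
    {g r : Space d → ℝ} {n : Space d → Space d} (h : HasDensities m γ μ ν g r n)
    (hsupp : μ.support ⊆ γ.support ∧ ν.var.support ⊆ γ.support) :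
    action φ γ μ ν = ∫⁻ x, perspective φ (g x) (r x) (n x) ∂m := by
  rw [action, if_pos hsupp]
  set G : Space d → ℝ≥0∞ := fun x => ENNReal.ofReal (g x) with hGdef
  set R : Space d → ℝ≥0∞ := fun x => ENNReal.ofReal (r x) with hRdef
  set N : Space d → ℝ≥0∞ := fun x => ‖n x‖ₑ with hNdef
  have hG : Measurable G := h.measurable_g.ennreal_ofReal
  have hR : Measurable R := h.measurable_r.ennreal_ofReal
  have hN : Measurable N := h.measurable_n.enorm
  have hGtop : ∀ x, G x ≠ ⊤ := fun x => ENNReal.ofReal_ne_top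
  have hγ : γ = m.withDensity G := h.gamma_eq
  have hμ : μ = m.withDensity R := h.mu_eq
  have hν : ν.var = m.withDensity N := h.var_eq
  set Z := G ⁻¹' {0} with hZdef
  have hZ : MeasurableSet Z := hG (measurableSet_singleton 0)
  have hZg : ∀ x, x ∈ Z ↔ g x = 0 := fun x => by
    simp only [hZdef, mem_preimage, mem_singleton_iff, hGdef, ENNReal.ofReal_eq_zero]
    exact ⟨fun h' => le_antisymm h' (h.g_nonneg x), fun h' => h'.le⟩
  have hpers := hφ.measurable_perspective h.measurable_g h.measurable_r h.measurable_n
  have : SigmaFinite (m.withDensity G) := hγ ▸ inferInstance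
  obtain ⟨hr1, hs1⟩ := lebesgue_decomposition_withDensity (m := m) hR hG hGtop
  obtain ⟨hr2, hs2⟩ := lebesgue_decomposition_withDensity (m := m) hN hG hGtop
  have hσ : singularRef γ μ ν = m.withDensity (Z.indicator (R + N)) := by
    rw [singularRef, hμ, hν, hγ, hs1, hs2, ← withDensity_add_left (hR.indicator hZ),
      indicator_add']
  have hRN : Measurable (Z.indicator (R + N)) := (hR.add hN).indicator hZ
  have : IsLocallyFiniteMeasure (singularRef γ μ ν) := by
    refine Measure.isLocallyFiniteMeasure_of_le (μ := μ + ν.var) ?_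
    exact add_le_add (Measure.singularPart_le _ _) (Measure.singularPart_le _ _)
  have : SigmaFinite (m.withDensity (Z.indicator (R + N))) := hσ ▸ inferInstance
  have hRNtop : ∀ x, Z.indicator (R + N) x ≠ ⊤ := fun x => by
    by_cases hx : x ∈ Z
    · simp [hx, hRdef, hNdef]
    · simp [hx]
  obtain ⟨hr3, -⟩ := lebesgue_decomposition_withDensity (m := m) (hR.indicator hZ) hRN hRNtop
  obtain ⟨hr4, -⟩ := lebesgue_decomposition_withDensity (m := m) (hN.indicator hZ) hRN hRNtop
  -- `γ` lives on `{g > 0}`, where its contribution is the integral of `g φ(r/g, n/g)`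
  have e1 : ∫⁻ x, extDensity φ (μ.rnDeriv γ x).toReal
      ((ν.var.rnDeriv γ x).toReal • ν.dir x) ∂γ =
      ∫⁻ x in Zᶜ, perspective φ (g x) (r x) (n x) ∂m := by
    have hdir : ∀ᵐ x ∂(m.withDensity G), n x = ‖n x‖ • ν.dir x :=
      (withDensity_absolutelyContinuous m G).ae_le h.dir_eq
    have : ∫⁻ x, extDensity φ (μ.rnDeriv γ x).toReal
      ((ν.var.rnDeriv γ x).toReal • ν.dir x) ∂γ =
      ∫⁻ x, extDensity φ (r x / g x) ((g x)⁻¹ • n x) ∂(m.withDensity G) := by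
      rw [hμ, hν, hγ]
      refine lintegral_congr_ae ?_
      filter_upwards [hr1, hr2, hdir] with x h1 h2 h3
      rw [h1, h2, ENNReal.toReal_div, ENNReal.toReal_div, ENNReal.toReal_ofReal (h.r_nonneg x),
        ENNReal.toReal_ofReal (h.g_nonneg x), toReal_enorm]
      congr 1
      conv_rhs => rw [h3, smul_smul]
      rw [div_eq_inv_mul]
    rw [this, lintegral_withDensity_eq_lintegral_mul_non_measurable _ hG
      (Eventually.of_forall fun x => (hGtop x).lt_top), ← lintegral_indicator hZ.compl]
    congr 1
    ext x
    by_cases hx : x ∈ Z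
    · have h0 : G x = 0 := hx
      simp [hx, h0]
    · have hg : 0 < g x := lt_of_le_of_ne (h.g_nonneg x) fun h' => hx ((hZg x).2 h'.symm)
      simp only [Pi.mul_apply, indicator_of_mem (show x ∈ Zᶜ from hx)]
      exact (hφ.perspective_of_pos hp hg (h.r_nonneg x) (n x)).symm
  -- the singular parts live on `{g = 0}`, where `r + |n|` is the density of their reference measure
  have e2 : ∫⁻ x, recession φ ((μ.singularPart γ).rnDeriv (singularRef γ μ ν) x).toReal
      (((ν.var.singularPart γ).rnDeriv (singularRef γ μ ν) x).toReal • ν.dir x)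
      ∂(singularRef γ μ ν) = ∫⁻ x in Z, perspective φ (g x) (r x) (n x) ∂m := by
    rw [hσ, hμ, hν, hγ, hs1, hs2]
    have : ∫⁻ x, recession φ ((m.withDensity (Z.indicator R)).rnDeriv
        (m.withDensity (Z.indicator (R + N))) x).toReal
        (((m.withDensity (Z.indicator N)).rnDeriv
        (m.withDensity (Z.indicator (R + N))) x).toReal • ν.dir x)
        ∂(m.withDensity (Z.indicator (R + N))) =
        ∫⁻ x, recession φ (Z.indicator R x / Z.indicator (R + N) x).toReal
        ((Z.indicator N x / Z.indicator (R + N) x).toReal • ν.dir x)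
        ∂(m.withDensity (Z.indicator (R + N))) := by
      refine lintegral_congr_ae ?_
      filter_upwards [hr3, hr4] with x h1 h2
      rw [h1, h2]
    rw [this, lintegral_withDensity_eq_lintegral_mul_non_measurable _ hRN
      (Eventually.of_forall fun x => (hRNtop x).lt_top), ← lintegral_indicator hZ]
    refine lintegral_congr_ae ?_
    filter_upwards [h.dir_eq] with x h3
    by_cases hx : x ∈ Z
    · have hg : g x = 0 := (hZg x).1 hx
      simp only [Pi.mul_apply, indicator_of_mem hx, Pi.add_apply]
      have hsum : R x + N x = ENNReal.ofReal (r x + ‖n x‖) := by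
        rw [ENNReal.ofReal_add (h.r_nonneg x) (norm_nonneg _), ofReal_norm]
      have hc : 0 ≤ r x + ‖n x‖ := add_nonneg (h.r_nonneg x) (norm_nonneg _)
      rw [hsum, ENNReal.toReal_div, ENNReal.toReal_div, ENNReal.toReal_ofReal (h.r_nonneg x),
        ENNReal.toReal_ofReal hc, toReal_enorm,
        ← hφ.perspective_zero hp (div_nonneg (h.r_nonneg x) hc), ← perspective_smul φ hc, mul_zero,
        hg, smul_smul]
      rcases hc.lt_or_eq with hc | hc
      · rw [mul_div_cancel₀ _ hc.ne', mul_div_cancel₀ _ hc.ne', ← h3]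
      · have h1 : r x = 0 := by linarith [h.r_nonneg x, norm_nonneg (n x)]
        have h2 : n x = 0 := norm_eq_zero.1 (by linarith [h.r_nonneg x, norm_nonneg (n x)])
        simp [h1, h2]
    · simp [hx]
  rw [e1, e2, add_comm, lintegral_add_compl _ hZ]

/-! ### Countable families of test functions -/

/-- A sequence of `C¹` cut-off functions fine enough to separate compact sets from the complements
of their open neighbourhoods. -/
structure IsBumpFamily (F : ℕ → Space d → ℝ) : Prop where
  contDiff : ∀ j, ContDiff ℝ 1 (F j)
  hasCompactSupport : ∀ j, HasCompactSupport (F j)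
  mem_Icc : ∀ j x, F j x ∈ Icc (0 : ℝ) 1
  exists_of_subset : ∀ K U : Set (Space d), IsCompact K → IsOpen U → K ⊆ U →
    ∃ j, (∀ x ∈ K, F j x = 1) ∧ tsupport (F j) ⊆ U

/-- `C¹` Urysohn functions. -/
lemma exists_contDiff_urysohn {K U : Set (Space d)} (hK : IsClosed K) (hU : IsOpen U)
    (hc : IsCompact (closure U)) (h : K ⊆ U) :
    ∃ f : Space d → ℝ, ContDiff ℝ 1 f ∧ HasCompactSupport f ∧ (∀ x, f x ∈ Icc (0 : ℝ) 1) ∧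
      (∀ x ∈ K, f x = 1) ∧ tsupport f ⊆ closure U := by
  obtain ⟨f, hf0, hf1, hf⟩ := exists_contMDiffMap_zero_one_of_isClosed (n := (1 : ℕ∞))
    (modelWithCornersSelf ℝ (Space d)) hU.isClosed_compl hK
    (disjoint_left.2 fun x hx hx' => hx (h hx'))
  have hsub : tsupport f ⊆ closure U := by
    refine closure_mono fun x hx => ?_
    by_contra hxU
    exact hx (hf0 hxU)
  exact ⟨f, f.contMDiff.contDiff, hc.of_isClosed_subset (isClosed_tsupport _) hsub, hf,
    fun x hx => hf1 hx, hsub⟩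

/-- A countable family of bump functions subordinate to all pairs of a compact set and an open
neighbourhood: one for each pair of finite unions of basic open sets. -/
theorem exists_isBumpFamily (d : ℕ) : ∃ F : ℕ → Space d → ℝ, IsBumpFamily F := by
  classical
  set b := TopologicalSpace.countableBasis (Space d)
  have hb : TopologicalSpace.IsTopologicalBasis b := TopologicalSpace.isBasis_countableBasis _
  set O : Set (Set (Space d)) := sUnion '' {t | t.Finite ∧ t ⊆ b}
  have hO : O.Countable :=
    (Set.countable_ofPred_finite_subset (TopologicalSpace.countable_countableBasis _)).image _
  have hOopen : ∀ V ∈ O, IsOpen V := by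
    rintro _ ⟨t, ht, rfl⟩
    exact isOpen_sUnion fun v hv => hb.isOpen (ht.2 hv)
  have sep : ∀ K U : Set (Space d), IsCompact K → IsOpen U → K ⊆ U →
      ∃ V ∈ O, K ⊆ V ∧ IsCompact (closure V) ∧ closure V ⊆ U := by
    intro K U hK hU hKU
    obtain ⟨L, hL, hKL, hLU⟩ := exists_compact_between hK hU hKU
    choose! v hvb hxv hvL using fun (x : Space d) (hx : x ∈ K) =>
      hb.exists_subset_of_mem_open (hKL hx) isOpen_interior
    obtain ⟨t, htK, ht⟩ := hK.elim_nhds_subcover v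
      fun x hx => (hb.isOpen (hvb x hx)).mem_nhds (hxv x hx)
    have hVL : ⋃₀ (v '' t) ⊆ L := by
      rintro x ⟨_, ⟨y, hy, rfl⟩, hx⟩
      exact interior_subset (hvL y (htK y hy) hx)
    have hcl : closure (⋃₀ (v '' t)) ⊆ L := closure_minimal hVL hL.isClosed
    refine ⟨⋃₀ (v '' t), ⟨v '' t, ⟨t.finite_toSet.image _, ?_⟩, rfl⟩, ?_,
      hL.of_isClosed_subset isClosed_closure hcl, hcl.trans hLU⟩
    · rintro _ ⟨y, hy, rfl⟩
      exact hvb y (htK y hy)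
    · intro x hx
      obtain ⟨y, hy, hxy⟩ := mem_iUnion₂.1 (ht hx)
      exact ⟨v y, ⟨y, hy, rfl⟩, hxy⟩
  have hne : (O ×ˢ O).Nonempty :=
    ⟨(⋃₀ ∅, ⋃₀ ∅), ⟨∅, ⟨finite_empty, empty_subset _⟩, rfl⟩, ⟨∅, ⟨finite_empty, empty_subset _⟩, rfl⟩⟩
  obtain ⟨q, hq⟩ := (hO.prod hO).exists_eq_range hne
  have hqO : ∀ j, q j ∈ O ×ˢ O := fun j => hq ▸ mem_range_self j
  have hex : ∀ j, ∃ f : Space d → ℝ, ContDiff ℝ 1 f ∧ HasCompactSupport f ∧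
      (∀ x, f x ∈ Icc (0 : ℝ) 1) ∧ (closure (q j).1 ⊆ (q j).2 → IsCompact (closure (q j).2) →
      (∀ x ∈ closure (q j).1, f x = 1) ∧ tsupport f ⊆ closure (q j).2) := by
    intro j
    by_cases h : closure (q j).1 ⊆ (q j).2 ∧ IsCompact (closure (q j).2)
    · obtain ⟨f, h1, h2, h3, h4, h5⟩ := exists_contDiff_urysohn isClosed_closure
        (hOopen _ (hqO j).2) h.2 h.1
      exact ⟨f, h1, h2, h3, fun _ _ => ⟨h4, h5⟩⟩
    · refine ⟨fun _ => 0, contDiff_const, HasCompactSupport.zero, fun x => by simp, fun h1 h2 => absurd ⟨h1, h2⟩ h⟩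
  choose F h1 h2 h3 h4 using hex
  refine ⟨F, h1, h2, h3, fun K U hK hU hKU => ?_⟩
  obtain ⟨V', hV', hKV', hc', hV'U⟩ := sep K U hK hU hKU
  obtain ⟨V, hV, hKV, hc, hVV'⟩ := sep K V' hK (hOopen _ hV') hKV'
  obtain ⟨j, hj⟩ : (V, V') ∈ range q := hq ▸ ⟨hV, hV'⟩
  have := h4 j
  rw [hj] at this
  exact ⟨j, fun x hx => (this hVV' hc').1 x (subset_closure (hKV hx)),
    (this hVV' hc').2.trans hV'U⟩

lemma IsBumpFamily.continuous {F : ℕ → Space d → ℝ} (hF : IsBumpFamily F) (j : ℕ) :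
    Continuous (F j) := (hF.contDiff j).continuous

/-- Finite families of pairs `(i, j)`, standing for the linear forms of index `i` localized by the
cut-offs `F j`, such that the cut-offs sum up to at most one and are supported in `W`. -/
def Admissible (F : ℕ → Space d → ℝ) (W : Set (Space d)) (s : Finset (ℕ × ℕ)) : Prop :=
  (∀ x, ∑ q ∈ s, F q.2 x ≤ 1) ∧ ∀ q ∈ s, tsupport (F q.2) ⊆ W

/-- Inner and outer regularity: the integral of a nonnegative function over `D` is almost attained
by any cut-off function between a suitable compact set in `D` and a suitable open set. -/
lemma exists_compact_open_le_integral {m : Measure (Space d)} [IsLocallyFiniteMeasure m]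
    {l : Space d → ℝ} (hl : Measurable l) (hloc : LocallyIntegrable l m) {W D : Set (Space d)}
    (hW : IsOpen W) (hD : MeasurableSet D) (hDW : D ⊆ W) (hDb : Bornology.IsBounded D)
    (hDl : ∀ x ∈ D, 0 ≤ l x) {δ : ℝ} (hδ : 0 < δ) :
    ∃ K V : Set (Space d), IsCompact K ∧ IsOpen V ∧ K ⊆ D ∧ K ⊆ V ∧ V ⊆ W ∧
      (∫⁻ x in D, ENNReal.ofReal (l x) ∂m) ≠ ⊤ ∧
      ∀ f : Space d → ℝ, Continuous f → HasCompactSupport f → (∀ x, f x ∈ Icc (0 : ℝ) 1) →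
        (∀ x ∈ K, f x = 1) → tsupport f ⊆ V →
        (∫⁻ x in D, ENNReal.ofReal (l x) ∂m).toReal - δ ≤ ∫ x, f x * l x ∂m := by
  obtain ⟨R, hR⟩ := hDb.subset_ball (0 : Space d)
  set B := Metric.ball (0 : Space d) R
  have hBl : IntegrableOn l B m :=
    (hloc.integrableOn_isCompact (isCompact_closedBall (0 : Space d) R)).mono_set
      Metric.ball_subset_closedBall
  set ρ := (m.restrict B).withDensity fun x => ‖l x‖ₑ
  have hρfin : IsFiniteMeasure ρ := ⟨by
    rw [withDensity_apply _ MeasurableSet.univ, Measure.restrict_univ]; exact hBl.2⟩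
  have hρ : ∀ S : Set (Space d), MeasurableSet S → S ⊆ B → ρ S = ∫⁻ x in S, ‖l x‖ₑ ∂m := by
    intro S hS hSB
    rw [withDensity_apply _ hS, Measure.restrict_restrict hS, inter_eq_left.2 hSB]
  have hpos : ∀ S : Set (Space d), MeasurableSet S → S ⊆ D →
      ∫⁻ x in S, ENNReal.ofReal (l x) ∂m = ρ S := by
    intro S hS hSD
    rw [hρ S hS (hSD.trans hR)]
    refine setLIntegral_congr_fun hS fun x hx => ?_
    rw [← ofReal_norm, Real.norm_of_nonneg (hDl x (hSD hx))]
  have hδ2 : ENNReal.ofReal (δ / 2) ≠ 0 := by simpa using hδ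
  obtain ⟨K, hKD, hK, hKlt⟩ := hD.exists_isCompact_sdiff_lt (μ := ρ) (measure_ne_top _ _) hδ2
  obtain ⟨V₀, hKV₀, hV₀, hV₀lt⟩ := K.exists_isOpen_lt_add (μ := ρ) (measure_ne_top _ _) hδ2
  refine ⟨K, V₀ ∩ W ∩ B, hK, (hV₀.inter hW).inter Metric.isOpen_ball, hKD,
    fun x hx => ⟨⟨hKV₀ hx, hDW (hKD hx)⟩, hR (hKD hx)⟩, fun x hx => hx.1.2, ?_, ?_⟩
  · rw [hpos D hD le_rfl]; exact measure_ne_top _ _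
  intro f hf hfc hf01 hfK hfV
  set V := V₀ ∩ W ∩ B
  have hVm : MeasurableSet V := ((hV₀.inter hW).inter Metric.isOpen_ball).measurableSet
  have hKm : MeasurableSet K := hK.measurableSet
  have hKV : K ⊆ V := fun x hx => ⟨⟨hKV₀ hx, hDW (hKD hx)⟩, hR (hKD hx)⟩
  have hVB : V ⊆ B := fun x hx => hx.2
  rw [hpos D hD le_rfl]
  have hint : Integrable (fun x => f x * l x) m :=
    hloc.integrable_smul_left_of_hasCompactSupport hf hfc
  have e1 : ∫ x, f x * l x ∂m = ∫ x in K, l x ∂m + ∫ x in V \ K, f x * l x ∂m := by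
    rw [← setIntegral_eq_integral_of_forall_compl_eq_zero (s := V), ← union_sdiff_cancel hKV,
      setIntegral_union disjoint_sdiff_right (hVm.diff hKm) hint.integrableOn hint.integrableOn,
      union_sdiff_cancel hKV]
    · congr 1
      exact setIntegral_congr_fun hKm fun x hx => by simp [hfK x hx]
    · intro x hx
      rw [image_eq_zero_of_notMem_tsupport fun h => hx (hfV h), zero_mul]
  have e2 : ∫ x in K, l x ∂m = (ρ K).toReal := by
    rw [integral_eq_lintegral_of_nonneg_ae _ hl.aestronglyMeasurable, hpos K hKm hKD]
    exact (ae_restrict_iff' hKm).2 (Eventually.of_forall fun x hx => hDl x (hKD hx))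
  have e3 : -(ρ (V \ K)).toReal ≤ ∫ x in V \ K, f x * l x ∂m := by
    have h1 : ‖∫ x in V \ K, f x * l x ∂m‖ₑ ≤ ρ (V \ K) := by
      rw [hρ _ (hVm.diff hKm) (sdiff_subset.trans hVB)]
      refine (enorm_integral_le_lintegral_enorm _).trans (lintegral_mono fun x => ?_)
      rw [enorm_mul]
      refine mul_le_of_le_one_left' ?_
      rw [← enorm_one (G := ℝ)]
      exact enorm_le_iff_norm_le.2 (by
        rw [Real.norm_of_nonneg (hf01 x).1, norm_one]; exact (hf01 x).2)
    have h2 := ENNReal.toReal_mono (measure_ne_top _ _) h1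
    rw [toReal_enorm, Real.norm_eq_abs] at h2
    linarith [neg_abs_le (∫ x in V \ K, f x * l x ∂m)]
  have e4 : (ρ (V \ K)).toReal ≤ δ / 2 := by
    refine ENNReal.toReal_le_of_le_ofReal (by linarith) ?_
    rw [measure_sdiff hKV hKm.nullMeasurableSet (measure_ne_top _ _)]
    refine tsub_le_iff_left.2 ((measure_mono fun x hx => hx.1.1).trans hV₀lt.le)
  have e5 : (ρ D).toReal ≤ (ρ K).toReal + δ / 2 := by
    rw [← ENNReal.toReal_ofReal (by linarith : 0 ≤ δ / 2),
      ← ENNReal.toReal_add (measure_ne_top _ _) ENNReal.ofReal_ne_top]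
    refine ENNReal.toReal_mono (by finiteness) ?_
    rw [← measure_sdiff_add_inter D hKm, inter_eq_right.2 hKD, add_comm]
    exact add_le_add le_rfl hKlt.le
  rw [e1, e2]
  linarith

lemma ofReal_integral_le_lintegral_ofReal {α : Type*} [MeasurableSpace α] {m : Measure α}
    {f : α → ℝ} (hf : Integrable f m) :
    ENNReal.ofReal (∫ x, f x ∂m) ≤ ∫⁻ x, ENNReal.ofReal (f x) ∂m := by
  rw [integral_eq_lintegral_pos_part_sub_lintegral_neg_part hf]
  exact (ENNReal.ofReal_le_ofReal (sub_le_self _ ENNReal.toReal_nonneg)).trans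
    ENNReal.ofReal_toReal_le

/-- The integral of a countable supremum of functions, as a supremum of finite sums of integrals
localized by cut-off functions from a countable family. -/
theorem lintegral_iSup_ofReal_eq {F : ℕ → Space d → ℝ} (hF : IsBumpFamily F)
    {m : Measure (Space d)} [IsLocallyFiniteMeasure m] {l : ℕ → Space d → ℝ}
    (hl : ∀ i, Measurable (l i)) (hloc : ∀ i, LocallyIntegrable (l i) m) {W : Set (Space d)}
    (hW : IsOpen W) :
    ∫⁻ x in W, ⨆ i, ENNReal.ofReal (l i x) ∂m =
      ⨆ (s : Finset (ℕ × ℕ)) (_ : Admissible F W s),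
        ENNReal.ofReal (∑ q ∈ s, ∫ x, F q.2 x * l q.1 x ∂m) := by
  classical
  have hint : ∀ i j, Integrable (fun x => F j x * l i x) m := fun i j =>
    (hloc i).integrable_smul_left_of_hasCompactSupport (hF.continuous j) (hF.hasCompactSupport j)
  refine le_antisymm ?_ (iSup₂_le fun s hs => ?_)
  swap
  · rw [← integral_finsetSum _ fun q _ => hint q.1 q.2]
    refine (ofReal_integral_le_lintegral_ofReal
      (integrable_finsetSum _ fun q _ => hint q.1 q.2)).trans ?_
    rw [← lintegral_indicator hW.measurableSet]
    refine lintegral_mono fun x => ?_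
    by_cases hx : x ∈ W
    · rw [indicator_of_mem hx]
      calc ENNReal.ofReal (∑ q ∈ s, F q.2 x * l q.1 x)
          ≤ ∑ q ∈ s, ENNReal.ofReal (F q.2 x * l q.1 x) := by
            refine Finset.le_sum_of_subadditive _ ENNReal.ofReal_zero.le
              (fun _ _ => ENNReal.ofReal_add_le) _ _
        _ ≤ ∑ q ∈ s, ENNReal.ofReal (F q.2 x) * ⨆ i, ENNReal.ofReal (l i x) := by
            refine Finset.sum_le_sum fun q _ => ?_
            rw [ENNReal.ofReal_mul (hF.mem_Icc _ _).1]
            gcongr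
            exact le_iSup (fun i => ENNReal.ofReal (l i x)) q.1
        _ = ENNReal.ofReal (∑ q ∈ s, F q.2 x) * ⨆ i, ENNReal.ofReal (l i x) := by
            rw [← Finset.sum_mul, ENNReal.ofReal_sum_of_nonneg fun q _ => (hF.mem_Icc _ _).1]
        _ ≤ _ := mul_le_of_le_one_left' (by simpa using hs.1 x)
    · rw [indicator_of_notMem hx, Finset.sum_eq_zero fun q hq => by
        rw [image_eq_zero_of_notMem_tsupport fun h => hx (hs.2 q hq h), zero_mul]]
      simp
  · refine le_of_forall_lt fun c hc => ?_
    -- truncation to finitely many functions and to a ball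
    set H : ℕ → Space d → ℝ≥0∞ := fun N => (Metric.ball (0 : Space d) N).indicator
      fun x => (Finset.range N).sup fun i => ENNReal.ofReal (l i x) with hH
    have hHm : ∀ N, Measurable (H N) := fun N =>
      (by
        simp only [Finset.sup_eq_iSup]
        exact Measurable.iSup fun i => Measurable.iSup fun _ => (hl i).ennreal_ofReal : Measurable
          fun x => (Finset.range N).sup fun i => ENNReal.ofReal (l i x)).indicator
        Metric.isOpen_ball.measurableSet
    have hHmono : Monotone H := by
      intro N M hNM x
      simp only [hH]
      by_cases hx : x ∈ Metric.ball (0 : Space d) N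
      · rw [indicator_of_mem hx,
          indicator_of_mem (Metric.ball_subset_ball (by exact_mod_cast hNM) hx)]
        exact Finset.sup_mono (Finset.range_mono hNM)
      · rw [indicator_of_notMem hx]
        exact zero_le
    have hsup : ∀ x, ⨆ i, ENNReal.ofReal (l i x) ≤ ⨆ N, H N x := by
      intro x
      refine iSup_le fun i => ?_
      obtain ⟨N, hN⟩ := exists_nat_gt (max (i : ℝ) ‖x‖)
      refine le_iSup_of_le N ?_
      have hx : x ∈ Metric.ball (0 : Space d) N := by simpa using (le_max_right _ _).trans_lt hN
      simp only [hH, indicator_of_mem hx]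
      exact Finset.le_sup (f := fun i => ENNReal.ofReal (l i x))
        (Finset.mem_range.2 (by exact_mod_cast (le_max_left _ _).trans_lt hN))
    have hc' : c < ⨆ N, ∫⁻ x in W, H N x ∂m := by
      rw [← lintegral_iSup hHm hHmono]
      exact hc.trans_le (lintegral_mono hsup)
    obtain ⟨N, hN⟩ := lt_iSup_iff.1 hc'
    -- the disjoint sets where the `i`-th function realizes the maximum
    set E : ℕ → Set (Space d) := fun i => if i < N then
      W ∩ Metric.ball (0 : Space d) N ∩ {x | 0 < l i x} ∩ {x | ENNReal.ofReal (l i x) = H N x} else ∅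
      with hE
    have hEm : ∀ i, MeasurableSet (E i) := by
      intro i
      simp only [hE]
      split_ifs
      · exact ((hW.measurableSet.inter Metric.isOpen_ball.measurableSet).inter
          (measurableSet_lt measurable_const (hl i))).inter
          (measurableSet_eq_fun (hl i).ennreal_ofReal (hHm N))
      · exact MeasurableSet.empty
    set D := disjointed E
    have hDm : ∀ i, MeasurableSet (D i) := fun i => MeasurableSet.disjointed hEm i
    have hDE : ∀ i, D i ⊆ E i := disjointed_subset E
    have hDmem : ∀ i x, x ∈ D i → i < N ∧ x ∈ W ∧ x ∈ Metric.ball (0 : Space d) N ∧ 0 < l i x ∧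
        ENNReal.ofReal (l i x) = H N x := by
      intro i x hx
      have := hDE i hx
      simp only [hE] at this
      split_ifs at this with h
      · exact ⟨h, this.1.1.1, this.1.1.2, this.1.2, this.2⟩
      · exact absurd this (notMem_empty _)
    have hsum : ∫⁻ x in W, H N x ∂m ≤ ∑ i ∈ Finset.range N, ∫⁻ x in D i, ENNReal.ofReal (l i x) ∂m := by
      rw [← lintegral_indicator hW.measurableSet]
      simp_rw [← lintegral_indicator (hDm _)]
      rw [← lintegral_finsetSum _ fun i _ => ((hl i).ennreal_ofReal).indicator (hDm i)]
      refine lintegral_mono fun x => ?_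
      by_cases hx0 : W.indicator (H N) x = 0
      · exact hx0.le.trans (zero_le)
      have hxW : x ∈ W := mem_of_indicator_ne_zero hx0
      rw [indicator_of_mem hxW] at hx0 ⊢
      have hxB : x ∈ Metric.ball (0 : Space d) N := mem_of_indicator_ne_zero hx0
      have hval : H N x = (Finset.range N).sup fun i => ENNReal.ofReal (l i x) :=
        indicator_of_mem hxB _
      have hne : (Finset.range N).Nonempty := by
        by_contra h
        rw [Finset.not_nonempty_iff_eq_empty] at h
        rw [h, Finset.sup_empty] at hval
        exact hx0 hval
      obtain ⟨i, hi, hieq⟩ := Finset.exists_mem_eq_sup _ hne fun i => ENNReal.ofReal (l i x)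
      have hxE : x ∈ E i := by
        simp only [hE, if_pos (Finset.mem_range.1 hi)]
        refine ⟨⟨⟨hxW, hxB⟩, ?_⟩, by rw [mem_ofPred_eq, hval, hieq]⟩
        rw [hval, hieq] at hx0
        simpa using hx0
      have hxU : x ∈ ⋃ i, D i := by
        rw [iUnion_disjointed]; exact mem_iUnion.2 ⟨i, hxE⟩
      obtain ⟨i', hi'⟩ := mem_iUnion.1 hxU
      obtain ⟨h1, -, -, -, h5⟩ := hDmem i' x hi'
      rw [← h5]
      refine le_trans ?_ (Finset.single_le_sum (f := fun i => (D i).indicator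
        (fun x => ENNReal.ofReal (l i x)) x) (fun _ _ => zero_le) (Finset.mem_range.2 h1))
      simp only [indicator_of_mem hi', le_refl]
    have hN' := hN.trans_le hsum
    have hDb : ∀ i, Bornology.IsBounded (D i) := fun i =>
      Metric.isBounded_ball.subset fun x hx => (hDmem i x hx).2.2.1
    have hDfin : ∀ i, (∫⁻ x in D i, ENNReal.ofReal (l i x) ∂m) ≠ ⊤ := fun i => by
      obtain ⟨_, _, _, _, _, _, _, h, _⟩ := exists_compact_open_le_integral (hl i) (hloc i) hW
        (hDm i) (fun x hx => (hDmem i x hx).2.1) (hDb i) (fun x hx => (hDmem i x hx).2.2.2.1.le)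
        one_pos
      exact h
    have hctop : c ≠ ⊤ := hN'.ne_top
    set T := ∑ i ∈ Finset.range N, (∫⁻ x in D i, ENNReal.ofReal (l i x) ∂m).toReal with hT
    have hTeq : (∑ i ∈ Finset.range N, ∫⁻ x in D i, ENNReal.ofReal (l i x) ∂m).toReal = T :=
      ENNReal.toReal_sum fun i _ => hDfin i
    have hcT : c.toReal < T := by
      rw [← hTeq]
      exact ENNReal.toReal_strict_mono (ENNReal.sum_ne_top.2 fun i _ => hDfin i) hN'
    set δ := (T - c.toReal) / (2 * (N + 1)) with hδdef
    have hδ : 0 < δ := div_pos (by linarith) (by positivity)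
    have hNδ : N * δ < T - c.toReal := by
      have h0 : 0 < T - c.toReal := by linarith
      rw [hδdef, ← mul_div_assoc, div_lt_iff₀ (by positivity)]
      nlinarith
    choose K V hK hV hKD hKV hVW _ hKf using fun i => exists_compact_open_le_integral (hl i) (hloc i)
      hW (hDm i) (fun x hx => (hDmem i x hx).2.1) (hDb i)
      (fun x hx => (hDmem i x hx).2.2.2.1.le) hδ
    -- the disjoint compact sets `K i` have disjoint open neighbourhoods, formed by the points that
    -- are closest to `K i`; cut-off functions supported there sum up to at most one
    set U : ℕ → Set (Space d) := fun i => V i ∩ ⋂ j ∈ Finset.range N, {x | j ≠ i →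
      Metric.infEDist x (K i) < Metric.infEDist x (K j)} with hU
    have hUo : ∀ i, IsOpen (U i) := by
      intro i
      refine (hV i).inter (isOpen_biInter_finset fun j _ => ?_)
      by_cases h : j = i
      · simp [h]
      · simp only [ne_eq, h, not_false_eq_true, forall_const]
        exact isOpen_lt Metric.continuous_infEDist Metric.continuous_infEDist
    have hKU : ∀ i, K i ⊆ U i := by
      intro i x hx
      refine ⟨hKV i hx, mem_iInter₂.2 fun j _ hji => ?_⟩
      rw [Metric.infEDist_zero_of_mem hx, pos_iff_ne_zero]
      intro h0
      have hxj : x ∈ K j := by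
        rw [← (hK j).isClosed.closure_eq]; exact Metric.mem_closure_iff_infEDist_zero.2 h0
      exact (disjoint_left.1 (disjoint_disjointed E hji) (hKD j hxj)) (hKD i hx)
    have hUdisj : ∀ i j, i < N → j < N → i ≠ j → ∀ x, x ∈ U i → x ∉ U j := by
      intro i j hi hj hij x hxi hxj
      have h1 := mem_iInter₂.1 hxi.2 j (Finset.mem_range.2 hj) hij.symm
      have h2 := mem_iInter₂.1 hxj.2 i (Finset.mem_range.2 hi) hij
      exact lt_asymm h1 h2
    choose J hJ1 hJU using fun i => hF.exists_of_subset (K i) (U i) (hK i) (hUo i) (hKU i)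
    have hinj : Set.InjOn (fun i : ℕ => (i, J i)) (Finset.range N) := fun i _ j _ h =>
      (Prod.ext_iff.1 h).1
    refine lt_of_lt_of_le ?_ (le_iSup₂_of_le ((Finset.range N).image fun i => (i, J i)) ⟨?_, ?_⟩ le_rfl)
    · rw [Finset.sum_image hinj]
      refine (ENNReal.lt_ofReal_iff_toReal_lt hctop).2 ?_
      have : T - N * δ ≤ ∑ i ∈ Finset.range N, ∫ x, F (J i) x * l i x ∂m := by
        calc T - N * δ = ∑ i ∈ Finset.range N,
            ((∫⁻ x in D i, ENNReal.ofReal (l i x) ∂m).toReal - δ) := by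
              rw [Finset.sum_sub_distrib, Finset.sum_const, Finset.card_range, nsmul_eq_mul]
          _ ≤ _ := Finset.sum_le_sum fun i _ => hKf i (F (J i)) (hF.continuous _)
              (hF.hasCompactSupport _) (hF.mem_Icc _) (hJ1 i)
              ((hJU i).trans inter_subset_left)
      linarith
    · intro x
      rw [Finset.sum_image hinj]
      by_cases hx : ∃ i ∈ Finset.range N, F (J i) x ≠ 0
      · obtain ⟨i, hi, hix⟩ := hx
        rw [Finset.sum_eq_single_of_mem i hi]
        · exact (hF.mem_Icc _ _).2
        · intro j hj hji
          by_contra hjx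
          exact hUdisj i j (Finset.mem_range.1 hi) (Finset.mem_range.1 hj) hji.symm x
            (hJU i (subset_tsupport _ hix)) (hJU j (subset_tsupport _ hjx))
      · push Not at hx
        rw [Finset.sum_eq_zero hx]; exact zero_le_one
    · intro q hq
      obtain ⟨i, -, rfl⟩ := Finset.mem_image.1 hq
      exact (hJU i).trans (inter_subset_left.trans (hVW i))

/-! ### Duality formulas and measurable dependence on parameters -/

lemma integral_withDensity_ofReal {m : Measure (Space d)} {g : Space d → ℝ} (hg : Measurable g)
    (h0 : ∀ x, 0 ≤ g x) (f : Space d → ℝ) :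
    ∫ x, f x ∂(m.withDensity fun x => ENNReal.ofReal (g x)) = ∫ x, f x * g x ∂m := by
  rw [integral_withDensity_eq_integral_toReal_smul hg.ennreal_ofReal
    (Eventually.of_forall fun _ => ENNReal.ofReal_lt_top)]
  refine integral_congr_ae (Eventually.of_forall fun x => ?_)
  simp only [smul_eq_mul, ENNReal.toReal_ofReal (h0 x), mul_comm]

lemma locallyIntegrable_of_isLocallyFiniteMeasure_withDensity {E : Type*} [NormedAddCommGroup E]
    {m : Measure (Space d)} {f : Space d → E} (hf : AEStronglyMeasurable f m)
    (h : IsLocallyFiniteMeasure (m.withDensity fun x => ‖f x‖ₑ)) : LocallyIntegrable f m := by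
  intro x
  obtain ⟨s, hs, hfin⟩ := h.1 x
  obtain ⟨t, hts, ht, hxt⟩ := mem_nhds_iff.1 hs
  refine ⟨t, ht.mem_nhds hxt, hf.restrict, ?_⟩
  have := (measure_mono hts).trans_lt hfin
  rwa [withDensity_apply _ ht.measurableSet] at this

namespace HasDensities

variable {m γ μ : Measure (Space d)} {ν : RadonVectorMeasure d} {g r : Space d → ℝ}
  {n : Space d → Space d}

lemma pairing_eq (h : HasDensities m γ μ ν g r n) (ζ : Space d → Space d) :
    ν.pairing ζ = ∫ x, inner ℝ (ζ x) (n x) ∂m := by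
  rw [RadonVectorMeasure.pairing, h.var_eq,
    integral_withDensity_eq_integral_toReal_smul h.measurable_n.enorm (by simp)]
  refine integral_congr_ae ?_
  filter_upwards [h.dir_eq] with x hx
  conv_rhs => rw [hx]
  rw [toReal_enorm, inner_smul_right, smul_eq_mul]

lemma value_eq (h : HasDensities m γ μ ν g r n) {B : Set (Space d)} (hB : MeasurableSet B) :
    ν.value B = ∫ x in B, n x ∂m := by
  rw [RadonVectorMeasure.value, h.var_eq, restrict_withDensity hB,
    integral_withDensity_eq_integral_toReal_smul h.measurable_n.enorm (by simp)]
  refine integral_congr_ae ?_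
  filter_upwards [ae_restrict_of_ae h.dir_eq] with x hx
  conv_rhs => rw [hx]
  rw [toReal_enorm]

lemma locallyIntegrable_g (h : HasDensities m γ μ ν g r n) [IsLocallyFiniteMeasure γ] :
    LocallyIntegrable g m := by
  refine locallyIntegrable_of_isLocallyFiniteMeasure_withDensity
    h.measurable_g.aestronglyMeasurable ?_
  have : γ = m.withDensity fun x => ‖g x‖ₑ := by
    rw [h.gamma_eq]; congr 1; ext x; rw [← ofReal_norm, Real.norm_of_nonneg (h.g_nonneg x)]
  rwa [← this]

lemma locallyIntegrable_r (h : HasDensities m γ μ ν g r n) [IsLocallyFiniteMeasure μ] :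
    LocallyIntegrable r m := by
  refine locallyIntegrable_of_isLocallyFiniteMeasure_withDensity
    h.measurable_r.aestronglyMeasurable ?_
  have : μ = m.withDensity fun x => ‖r x‖ₑ := by
    rw [h.mu_eq]; congr 1; ext x; rw [← ofReal_norm, Real.norm_of_nonneg (h.r_nonneg x)]
  rwa [← this]

lemma locallyIntegrable_n (h : HasDensities m γ μ ν g r n) : LocallyIntegrable n m := by
  refine locallyIntegrable_of_isLocallyFiniteMeasure_withDensity
    h.measurable_n.aestronglyMeasurable ?_
  rw [← h.var_eq]; infer_instance

lemma measurable_affineForm (h : HasDensities m γ μ ν g r n) (k : ℝ × ℝ × Space d) :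
    Measurable fun x => affineForm k (g x) (r x) (n x) := by
  have h1 := h.measurable_g
  have h2 := h.measurable_r
  have h3 := h.measurable_n
  unfold affineForm
  fun_prop

lemma locallyIntegrable_affineForm (h : HasDensities m γ μ ν g r n) [IsLocallyFiniteMeasure γ]
    [IsLocallyFiniteMeasure μ] (k : ℝ × ℝ × Space d) :
    LocallyIntegrable (fun x => affineForm k (g x) (r x) (n x)) m := by
  refine ((h.locallyIntegrable_g.smul k.1).add (h.locallyIntegrable_r.smul k.2.1)).add ?_
  intro x
  obtain ⟨s, hs, hint⟩ := h.locallyIntegrable_n x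
  exact ⟨s, hs, hint.const_inner k.2.2⟩

lemma integral_mul_affineForm (h : HasDensities m γ μ ν g r n) [IsLocallyFiniteMeasure γ]
    [IsLocallyFiniteMeasure μ] (k : ℝ × ℝ × Space d) {f : Space d → ℝ} (hf : Continuous f)
    (hc : HasCompactSupport f) :
    ∫ x, f x * affineForm k (g x) (r x) (n x) ∂m =
      k.1 * ∫ x, f x ∂γ + k.2.1 * ∫ x, f x ∂μ + ν.pairing (fun x => f x • k.2.2) := by
  have i1 : Integrable (fun x => f x * g x) m :=
    h.locallyIntegrable_g.integrable_smul_left_of_hasCompactSupport hf hc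
  have i2 : Integrable (fun x => f x * r x) m :=
    h.locallyIntegrable_r.integrable_smul_left_of_hasCompactSupport hf hc
  have i3 : Integrable (fun x => inner ℝ (f x • k.2.2) (n x)) m := by
    have := (h.locallyIntegrable_n.integrable_smul_left_of_hasCompactSupport hf hc).const_inner
      (𝕜 := ℝ) k.2.2
    refine this.congr (Eventually.of_forall fun x => ?_)
    simp only [real_inner_smul_left, inner_smul_right]
  have e1 : ∫ x, f x ∂γ = ∫ x, f x * g x ∂m := by
    conv_lhs => rw [h.gamma_eq]
    exact integral_withDensity_ofReal h.measurable_g h.g_nonneg f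
  have e2 : ∫ x, f x ∂μ = ∫ x, f x * r x ∂m := by
    conv_lhs => rw [h.mu_eq]
    exact integral_withDensity_ofReal h.measurable_r h.r_nonneg f
  rw [e1, e2, h.pairing_eq, ← integral_const_mul, ← integral_const_mul,
    ← integral_add (i1.const_mul _) (i2.const_mul _),
    ← integral_add (f := fun x => k.1 * (f x * g x) + k.2.1 * (f x * r x))
      ((i1.const_mul _).add (i2.const_mul _)) i3]
  refine integral_congr_ae (Eventually.of_forall fun x => ?_)
  simp only [affineForm, real_inner_smul_left]
  ring

end HasDensities

/-- The value of `∑ ∫ F_j (α_i dγ + β_i dμ + ξ_i · dν)`, the sum running over the pairs `(i, j)`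
in `s`, where `k i = (α_i, β_i, ξ_i)`. -/
def testValue (F : ℕ → Space d → ℝ) (k : ℕ → ℝ × ℝ × Space d) (γ μ : Measure (Space d))
    (ν : RadonVectorMeasure d) (s : Finset (ℕ × ℕ)) : ℝ :=
  ∑ q ∈ s, ((k q.1).1 * ∫ x, F q.2 x ∂γ + (k q.1).2.1 * ∫ x, F q.2 x ∂μ +
    ν.pairing (fun x => F q.2 x • (k q.1).2.2))

lemma HasDensities.lintegral_iSup_affineForm {m γ μ : Measure (Space d)} {ν : RadonVectorMeasure d}
    {g r : Space d → ℝ} {n : Space d → Space d} (h : HasDensities m γ μ ν g r n)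
    [IsLocallyFiniteMeasure m] [IsLocallyFiniteMeasure γ] [IsLocallyFiniteMeasure μ]
    {F : ℕ → Space d → ℝ} (hF : IsBumpFamily F) (k : ℕ → ℝ × ℝ × Space d)
    {W : Set (Space d)} (hW : IsOpen W) :
    ∫⁻ x in W, ⨆ i, ENNReal.ofReal (affineForm (k i) (g x) (r x) (n x)) ∂m =
      ⨆ (s : Finset (ℕ × ℕ)) (_ : Admissible F W s), ENNReal.ofReal (testValue F k γ μ ν s) := by
  rw [lintegral_iSup_ofReal_eq hF (fun i => h.measurable_affineForm (k i))
    (fun i => h.locallyIntegrable_affineForm (k i)) hW]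
  refine iSup_congr fun s => iSup_congr fun _ => ?_
  rw [testValue]
  congr 1
  exact Finset.sum_congr rfl fun q _ =>
    h.integral_mul_affineForm (k q.1) (hF.continuous q.2) (hF.hasCompactSupport q.2)

/-- Dual formula for the action, as a supremum of weakly* continuous functionals. -/
theorem action_eq_iSup_testValue {p : ℝ} {φ : ℝ → Space d → ℝ} (hφ : IsActionDensity p φ)
    (hp : 1 < p) {F : ℕ → Space d → ℝ} (hF : IsBumpFamily F) {k : ℕ → ℝ × ℝ × Space d}
    (hk : ∀ g r n, perspective φ g r n = ⨆ i, ENNReal.ofReal (affineForm (k i) g r n))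
    {γ μ : Measure (Space d)} {ν : RadonVectorMeasure d}
    [IsLocallyFiniteMeasure γ] [IsLocallyFiniteMeasure μ]
    (hsupp : μ.support ⊆ γ.support ∧ ν.var.support ⊆ γ.support) :
    action φ γ μ ν = ⨆ (s : Finset (ℕ × ℕ)) (_ : Admissible F univ s),
      ENNReal.ofReal (testValue F k γ μ ν s) := by
  obtain ⟨g, r, n, h⟩ := exists_hasDensities_sum γ μ ν
  rw [action_eq_lintegral_perspective hφ hp h hsupp, ← h.lintegral_iSup_affineForm hF k isOpen_univ,
    Measure.restrict_univ]
  simp only [hk]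

lemma exists_seq_enorm_eq (d : ℕ) : ∃ ξ : ℕ → Space d, ∀ n : Space d,
    ‖n‖ₑ = ⨆ i, ENNReal.ofReal (inner ℝ (ξ i) n) := by
  have : Nonempty (Metric.closedBall (0 : Space d) 1) := ⟨⟨0, by simp⟩⟩
  let u := TopologicalSpace.denseSeq (Metric.closedBall (0 : Space d) 1)
  have hu : DenseRange u := TopologicalSpace.denseRange_denseSeq _
  refine ⟨fun i => u i, fun n => le_antisymm ?_ (iSup_le fun i => ?_)⟩
  · have hcl : IsClosed {v : Metric.closedBall (0 : Space d) 1 | ENNReal.ofReal (inner ℝ (v : Space d) n)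
        ≤ ⨆ i, ENNReal.ofReal (inner ℝ (u i : Space d) n)} :=
      isClosed_le (ENNReal.continuous_ofReal.comp (by fun_prop)) continuous_const
    have key : ∀ v : Metric.closedBall (0 : Space d) 1, ENNReal.ofReal (inner ℝ (v : Space d) n)
        ≤ ⨆ i, ENNReal.ofReal (inner ℝ (u i : Space d) n) := fun v =>
      hu.induction_on (p := fun v : Metric.closedBall (0 : Space d) 1 =>
        ENNReal.ofReal (inner ℝ (v : Space d) n) ≤ ⨆ i, ENNReal.ofReal (inner ℝ (u i : Space d) n))
        v hcl fun i => le_iSup (fun i => ENNReal.ofReal (inner ℝ (u i : Space d) n)) i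
    refine le_trans (le_of_eq ?_) (key ⟨‖n‖⁻¹ • n, by
      rw [mem_closedBall_zero_iff, norm_smul, norm_inv, norm_norm]
      exact inv_mul_le_one⟩)
    rw [real_inner_smul_left, real_inner_self_eq_norm_sq, ← ofReal_norm]
    congr 1
    rcases eq_or_ne ‖n‖ 0 with h | h
    · simp [h]
    · field_simp
  · rw [← ofReal_norm]
    refine ENNReal.ofReal_le_ofReal ((real_inner_le_norm _ _).trans ?_)
    exact mul_le_of_le_one_left (norm_nonneg _) (mem_closedBall_zero_iff.1 (u i).2)

/-- Dual formula for the total variation on open sets. -/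
lemma RadonVectorMeasure.var_eq_iSup_testValue {F : ℕ → Space d → ℝ} (hF : IsBumpFamily F)
    {ξ : ℕ → Space d} (hξ : ∀ n : Space d, ‖n‖ₑ = ⨆ i, ENNReal.ofReal (inner ℝ (ξ i) n))
    (ν : RadonVectorMeasure d) {W : Set (Space d)} (hW : IsOpen W) :
    ν.var W = ⨆ (s : Finset (ℕ × ℕ)) (_ : Admissible F W s),
      ENNReal.ofReal (testValue F (fun i => (0, 0, ξ i)) 0 0 ν s) := by
  obtain ⟨g, r, n, h⟩ := exists_hasDensities ν.var 0 0 ν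
    (Measure.AbsolutelyContinuous.zero _) (Measure.AbsolutelyContinuous.zero _)
    Measure.AbsolutelyContinuous.rfl
  rw [← h.lintegral_iSup_affineForm hF _ hW]
  simp only [affineForm, zero_mul, zero_add, ← hξ]
  conv_lhs => rw [h.var_eq, withDensity_apply _ hW.measurableSet]

section Parameters

variable {α : Type*} [MeasurableSpace α]

lemma measurable_measure_of_isOpen {κ : α → Measure (Space d)}
    (hfin : ∀ a, IsLocallyFiniteMeasure (κ a))
    (h : ∀ W : Set (Space d), IsOpen W → Measurable fun a => κ a W) : Measurable κ := by
  have hball : ∀ N : ℕ, Measurable fun a => (κ a).restrict (Metric.ball (0 : Space d) N) := by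
    intro N
    have : ∀ a, IsFiniteMeasure ((κ a).restrict (Metric.ball (0 : Space d) N)) := fun a =>
      ⟨by rw [Measure.restrict_apply_univ]; exact measure_ball_lt_top⟩
    refine Measurable.measure_of_isPiSystem (S := {W : Set (Space d) | IsOpen W})
      (BorelSpace.measurable_eq (α := Space d)) isPiSystem_isOpen (fun W (hW : IsOpen W) => ?_) ?_
    · simp only [Measure.restrict_apply hW.measurableSet]
      exact h _ (hW.inter Metric.isOpen_ball)
    · simp only [Measure.restrict_apply_univ]
      exact h _ Metric.isOpen_ball
  refine Measure.measurable_of_measurable_coe _ fun B hB => ?_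
  have : ∀ a, κ a B = ⨆ N : ℕ, (κ a).restrict (Metric.ball (0 : Space d) N) B := by
    intro a
    have hU : B = ⋃ N : ℕ, B ∩ Metric.ball (0 : Space d) N := by
      rw [← inter_iUnion, Metric.iUnion_ball_nat, inter_univ]
    conv_lhs => rw [hU]
    rw [Monotone.measure_iUnion]
    · simp only [Measure.restrict_apply hB]
    · intro N M hNM
      exact inter_subset_inter_right _ (Metric.ball_subset_ball (by exact_mod_cast hNM))
  simp only [this]
  exact Measurable.iSup fun N => (Measure.measurable_coe hB).comp (hball N)

lemma measurable_measure_of_integral {F : ℕ → Space d → ℝ} (hF : IsBumpFamily F)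
    {κ : α → Measure (Space d)} (hfin : ∀ a, IsLocallyFiniteMeasure (κ a))
    (h : ∀ j, Measurable fun a => ∫ x, F j x ∂(κ a)) : Measurable κ := by
  refine measurable_measure_of_isOpen hfin fun W hW => ?_
  have : ∀ a, κ a W = ⨆ (j : ℕ) (_ : tsupport (F j) ⊆ W), ENNReal.ofReal (∫ x, F j x ∂(κ a)) := by
    intro a
    have hint : ∀ j, ENNReal.ofReal (∫ x, F j x ∂(κ a)) = ∫⁻ x, ENNReal.ofReal (F j x) ∂(κ a) :=
      fun j => ofReal_integral_eq_lintegral_ofReal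
        ((hF.continuous j).integrable_of_hasCompactSupport (hF.hasCompactSupport j))
        (Eventually.of_forall fun x => (hF.mem_Icc j x).1)
    refine le_antisymm ?_ (iSup₂_le fun j hj => ?_)
    · rw [hW.measure_eq_iSup_isCompact]
      refine iSup_le fun K => iSup_le fun hKW => iSup_le fun hK => ?_
      obtain ⟨j, hj1, hjW⟩ := hF.exists_of_subset K W hK hW hKW
      refine le_iSup₂_of_le j hjW ?_
      rw [hint, ← lintegral_indicator_one hK.measurableSet]
      refine lintegral_mono fun x => ?_
      by_cases hx : x ∈ K
      · simp [hx, hj1 x hx]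
      · simp [hx]
    · rw [hint, ← lintegral_indicator_one hW.measurableSet]
      refine lintegral_mono fun x => ?_
      by_cases hx : x ∈ W
      · simpa [hx] using (hF.mem_Icc j x).2
      · simp [image_eq_zero_of_notMem_tsupport fun h' => hx (hj h')]
  simp only [this]
  exact Measurable.iSup fun j => Measurable.iSup fun _ => (h j).ennreal_ofReal

/-- For a Borel family of vector measures, the values on bounded Borel sets determine the pairings
with simple functions, and these approximate the pairing with a continuous vector field. -/
lemma measurable_pairing {ν : α → RadonVectorMeasure d}
    (hν : ∀ B : Set (Space d), MeasurableSet B → Bornology.IsBounded B →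
      Measurable fun a => (ν a).value B)
    {ζ : Space d → Space d} (hζ : Continuous ζ) (hc : HasCompactSupport ζ) :
    Measurable fun a => (ν a).pairing ζ := by
  obtain ⟨R, hR⟩ := hc.isCompact.isBounded.subset_ball (0 : Space d)
  obtain ⟨C, hC⟩ := hc.exists_bound_of_continuous hζ
  set B := Metric.ball (0 : Space d) R
  have hBm : MeasurableSet B := Metric.isOpen_ball.measurableSet
  have hfin : ∀ a, IsFiniteMeasure ((ν a).var.restrict B) := fun a =>
    ⟨by rw [Measure.restrict_apply_univ]; exact measure_ball_lt_top⟩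
  have hdir : ∀ a, ∀ᵐ x ∂(ν a).var.restrict B, ‖(ν a).dir x‖ = 1 := fun a =>
    ae_restrict_of_ae (ν a).norm_dir
  have hsimple : ∀ f : SimpleFunc (Space d) (Space d),
      Measurable fun a => ∫ x in B, inner ℝ (f x) ((ν a).dir x) ∂(ν a).var := by
    have hint : ∀ (a : α) (f : SimpleFunc (Space d) (Space d)),
        Integrable (fun x => inner ℝ (f x) ((ν a).dir x)) ((ν a).var.restrict B) := by
      intro a f
      obtain ⟨D, hD⟩ := f.exists_forall_norm_le
      refine Integrable.of_bound (f.measurable.inner (ν a).measurable_dir).aestronglyMeasurable D ?_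
      filter_upwards [hdir a] with x hx
      exact (norm_inner_le_norm _ _).trans (by rw [hx, mul_one]; exact hD x)
    intro f
    induction f using SimpleFunc.induction with
    | @const c s hs =>
      have : ∀ a, ∫ x in B, inner ℝ ((SimpleFunc.piecewise s hs (SimpleFunc.const _ c)
          (SimpleFunc.const _ 0)) x) ((ν a).dir x) ∂(ν a).var = inner ℝ c ((ν a).value (s ∩ B)) := by
        intro a
        have hi : Integrable ((ν a).dir) ((ν a).var.restrict (s ∩ B)) := by
          have : IsFiniteMeasure ((ν a).var.restrict (s ∩ B)) :=
            ⟨by rw [Measure.restrict_apply_univ]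
                exact (measure_mono inter_subset_right).trans_lt measure_ball_lt_top⟩
          refine Integrable.of_bound (ν a).measurable_dir.aestronglyMeasurable 1 ?_
          filter_upwards [ae_restrict_of_ae (ν a).norm_dir] with x hx using hx.le
        rw [RadonVectorMeasure.value, ← integral_inner hi c, ← Measure.restrict_restrict hs,
          ← integral_indicator hs]
        refine integral_congr_ae (Eventually.of_forall fun x => ?_)
        by_cases hx : x ∈ s <;> simp [hx]
      simp only [this]
      exact measurable_const.inner (hν _ (hs.inter hBm) (Metric.isBounded_ball.subset inter_subset_right))
    | @add f g _ hf hg =>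
      have : ∀ a, ∫ x in B, inner ℝ ((f + g) x) ((ν a).dir x) ∂(ν a).var =
          ∫ x in B, inner ℝ (f x) ((ν a).dir x) ∂(ν a).var +
          ∫ x in B, inner ℝ (g x) ((ν a).dir x) ∂(ν a).var := by
        intro a
        rw [← integral_add (hint a f) (hint a g)]
        simp [inner_add_left]
      simp only [this]
      exact hf.add hg
  have hsm : StronglyMeasurable ζ := hζ.stronglyMeasurable
  refine measurable_of_tendsto_metrizable (fun N => hsimple (hsm.approxBounded C N)) ?_
  rw [tendsto_pi_nhds]
  intro a
  have e : (ν a).pairing ζ = ∫ x in B, inner ℝ (ζ x) ((ν a).dir x) ∂(ν a).var := by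
    rw [RadonVectorMeasure.pairing, setIntegral_eq_integral_of_forall_compl_eq_zero]
    intro x hx
    rw [image_eq_zero_of_notMem_tsupport fun h => hx (hR h), inner_zero_left]
  rw [e]
  have hC0 : 0 ≤ C := (norm_nonneg _).trans (hC 0)
  refine tendsto_integral_of_dominated_convergence (fun _ => C)
    (fun N => ((hsm.approxBounded C N).measurable.inner (ν a).measurable_dir).aestronglyMeasurable)
    (integrable_const C) (fun N => ?_) (Eventually.of_forall fun x => ?_)
  · filter_upwards [hdir a] with x hx
    exact (norm_inner_le_norm _ _).trans (by
      rw [hx, mul_one]; exact hsm.norm_approxBounded_le hC0 N x)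
  · exact (hsm.tendsto_approxBounded_of_norm_le (hC x)).inner tendsto_const_nhds

lemma measurable_testValue {F : ℕ → Space d → ℝ} (hF : IsBumpFamily F)
    (k : ℕ → ℝ × ℝ × Space d) (γ : Measure (Space d)) {μ : α → Measure (Space d)}
    {ν : α → RadonVectorMeasure d} (hμ : ∀ j, Measurable fun a => ∫ x, F j x ∂(μ a))
    (hν : ∀ B : Set (Space d), MeasurableSet B → Bornology.IsBounded B →
      Measurable fun a => (ν a).value B) (s : Finset (ℕ × ℕ)) :
    Measurable fun a => testValue F k γ (μ a) (ν a) s := by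
  unfold testValue
  refine Finset.measurable_fun_sum _ fun q _ => ?_
  refine (measurable_const.add ((hμ _).const_mul _)).add
    (measurable_pairing hν ((hF.continuous _).smul continuous_const)
      ((hF.hasCompactSupport _).smul_right))

/-- The total variation of a Borel family of vector measures is a Borel family of measures. -/
lemma measurable_var {ν : α → RadonVectorMeasure d}
    (hν : ∀ B : Set (Space d), MeasurableSet B → Bornology.IsBounded B →
      Measurable fun a => (ν a).value B) : Measurable fun a => (ν a).var := by
  obtain ⟨F, hF⟩ := exists_isBumpFamily d
  obtain ⟨ξ, hξ⟩ := exists_seq_enorm_eq d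
  refine measurable_measure_of_isOpen (fun a => inferInstance) fun W hW => ?_
  simp only [RadonVectorMeasure.var_eq_iSup_testValue hF hξ _ hW]
  exact Measurable.iSup fun s => Measurable.iSup fun _ =>
    (measurable_testValue hF _ 0 (μ := fun _ => 0) (fun j => measurable_const) hν s).ennreal_ofReal

lemma support_subset_iff_measure_compl {γ μ : Measure (Space d)} :
    μ.support ⊆ γ.support ↔ μ γ.supportᶜ = 0 := by
  constructor
  · intro h
    exact measure_mono_null (compl_subset_compl.2 h) Measure.measure_compl_support
  · intro h
    exact Measure.support_subset_of_isClosed Measure.isClosed_support (mem_ae_iff.2 h)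

/-- Measurability of the action along Borel families. -/
theorem measurable_action {p : ℝ} {φ : ℝ → Space d → ℝ} (hφ : IsActionDensity p φ)
    (hp : 1 < p) (γ : Measure (Space d)) [IsLocallyFiniteMeasure γ] {μ : α → Measure (Space d)}
    (hfin : ∀ a, IsLocallyFiniteMeasure (μ a)) {ν : α → RadonVectorMeasure d}
    (hμ : ∀ ζ : Space d → ℝ, ContDiff ℝ 1 ζ → HasCompactSupport ζ →
      Measurable fun a => ∫ x, ζ x ∂(μ a))
    (hν : ∀ B : Set (Space d), MeasurableSet B → Bornology.IsBounded B →
      Measurable fun a => (ν a).value B) :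
    Measurable fun a => action φ γ (μ a) (ν a) := by
  classical
  obtain ⟨F, hF⟩ := exists_isBumpFamily d
  obtain ⟨k, -, hk⟩ := hφ.exists_seq_perspective_eq
  have hμF : ∀ j, Measurable fun a => ∫ x, F j x ∂(μ a) := fun j =>
    hμ _ (hF.contDiff j) (hF.hasCompactSupport j)
  have hμm := measurable_measure_of_integral hF hfin hμF
  have hSm : MeasurableSet γ.supportᶜ := Measure.isOpen_compl_support.measurableSet
  have hset : MeasurableSet {a | (μ a).support ⊆ γ.support ∧ (ν a).var.support ⊆ γ.support} := by
    simp only [support_subset_iff_measure_compl]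
    exact ((Measure.measurable_coe hSm).comp hμm (measurableSet_singleton 0)).inter
      ((Measure.measurable_coe hSm).comp (measurable_var hν) (measurableSet_singleton 0))
  have : (fun a => action φ γ (μ a) (ν a)) = fun a =>
      if (μ a).support ⊆ γ.support ∧ (ν a).var.support ⊆ γ.support then
        ⨆ (s : Finset (ℕ × ℕ)) (_ : Admissible F univ s),
          ENNReal.ofReal (testValue F k γ (μ a) (ν a) s) else ⊤ := by
    ext a
    split_ifs with h
    · exact action_eq_iSup_testValue hφ hp hF hk h
    · rw [action, if_neg h]
  rw [this]
  exact Measurable.ite hset (Measurable.iSup fun s => Measurable.iSup fun _ =>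
    (measurable_testValue hF k γ hμF hν s).ennreal_ofReal) measurable_const

end Parameters

/-! ### Elementary properties of the action -/

lemma HasDensities.scale {m γ μ : Measure (Space d)} {ν : RadonVectorMeasure d}
    {g r : Space d → ℝ} {n : Space d → Space d} (h : HasDensities m γ μ ν g r n) {c : ℝ}
    (hc : 0 ≤ c) : HasDensities m γ μ (ν.scale c) g r (fun x => c • n x) where
  measurable_g := h.measurable_g
  measurable_r := h.measurable_r
  measurable_n := h.measurable_n.const_smul c
  g_nonneg := h.g_nonneg
  r_nonneg := h.r_nonneg
  gamma_eq := h.gamma_eq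
  mu_eq := h.mu_eq
  var_eq := by
    have : ∀ x, ‖c • n x‖ₑ = ENNReal.ofReal c * ‖n x‖ₑ := fun x => by
      rw [enorm_smul, Real.enorm_of_nonneg hc]
    simp only [this]
    change ENNReal.ofReal c • ν.var = m.withDensity (ENNReal.ofReal c • fun x => ‖n x‖ₑ)
    rw [withDensity_smul _ h.measurable_n.enorm, ← h.var_eq]
  dir_eq := by
    filter_upwards [h.dir_eq] with x hx
    rw [norm_smul, Real.norm_of_nonneg hc, mul_smul]
    exact congrArg (c • ·) hx

lemma HasDensities.opp {m γ μ : Measure (Space d)} {ν : RadonVectorMeasure d}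
    {g r : Space d → ℝ} {n : Space d → Space d} (h : HasDensities m γ μ ν g r n) :
    HasDensities m γ μ ν.opp g r (fun x => -n x) where
  measurable_g := h.measurable_g
  measurable_r := h.measurable_r
  measurable_n := h.measurable_n.neg
  g_nonneg := h.g_nonneg
  r_nonneg := h.r_nonneg
  gamma_eq := h.gamma_eq
  mu_eq := h.mu_eq
  var_eq := by
    simp only [enorm_neg]
    exact h.var_eq
  dir_eq := by
    filter_upwards [h.dir_eq] with x hx
    simp only [RadonVectorMeasure.opp, norm_neg, smul_neg]
    exact congrArg Neg.neg hx

lemma support_subset_of_action_ne_top {φ : ℝ → Space d → ℝ} {γ μ : Measure (Space d)}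
    {ν : RadonVectorMeasure d} (h : action φ γ μ ν ≠ ⊤) :
    μ.support ⊆ γ.support ∧ ν.var.support ⊆ γ.support := by
  by_contra hs
  rw [action, if_neg hs] at h
  exact h rfl

lemma action_scale {p : ℝ} {φ : ℝ → Space d → ℝ} (hφ : IsActionDensity p φ) (hp : 1 < p)
    (γ μ : Measure (Space d)) [IsLocallyFiniteMeasure γ] [IsLocallyFiniteMeasure μ]
    (ν : RadonVectorMeasure d) {c : ℝ} (hc : 0 < c) :
    action φ γ μ (ν.scale c) = ENNReal.ofReal (c ^ p) * action φ γ μ ν := by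
  have hcp : 0 < c ^ p := Real.rpow_pos_of_pos hc p
  have hsup : (ν.scale c).var.support = ν.var.support := by
    refine Subset.antisymm
      (Measure.AbsolutelyContinuous.support_mono (Measure.smul_absolutelyContinuous))
      (Measure.AbsolutelyContinuous.support_mono ?_)
    intro s hs
    have : ENNReal.ofReal c * ν.var s = 0 := hs
    simpa [hc, not_le.2 hc] using this
  by_cases hs : μ.support ⊆ γ.support ∧ ν.var.support ⊆ γ.support
  · obtain ⟨g, r, n, h⟩ := exists_hasDensities_sum γ μ ν
    rw [action_eq_lintegral_perspective hφ hp (h.scale hc.le) (by rwa [hsup]),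
      action_eq_lintegral_perspective hφ hp h hs, ← lintegral_const_mul _
      (hφ.measurable_perspective h.measurable_g h.measurable_r h.measurable_n)]
    simp only [hφ.perspective_smul_flux hc.ne', abs_of_pos hc]
  · rw [action, hsup, if_neg hs, action, if_neg hs, ENNReal.mul_top (by simpa using hcp)]

lemma action_opp {p : ℝ} {φ : ℝ → Space d → ℝ} (hφ : IsActionDensity p φ) (hp : 1 < p)
    (γ μ : Measure (Space d)) [IsLocallyFiniteMeasure γ] [IsLocallyFiniteMeasure μ]
    (ν : RadonVectorMeasure d) : action φ γ μ ν.opp = action φ γ μ ν := by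
  by_cases hs : μ.support ⊆ γ.support ∧ ν.var.support ⊆ γ.support
  · obtain ⟨g, r, n, h⟩ := exists_hasDensities_sum γ μ ν
    rw [action_eq_lintegral_perspective hφ hp h.opp hs, action_eq_lintegral_perspective hφ hp h hs]
    refine lintegral_congr fun x => ?_
    have := hφ.perspective_smul_flux (c := -1) (by norm_num) (g x) (r x) (n x)
    simpa using this
  · rw [action, if_neg (show ¬(_ ∧ ν.opp.var.support ⊆ _) from hs), action, if_neg hs]

/-- The total variation of the flux is controlled by the action: Hölder's inequality applied to
`|n| ≤ C perspective^(1/p) (g + r)^(1/q)`. -/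
theorem exists_lintegral_var_le {p q : ℝ} (hpq : p.HolderConjugate q) {φ : ℝ → Space d → ℝ}
    (hφ : IsActionDensity p φ) :
    ∃ C : ℝ, 0 < C ∧ ∀ (γ μ : Measure (Space d)) [IsLocallyFiniteMeasure γ]
      [IsLocallyFiniteMeasure μ] (ν : RadonVectorMeasure d), action φ γ μ ν ≠ ⊤ →
      ∀ f : Space d → ℝ≥0∞, Measurable f → ∫⁻ x, f x ∂ν.var ≤
        ENNReal.ofReal C * action φ γ μ ν ^ (1 / p) * (∫⁻ x, f x ^ q ∂(γ + μ)) ^ (1 / q) := by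
  have hp : 1 < p := hpq.lt
  obtain ⟨C, hC, hcoer⟩ := hφ.exists_norm_rpow_le_perspective hp
  refine ⟨C ^ (1 / p), by positivity, fun γ μ _ _ ν hfin f hf => ?_⟩
  obtain ⟨g, r, n, h⟩ := exists_hasDensities_sum γ μ ν
  set m := γ + μ + ν.var
  have hact := action_eq_lintegral_perspective hφ hp h (support_subset_of_action_ne_top hfin)
  have hPm := hφ.measurable_perspective h.measurable_g h.measurable_r h.measurable_n
  set P : Space d → ℝ≥0∞ := fun x => perspective φ (g x) (r x) (n x) with hP
  set S : Space d → ℝ≥0∞ := fun x => ENNReal.ofReal (g x + r x) with hS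
  have hSm : Measurable S := (h.measurable_g.add h.measurable_r).ennreal_ofReal
  have hPfin : ∀ᵐ x ∂m, P x < ⊤ := ae_lt_top hPm (hact ▸ hfin)
  have hpt : ∀ᵐ x ∂m, ‖n x‖ₑ ≤ ENNReal.ofReal (C ^ (1 / p)) * (P x ^ (1 / p) * S x ^ (1 / q)) := by
    filter_upwards [hPfin] with x hx
    have h1 := hcoer (g x) (r x) (h.g_nonneg x) (h.r_nonneg x) (n x) hx.ne
    have hgr : 0 ≤ g x + r x := add_nonneg (h.g_nonneg x) (h.r_nonneg x)
    have h2 := Real.rpow_le_rpow (by positivity) h1 (by have := hpq.pos; positivity : 0 ≤ 1 / p)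
    rw [← Real.rpow_mul (norm_nonneg _), mul_one_div_cancel hpq.ne_zero, Real.rpow_one,
      Real.mul_rpow (mul_nonneg hC.le ENNReal.toReal_nonneg) (by positivity),
      Real.mul_rpow hC.le ENNReal.toReal_nonneg, ← Real.rpow_mul hgr] at h2
    have hq' : (p - 1) * (1 / p) = 1 / q := by
      have := hpq.inv_add_inv_eq_one
      have hp0 := hpq.ne_zero
      rw [one_div, one_div, sub_mul, mul_inv_cancel₀ hp0]; linarith
    rw [hq'] at h2
    calc ‖n x‖ₑ = ENNReal.ofReal ‖n x‖ := (ofReal_norm _).symm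
      _ ≤ ENNReal.ofReal (C ^ (1 / p) * (P x).toReal ^ (1 / p) * (g x + r x) ^ (1 / q)) :=
        ENNReal.ofReal_le_ofReal h2
      _ = _ := by
        rw [ENNReal.ofReal_mul (by positivity), ENNReal.ofReal_mul (by positivity), mul_assoc,
          ← ENNReal.ofReal_rpow_of_nonneg hgr (by have := hpq.symm.pos; positivity),
          ← ENNReal.ofReal_rpow_of_nonneg ENNReal.toReal_nonneg (by have := hpq.pos; positivity),
          ENNReal.ofReal_toReal hx.ne]
  have hsum : γ + μ = m.withDensity S := by
    have : S = (fun x => ENNReal.ofReal (g x)) + fun x => ENNReal.ofReal (r x) := by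
      ext x; exact ENNReal.ofReal_add (h.g_nonneg x) (h.r_nonneg x)
    rw [this, withDensity_add_left h.measurable_g.ennreal_ofReal, ← h.gamma_eq, ← h.mu_eq]
  have hq0 : 0 < q := hpq.symm.pos
  calc ∫⁻ x, f x ∂ν.var = ∫⁻ x, ‖n x‖ₑ * f x ∂m := by
        conv_lhs => rw [h.var_eq]
        rw [lintegral_withDensity_eq_lintegral_mul _ h.measurable_n.enorm hf]
        rfl
    _ ≤ ∫⁻ x, ENNReal.ofReal (C ^ (1 / p)) * (P x ^ (1 / p) * (S x ^ (1 / q) * f x)) ∂m := by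
        refine lintegral_mono_ae ?_
        filter_upwards [hpt] with x hx
        calc ‖n x‖ₑ * f x ≤ _ := mul_le_mul_left hx (f x)
          _ = _ := by ring
    _ = ENNReal.ofReal (C ^ (1 / p)) * ∫⁻ x, P x ^ (1 / p) * (S x ^ (1 / q) * f x) ∂m :=
        lintegral_const_mul _ ((hPm.pow_const _).mul ((hSm.pow_const _).mul hf))
    _ ≤ ENNReal.ofReal (C ^ (1 / p)) * ((∫⁻ x, (P x ^ (1 / p)) ^ p ∂m) ^ (1 / p) *
          (∫⁻ x, (S x ^ (1 / q) * f x) ^ q ∂m) ^ (1 / q)) := by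
        gcongr
        exact ENNReal.lintegral_mul_le_Lp_mul_Lq m hpq (hPm.pow_const _).aemeasurable
          ((hSm.pow_const _).mul hf).aemeasurable
    _ = _ := by
        rw [hact, hsum, lintegral_withDensity_eq_lintegral_mul _ hSm (hf.pow_const _), mul_assoc]
        congr 3
        · refine lintegral_congr fun x => ?_
          rw [← ENNReal.rpow_mul, one_div_mul_cancel hpq.ne_zero, ENNReal.rpow_one]
        · congr 1
          ext x
          rw [ENNReal.mul_rpow_of_nonneg _ _ hq0.le, ← ENNReal.rpow_mul,
            one_div_mul_cancel hq0.ne', ENNReal.rpow_one]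
          rfl

/-! ### The fundamental lemma of the calculus of variations on an interval -/

lemma exists_Icc_superset_of_isCompact {a b : ℝ} (hab : a < b) {K : Set ℝ} (hK : IsCompact K)
    (h : K ⊆ Ioo a b) : ∃ a' b', a < a' ∧ b' < b ∧ K ⊆ Icc a' b' := by
  rcases K.eq_empty_or_nonempty with rfl | hne
  · exact ⟨b, a, hab, hab, empty_subset _⟩
  · obtain ⟨l, hl⟩ := hK.exists_isLeast hne
    obtain ⟨u, hu⟩ := hK.exists_isGreatest hne
    exact ⟨l, u, (h hl.1).1, (h hu.1).2, fun x hx => ⟨hl.2 hx, hu.2 hx⟩⟩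

/-- If `P` is the weak derivative of `F` on `(a,b)`, then `F` is a primitive of `P`. -/
theorem sub_eq_setIntegral_of_weak_deriv {a b : ℝ} (hab : a < b) {F P : ℝ → ℝ}
    (hF : ContinuousOn F (Icc a b)) (hP : IntegrableOn P (Ioo a b))
    (h : ∀ η : ℝ → ℝ, ContDiff ℝ 1 η → HasCompactSupport η → tsupport η ⊆ Ioo a b →
      (∫ t in Ioo a b, deriv η t * F t) + ∫ t in Ioo a b, η t * P t = 0)
    {s t : ℝ} (has : a ≤ s) (hst : s ≤ t) (htb : t ≤ b) : F t - F s = ∫ r in Ioo s t, P r := by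
  have hPi : IntervalIntegrable P volume a b :=
    (intervalIntegrable_iff_integrableOn_Ioo_of_le hab.le).2 hP
  set Q : ℝ → ℝ := fun x => ∫ r in a..x, P r with hQ
  have hQac : AbsolutelyContinuousOnInterval Q a b :=
    hPi.absolutelyContinuousOnInterval_intervalIntegral left_mem_uIcc
  have hQc : ContinuousOn Q (Icc a b) := by
    have := hQac.continuousOn; rwa [uIcc_of_le hab.le] at this
  have hQd : ∀ᵐ x, x ∈ uIcc a b → deriv Q x = P x := by
    filter_upwards [hPi.ae_hasDerivAt_integral] with x hx hxab
    exact (hx hxab a left_mem_uIcc).deriv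
  set H : ℝ → ℝ := fun x => F x - Q x with hH
  have hHc : ContinuousOn H (Icc a b) := hF.sub hQc
  have convI : ∀ f : ℝ → ℝ, ∫ t in Ioo a b, f t = ∫ t in a..b, f t := fun f => by
    rw [intervalIntegral.integral_of_le hab.le, integral_Ioc_eq_integral_Ioo]
  -- the difference of `F` and a primitive of `P` has vanishing weak derivative
  have key : ∀ η : ℝ → ℝ, ContDiff ℝ 1 η → HasCompactSupport η → tsupport η ⊆ Ioo a b →
      ∫ t in a..b, deriv η t * H t = 0 := by
    intro η hη hηc hηs
    have h1 := h η hη hηc hηs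
    have hηa : η a = 0 := image_eq_zero_of_notMem_tsupport fun h' => lt_irrefl _ (hηs h').1
    have hηb : η b = 0 := image_eq_zero_of_notMem_tsupport fun h' => lt_irrefl _ (hηs h').2
    have h2 := hη.contDiffOn.absolutelyContinuousOnInterval.integral_mul_deriv_eq_deriv_mul hQac
    rw [hηa, hηb, zero_mul, zero_mul, sub_zero, zero_sub] at h2
    have h3 : ∫ x in a..b, η x * deriv Q x = ∫ x in a..b, η x * P x := by
      refine intervalIntegral.integral_congr_ae ?_
      filter_upwards [hQd] with x hx hxab
      rw [hx (uIoc_subset_uIcc hxab)]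
    rw [convI, convI, ← h3, h2] at h1
    have hdη : Continuous (deriv η) := hη.continuous_deriv le_rfl
    simp only [hH, mul_sub]
    rw [intervalIntegral.integral_sub]
    · linarith
    · exact (hdη.continuousOn.mul (by rwa [uIcc_of_le hab.le])).intervalIntegrable
    · exact (hdη.continuousOn.mul (by rwa [uIcc_of_le hab.le])).intervalIntegrable
  -- a fixed bump function of integral one, to correct the mean of test functions
  set β : ContDiffBump ((a + b) / 2) :=
    ⟨(b - a) / 8, (b - a) / 4, by linarith, by linarith⟩ with hβ
  set ψ₀ : ℝ → ℝ := β.normed volume with hψ₀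
  have hψ₀s : tsupport ψ₀ ⊆ Ioo a b := by
    rw [hψ₀, β.tsupport_normed_eq]
    intro x hx
    rw [Metric.mem_closedBall, Real.dist_eq, abs_le, show β.rOut = (b - a) / 4 from rfl] at hx
    exact ⟨by linarith [hx.1], by linarith [hx.2]⟩
  have hψ₀c : HasCompactSupport ψ₀ := β.hasCompactSupport_normed
  have hψ₀d : ContDiff ℝ 1 ψ₀ := β.contDiff_normed
  set c : ℝ := ∫ x in a..b, ψ₀ x * H x with hc
  -- a test function of integral zero is the derivative of a test function
  have hzero : ∀ᵐ x, x ∈ Ioo a b → H x - c = 0 := by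
    refine isOpen_Ioo.ae_eq_zero_of_integral_contDiff_smul_eq_zero
      (((hHc.mono Ioo_subset_Icc_self).sub continuousOn_const).locallyIntegrableOn
        measurableSet_Ioo) ?_
    intro ψ hψ hψc hψs
    set g : ℝ → ℝ := fun x => ψ x - (∫ y, ψ y) * ψ₀ x with hg
    have hgcont : Continuous g := hψ.continuous.sub (continuous_const.mul hψ₀d.continuous)
    have hψi : Integrable ψ := hψ.continuous.integrable_of_hasCompactSupport hψc
    have hψ₀i : Integrable ψ₀ := hψ₀d.continuous.integrable_of_hasCompactSupport hψ₀c
    have hgi : Integrable g := hψi.sub (hψ₀i.const_mul _)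
    have hg0 : ∫ x, g x = 0 := by
      rw [integral_sub hψi (hψ₀i.const_mul _), integral_const_mul, hψ₀, β.integral_normed]
      ring
    obtain ⟨a', b', haa', hb'b, hsub⟩ := exists_Icc_superset_of_isCompact hab
      (hψc.isCompact.union hψ₀c.isCompact) (union_subset hψs hψ₀s)
    have hgout : ∀ x, x ∉ Icc a' b' → g x = 0 := by
      intro x hx
      simp only [hg]
      rw [image_eq_zero_of_notMem_tsupport fun h' => hx (hsub (Or.inl h')),
        image_eq_zero_of_notMem_tsupport fun h' => hx (hsub (Or.inr h'))]
      simp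
    set η : ℝ → ℝ := fun x => ∫ r in a..x, g r with hη
    have hηd : ∀ x, HasDerivAt η (g x) x := fun x =>
      intervalIntegral.integral_hasDerivAt_right (hgcont.intervalIntegrable _ _)
        (hgcont.stronglyMeasurableAtFilter _ _) hgcont.continuousAt
    have hηdd : deriv η = g := funext fun x => (hηd x).deriv
    have hη1 : ContDiff ℝ 1 η := contDiff_one_iff_deriv.2
      ⟨fun x => (hηd x).differentiableAt, hηdd ▸ hgcont⟩
    have hηIic : ∀ x, η x = ∫ r in Iic x, g r := by
      intro x
      have h0 : ∫ r in Iic a, g r = 0 := setIntegral_eq_zero_of_forall_eq_zero fun y hy =>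
        hgout y fun h' => by linarith [h'.1, mem_Iic.1 hy]
      change ∫ r in a..x, g r = _
      rw [← intervalIntegral.integral_Iic_sub_Iic hgi.integrableOn hgi.integrableOn, h0, sub_zero]
    have hηsupp : tsupport η ⊆ Icc a' b' := by
      refine closure_minimal (fun x hx => ?_) isClosed_Icc
      by_contra hx'
      refine hx ?_
      rw [hηIic]
      rcases lt_or_ge x a' with hxa | hxa
      · exact setIntegral_eq_zero_of_forall_eq_zero fun y hy =>
          hgout y fun h' => by linarith [h'.1, mem_Iic.1 hy]
      · have hxb : b' < x := by
          by_contra! h'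
          exact hx' ⟨hxa, h'⟩
        rw [setIntegral_eq_integral_of_forall_compl_eq_zero, hg0]
        intro y hy
        exact hgout y fun h' => by linarith [h'.2, not_le.1 (fun h => hy (mem_Iic.2 h))]
    have h4 := key η hη1 (isCompact_Icc.of_isClosed_subset (isClosed_tsupport _) hηsupp)
      (hηsupp.trans fun x hx => ⟨haa'.trans_le hx.1, hx.2.trans_lt hb'b⟩)
    rw [hηdd] at h4
    have hi : ∀ f : ℝ → ℝ, Continuous f → IntervalIntegrable (fun x => f x * H x) volume a b :=
      fun f hf => (hf.continuousOn.mul (by rwa [uIcc_of_le hab.le])).intervalIntegrable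
    have h5 : ∫ x in a..b, ψ x * H x = (∫ y, ψ y) * c := by
      have : ∀ x, g x * H x = ψ x * H x - (∫ y, ψ y) * (ψ₀ x * H x) := fun x => by
        simp only [hg]; ring
      simp only [this] at h4
      rw [intervalIntegral.integral_sub (hi ψ hψ.continuous)
        ((hi ψ₀ hψ₀d.continuous).const_mul _), intervalIntegral.integral_const_mul] at h4
      linarith
    have hψab : ∫ y, ψ y = ∫ y in a..b, ψ y := by
      rw [← convI, setIntegral_eq_integral_of_forall_compl_eq_zero]
      exact fun x hx => image_eq_zero_of_notMem_tsupport fun h' => hx (hψs h')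
    have h6 : ∫ x, ψ x • (H x - c) = ∫ x in a..b, ψ x * (H x - c) := by
      rw [← convI, setIntegral_eq_integral_of_forall_compl_eq_zero]
      · rfl
      · intro x hx
        rw [image_eq_zero_of_notMem_tsupport fun h' => hx (hψs h'), zero_mul]
    rw [h6]
    simp only [mul_sub]
    rw [intervalIntegral.integral_sub (hi ψ hψ.continuous)
      ((hψ.continuous.intervalIntegrable _ _).mul_const c), intervalIntegral.integral_mul_const, h5,
      hψab, sub_self]
  have hEq : EqOn H (fun _ => c) (Icc a b) := by
    refine Measure.eqOn_Icc_of_ae_eq volume hab.ne ?_ hHc continuousOn_const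
    rw [← restrict_Ioo_eq_restrict_Icc]
    exact (ae_restrict_iff' measurableSet_Ioo).2 (hzero.mono fun x hx hx' => sub_eq_zero.1 (hx hx'))
  have e1 := hEq ⟨has, hst.trans htb⟩
  have e2 := hEq ⟨has.trans hst, htb⟩
  simp only [hH, hQ] at e1 e2
  rw [← integral_Ioc_eq_integral_Ioo, ← intervalIntegral.integral_of_le hst,
    ← intervalIntegral.integral_interval_sub_left (a := a)]
  · linarith
  · exact hPi.mono_set (by rw [uIcc_of_le hab.le, uIcc_of_le (has.trans hst)]; exact Icc_subset_Icc_right htb)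
  · exact hPi.mono_set (by rw [uIcc_of_le hab.le, uIcc_of_le has]; exact Icc_subset_Icc_right (hst.trans htb))

/-- A function whose increments are `o(1)`-small multiples of those of a fixed absolutely
continuous function is constant. -/
lemma eq_of_forall_local_estimate {a b : ℝ} (hab : a < b) {A w : ℝ → ℝ}
    (hw : IntervalIntegrable w volume a b)
    (h : ∀ ε : ℝ, 0 < ε → ∃ δ : ℝ, 0 < δ ∧ ∀ s t : ℝ, a ≤ s → s ≤ t → t ≤ b → t - s < δ →
      |A t - A s| ≤ ε * ∫ r in s..t, w r) : A b = A a := by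
  have key : ∀ ε : ℝ, 0 < ε → |A b - A a| ≤ ε * ∫ r in a..b, w r := by
    intro ε hε
    obtain ⟨δ, hδ, hest⟩ := h ε hε
    obtain ⟨N, hN⟩ := exists_nat_gt ((b - a) / δ)
    have hN0 : (0 : ℝ) < N := (div_pos (by linarith) hδ).trans hN
    have hstep : (b - a) / N < δ := by
      rw [div_lt_iff₀ hδ] at hN
      rw [div_lt_iff₀ hN0]; linarith
    set τ : ℕ → ℝ := fun i => a + i * ((b - a) / N) with hτ
    have hτ0 : τ 0 = a := by simp [hτ]
    have hτN : τ N = b := by simp only [hτ]; field_simp; ring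
    have hd : 0 ≤ (b - a) / N := div_nonneg (by linarith) hN0.le
    have hτmono : Monotone τ := fun i j hij => by
      simp only [hτ]; gcongr
    have hmem : ∀ i, i ≤ N → a ≤ τ i ∧ τ i ≤ b := fun i hi =>
      ⟨hτ0 ▸ hτmono (Nat.zero_le i), hτN ▸ hτmono hi⟩
    have h1 : A b - A a = ∑ i ∈ Finset.range N, (A (τ (i + 1)) - A (τ i)) := by
      rw [Finset.sum_range_sub fun i => A (τ i), hτN, hτ0]
    have h2 : ∫ r in a..b, w r = ∑ i ∈ Finset.range N, ∫ r in τ i..τ (i + 1), w r := by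
      rw [intervalIntegral.sum_integral_adjacent_intervals, hτN, hτ0]
      intro i hi
      refine hw.mono_set ?_
      rw [uIcc_of_le hab.le, uIcc_of_le (hτmono (Nat.le_succ i))]
      exact Icc_subset_Icc (hmem i hi.le).1 (hmem (i + 1) hi).2
    rw [h1, h2, Finset.mul_sum]
    refine (Finset.abs_sum_le_sum_abs _ _).trans (Finset.sum_le_sum fun i hi => ?_)
    have hi' := Finset.mem_range.1 hi
    refine hest _ _ (hmem i hi'.le).1 (hτmono (Nat.le_succ i)) (hmem (i + 1) hi').2 ?_
    simp only [hτ]; push_cast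
    linarith
  have hlim : Tendsto (fun ε : ℝ => ε * ∫ r in a..b, w r) (𝓝[>] 0) (𝓝 (0 * ∫ r in a..b, w r)) :=
    ((continuous_id.mul continuous_const).tendsto 0).mono_left nhdsWithin_le_nhds
  rw [zero_mul] at hlim
  have := ge_of_tendsto hlim (by filter_upwards [self_mem_nhdsWithin] with ε hε using key ε hε)
  exact sub_eq_zero.1 (abs_eq_zero.1 (le_antisymm this (abs_nonneg _)))

/-! ### The continuity equation in integrated form -/

/-- Solutions of the continuity equation on `[a,b]`, with the equation in integrated form: for every
`ζ ∈ C¹_c` the increments of `t ↦ ∫ ζ dμ_t` are the integrals of `t ↦ ∫ ∇ζ · dν_t`. -/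
structure ContinuityEqOn (a b : ℝ) (μ : ℝ → Measure (Space d)) (ν : ℝ → RadonVectorMeasure d) :
    Prop where
  locallyFinite : ∀ t ∈ Icc a b, IsLocallyFiniteMeasure (μ t)
  weakStar_continuous : ∀ ζ : Space d → ℝ, Continuous ζ → HasCompactSupport ζ →
    ContinuousOn (fun t => ∫ x, ζ x ∂(μ t)) (Icc a b)
  borel : ∀ B : Set (Space d), MeasurableSet B → Bornology.IsBounded B →
    Measurable (fun t : Ioo a b => (ν t).value B)
  locally_integrable : ∀ R : ℝ, 0 < R →
    ∫⁻ t in Ioo a b, (ν t).var (Metric.ball 0 R) < ⊤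
  balance : ∀ ζ : Space d → ℝ, ContDiff ℝ 1 ζ → HasCompactSupport ζ → ∀ s t : ℝ, a ≤ s → s ≤ t →
    t ≤ b → ∫ x, ζ x ∂(μ t) - ∫ x, ζ x ∂(μ s) = ∫ r in Ioo s t, (ν r).pairing (gradient ζ)

lemma continuous_gradient {ζ : Space d → ℝ} (h : ContDiff ℝ 1 ζ) : Continuous (gradient ζ) :=
  (InnerProductSpace.toDual ℝ (Space d)).symm.continuous.comp (h.continuous_fderiv one_ne_zero)

lemma hasCompactSupport_gradient {ζ : Space d → ℝ} (h : HasCompactSupport ζ) :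
    HasCompactSupport (gradient ζ) :=
  (h.fderiv (𝕜 := ℝ)).comp_left (g := (InnerProductSpace.toDual ℝ (Space d)).symm) (map_zero _)

lemma RadonVectorMeasure.enorm_pairing_le_ball (ν : RadonVectorMeasure d)
    {ζ : Space d → Space d} {C R : ℝ} (hC : ∀ x, ‖ζ x‖ ≤ C)
    (hR : ∀ x, x ∉ Metric.ball (0 : Space d) R → ζ x = 0) :
    ‖ν.pairing ζ‖ₑ ≤ ENNReal.ofReal C * ν.var (Metric.ball 0 R) := by
  refine (ν.enorm_pairing_le ζ).trans ?_
  rw [← lintegral_indicator_const Metric.isOpen_ball.measurableSet]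
  refine lintegral_mono fun x => ?_
  by_cases hx : x ∈ Metric.ball (0 : Space d) R
  · rw [indicator_of_mem hx, ← ofReal_norm]
    exact ENNReal.ofReal_le_ofReal (hC x)
  · simp [hR x hx]

lemma exists_ball_of_hasCompactSupport {E : Type*} [NormedAddCommGroup E] {ζ : Space d → E}
    (h : HasCompactSupport ζ) : ∃ R : ℝ, 0 < R ∧ ∀ x, x ∉ Metric.ball (0 : Space d) R → ζ x = 0 := by
  obtain ⟨R, hR⟩ := h.isCompact.isBounded.subset_ball (0 : Space d)
  refine ⟨max R 1, by positivity, fun x hx => image_eq_zero_of_notMem_tsupport fun h' => hx ?_⟩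
  exact Metric.ball_subset_ball (le_max_left _ _) (hR h')

lemma integrableOn_pairing_of_borel {a b : ℝ} {ν : ℝ → RadonVectorMeasure d}
    (hborel : ∀ B : Set (Space d), MeasurableSet B → Bornology.IsBounded B →
      Measurable fun t : Ioo a b => (ν t).value B)
    (hloc : ∀ R : ℝ, 0 < R → ∫⁻ t in Ioo a b, (ν t).var (Metric.ball 0 R) < ⊤)
    {ζ : Space d → Space d} (hζ : Continuous ζ) (hc : HasCompactSupport ζ) :
    IntegrableOn (fun t => (ν t).pairing ζ) (Ioo a b) := by
  obtain ⟨C, hC⟩ := hc.exists_bound_of_continuous hζ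
  obtain ⟨R, hR, hRζ⟩ := exists_ball_of_hasCompactSupport hc
  refine ⟨(aemeasurable_restrict_of_measurable_subtype measurableSet_Ioo
    (measurable_pairing (ν := fun t : Ioo a b => ν t) hborel hζ hc)).aestronglyMeasurable, ?_⟩
  refine (lintegral_mono fun t => (ν t).enorm_pairing_le_ball hC hRζ).trans_lt ?_
  rw [lintegral_const_mul' _ _ ENNReal.ofReal_ne_top]
  exact ENNReal.mul_lt_top ENNReal.ofReal_lt_top (hloc R hR)

namespace ContinuityEqOn

variable {a b : ℝ} {μ : ℝ → Measure (Space d)} {ν : ℝ → RadonVectorMeasure d}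

lemma aemeasurable_var (h : ContinuityEqOn a b μ ν) {U : Set (Space d)} (hU : MeasurableSet U) :
    AEMeasurable (fun t => (ν t).var U) (volume.restrict (Ioo a b)) :=
  aemeasurable_restrict_of_measurable_subtype measurableSet_Ioo
    ((Measure.measurable_coe hU).comp (measurable_var (ν := fun t : Ioo a b => ν t) h.borel))

lemma aemeasurable_action (h : ContinuityEqOn a b μ ν) {p : ℝ} {φ : ℝ → Space d → ℝ}
    (hφ : IsActionDensity p φ) (hp : 1 < p) (γ : Measure (Space d)) [IsLocallyFiniteMeasure γ] :
    AEMeasurable (fun t => action φ γ (μ t) (ν t)) (volume.restrict (Ioo a b)) := by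
  refine aemeasurable_restrict_of_measurable_subtype measurableSet_Ioo
    (measurable_action hφ hp γ (μ := fun t : Ioo a b => μ t) (ν := fun t : Ioo a b => ν t)
      (fun t => h.locallyFinite t (Ioo_subset_Icc_self t.2)) (fun ζ hζ hc => ?_) h.borel)
  have := (h.weakStar_continuous ζ hζ.continuous hc).mono (Ioo_subset_Icc_self)
  exact (continuousOn_iff_continuous_domRestrict.1 this).measurable

lemma integrableOn_var (h : ContinuityEqOn a b μ ν) {R : ℝ} (hR : 0 < R) :
    IntegrableOn (fun t => ((ν t).var (Metric.ball 0 R)).toReal) (Ioo a b) :=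
  integrable_toReal_of_lintegral_ne_top
    (h.aemeasurable_var Metric.isOpen_ball.measurableSet) (h.locally_integrable R hR).ne

lemma integrableOn_pairing (h : ContinuityEqOn a b μ ν) {ζ : Space d → Space d}
    (hζ : Continuous ζ) (hc : HasCompactSupport ζ) :
    IntegrableOn (fun t => (ν t).pairing ζ) (Ioo a b) :=
  integrableOn_pairing_of_borel h.borel h.locally_integrable hζ hc

end ContinuityEqOn

lemma exists_forall_measure_le {I : Set ℝ} (hI : IsCompact I) {μ : ℝ → Measure (Space d)}
    (hfin : ∀ t ∈ I, IsLocallyFiniteMeasure (μ t))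
    (hcont : ∀ ζ : Space d → ℝ, ContDiff ℝ 1 ζ → HasCompactSupport ζ →
      ContinuousOn (fun t => ∫ x, ζ x ∂(μ t)) I) {K : Set (Space d)} (hK : IsCompact K) :
    ∃ M : ℝ, 0 ≤ M ∧ ∀ t ∈ I, μ t K ≤ ENNReal.ofReal M := by
  obtain ⟨F, hF⟩ := exists_isBumpFamily d
  obtain ⟨j, hj, -⟩ := hF.exists_of_subset K univ hK isOpen_univ (subset_univ _)
  obtain ⟨M, hM⟩ := (hI.image_of_continuousOn
    (hcont _ (hF.contDiff j) (hF.hasCompactSupport j))).bddAbove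
  refine ⟨max M 0, le_max_right _ _, fun t ht => ?_⟩
  have := hfin t ht
  have h1 : ∫ x, F j x ∂(μ t) ≤ max M 0 := (hM ⟨t, ht, rfl⟩).trans (le_max_left _ _)
  refine le_trans ?_ (ENNReal.ofReal_le_ofReal h1)
  rw [ofReal_integral_eq_lintegral_ofReal
    ((hF.continuous j).integrable_of_hasCompactSupport (hF.hasCompactSupport j))
    (Eventually.of_forall fun x => (hF.mem_Icc j x).1), ← lintegral_indicator_one hK.measurableSet]
  refine lintegral_mono fun x => ?_
  by_cases hx : x ∈ K
  · simp [hx, hj x hx]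
  · simp [hx]

lemma abs_integral_le_of_abs_le {m : Measure (Space d)} {K : Set (Space d)} {M ε : ℝ}
    (hM0 : 0 ≤ M) (hM : m K ≤ ENNReal.ofReal M) {f : Space d → ℝ} (hε : 0 ≤ ε)
    (hf : ∀ x, |f x| ≤ ε) (hfK : ∀ x, x ∉ K → f x = 0) : |∫ x, f x ∂m| ≤ ε * M := by
  rw [← setIntegral_eq_integral_of_forall_compl_eq_zero hfK]
  have h1 := norm_setIntegral_le_of_norm_le_const (μ := m) (s := K) (C := ε) (f := f)
    (hM.trans_lt ENNReal.ofReal_lt_top) fun x _ => hf x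
  refine h1.trans (mul_le_mul_of_nonneg_left ?_ hε)
  exact ENNReal.toReal_le_of_le_ofReal hM0 hM

/-- Joint continuity in the parameter of the integrand and in the time of the measure. -/
lemma continuousOn_integral_prod {I : Set ℝ} (hI : IsCompact I) {μ : ℝ → Measure (Space d)}
    (hfin : ∀ t ∈ I, IsLocallyFiniteMeasure (μ t))
    (hcont : ∀ ζ : Space d → ℝ, Continuous ζ → HasCompactSupport ζ →
      ContinuousOn (fun t => ∫ x, ζ x ∂(μ t)) I)
    {G : Space d × ℝ → ℝ} (hG : Continuous G) (hGc : HasCompactSupport G) :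
    ContinuousOn (fun q : ℝ × ℝ => ∫ x, G (x, q.1) ∂(μ q.2)) (univ ×ˢ I) := by
  set K := Prod.fst '' tsupport G
  have hK : IsCompact K := hGc.isCompact.image continuous_fst
  obtain ⟨M, hM0, hM⟩ := exists_forall_measure_le hI hfin (fun ζ hζ => hcont ζ hζ.continuous) hK
  have hGK : ∀ x s, x ∉ K → G (x, s) = 0 := fun x s hx =>
    image_eq_zero_of_notMem_tsupport fun h => hx ⟨_, h, rfl⟩
  have hslice : ∀ s, HasCompactSupport fun x => G (x, s) := fun s =>
    HasCompactSupport.intro hK fun x hx => hGK x s hx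
  have hslc : ∀ s, Continuous fun x => G (x, s) := fun s => by fun_prop
  have hunif := hGc.uniformContinuous_of_continuous hG
  rintro ⟨s₀, t₀⟩ ⟨-, ht₀⟩
  rw [ContinuousWithinAt, Metric.tendsto_nhds]
  intro ε hε
  obtain ⟨δ, hδ, hδ'⟩ := Metric.uniformContinuous_iff.1 hunif (ε / (2 * (M + 1))) (by positivity)
  have h1 := Metric.tendsto_nhds.1 ((hcont _ (hslc s₀) (hslice s₀)) t₀ ht₀) (ε / 2) (by positivity)
  have h2 : ∀ᶠ q : ℝ × ℝ in 𝓝[univ ×ˢ I] (s₀, t₀), q.2 ∈ I ∧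
      dist (∫ x, G (x, s₀) ∂(μ q.2)) (∫ x, G (x, s₀) ∂(μ t₀)) < ε / 2 := by
    rw [nhdsWithin_prod_eq]
    exact (tendsto_snd.eventually self_mem_nhdsWithin).and (tendsto_snd.eventually h1)
  have h3 : ∀ᶠ q : ℝ × ℝ in 𝓝[univ ×ˢ I] (s₀, t₀), dist q.1 s₀ < δ := by
    have : ContinuousAt (fun q : ℝ × ℝ => q.1) (s₀, t₀) := continuousAt_fst
    exact (this.tendsto.mono_left nhdsWithin_le_nhds).eventually (Metric.ball_mem_nhds _ hδ)
  filter_upwards [h2, h3] with q ⟨hqI, hq2⟩ hq3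
  have := hfin q.2 hqI
  have h4 : |∫ x, G (x, q.1) ∂(μ q.2) - ∫ x, G (x, s₀) ∂(μ q.2)| ≤ ε / (2 * (M + 1)) * M := by
    rw [← integral_sub ((hslc _).integrable_of_hasCompactSupport (hslice _))
      ((hslc _).integrable_of_hasCompactSupport (hslice _))]
    refine abs_integral_le_of_abs_le hM0 (hM _ hqI) (by positivity) (fun x => ?_) fun x hx => by
      rw [hGK x _ hx, hGK x _ hx, sub_zero]
    rw [← Real.dist_eq]
    refine (hδ' ?_).le
    rw [Prod.dist_eq]; simpa [hδ] using hq3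
  have h5 : ε / (2 * (M + 1)) * M ≤ ε / 2 := by
    rw [div_mul_eq_mul_div, div_le_div_iff₀ (by positivity) (by positivity)]
    nlinarith
  rw [Real.dist_eq] at hq2 ⊢
  calc |∫ x, G (x, q.1) ∂(μ q.2) - ∫ x, G (x, s₀) ∂(μ t₀)|
      ≤ |∫ x, G (x, q.1) ∂(μ q.2) - ∫ x, G (x, s₀) ∂(μ q.2)| +
        |∫ x, G (x, s₀) ∂(μ q.2) - ∫ x, G (x, s₀) ∂(μ t₀)| := abs_sub_le _ _ _
    _ < ε := by linarith

/-- The continuity equation tested against products. -/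
lemma ContinuityEq.integral_deriv_mul_add {T : ℝ} {μ : ℝ → Measure (Space d)}
    {ν : ℝ → RadonVectorMeasure d} (h : ContinuityEq T μ ν) {ζ : Space d → ℝ}
    (hζ : ContDiff ℝ 1 ζ) (hc : HasCompactSupport ζ) {η : ℝ → ℝ} (hη : ContDiff ℝ 1 η)
    (hηc : HasCompactSupport η) (hηs : tsupport η ⊆ Ioo 0 T) :
    (∫ t in Ioo 0 T, deriv η t * ∫ x, ζ x ∂(μ t)) +
      ∫ t in Ioo 0 T, η t * (ν t).pairing (gradient ζ) = 0 := by
  have hsupp : tsupport (fun z : Space d × ℝ => ζ z.1 * η z.2) ⊆ tsupport ζ ×ˢ tsupport η := by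
    refine closure_minimal (fun z hz => ?_) ((isClosed_tsupport _).prod (isClosed_tsupport _))
    have hz' : ζ z.1 * η z.2 ≠ 0 := hz
    exact ⟨subset_tsupport _ (left_ne_zero_of_mul hz'), subset_tsupport _ (right_ne_zero_of_mul hz')⟩
  have heq := h.equation (fun z => ζ z.1 * η z.2)
    ((hζ.comp contDiff_fst).mul (hη.comp contDiff_snd))
    ((hc.isCompact.prod hηc.isCompact).of_isClosed_subset (isClosed_tsupport _) hsupp)
    (hsupp.trans (prod_mono (subset_univ _) hηs))
  have e1 : ∀ t, ∫ x, deriv (fun s => ζ x * η s) t ∂(μ t) = deriv η t * ∫ x, ζ x ∂(μ t) := by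
    intro t
    rw [← integral_const_mul]
    refine integral_congr_ae (Eventually.of_forall fun x => ?_)
    simp only
    rw [deriv_const_mul _ (hη.differentiable one_ne_zero t), mul_comm]
  have e2 : ∀ t, (ν t).pairing (fun x => gradient (fun y => ζ y * η t) x) =
      η t * (ν t).pairing (gradient ζ) := by
    intro t
    rw [← RadonVectorMeasure.pairing_smul]
    congr 1
    ext1 x
    simp only [gradient]
    rw [fderiv_mul_const (hζ.differentiable one_ne_zero x), map_smulₛₗ]
    simp
  simp only [e1, e2] at heq
  exact heq

/-- The distributional form implies the integrated form: tested against products, it says that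
`t ↦ ∫ ζ dμ_t` has the weak derivative `∫ ∇ζ · dν_t`. -/
theorem ContinuityEq.continuityEqOn {T : ℝ} (hT : 0 < T)
    {μ : ℝ → Measure (Space d)} {ν : ℝ → RadonVectorMeasure d} (h : ContinuityEq T μ ν) :
    ContinuityEqOn 0 T μ ν where
  locallyFinite := h.locallyFinite
  weakStar_continuous := h.weakStar_continuous
  borel := h.borel
  locally_integrable := h.locally_integrable
  balance := by
    intro ζ hζ hc s t hs hst ht
    have hgc := continuous_gradient hζ
    have hgs := hasCompactSupport_gradient hc
    refine sub_eq_setIntegral_of_weak_deriv hT (h.weakStar_continuous ζ hζ.continuous hc)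
      (integrableOn_pairing_of_borel h.borel h.locally_integrable hgc hgs)
      (fun η hη hηc hηs => h.integral_deriv_mul_add hζ hc hη hηc hηs)
      hs hst ht

/-- The integrated form implies the distributional form. For a space-time test function `ζ` the
function `t ↦ ∫ ζ(·,t) dμ_t` has the expected derivative up to an error that is small on short
intervals uniformly in their position, so no regularity in time of the flux is needed. -/
theorem ContinuityEqOn.continuityEq {T : ℝ} (hT : 0 < T)
    {μ : ℝ → Measure (Space d)} {ν : ℝ → RadonVectorMeasure d} (h : ContinuityEqOn 0 T μ ν) :
    ContinuityEq T μ ν where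
  locallyFinite := h.locallyFinite
  weakStar_continuous := h.weakStar_continuous
  borel := h.borel
  locally_integrable := h.locally_integrable
  equation := by
    intro ζ hζ hc hsupp
    have hfd : Continuous (fderiv ℝ ζ) := hζ.continuous_fderiv one_ne_zero
    have hfc : HasCompactSupport (fderiv ℝ ζ) := hc.fderiv (𝕜 := ℝ)
    -- time derivative and spatial gradient of the test function
    set G : Space d × ℝ → ℝ := fun z => fderiv ℝ ζ z (0, 1) with hG
    have hGcont : Continuous G := hfd.clm_apply continuous_const
    have hGc : HasCompactSupport G := hfc.comp_left (g := fun L : Space d × ℝ →L[ℝ] ℝ => L (0, 1)) rfl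
    have hGd : ∀ x t, HasDerivAt (fun s => ζ (x, s)) (G (x, t)) t := by
      intro x t
      have h1 := (hζ.differentiable one_ne_zero (x, t)).hasFDerivAt
      have h2 : HasDerivAt (fun s : ℝ => (x, s)) ((0 : Space d), (1 : ℝ)) t :=
        (hasDerivAt_const t x).prodMk (hasDerivAt_id t)
      exact h1.comp_hasDerivAt t h2
    set Γ : Space d × ℝ → Space d := fun z => (InnerProductSpace.toDual ℝ (Space d)).symm
      ((fderiv ℝ ζ z).comp (ContinuousLinearMap.inl ℝ (Space d) ℝ)) with hΓ
    have hΓcont : Continuous Γ := (InnerProductSpace.toDual ℝ (Space d)).symm.continuous.comp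
      (hfd.clm_comp continuous_const)
    have hΓc : HasCompactSupport Γ := hfc.comp_left
      (g := fun L : Space d × ℝ →L[ℝ] ℝ => (InnerProductSpace.toDual ℝ (Space d)).symm
      (L.comp (ContinuousLinearMap.inl ℝ (Space d) ℝ))) (by simp)
    have hΓg : ∀ t, gradient (fun y => ζ (y, t)) = fun x => Γ (x, t) := by
      intro t
      ext1 x
      simp only [gradient, hΓ]
      congr 1
      have h1 := (hζ.differentiable one_ne_zero (x, t)).hasFDerivAt
      exact (h1.comp x (hasFDerivAt_prodMk_left x t)).fderiv
    have e1 : ∀ x t, deriv (fun s => ζ (x, s)) t = G (x, t) := fun x t => (hGd x t).deriv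
    simp only [e1]
    have e2 : ∀ t, (ν t).pairing (fun x => gradient (fun y => ζ (y, t)) x) =
        (ν t).pairing (fun x => Γ (x, t)) := fun t => by rw [← hΓg t]
    simp only [e2]
    -- a compact set carrying everything
    set K := Prod.fst '' tsupport ζ
    have hK : IsCompact K := hc.isCompact.image continuous_fst
    have hζK : ∀ x s, x ∉ K → ζ (x, s) = 0 := fun x s hx =>
      image_eq_zero_of_notMem_tsupport fun h => hx ⟨_, h, rfl⟩
    have hfK : ∀ x s, x ∉ K → fderiv ℝ ζ (x, s) = 0 := fun x s hx =>
      image_eq_zero_of_notMem_tsupport fun h => hx ⟨_, tsupport_fderiv_subset ℝ h, rfl⟩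
    have hGK : ∀ x s, x ∉ K → G (x, s) = 0 := fun x s hx => by simp [hG, hfK x s hx]
    have hΓK : ∀ x s, x ∉ K → Γ (x, s) = 0 := fun x s hx => by simp [hΓ, hfK x s hx]
    obtain ⟨M, hM0, hM⟩ := exists_forall_measure_le isCompact_Icc h.locallyFinite
      (fun ζ hζ => h.weakStar_continuous ζ hζ.continuous) hK
    obtain ⟨R₀, hR₀⟩ := hK.isBounded.subset_ball (0 : Space d)
    set R := max R₀ 1
    have hR : 0 < R := by positivity
    have hKR : K ⊆ Metric.ball 0 R := hR₀.trans (Metric.ball_subset_ball (le_max_left _ _))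
    have hζs : ∀ s, Continuous fun x => ζ (x, s) := fun s => hζ.continuous.comp (by fun_prop)
    have hζsc : ∀ s, HasCompactSupport fun x => ζ (x, s) := fun s =>
      HasCompactSupport.intro hK fun x hx => hζK x s hx
    have hGs : ∀ s, Continuous fun x => G (x, s) := fun s => hGcont.comp (by fun_prop)
    have hGsc : ∀ s, HasCompactSupport fun x => G (x, s) := fun s =>
      HasCompactSupport.intro hK fun x hx => hGK x s hx
    have hΓs : ∀ s, Continuous fun x => Γ (x, s) := fun s => hΓcont.comp (by fun_prop)
    have hΓsc : ∀ s, HasCompactSupport fun x => Γ (x, s) := fun s =>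
      HasCompactSupport.intro hK fun x hx => hΓK x s hx
    -- the two integrands of the weak formulation
    set e : ℝ × ℝ → ℝ := fun q => ∫ x, G (x, q.1) ∂(μ q.2) with he
    have hecont : ContinuousOn e (univ ×ˢ Icc 0 T) :=
      continuousOn_integral_prod isCompact_Icc h.locallyFinite h.weakStar_continuous hGcont hGc
    have hdiag : ContinuousOn (fun r => e (r, r)) (Icc 0 T) :=
      hecont.comp (by fun_prop) fun r hr => ⟨mem_univ _, hr⟩
    set E : ℝ → ℝ := fun r => e (r, r)
    set P : ℝ → ℝ := fun r => (ν r).pairing (fun x => Γ (x, r)) with hP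
    set V : ℝ → ℝ := fun r => ((ν r).var (Metric.ball 0 R)).toReal with hV
    have hVi : IntegrableOn V (Ioo 0 T) := h.integrableOn_var hR
    have hpair : ∀ (r : ℝ) (ξ : Space d → Space d) (C : ℝ), 0 ≤ C → (∀ x, ‖ξ x‖ ≤ C) →
        (∀ x, x ∉ K → ξ x = 0) → |(ν r).pairing ξ| ≤ C * V r := by
      intro r ξ C hC0 hC hξ
      have h1 := (ν r).enorm_pairing_le_ball hC fun x hx => hξ x fun h' => hx (hKR h')
      have h2 := ENNReal.toReal_mono (ENNReal.mul_ne_top ENNReal.ofReal_ne_top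
        measure_ball_lt_top.ne) h1
      rwa [toReal_enorm, ENNReal.toReal_mul, ENNReal.toReal_ofReal hC0] at h2
    have hPi : IntegrableOn P (Ioo 0 T) := by
      obtain ⟨C, hC⟩ := hΓc.exists_bound_of_continuous hΓcont
      have hC0 : 0 ≤ C := (norm_nonneg _).trans (hC 0)
      refine (hVi.const_mul C).mono' ?_ (Eventually.of_forall fun r =>
        hpair r _ C hC0 (fun x => hC _) fun x hx => hΓK x r hx)
      refine AEMeasurable.aestronglyMeasurable
        (aemeasurable_restrict_of_measurable_subtype measurableSet_Ioo ?_)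
      -- the pairing is measurable in time for a fixed vector field, and continuous in the latter
      have := measurable_uncurry_of_continuous_of_measurable
        (u := fun (s : ℝ) (r : Ioo 0 T) => (ν r).pairing fun x => Γ (x, s)) (fun r => ?_)
        (fun s => measurable_pairing (ν := fun t : Ioo 0 T => ν t) h.borel (hΓs s) (hΓsc s))
      · exact this.comp (measurable_subtype_coe.prodMk measurable_id)
      · refine Metric.continuous_iff.2 fun s₀ ε hε => ?_
        have hVr : 0 ≤ V r := ENNReal.toReal_nonneg
        obtain ⟨δ, hδ, hδ'⟩ := Metric.uniformContinuous_iff.1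
          (hΓc.uniformContinuous_of_continuous hΓcont) (ε / (V r + 1)) (by positivity)
        refine ⟨δ, hδ, fun s hs => ?_⟩
        rw [Real.dist_eq, ← (ν r).pairing_sub (hΓs s) (hΓsc s) (hΓs s₀) (hΓsc s₀)]
        refine (hpair r _ (ε / (V r + 1)) (by positivity) (fun x => ?_) fun x hx => ?_).trans_lt ?_
        · rw [← dist_eq_norm]
          refine (hδ' ?_).le
          rw [Prod.dist_eq]; simpa [hδ] using hs
        · rw [hΓK x _ hx, hΓK x _ hx, sub_zero]
        · rw [div_mul_eq_mul_div, div_lt_iff₀ (by positivity)]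
          nlinarith
    have hEi : IntervalIntegrable E volume 0 T := by
      refine ContinuousOn.intervalIntegrable ?_
      rwa [uIcc_of_le hT.le]
    have hPii : IntervalIntegrable P volume 0 T :=
      (intervalIntegrable_iff_integrableOn_Ioo_of_le hT.le).2 hPi
    have hVii : IntervalIntegrable V volume 0 T :=
      (intervalIntegrable_iff_integrableOn_Ioo_of_le hT.le).2 hVi
    have hsub : ∀ {f : ℝ → ℝ}, IntervalIntegrable f volume 0 T → ∀ {s t : ℝ}, 0 ≤ s → s ≤ t → t ≤ T →
        IntervalIntegrable f volume s t := by
      intro f hf s t hs hst ht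
      refine hf.mono_set ?_
      rw [uIcc_of_le hst, uIcc_of_le hT.le]
      exact Icc_subset_Icc hs ht
    -- the defect `B` of the product rule is constant, and `A` vanishes at both ends
    set A : ℝ → ℝ := fun t => ∫ x, ζ (x, t) ∂(μ t) with hA
    set B : ℝ → ℝ := fun t => A t - ((∫ r in (0 : ℝ)..t, E r) + ∫ r in (0 : ℝ)..t, P r) with hB
    have hconst : B T = B 0 := by
      refine eq_of_forall_local_estimate hT (w := fun r => (M + 1) + V r)
        (intervalIntegrable_const.add hVii) fun ε hε => ?_
      obtain ⟨δ₁, hδ₁, hu₁⟩ := Metric.uniformContinuous_iff.1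
        (hGc.uniformContinuous_of_continuous hGcont) ε hε
      obtain ⟨δ₂, hδ₂, hu₂⟩ := Metric.uniformContinuous_iff.1
        (hΓc.uniformContinuous_of_continuous hΓcont) ε hε
      obtain ⟨δ₃, hδ₃, hu₃⟩ := Metric.uniformContinuousOn_iff.1
        ((isCompact_Icc.prod isCompact_Icc : IsCompact (Icc 0 T ×ˢ Icc 0 T)).uniformContinuousOn_of_continuous
          (hecont.mono (prod_mono (subset_univ _) le_rfl))) ε hε
      refine ⟨min δ₁ (min δ₂ δ₃), by positivity, fun s t hs hst ht hd => ?_⟩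
      have hd1 : t - s < δ₁ := hd.trans_le (min_le_left _ _)
      have hd2 : t - s < δ₂ := hd.trans_le ((min_le_right _ _).trans (min_le_left _ _))
      have hd3 : t - s < δ₃ := hd.trans_le ((min_le_right _ _).trans (min_le_right _ _))
      have htI : t ∈ Icc 0 T := ⟨hs.trans hst, ht⟩
      have hsI : s ∈ Icc 0 T := ⟨hs, hst.trans ht⟩
      have := h.locallyFinite t htI
      have hζi : ∀ r, Integrable (fun x => ζ (x, r)) (μ t) := fun r =>
        (hζs r).integrable_of_hasCompactSupport (hζsc r)
      have hGi : ∀ r, Integrable (fun x => G (x, r)) (μ t) := fun r =>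
        (hGs r).integrable_of_hasCompactSupport (hGsc r)
      have hbal := h.balance (fun x => ζ (x, s)) (hζ.comp (contDiff_id.prodMk contDiff_const))
        (hζsc s) s t hs hst ht
      rw [hΓg, ← integral_Ioc_eq_integral_Ioo, ← intervalIntegral.integral_of_le hst] at hbal
      -- the increment of `B`, with the balance law applied to the test function frozen at time `s`
      have hincr : B t - B s =
          (∫ x, (ζ (x, t) - ζ (x, s) - (t - s) * G (x, s)) ∂(μ t)) +
          (∫ r in s..t, (e (s, t) - E r)) +
          ∫ r in s..t, ((ν r).pairing (fun x => Γ (x, s)) - P r) := by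
        have hpi : IntervalIntegrable (fun r => (ν r).pairing (fun x => Γ (x, s))) volume s t := by
          refine hsub ((intervalIntegrable_iff_integrableOn_Ioo_of_le hT.le).2 ?_) hs hst ht
          exact h.integrableOn_pairing (hΓs s) (hΓsc s)
        rw [integral_sub (f := fun x => ζ (x, t) - ζ (x, s)) ((hζi t).sub (hζi s)) ((hGi s).const_mul _), integral_sub (hζi t) (hζi s),
          integral_const_mul, intervalIntegral.integral_sub intervalIntegrable_const
          (hsub hEi hs hst ht), intervalIntegral.integral_sub hpi (hsub hPii hs hst ht), ← hbal,
          intervalIntegral.integral_const]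
        have i1 := intervalIntegral.integral_interval_sub_left (hsub hEi le_rfl (hs.trans hst) ht)
          (hsub hEi le_rfl hs (hst.trans ht))
        have i2 := intervalIntegral.integral_interval_sub_left (hsub hPii le_rfl (hs.trans hst) ht)
          (hsub hPii le_rfl hs (hst.trans ht))
        simp only [hB, hA, smul_eq_mul, he]
        linarith
      have b1 : |∫ x, (ζ (x, t) - ζ (x, s) - (t - s) * G (x, s)) ∂(μ t)| ≤ ε * (t - s) * M := by
        refine abs_integral_le_of_abs_le hM0 (hM t htI) (mul_nonneg hε.le (by linarith)) (fun x => ?_)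
          fun x hx => by rw [hζK x _ hx, hζK x _ hx, hGK x _ hx]; ring
        have hmv := Convex.norm_image_sub_le_of_norm_hasDerivWithin_le (s := Icc s t)
          (f := fun r => ζ (x, r) - r * G (x, s)) (f' := fun r => G (x, r) - G (x, s)) (C := ε)
          (x := s) (y := t) (fun r _ => by
            have := ((hGd x r).fun_sub ((hasDerivAt_id' r).mul_const (G (x, s)))).hasDerivWithinAt
              (s := Icc s t)
            simpa using this) (fun r hr => by
            rw [← dist_eq_norm]
            refine (hu₁ ?_).le
            rw [Prod.dist_eq, Real.dist_eq, dist_self, abs_of_nonneg (by linarith [hr.1])]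
            exact max_lt hδ₁ (by linarith [hr.2])) (convex_Icc s t) ⟨le_rfl, hst⟩ ⟨hst, le_rfl⟩
        rw [Real.norm_eq_abs, Real.norm_eq_abs, abs_of_nonneg (by linarith : 0 ≤ t - s)] at hmv
        calc |ζ (x, t) - ζ (x, s) - (t - s) * G (x, s)|
            = |ζ (x, t) - t * G (x, s) - (ζ (x, s) - s * G (x, s))| := by congr 1; ring
          _ ≤ _ := hmv
      have b2 : |∫ r in s..t, (e (s, t) - E r)| ≤ ε * (t - s) := by
        have := intervalIntegral.norm_integral_le_of_norm_le_const (a := s) (b := t) (C := ε)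
          (f := fun r => e (s, t) - E r) (fun r hr => by
            rw [uIoc_of_le hst] at hr
            rw [← dist_eq_norm]
            have hrI : r ∈ Icc 0 T := ⟨hs.trans hr.1.le, hr.2.trans ht⟩
            refine (hu₃ (s, t) ⟨hsI, htI⟩ (r, r) ⟨hrI, hrI⟩ ?_).le
            rw [Prod.dist_eq, Real.dist_eq, Real.dist_eq, abs_of_nonpos (by linarith [hr.1]),
              abs_of_nonneg (by linarith [hr.2])]
            exact max_lt (by linarith [hr.2]) (by linarith [hr.1]))
        rwa [abs_of_nonneg (by linarith : 0 ≤ t - s)] at this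
      have b3 : |∫ r in s..t, ((ν r).pairing (fun x => Γ (x, s)) - P r)| ≤ ε * ∫ r in s..t, V r := by
        rw [← intervalIntegral.integral_const_mul, ← Real.norm_eq_abs]
        refine intervalIntegral.norm_integral_le_of_norm_le hst
          (Eventually.of_forall fun r hr => ?_) ((hsub hVii hs hst ht).const_mul ε)
        simp only [hP]
        rw [Real.norm_eq_abs, ← (ν r).pairing_sub (hΓs s) (hΓsc s) (hΓs r) (hΓsc r)]
        refine hpair r _ ε hε.le (fun x => ?_) fun x hx => by rw [hΓK x _ hx, hΓK x _ hx, sub_zero]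
        rw [← dist_eq_norm]
        refine (hu₂ ?_).le
        rw [Prod.dist_eq, Real.dist_eq, dist_self, abs_of_nonpos (by linarith [hr.1])]
        exact max_lt hδ₂ (by linarith [hr.2])
      rw [hincr, intervalIntegral.integral_add intervalIntegrable_const (hsub hVii hs hst ht),
        intervalIntegral.integral_const, smul_eq_mul]
      refine (abs_add_three _ _ _).trans ?_
      linarith
    have hends : ∀ t, t ∉ Ioo 0 T → A t = 0 := by
      intro t ht
      simp only [hA]
      rw [integral_congr_ae (Eventually.of_forall fun x => image_eq_zero_of_notMem_tsupport
        fun h' => ht (hsupp h').2), integral_zero]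
    simp only [hB, hends T (fun h' => lt_irrefl _ h'.2), hends 0 (fun h' => lt_irrefl _ h'.1),
      intervalIntegral.integral_same] at hconst
    rw [← integral_Ioc_eq_integral_Ioo, ← integral_Ioc_eq_integral_Ioo,
      ← intervalIntegral.integral_of_le hT.le, ← intervalIntegral.integral_of_le hT.le]
    change (∫ r in (0 : ℝ)..T, E r) + ∫ r in (0 : ℝ)..T, P r = 0
    linarith

/-! ### Changes of time -/

/-- An increasing bijection `e` of the time line with positive derivative `k`, the derivative being
understood in the sense that `∫_s^t k = e(t) - e(s)`. -/
structure IsTimeChange (e : ℝ ≃o ℝ) (k : ℝ → ℝ) : Prop where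
  measurable : Measurable k
  pos : ∀ t, 0 < k t
  lintegral_Ioo : ∀ s t, s ≤ t → ∫⁻ r in Ioo s t, ENNReal.ofReal (k r) = ENNReal.ofReal (e t - e s)

namespace IsTimeChange

variable {e : ℝ ≃o ℝ} {k : ℝ → ℝ}

lemma measurableEmbedding (e : ℝ ≃o ℝ) : MeasurableEmbedding e :=
  e.toHomeomorph.measurableEmbedding

lemma measurePreserving (h : IsTimeChange e k) :
    MeasurePreserving e (volume.withDensity fun t => ENNReal.ofReal (k t)) volume := by
  refine ⟨e.toHomeomorph.continuous.measurable, (Real.measure_ext_Ioo_rat fun a b => ?_).symm⟩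
  rw [(measurableEmbedding e).map_apply, OrderIso.preimage_Ioo,
    withDensity_apply _ measurableSet_Ioo, Real.volume_Ioo]
  rcases le_total (e.symm a) (e.symm b) with hab | hab
  · rw [h.lintegral_Ioo _ _ hab]; simp
  · rw [Ioo_eq_empty (not_lt.2 hab), setLIntegral_empty, ENNReal.ofReal_of_nonpos]
    have := e.symm.le_iff_le.1 hab
    linarith

lemma setLIntegral_comp (h : IsTimeChange e k) (f : ℝ → ℝ≥0∞) (a b : ℝ) :
    ∫⁻ s in Ioo a b, ENNReal.ofReal (k s) * f (e s) = ∫⁻ t in Ioo (e a) (e b), f t := by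
  rw [← h.measurePreserving.setLIntegral_comp_preimage_emb (measurableEmbedding e) f,
    OrderIso.preimage_Ioo, e.symm_apply_apply, e.symm_apply_apply,
    restrict_withDensity measurableSet_Ioo, lintegral_withDensity_eq_lintegral_mul_non_measurable _
      h.measurable.ennreal_ofReal (Eventually.of_forall fun _ => ENNReal.ofReal_lt_top)]
  rfl

lemma setIntegral_comp (h : IsTimeChange e k) (f : ℝ → ℝ) (a b : ℝ) :
    ∫ s in Ioo a b, k s * f (e s) = ∫ t in Ioo (e a) (e b), f t := by
  rw [← h.measurePreserving.setIntegral_preimage_emb (measurableEmbedding e) f,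
    OrderIso.preimage_Ioo, e.symm_apply_apply, e.symm_apply_apply,
    restrict_withDensity measurableSet_Ioo, integral_withDensity_eq_integral_toReal_smul
      h.measurable.ennreal_ofReal (Eventually.of_forall fun _ => ENNReal.ofReal_lt_top)]
  refine integral_congr_ae (Eventually.of_forall fun t => ?_)
  simp [ENNReal.toReal_ofReal (h.pos t).le]

lemma symm (h : IsTimeChange e k) : IsTimeChange e.symm fun t => (k (e.symm t))⁻¹ where
  measurable := (h.measurable.comp e.symm.toHomeomorph.continuous.measurable).inv
  pos t := inv_pos.2 (h.pos _)
  lintegral_Ioo s t hst := by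
    have h1 := h.setLIntegral_comp (fun t => ENNReal.ofReal (k (e.symm t))⁻¹) (e.symm s) (e.symm t)
    rw [e.apply_symm_apply, e.apply_symm_apply] at h1
    rw [← h1]
    have h2 : ∀ x, ENNReal.ofReal (k x) * ENNReal.ofReal (k x)⁻¹ = 1 := fun x => by
      rw [← ENNReal.ofReal_mul (h.pos x).le, mul_inv_cancel₀ (h.pos x).ne',
        ENNReal.ofReal_one]
    simp [h2]

lemma affine {α : ℝ} (hα : 0 < α) (β : ℝ) :
    ∃ e : ℝ ≃o ℝ, IsTimeChange e (fun _ => α) ∧ ∀ t, e t = α * t + β := by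
  have hmono : StrictMono fun t : ℝ => α * t + β := fun s t hst => by
    have := mul_lt_mul_of_pos_left hst hα
    simp only; linarith
  have hsurj : Function.Surjective fun t : ℝ => α * t + β := fun y =>
    ⟨(y - β) / α, by field_simp; ring⟩
  refine ⟨hmono.orderIsoOfSurjective _ hsurj, ⟨measurable_const, fun _ => hα, fun s t hst => ?_⟩,
    fun t => rfl⟩
  rw [setLIntegral_const, Real.volume_Ioo, ← ENNReal.ofReal_mul hα.le]
  congr 1
  change α * (t - s) = α * t + β - (α * s + β)
  ring

/-- A positive integrable function on `(a,b)` is the derivative of a change of time. -/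
lemma exists_of_integrableOn {a b : ℝ} (hab : a ≤ b) {h : ℝ → ℝ} (hm : Measurable h)
    (hpos : ∀ t, 0 < h t) (hint : IntegrableOn h (Ioo a b)) :
    ∃ (e : ℝ ≃o ℝ) (k : ℝ → ℝ), IsTimeChange e k ∧ (∀ t ∈ Ioo a b, k t = h t) ∧ e a = 0 ∧
      e b = ∫ t in Ioo a b, h t := by
  classical
  -- outside `(a,b)` the derivative is set to `1`
  set k : ℝ → ℝ := fun t => 1 + (Ioo a b).indicator (fun t => h t - 1) t with hk
  have hg : Integrable ((Ioo a b).indicator fun t => h t - 1) := by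
    rw [integrable_indicator_iff measurableSet_Ioo]
    exact hint.sub (integrableOn_const (by simp))
  have hkm : Measurable k := measurable_const.add
    ((hm.sub_const 1).indicator measurableSet_Ioo)
  have hkh : ∀ t ∈ Ioo a b, k t = h t := fun t ht => by simp [hk, indicator_of_mem ht]
  have hkpos : ∀ t, 0 < k t := fun t => by
    by_cases ht : t ∈ Ioo a b
    · rw [hkh t ht]; exact hpos t
    · simp [hk, indicator_of_notMem ht]
  have hki : ∀ s t, IntervalIntegrable k volume s t := fun s t =>
    intervalIntegrable_const.add hg.intervalIntegrable
  set E : ℝ → ℝ := fun t => ∫ r in a..t, k r with hE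
  have hdiff : ∀ s t, E t - E s = ∫ r in s..t, k r := fun s t =>
    intervalIntegral.integral_interval_sub_left (hki _ _) (hki _ _)
  have hmono : StrictMono E := fun s t hst => by
    rw [← sub_pos, hdiff]
    exact intervalIntegral.intervalIntegral_pos_of_pos (hki _ _) hkpos hst
  have hcont : Continuous E := intervalIntegral.continuous_primitive hki a
  -- `E` differs from a translation by a bounded function, hence is surjective
  have hbound : ∀ t, |E t - (t - a)| ≤ ∫ r, |(Ioo a b).indicator (fun t => h t - 1) r| := fun t => by
    have h1 : E t = (t - a) + ∫ r in a..t, (Ioo a b).indicator (fun t => h t - 1) r := by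
      rw [hE, hk]
      simp only
      rw [intervalIntegral.integral_add intervalIntegrable_const hg.intervalIntegrable]
      simp
    rw [h1, add_sub_cancel_left, intervalIntegral.abs_integral_eq_abs_integral_uIoc]
    refine (abs_integral_le_integral_abs).trans ?_
    exact setIntegral_le_integral hg.abs (Eventually.of_forall fun _ => abs_nonneg _)
  set M := ∫ r, |(Ioo a b).indicator (fun t => h t - 1) r|
  have hsurj : Function.Surjective E := by
    refine hcont.surjective ?_ ?_
    · refine tendsto_atTop_mono (fun t => ?_) (tendsto_atTop_add_const_right _ (-a - M) tendsto_id)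
      have := (abs_le.1 (hbound t)).1
      simp only [id]; linarith
    · refine tendsto_atBot_mono (fun t => ?_) (tendsto_atBot_add_const_right _ (-a + M) tendsto_id)
      have := (abs_le.1 (hbound t)).2
      simp only [id]; linarith
  refine ⟨hmono.orderIsoOfSurjective _ hsurj, k, ⟨hkm, hkpos, fun s t hst => ?_⟩, hkh, ?_, ?_⟩
  · change _ = ENNReal.ofReal (E t - E s)
    rw [hdiff, intervalIntegral.integral_of_le hst, integral_Ioc_eq_integral_Ioo,
      ofReal_integral_eq_lintegral_ofReal]
    · exact (hki s t).1.mono_set Ioo_subset_Ioc_self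
    · exact Eventually.of_forall fun t => (hkpos t).le
  · exact intervalIntegral.integral_same
  · change E b = _
    rw [hE]
    simp only
    rw [intervalIntegral.integral_of_le hab, integral_Ioc_eq_integral_Ioo]
    exact setIntegral_congr_fun measurableSet_Ioo hkh

end IsTimeChange

/-! ### Operations on solutions of the continuity equation -/

lemma measurable_indicator_of_subtype {α β : Type*} [MeasurableSpace α] [MeasurableSpace β]
    [Zero β] {s : Set α} (hs : MeasurableSet s) {f : α → β} (hf : Measurable fun x : s => f x) :
    Measurable (s.indicator f) := by
  convert (MeasurableEmbedding.subtype_coe hs).measurable_extend hf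
    (measurable_const (a := (0 : β))) using 1
  ext1 x
  by_cases hx : x ∈ s
  · rw [indicator_of_mem hx]
    exact (Subtype.val_injective.extend_apply (fun x : s => f x) _ ⟨x, hx⟩).symm
  · rw [indicator_of_notMem hx, Function.extend_apply']
    rintro ⟨y, rfl⟩
    exact hx y.2

namespace ContinuityEqOn

variable {a b : ℝ} {μ : ℝ → Measure (Space d)} {ν : ℝ → RadonVectorMeasure d}

lemma comp_timeChange {e : ℝ ≃o ℝ} {k : ℝ → ℝ} (hk : IsTimeChange e k)
    (h : ContinuityEqOn (e a) (e b) μ ν) :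
    ContinuityEqOn a b (fun s => μ (e s)) (fun s => (ν (e s)).scale (k s)) where
  locallyFinite t ht := h.locallyFinite _ ⟨e.monotone ht.1, e.monotone ht.2⟩
  weakStar_continuous ζ hζ hc := (h.weakStar_continuous ζ hζ hc).comp
    e.toHomeomorph.continuous.continuousOn fun t ht => ⟨e.monotone ht.1, e.monotone ht.2⟩
  borel B hB hBb := by
    simp only [RadonVectorMeasure.value_scale (hk.pos _).le]
    refine (hk.measurable.comp measurable_subtype_coe).smul ((h.borel B hB hBb).comp
      (g := fun t : Ioo (e a) (e b) => (ν t).value B)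
      (f := fun t : Ioo a b => (⟨e t, e.strictMono t.2.1, e.strictMono t.2.2⟩ : Ioo (e a) (e b))) ?_)
    exact (e.toHomeomorph.continuous.measurable.comp measurable_subtype_coe).subtype_mk
  locally_integrable R hR := by
    refine lt_of_eq_of_lt ?_ (h.locally_integrable R hR)
    exact hk.setLIntegral_comp (fun t => (ν t).var (Metric.ball 0 R)) a b
  balance ζ hζ hc s t hs hst ht := by
    rw [h.balance ζ hζ hc (e s) (e t) (e.monotone hs) (e.monotone hst) (e.monotone ht),
      ← hk.setIntegral_comp]
    simp only [RadonVectorMeasure.pairing_scale (hk.pos _).le]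

lemma restrict (h : ContinuityEqOn a b μ ν) {a' b' : ℝ} (ha : a ≤ a') (hb : b' ≤ b) :
    ContinuityEqOn a' b' μ ν where
  locallyFinite t ht := h.locallyFinite t ⟨ha.trans ht.1, ht.2.trans hb⟩
  weakStar_continuous ζ hζ hc := (h.weakStar_continuous ζ hζ hc).mono (Icc_subset_Icc ha hb)
  borel B hB hBb := (h.borel B hB hBb).comp (measurable_inclusion (Ioo_subset_Ioo ha hb))
  locally_integrable R hR :=
    (lintegral_mono_set (Ioo_subset_Ioo ha hb)).trans_lt (h.locally_integrable R hR)
  balance ζ hζ hc s t hs hst ht := h.balance ζ hζ hc s t (ha.trans hs) hst (ht.trans hb)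

lemma reverse (h : ContinuityEqOn a b μ ν) :
    ContinuityEqOn (-b) (-a) (fun t => μ (-t)) (fun t => (ν (-t)).opp) where
  locallyFinite t ht := h.locallyFinite _ ⟨by linarith [ht.2], by linarith [ht.1]⟩
  weakStar_continuous ζ hζ hc := (h.weakStar_continuous ζ hζ hc).comp continuousOn_neg
    fun t ht => ⟨by linarith [ht.2], by linarith [ht.1]⟩
  borel B hB hBb := by
    simp only [RadonVectorMeasure.value_opp]
    refine ((h.borel B hB hBb).comp (g := fun t : Ioo a b => (ν t).value B)
      (f := fun t : Ioo (-b) (-a) =>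
        (⟨-t, by linarith [t.2.2], by linarith [t.2.1]⟩ : Ioo a b)) ?_).neg
    exact (measurable_subtype_coe.neg).subtype_mk
  locally_integrable R hR := by
    refine lt_of_eq_of_lt ?_ (h.locally_integrable R hR)
    have := (Measure.measurePreserving_neg (volume : Measure ℝ)).setLIntegral_comp_preimage_emb
      (MeasurableEquiv.neg ℝ).measurableEmbedding (fun t => (ν t).var (Metric.ball 0 R)) (Ioo a b)
    rwa [Set.neg_preimage, Set.neg_Ioo] at this
  balance ζ hζ hc s t hs hst ht := by
    have h1 := h.balance ζ hζ hc (-t) (-s) (by linarith) (by linarith) (by linarith)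
    have := (Measure.measurePreserving_neg (volume : Measure ℝ)).setIntegral_preimage_emb
      (MeasurableEquiv.neg ℝ).measurableEmbedding (fun t => (ν t).pairing (gradient ζ))
      (Ioo (-t) (-s))
    rw [Set.neg_preimage, Set.neg_Ioo, neg_neg, neg_neg] at this
    simp only [RadonVectorMeasure.pairing_opp, integral_neg]
    linarith

/-- Two solutions on adjacent intervals that agree at the common time can be concatenated. -/
lemma glue {c : ℝ} (hab : a ≤ b) (hbc : b ≤ c) {μ' : ℝ → Measure (Space d)}
    {ν' : ℝ → RadonVectorMeasure d} (h : ContinuityEqOn a b μ ν) (h' : ContinuityEqOn b c μ' ν')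
    (heq : μ b = μ' b) :
    ContinuityEqOn a c (fun t => if t ≤ b then μ t else μ' t)
      (fun t => if t < b then ν t else ν' t) := by
  have e2 : ∀ t ∈ Icc b c, (if t ≤ b then μ t else μ' t) = μ' t := fun t ht => by
    rcases ht.1.eq_or_lt with rfl | hlt
    · simp [heq]
    · simp [not_le.2 hlt]
  refine ⟨fun t ht => ?_, fun ζ hζ hc => ?_, fun B hB hBb => ?_, fun R hR => ?_,
    fun ζ hζ hc s t hs hst ht => ?_⟩
  · split_ifs with htb
    · exact h.locallyFinite t ⟨ht.1, htb⟩
    · exact h'.locallyFinite t ⟨(not_le.1 htb).le, ht.2⟩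
  · rw [← Icc_union_Icc_eq_Icc hab hbc]
    refine ContinuousOn.union_of_isClosed ?_ ?_ isClosed_Icc isClosed_Icc
    · exact (h.weakStar_continuous ζ hζ hc).congr fun t ht => by simp [ht.2]
    · exact (h'.weakStar_continuous ζ hζ hc).congr fun t ht => by simp only [e2 t ht]
  · have i1 := measurable_indicator_of_subtype (f := fun t => (ν t).value B) measurableSet_Ioo
      (h.borel B hB hBb)
    have i2 := measurable_indicator_of_subtype (f := fun t => (ν' t).value B) measurableSet_Ioo
      (h'.borel B hB hBb)
    have i3 : Measurable (({b} : Set ℝ).indicator fun _ : ℝ => (ν' b).value B) :=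
      measurable_const.indicator (measurableSet_singleton b)
    have := ((i1.add i2).add i3).comp (measurable_subtype_coe (p := fun t => t ∈ Ioo a c))
    convert this using 1
    ext1 ⟨t, ht⟩
    rcases lt_trichotomy t b with hlt | rfl | hlt
    · simp [hlt, ht.1, hlt.not_gt, hlt.ne]
    · simp
    · simp [hlt.not_gt, ht.2, hlt, hlt.ne']
  · refine (lintegral_mono_set (t := Ioo a b ∪ Ico b c) fun t ht => ?_).trans_lt ?_
    · rcases lt_or_ge t b with hlt | hge
      · exact Or.inl ⟨ht.1, hlt⟩
      · exact Or.inr ⟨hge, ht.2⟩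
    refine (lintegral_union_le _ _ _).trans_lt (ENNReal.add_lt_top.2 ⟨?_, ?_⟩)
    · rw [setLIntegral_congr_fun (g := fun t => (ν t).var (Metric.ball 0 R)) measurableSet_Ioo
        fun t ht => by simp [ht.2]]
      exact h.locally_integrable R hR
    · rw [setLIntegral_congr_fun (g := fun t => (ν' t).var (Metric.ball 0 R)) measurableSet_Ico
        fun t ht => by simp [not_lt.2 ht.1], ← restrict_Ioo_eq_restrict_Ico]
      exact h'.locally_integrable R hR
  · have c1 : ∀ s t, t ≤ b → ∫ r in Ioo s t, (if r < b then ν r else ν' r).pairing (gradient ζ) =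
        ∫ r in Ioo s t, (ν r).pairing (gradient ζ) := fun s t htb =>
      setIntegral_congr_fun measurableSet_Ioo fun r hr => by simp [hr.2.trans_le htb]
    have c2 : ∀ s t, b ≤ s → ∫ r in Ioo s t, (if r < b then ν r else ν' r).pairing (gradient ζ) =
        ∫ r in Ioo s t, (ν' r).pairing (gradient ζ) := fun s t hsb =>
      setIntegral_congr_fun measurableSet_Ioo fun r hr => by simp [(hsb.trans_lt hr.1).not_gt]
    rcases le_total t b with htb | htb
    · simp only [if_pos htb, if_pos (hst.trans htb)]
      rw [c1 s t htb]
      exact h.balance ζ hζ hc s t hs hst htb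
    rcases le_total b s with hsb | hsb
    · simp only [e2 t ⟨htb, ht⟩, e2 s ⟨hsb, hst.trans ht⟩]
      rw [c2 s t hsb]
      exact h'.balance ζ hζ hc s t hsb hst ht
    simp only [e2 t ⟨htb, ht⟩, if_pos hsb]
    have k1 := h.balance ζ hζ hc s b hs hsb le_rfl
    have k2 := h'.balance ζ hζ hc b t le_rfl htb ht
    rw [heq] at k1
    have hg := continuous_gradient hζ
    have hgc := hasCompactSupport_gradient hc
    have p1 : IntegrableOn (fun r => (if r < b then ν r else ν' r).pairing (gradient ζ))
        (Ioo s b) :=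
      ((h.integrableOn_pairing hg hgc).mono_set (Ioo_subset_Ioo_left hs)).congr_fun
        (fun r hr => by simp [hr.2]) measurableSet_Ioo
    have p2 : IntegrableOn (fun r => (if r < b then ν r else ν' r).pairing (gradient ζ))
        (Ioo b t) :=
      ((h'.integrableOn_pairing hg hgc).mono_set (Ioo_subset_Ioo_right ht)).congr_fun
        (fun r hr => by simp [hr.1.not_gt]) measurableSet_Ioo
    have q1 := (intervalIntegrable_iff_integrableOn_Ioo_of_le hsb).2 p1
    have q2 := (intervalIntegrable_iff_integrableOn_Ioo_of_le htb).2 p2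
    have q := intervalIntegral.integral_add_adjacent_intervals q1 q2
    rw [intervalIntegral.integral_of_le hsb, intervalIntegral.integral_of_le htb,
      intervalIntegral.integral_of_le (hsb.trans htb), integral_Ioc_eq_integral_Ioo,
      integral_Ioc_eq_integral_Ioo, integral_Ioc_eq_integral_Ioo, c1 s b le_rfl,
      c2 b t le_rfl] at q
    linarith

end ContinuityEqOn

/-! ### The distance as an infimum of lengths -/

lemma setLIntegral_rpow_inv_le {p q : ℝ} (hpq : p.HolderConjugate q) {a b : ℝ} {f : ℝ → ℝ≥0∞}
    (hf : AEMeasurable f (volume.restrict (Ioo a b))) :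
    ∫⁻ t in Ioo a b, f t ^ (1 / p) ≤
      (∫⁻ t in Ioo a b, f t) ^ (1 / p) * ENNReal.ofReal (b - a) ^ (1 / q) := by
  have h := ENNReal.lintegral_mul_le_Lp_mul_Lq (volume.restrict (Ioo a b)) hpq
    (f := fun t => f t ^ (1 / p)) (g := fun _ => 1) (hf.pow_const _) aemeasurable_const
  have hp : p ≠ 0 := hpq.ne_zero
  simpa [← ENNReal.rpow_mul, inv_mul_cancel₀ hp] using h

section Distance

variable {p : ℝ} {φ : ℝ → Space d → ℝ} {γ : Measure (Space d)} {a b : ℝ}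
  {μ : ℝ → Measure (Space d)} {ν : ℝ → RadonVectorMeasure d}

lemma wDist_le_rpow_lintegral_action (hp : 1 < p) (h : ContinuityEqOn 0 1 μ ν) :
    wDist p φ γ (μ 0) (μ 1) ≤ (∫⁻ t in Ioo (0 : ℝ) 1, action φ γ (μ t) (ν t)) ^ (1 / p) :=
  ENNReal.rpow_le_rpow (iInf_le_of_le μ (iInf_le_of_le ν
    (iInf_le _ ⟨h.continuityEq one_pos, rfl, rfl⟩))) (by positivity)

lemma exists_lintegral_action_lt_of_wDist_rpow_lt (hp : 1 < p) {μ₀ μ₁ : Measure (Space d)}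
    {c : ℝ≥0∞} (h : wDist p φ γ μ₀ μ₁ ^ p < c) :
    ∃ (μ : ℝ → Measure (Space d)) (ν : ℝ → RadonVectorMeasure d), ContinuityEqOn 0 1 μ ν ∧
      μ 0 = μ₀ ∧ μ 1 = μ₁ ∧ ∫⁻ t in Ioo (0 : ℝ) 1, action φ γ (μ t) (ν t) < c := by
  rw [wDist, ← ENNReal.rpow_mul, one_div_mul_cancel (by linarith), ENNReal.rpow_one] at h
  simp only [iInf_lt_iff] at h
  obtain ⟨μ, ν, ⟨hc, h0, h1⟩, hlt⟩ := h
  exact ⟨μ, ν, hc.continuityEqOn one_pos, h0, h1, hlt⟩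

lemma ContinuityEqOn.action_comp_timeChange [IsLocallyFiniteMeasure γ] (hφ : IsActionDensity p φ)
    (hp : 1 < p) {e : ℝ ≃o ℝ} {k : ℝ → ℝ} (hk : IsTimeChange e k)
    (h : ContinuityEqOn (e a) (e b) μ ν) {s : ℝ} (hs : s ∈ Icc a b) :
    action φ γ (μ (e s)) ((ν (e s)).scale (k s)) =
      ENNReal.ofReal (k s ^ p) * action φ γ (μ (e s)) (ν (e s)) := by
  have := h.locallyFinite (e s) ⟨e.monotone hs.1, e.monotone hs.2⟩
  exact action_scale hφ hp γ _ _ (hk.pos s)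

lemma ContinuityEqOn.length_comp_timeChange [IsLocallyFiniteMeasure γ] (hφ : IsActionDensity p φ)
    (hp : 1 < p) {e : ℝ ≃o ℝ} {k : ℝ → ℝ} (hk : IsTimeChange e k)
    (h : ContinuityEqOn (e a) (e b) μ ν) :
    ∫⁻ s in Ioo a b, action φ γ (μ (e s)) ((ν (e s)).scale (k s)) ^ (1 / p) =
      ∫⁻ t in Ioo (e a) (e b), action φ γ (μ t) (ν t) ^ (1 / p) := by
  rw [← hk.setLIntegral_comp]
  refine setLIntegral_congr_fun measurableSet_Ioo fun s hs => ?_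
  rw [h.action_comp_timeChange hφ hp hk (Ioo_subset_Icc_self hs),
    ENNReal.mul_rpow_of_nonneg _ _ (by positivity), ENNReal.ofReal_rpow_of_nonneg
    (Real.rpow_nonneg (hk.pos s).le p) (by positivity), ← Real.rpow_mul (hk.pos s).le,
    mul_one_div_cancel (by linarith), Real.rpow_one]

/-- The distance is at most the length of any connecting solution: reparametrized with (almost)
constant speed, it has action (almost) equal to the `p`-th power of its length. -/
theorem wDist_le_length [IsLocallyFiniteMeasure γ] (hφ : IsActionDensity p φ) (hp : 1 < p)
    (hab : a < b) (h : ContinuityEqOn a b μ ν) :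
    wDist p φ γ (μ a) (μ b) ≤ ∫⁻ t in Ioo a b, action φ γ (μ t) (ν t) ^ (1 / p) := by
  have hp0 : 0 < p := by linarith
  refine ENNReal.le_of_forall_pos_le_add fun ε hε hL => ?_
  set g : ℝ → ℝ≥0∞ := fun t => action φ γ (μ t) (ν t) ^ (1 / p) with hg
  have hgm : AEMeasurable g (volume.restrict (Ioo a b)) :=
    (h.aemeasurable_action hφ hp γ).pow_const _
  set g₀ := hgm.mk g
  have hg₀ : Measurable g₀ := hgm.measurable_mk
  have hgg : g =ᵐ[volume.restrict (Ioo a b)] g₀ := hgm.ae_eq_mk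
  have hba : 0 < b - a := sub_pos.2 hab
  have hε' : 0 < (ε : ℝ) / (b - a) := div_pos (by exact_mod_cast hε) hba
  -- a strictly positive majorant of the speed; the additional term makes the new time strictly
  -- increasing, at the cost of `ε` in the length
  set η : ℝ → ℝ := fun t => ε / (b - a) + (g₀ t).toReal with hη
  have hηm : Measurable η := measurable_const.add hg₀.ennreal_toReal
  have hηpos : ∀ t, 0 < η t := fun t => add_pos_of_pos_of_nonneg hε' ENNReal.toReal_nonneg
  have hL₀ : ∫⁻ t in Ioo a b, g₀ t ≠ ⊤ := by rw [← lintegral_congr_ae hgg]; exact hL.ne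
  have hηi : IntegrableOn η (Ioo a b) :=
    (integrableOn_const (by simp)).add (integrable_toReal_of_lintegral_ne_top hg₀.aemeasurable hL₀)
  have hηg : ∀ᵐ t ∂(volume.restrict (Ioo a b)), g t ≤ ENNReal.ofReal (η t) := by
    filter_upwards [hgg, ae_lt_top hg₀ hL₀] with t h1 h2
    rw [h1, hη]
    refine (ENNReal.ofReal_toReal h2.ne).symm.le.trans (ENNReal.ofReal_le_ofReal ?_)
    linarith
  set L := ∫ t in Ioo a b, η t with hLdef
  have hLpos : 0 < L := by
    rw [hLdef, setIntegral_pos_iff_support_of_nonneg_ae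
      (Eventually.of_forall fun t => (hηpos t).le) hηi]
    have : Function.support η = univ := eq_univ_of_forall fun t => (hηpos t).ne'
    simp [this, hab]
  have hLle : ENNReal.ofReal L ≤ (∫⁻ t in Ioo a b, g t) + ε := by
    rw [hLdef, ofReal_integral_eq_lintegral_ofReal hηi (Eventually.of_forall fun t => (hηpos t).le)]
    calc ∫⁻ t in Ioo a b, ENNReal.ofReal (η t)
        ≤ ∫⁻ t in Ioo a b, (ENNReal.ofReal (ε / (b - a)) + g₀ t) := by
          refine lintegral_mono fun t => ?_
          rw [hη]
          simp only
          rw [ENNReal.ofReal_add hε'.le ENNReal.toReal_nonneg]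
          gcongr
          exact ENNReal.ofReal_toReal_le
      _ = (∫⁻ t in Ioo a b, g t) + ε := by
          rw [lintegral_add_left measurable_const, ← lintegral_congr_ae hgg, setLIntegral_const,
            Real.volume_Ioo, ← ENNReal.ofReal_mul hε'.le, div_mul_cancel₀ _ hba.ne', add_comm]
          simp
  refine le_trans ?_ hLle
  -- in the time `e` with derivative `η / L` the speed is at most `L`
  obtain ⟨e, k, hk, hke, hea, heb⟩ := IsTimeChange.exists_of_integrableOn hab.le
    (h := fun t => η t / L) (hηm.div_const _) (fun t => div_pos (hηpos t) hLpos)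
    (hηi.div_const _)
  rw [integral_div, div_self hLpos.ne'] at heb
  have ha : e.symm 0 = a := by rw [← hea, e.symm_apply_apply]
  have hb : e.symm 1 = b := by rw [← heb, e.symm_apply_apply]
  have h' : ContinuityEqOn (e.symm 0) (e.symm 1) μ ν := by rwa [ha, hb]
  have hW := wDist_le_rpow_lintegral_action (φ := φ) (γ := γ) hp (h'.comp_timeChange hk.symm)
  rw [ha, hb] at hW
  refine hW.trans ?_
  have hE : ∫⁻ s in Ioo (0 : ℝ) 1, action φ γ (μ (e.symm s))
      ((ν (e.symm s)).scale (k (e.symm s))⁻¹) ≤ ENNReal.ofReal L ^ p := by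
    rw [← hea, ← heb, ← hk.setLIntegral_comp]
    have h1 : ∀ᵐ t ∂(volume.restrict (Ioo a b)), ENNReal.ofReal (k t) *
        action φ γ (μ (e.symm (e t))) ((ν (e.symm (e t))).scale (k (e.symm (e t)))⁻¹) ≤
          ENNReal.ofReal (k t) * ENNReal.ofReal L ^ p := by
      filter_upwards [hηg, ae_restrict_mem measurableSet_Ioo] with t ht htm
      gcongr
      rw [e.symm_apply_apply]
      have := h.locallyFinite t (Ioo_subset_Icc_self htm)
      rw [action_scale hφ hp γ _ _ (inv_pos.2 (hk.pos t)), hke t htm]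
      have h2 : action φ γ (μ t) (ν t) = g t ^ p := by
        rw [hg]; simp only
        rw [← ENNReal.rpow_mul, one_div_mul_cancel hp0.ne', ENNReal.rpow_one]
      rw [h2, ENNReal.ofReal_rpow_of_pos hLpos]
      calc ENNReal.ofReal ((η t / L)⁻¹ ^ p) * g t ^ p
          ≤ ENNReal.ofReal ((η t / L)⁻¹ ^ p) * ENNReal.ofReal (η t) ^ p := by gcongr
        _ = ENNReal.ofReal (L ^ p) := by
          have hηt := hηpos t
          rw [ENNReal.ofReal_rpow_of_pos hηt, ← ENNReal.ofReal_mul (by positivity),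
            ← Real.mul_rpow (by positivity) hηt.le]
          congr 2
          field_simp
    refine (lintegral_mono_ae h1).trans ?_
    rw [lintegral_mul_const _ hk.measurable.ennreal_ofReal, hk.lintegral_Ioo a b hab.le, hea, heb]
    simp
  refine (ENNReal.rpow_le_rpow hE (by positivity)).trans ?_
  rw [← ENNReal.rpow_mul, mul_one_div_cancel hp0.ne', ENNReal.rpow_one]

/-- Almost optimal solutions on an interval `[a,b]`, with a bound on their action. -/
lemma exists_lintegral_action_le [IsLocallyFiniteMeasure γ] (hφ : IsActionDensity p φ)
    (hp : 1 < p) (hab : a < b) {μ₀ μ₁ : Measure (Space d)} {c : ℝ≥0∞}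
    (h : wDist p φ γ μ₀ μ₁ ^ p < c) :
    ∃ (μ : ℝ → Measure (Space d)) (ν : ℝ → RadonVectorMeasure d), ContinuityEqOn a b μ ν ∧
      μ a = μ₀ ∧ μ b = μ₁ ∧
      ∫⁻ t in Ioo a b, action φ γ (μ t) (ν t) ≤ ENNReal.ofReal ((b - a) ^ (1 - p)) * c := by
  obtain ⟨μ, ν, hc, h0, h1, hlt⟩ := exists_lintegral_action_lt_of_wDist_rpow_lt hp h
  have hba : 0 < b - a := sub_pos.2 hab
  obtain ⟨e, hk, he⟩ := IsTimeChange.affine (inv_pos.2 hba) (-(b - a)⁻¹ * a)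
  have ea : e a = 0 := by rw [he]; ring
  have eb : e b = 1 := by rw [he]; field_simp; ring
  have hc' : ContinuityEqOn (e a) (e b) μ ν := by rwa [ea, eb]
  refine ⟨_, _, hc'.comp_timeChange hk, by rw [ea, h0], by rw [eb, h1], ?_⟩
  refine le_trans (le_of_eq ?_) (mul_le_mul_right hlt.le _)
  have hI : Ioo (0 : ℝ) 1 = Ioo (e a) (e b) := by rw [ea, eb]
  rw [hI, ← hk.setLIntegral_comp, ← lintegral_const_mul' _ _ ENNReal.ofReal_ne_top]
  refine setLIntegral_congr_fun measurableSet_Ioo fun s hs => ?_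
  rw [hc'.action_comp_timeChange hφ hp hk (Ioo_subset_Icc_self hs), ← mul_assoc,
    ← ENNReal.ofReal_mul (by positivity)]
  congr 2
  rw [Real.inv_rpow hba.le, ← Real.rpow_neg hba.le, ← Real.rpow_neg_one (b - a),
    ← Real.rpow_add hba]
  congr 1
  ring

/-- Solutions on a given interval whose length is almost the distance. -/
lemma exists_length_lt [IsLocallyFiniteMeasure γ] (hφ : IsActionDensity p φ)
    (hp : 1 < p) (hab : a < b) {μ₀ μ₁ : Measure (Space d)} {c : ℝ≥0∞}
    (h : wDist p φ γ μ₀ μ₁ < c) :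
    ∃ (μ : ℝ → Measure (Space d)) (ν : ℝ → RadonVectorMeasure d), ContinuityEqOn a b μ ν ∧
      μ a = μ₀ ∧ μ b = μ₁ ∧ ∫⁻ t in Ioo a b, action φ γ (μ t) (ν t) ^ (1 / p) < c := by
  have hp0 : 0 < p := by linarith
  obtain ⟨μ, ν, hc, h0, h1, hlt⟩ := exists_lintegral_action_lt_of_wDist_rpow_lt hp
    (ENNReal.rpow_lt_rpow h hp0)
  have hba : 0 < b - a := sub_pos.2 hab
  obtain ⟨e, hk, he⟩ := IsTimeChange.affine (inv_pos.2 hba) (-(b - a)⁻¹ * a)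
  have ea : e a = 0 := by rw [he]; ring
  have eb : e b = 1 := by rw [he]; field_simp; ring
  have hc' : ContinuityEqOn (e a) (e b) μ ν := by rwa [ea, eb]
  refine ⟨_, _, hc'.comp_timeChange hk, by rw [ea, h0], by rw [eb, h1], ?_⟩
  rw [hc'.length_comp_timeChange hφ hp hk, ea, eb]
  refine (setLIntegral_rpow_inv_le (Real.HolderConjugate.conjExponent hp)
    (hc.aemeasurable_action hφ hp γ)).trans_lt ?_
  have h2 := ENNReal.rpow_lt_rpow hlt (one_div_pos.2 hp0)
  rw [← ENNReal.rpow_mul, mul_one_div_cancel hp0.ne', ENNReal.rpow_one] at h2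
  simpa using h2

/-- The distance is symmetric since time can be reversed. -/
theorem wDist_symm [IsLocallyFiniteMeasure γ] (hφ : IsActionDensity p φ) (hp : 1 < p)
    (μ₀ μ₁ : Measure (Space d)) : wDist p φ γ μ₀ μ₁ = wDist p φ γ μ₁ μ₀ := by
  have key : ∀ μ₀ μ₁ : Measure (Space d), wDist p φ γ μ₀ μ₁ ≤ wDist p φ γ μ₁ μ₀ := by
    intro μ₀ μ₁
    refine le_of_forall_gt fun c hc => ?_
    obtain ⟨μ, ν, h, h0, h1, hlt⟩ := exists_length_lt hφ hp (one_pos : (0 : ℝ) < 1) hc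
    have hW := wDist_le_length hφ hp (γ := γ) (by norm_num) h.reverse
    simp only [neg_neg, neg_zero, h0, h1] at hW
    refine lt_of_le_of_lt (hW.trans_eq ?_) hlt
    have := (Measure.measurePreserving_neg (volume : Measure ℝ)).setLIntegral_comp_preimage_emb
      (MeasurableEquiv.neg ℝ).measurableEmbedding
      (fun t => action φ γ (μ t) (ν t) ^ (1 / p)) (Ioo 0 1)
    rw [Set.neg_preimage, Set.neg_Ioo, neg_zero] at this
    rw [← this]
    refine setLIntegral_congr_fun measurableSet_Ioo fun t ht => ?_
    have := h.locallyFinite (-t) ⟨by linarith [ht.2], by linarith [ht.1]⟩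
    rw [action_opp hφ hp]
  exact le_antisymm (key _ _) (key _ _)

/-- The triangle inequality holds since lengths add up under concatenation. -/
theorem wDist_triangle [IsLocallyFiniteMeasure γ] (hφ : IsActionDensity p φ) (hp : 1 < p)
    (μ₀ μ₁ μ₂ : Measure (Space d)) :
    wDist p φ γ μ₀ μ₂ ≤ wDist p φ γ μ₀ μ₁ + wDist p φ γ μ₁ μ₂ := by
  refine ENNReal.le_of_forall_pos_le_add fun ε hε hfin => ?_
  have hε' : (ε : ℝ≥0∞) / 2 ≠ 0 := by simpa using hε.ne'
  obtain ⟨h1, h2⟩ := ENNReal.add_lt_top.1 hfin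
  obtain ⟨μ, ν, h, h0, h1, hlt⟩ := exists_length_lt hφ hp (one_pos : (0 : ℝ) < 1)
    (ENNReal.lt_add_right h1.ne hε')
  obtain ⟨μ', ν', h', h0', h1', hlt'⟩ := exists_length_lt hφ hp (one_lt_two : (1 : ℝ) < 2)
    (ENNReal.lt_add_right h2.ne hε')
  have hW := wDist_le_length hφ hp (γ := γ) (by norm_num)
    (h.glue zero_le_one one_le_two h' (h1.trans h0'.symm))
  simp only [zero_le_one, if_true, h0, not_le.2 (one_lt_two : (1 : ℝ) < 2), if_false, h1'] at hW
  refine hW.trans ?_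
  have hsub : Ioo (0 : ℝ) 2 ⊆ Ioo 0 1 ∪ Ico 1 2 := fun t ht => by
    rcases lt_or_ge t 1 with hlt | hge
    · exact Or.inl ⟨ht.1, hlt⟩
    · exact Or.inr ⟨hge, ht.2⟩
  refine (lintegral_mono_set hsub).trans ((lintegral_union_le _ _ _).trans ?_)
  have e1 : ∫⁻ t in Ioo (0 : ℝ) 1, action φ γ (if t ≤ 1 then μ t else μ' t)
      (if t < 1 then ν t else ν' t) ^ (1 / p) =
      ∫⁻ t in Ioo (0 : ℝ) 1, action φ γ (μ t) (ν t) ^ (1 / p) :=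
    setLIntegral_congr_fun measurableSet_Ioo fun t ht => by simp [ht.2, ht.2.le]
  have e2 : ∫⁻ t in Ico (1 : ℝ) 2, action φ γ (if t ≤ 1 then μ t else μ' t)
      (if t < 1 then ν t else ν' t) ^ (1 / p) =
      ∫⁻ t in Ioo (1 : ℝ) 2, action φ γ (μ' t) (ν' t) ^ (1 / p) := by
    rw [← restrict_Ioo_eq_restrict_Ico]
    exact setLIntegral_congr_fun measurableSet_Ioo fun t ht => by simp [ht.1.not_gt, not_le.2 ht.1]
  rw [e1, e2]
  refine (add_le_add hlt.le hlt'.le).trans_eq ?_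
  conv_rhs => rw [← ENNReal.add_halves (ε : ℝ≥0∞)]
  ring

end Distance

/-! ### Local mass bounds along solutions of finite length -/

/-- Compactly supported `C¹` functions `ζ ≥ 0` with `|∇ζ|^q ≤ C ζ`, so that the rate of change of
the mass `∫ ζ dμ_t` is controlled by the mass itself. -/
structure IsCutoff (q : ℝ) (ζ : Space d → ℝ) : Prop where
  contDiff : ContDiff ℝ 1 ζ
  hasCompactSupport : HasCompactSupport ζ
  nonneg : ∀ x, 0 ≤ ζ x
  exists_norm_gradient_rpow_le : ∃ C : ℝ, 0 ≤ C ∧ ∀ x, ‖gradient ζ x‖ ^ q ≤ C * ζ x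

lemma norm_gradient (ζ : Space d → ℝ) (x : Space d) : ‖gradient ζ x‖ = ‖fderiv ℝ ζ x‖ :=
  LinearIsometryEquiv.norm_map _ _

/-- Large powers of a cut-off function are cut-off functions in the sense of `IsCutoff`. -/
lemma exists_isCutoff {p q : ℝ} (hpq : p.HolderConjugate q) {K : Set (Space d)}
    (hK : IsCompact K) : ∃ ζ : Space d → ℝ, IsCutoff q ζ ∧ ∀ x ∈ K, ζ x = 1 := by
  obtain ⟨F, hF⟩ := exists_isBumpFamily d
  obtain ⟨j, hj, -⟩ := hF.exists_of_subset K univ hK isOpen_univ (subset_univ _)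
  obtain ⟨k, hk⟩ := exists_nat_ge p
  have hk1 : (1 : ℝ) < k := hpq.lt.trans_le hk
  have hk0 : k ≠ 0 := by rintro rfl; norm_num at hk1
  have hq1 : 1 < q := hpq.symm.lt
  have hχ := hF.contDiff j
  obtain ⟨M, hM⟩ := ((hF.hasCompactSupport j).fderiv (𝕜 := ℝ)).exists_bound_of_continuous
    (hχ.continuous_fderiv one_ne_zero)
  have hM0 : 0 ≤ M := (norm_nonneg _).trans (hM 0)
  refine ⟨fun x => F j x ^ k, ⟨hχ.pow k, ?_, fun x => pow_nonneg (hF.mem_Icc j x).1 k,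
    (k * M) ^ q, by positivity, fun x => ?_⟩, fun x hx => by simp [hj x hx]⟩
  · exact (hF.hasCompactSupport j).comp_left (g := fun s : ℝ => s ^ k) (zero_pow hk0)
  · have h0 := (hF.mem_Icc j x).1
    have h1 := (hF.mem_Icc j x).2
    rw [norm_gradient, fderiv_fun_pow _ (hχ.differentiable one_ne_zero x), norm_smul]
    have e1 : ‖k • F j x ^ (k - 1)‖ = k * F j x ^ (k - 1) := by
      rw [nsmul_eq_mul, Real.norm_of_nonneg (by positivity)]
    rw [e1]
    calc (k * F j x ^ (k - 1) * ‖fderiv ℝ (F j) x‖) ^ q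
        ≤ (k * F j x ^ (k - 1) * M) ^ q := by gcongr; exact hM x
      _ = (k * M) ^ q * (F j x ^ (k - 1)) ^ q := by
          rw [← Real.mul_rpow (by positivity) (by positivity)]; congr 1; ring
      _ ≤ (k * M) ^ q * F j x ^ k := by
          gcongr
          rw [← Real.rpow_natCast _ (k - 1), ← Real.rpow_natCast _ k, ← Real.rpow_mul h0]
          refine Real.rpow_le_rpow_of_exponent_ge' h0 h1 (by positivity) ?_
          rw [Nat.cast_sub (Nat.one_le_iff_ne_zero.2 hk0), Nat.cast_one]
          have := hpq.symm.sub_one_mul_conj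
          nlinarith [mul_le_mul_of_nonneg_left hk (by linarith : 0 ≤ q - 1)]

lemma exists_enorm_pairing_le {p q : ℝ} (hpq : p.HolderConjugate q) {φ : ℝ → Space d → ℝ}
    (hφ : IsActionDensity p φ) :
    ∃ C : ℝ, 0 < C ∧ ∀ (γ μ : Measure (Space d)) [IsLocallyFiniteMeasure γ]
      [IsLocallyFiniteMeasure μ] (ν : RadonVectorMeasure d), action φ γ μ ν ≠ ⊤ →
      ∀ η : Space d → Space d, Continuous η → ‖ν.pairing η‖ₑ ≤
        ENNReal.ofReal C * action φ γ μ ν ^ (1 / p) * (∫⁻ x, ‖η x‖ₑ ^ q ∂(γ + μ)) ^ (1 / q) := by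
  obtain ⟨C, hC, h⟩ := exists_lintegral_var_le hpq hφ
  exact ⟨C, hC, fun γ μ _ _ ν hν η hη =>
    (ν.enorm_pairing_le η).trans (h γ μ ν hν _ hη.enorm.measurable)⟩

/-- Absorption of a sublinear term. -/
lemma le_of_le_add_mul_rpow {p q : ℝ} (hpq : p.HolderConjugate q) {S Y c : ℝ} (hS : 0 ≤ S)
    (hY : 0 ≤ Y) (hc : 0 ≤ c) (h : S ≤ Y + c * S ^ (1 / q)) : S ≤ 2 * Y + (2 * c) ^ p := by
  have hcp : 0 ≤ (2 * c) ^ p := by positivity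
  by_contra! hlt
  have hSpos : 0 < S := by linarith
  have h1 : S < 2 * c * S ^ (1 / q) := by linarith
  have h2 : S = S ^ (1 / p) * S ^ (1 / q) := by
    rw [← Real.rpow_add hSpos, one_div, one_div, hpq.inv_add_inv_eq_one, Real.rpow_one]
  have h3 : S ^ (1 / p) < 2 * c := by
    have : 0 < S ^ (1 / q) := by positivity
    nlinarith
  have h4 := Real.rpow_lt_rpow (by positivity) h3 hpq.pos
  rw [← Real.rpow_mul hS, one_div_mul_cancel hpq.ne_zero, Real.rpow_one] at h4
  linarith

section

variable {p q : ℝ} {φ : ℝ → Space d → ℝ}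

/-- The increments of `t ↦ ∫ ξ dμ_t` are bounded by the length of the curve, uniformly for curves
with bounded local mass. -/
lemma exists_abs_integral_sub_le (hpq : p.HolderConjugate q) (hφ : IsActionDensity p φ)
    (γ : Measure (Space d)) [IsLocallyFiniteMeasure γ] {ξ ζ : Space d → ℝ} (hξ : ContDiff ℝ 1 ξ)
    (hξc : HasCompactSupport ξ) (hζ : Continuous ζ) (hζc : HasCompactSupport ζ)
    (hζ0 : ∀ x, 0 ≤ ζ x) {C₁ : ℝ} (hC₁ : 0 ≤ C₁) (hξζ : ∀ x, ‖gradient ξ x‖ ^ q ≤ C₁ * ζ x) :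
    ∃ B : ℝ, 0 < B ∧ ∀ (a b : ℝ) (μ : ℝ → Measure (Space d)) (ν : ℝ → RadonVectorMeasure d),
      ContinuityEqOn a b μ ν → (∫⁻ t in Ioo a b, action φ γ (μ t) (ν t) ^ (1 / p)) ≠ ⊤ →
      ∀ s t : ℝ, a ≤ s → s ≤ t → t ≤ b → ∀ M : ℝ, 0 ≤ M → (∀ r ∈ Ioo s t, ∫ x, ζ x ∂(μ r) ≤ M) →
      ENNReal.ofReal |∫ x, ξ x ∂(μ t) - ∫ x, ξ x ∂(μ s)| ≤
        ENNReal.ofReal (B * ((∫ x, ζ x ∂γ) + M) ^ (1 / q)) *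
          ∫⁻ r in Ioo s t, action φ γ (μ r) (ν r) ^ (1 / p) := by
  obtain ⟨C, hC, hpair⟩ := exists_enorm_pairing_le (d := d) hpq hφ
  have hq0 : 0 < q := hpq.symm.pos
  have hp1 : 1 < p := hpq.lt
  refine ⟨C * (C₁ + 1) ^ (1 / q), by positivity, fun a b μ ν h hL s t hs hst ht M hM hmass => ?_⟩
  have hγζ : Integrable ζ γ := hζ.integrable_of_hasCompactSupport hζc
  have hγ0 : 0 ≤ ∫ x, ζ x ∂γ := integral_nonneg hζ0
  set G := (∫ x, ζ x ∂γ) + M with hG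
  have hG0 : 0 ≤ G := by positivity
  have hsub : Ioo s t ⊆ Ioo a b := Ioo_subset_Ioo hs ht
  have hΦm : AEMeasurable (fun r => action φ γ (μ r) (ν r) ^ (1 / p)) (volume.restrict (Ioo a b)) :=
    (h.aemeasurable_action hφ hp1 γ).pow_const _
  rw [h.balance ξ hξ hξc s t hs hst ht, ← Real.norm_eq_abs, ofReal_norm]
  refine (enorm_integral_le_lintegral_enorm _).trans ?_
  rw [← lintegral_const_mul'' _ (hΦm.mono_measure (Measure.restrict_mono hsub le_rfl))]
  have hfin : ∀ᵐ r ∂(volume.restrict (Ioo s t)), action φ γ (μ r) (ν r) ^ (1 / p) < ⊤ :=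
    ae_mono (Measure.restrict_mono hsub le_rfl) (ae_lt_top' hΦm hL)
  refine lintegral_mono_ae ?_
  filter_upwards [hfin, ae_restrict_mem measurableSet_Ioo] with r hr hrI
  have hr' : action φ γ (μ r) (ν r) ≠ ⊤ := fun h' => by
    rw [h', ENNReal.top_rpow_of_pos (by positivity)] at hr
    exact lt_irrefl _ hr
  have := h.locallyFinite r (Ioo_subset_Icc_self (hsub hrI))
  have hμζ : Integrable ζ (μ r) := hζ.integrable_of_hasCompactSupport hζc
  refine (hpair γ (μ r) (ν r) hr' _ (continuous_gradient hξ)).trans ?_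
  have hint : ∫⁻ x, ‖gradient ξ x‖ₑ ^ q ∂(γ + μ r) ≤ ENNReal.ofReal ((C₁ + 1) * G) := by
    calc ∫⁻ x, ‖gradient ξ x‖ₑ ^ q ∂(γ + μ r)
        ≤ ∫⁻ x, ENNReal.ofReal ((C₁ + 1) * ζ x) ∂(γ + μ r) := by
          refine lintegral_mono fun x => ?_
          rw [← ofReal_norm, ENNReal.ofReal_rpow_of_nonneg (norm_nonneg _) hq0.le]
          refine ENNReal.ofReal_le_ofReal ((hξζ x).trans ?_)
          nlinarith [hζ0 x]
      _ = ENNReal.ofReal (∫ x, (C₁ + 1) * ζ x ∂(γ + μ r)) := by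
          rw [ofReal_integral_eq_lintegral_ofReal ((hγζ.add_measure hμζ).const_mul _)]
          exact Eventually.of_forall fun x => mul_nonneg (by positivity) (hζ0 x)
      _ ≤ ENNReal.ofReal ((C₁ + 1) * G) := by
          refine ENNReal.ofReal_le_ofReal ?_
          rw [integral_const_mul, integral_add_measure hγζ hμζ]
          exact mul_le_mul_of_nonneg_left (by rw [hG]; linarith [hmass r hrI]) (by positivity)
  calc ENNReal.ofReal C * action φ γ (μ r) (ν r) ^ (1 / p) *
        (∫⁻ x, ‖gradient ξ x‖ₑ ^ q ∂(γ + μ r)) ^ (1 / q)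
      ≤ ENNReal.ofReal C * action φ γ (μ r) (ν r) ^ (1 / p) *
        ENNReal.ofReal ((C₁ + 1) * G) ^ (1 / q) := by gcongr
    _ = ENNReal.ofReal (C * (C₁ + 1) ^ (1 / q) * G ^ (1 / q)) *
        action φ γ (μ r) (ν r) ^ (1 / p) := by
        rw [ENNReal.ofReal_rpow_of_nonneg (by positivity) (by positivity),
          Real.mul_rpow (by positivity) hG0, mul_assoc C, ENNReal.ofReal_mul hC.le]
        ring

/-- Gronwall-type bound for the local mass along a solution of finite length. -/
lemma IsCutoff.exists_integral_le (hpq : p.HolderConjugate q) (hφ : IsActionDensity p φ)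
    (γ : Measure (Space d)) [IsLocallyFiniteMeasure γ] {ζ : Space d → ℝ} (hζ : IsCutoff q ζ) :
    ∃ B : ℝ, 0 < B ∧ ∀ (a b : ℝ) (μ : ℝ → Measure (Space d)) (ν : ℝ → RadonVectorMeasure d),
      a ≤ b → ContinuityEqOn a b μ ν →
      (∫⁻ t in Ioo a b, action φ γ (μ t) (ν t) ^ (1 / p)) ≠ ⊤ → ∀ t ∈ Icc a b,
      ∫ x, ζ x ∂(μ t) ≤ 2 * (∫ x, ζ x ∂(μ a) + ∫ x, ζ x ∂γ) +
        (B * (∫⁻ t in Ioo a b, action φ γ (μ t) (ν t) ^ (1 / p)).toReal) ^ p := by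
  obtain ⟨C₁, hC₁, hgrad⟩ := hζ.exists_norm_gradient_rpow_le
  obtain ⟨B, hB, h⟩ := exists_abs_integral_sub_le hpq hφ γ hζ.contDiff hζ.hasCompactSupport
    hζ.contDiff.continuous hζ.hasCompactSupport hζ.nonneg hC₁ hgrad
  refine ⟨2 * B, by positivity, fun a b μ ν hab hc hL t ht => ?_⟩
  set L := ∫⁻ t in Ioo a b, action φ γ (μ t) (ν t) ^ (1 / p)
  -- the bound for the increments, applied at a time of maximal mass, is sublinear in that mass
  obtain ⟨t₀, ht₀, hmax⟩ := isCompact_Icc.exists_isMaxOn ⟨a, left_mem_Icc.2 hab⟩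
    (hc.weakStar_continuous ζ hζ.contDiff.continuous hζ.hasCompactSupport)
  have hm0 : ∀ r, 0 ≤ ∫ x, ζ x ∂(μ r) := fun r => integral_nonneg hζ.nonneg
  have hγ0 : 0 ≤ ∫ x, ζ x ∂γ := integral_nonneg hζ.nonneg
  have h1 := h a b μ ν hc hL a t₀ le_rfl ht₀.1 ht₀.2 (∫ x, ζ x ∂(μ t₀)) (hm0 _)
    fun r hr => hmax ⟨hr.1.le, hr.2.le.trans ht₀.2⟩
  have h2 := h1.trans (mul_le_mul_right (lintegral_mono_set (Ioo_subset_Ioo_right ht₀.2)) _)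
  have h3 := ENNReal.toReal_mono (ENNReal.mul_ne_top ENNReal.ofReal_ne_top hL) h2
  rw [ENNReal.toReal_ofReal (abs_nonneg _), ENNReal.toReal_mul, ENNReal.toReal_ofReal
    (by have := hm0 t₀; positivity)] at h3
  have h4 := (le_abs_self _).trans h3
  have h5 := le_of_le_add_mul_rpow hpq (S := (∫ x, ζ x ∂γ) + ∫ x, ζ x ∂(μ t₀))
    (Y := (∫ x, ζ x ∂(μ a)) + ∫ x, ζ x ∂γ) (c := B * L.toReal) (add_nonneg hγ0 (hm0 _))
    (add_nonneg (hm0 _) hγ0) (by positivity) (by linarith)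
  have h6 : ∫ x, ζ x ∂(μ t) ≤ ∫ x, ζ x ∂(μ t₀) := hmax ht
  rw [mul_assoc]
  linarith

end

lemma measure_le_ofReal_integral {m : Measure (Space d)} [IsLocallyFiniteMeasure m]
    {ζ : Space d → ℝ} (hζ : Continuous ζ) (hc : HasCompactSupport ζ) (h0 : ∀ x, 0 ≤ ζ x)
    {K : Set (Space d)} (hK : MeasurableSet K) (h1 : ∀ x ∈ K, 1 ≤ ζ x) :
    m K ≤ ENNReal.ofReal (∫ x, ζ x ∂m) := by
  rw [ofReal_integral_eq_lintegral_ofReal (hζ.integrable_of_hasCompactSupport hc)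
    (Eventually.of_forall h0), ← lintegral_indicator_one hK]
  refine lintegral_mono fun x => ?_
  by_cases hx : x ∈ K
  · simpa [hx] using h1 x hx
  · simp [hx]

/-- Weak* convergence may be tested on `C¹` functions, given local mass bounds. -/
lemma tendsto_integral_of_contDiff {ι : Type*} {l : Filter ι} {m : ι → Measure (Space d)}
    {m₀ : Measure (Space d)} [IsLocallyFiniteMeasure m₀]
    (hfin : ∀ᶠ i in l, IsLocallyFiniteMeasure (m i))
    (hmass : ∀ K : Set (Space d), IsCompact K →
      ∃ M : ℝ, 0 ≤ M ∧ ∀ᶠ i in l, m i K ≤ ENNReal.ofReal M)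
    (hlim : ∀ ζ : Space d → ℝ, ContDiff ℝ 1 ζ → HasCompactSupport ζ →
      Tendsto (fun i => ∫ x, ζ x ∂(m i)) l (𝓝 (∫ x, ζ x ∂m₀))) {f : Space d → ℝ}
    (hf : Continuous f) (hfc : HasCompactSupport f) :
    Tendsto (fun i => ∫ x, f x ∂(m i)) l (𝓝 (∫ x, f x ∂m₀)) := by
  obtain ⟨M₁, hM₁, hM₁'⟩ := hmass _ hfc.isCompact
  set M := max M₁ (m₀ (tsupport f)).toReal
  have hM0 : 0 ≤ M := le_max_of_le_left hM₁
  have hM₀ : m₀ (tsupport f) ≤ ENNReal.ofReal M := by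
    rw [← ENNReal.ofReal_toReal hfc.isCompact.measure_lt_top.ne]
    exact ENNReal.ofReal_le_ofReal (le_max_right _ _)
  rw [Metric.tendsto_nhds]
  intro ε hε
  have hε' : 0 < ε / (3 * (M + 1)) := by positivity
  obtain ⟨g, hg, hgf, hgs⟩ := hf.exists_contDiff_approx 1 (ε := fun _ => ε / (3 * (M + 1)))
    continuous_const fun _ => hε'
  have hgc : HasCompactSupport g := hfc.mono hgs
  have hclose : ∀ (m' : Measure (Space d)) [IsLocallyFiniteMeasure m'],
      m' (tsupport f) ≤ ENNReal.ofReal M → |∫ x, f x ∂m' - ∫ x, g x ∂m'| ≤ ε / 3 := by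
    intro m' _ hm'
    rw [← integral_sub (hf.integrable_of_hasCompactSupport hfc)
      (hg.continuous.integrable_of_hasCompactSupport hgc)]
    refine (abs_integral_le_of_abs_le hM0 hm' hε'.le (fun x => ?_) fun x hx => ?_).trans ?_
    · rw [← Real.dist_eq, dist_comm]; exact (hgf x).le
    · have h1 : f x = 0 := image_eq_zero_of_notMem_tsupport hx
      have h2 : g x = 0 := by
        by_contra h; exact hgs h h1
      rw [h1, h2, sub_zero]
    · rw [div_mul_eq_mul_div, div_le_div_iff₀ (by positivity) (by positivity)]
      nlinarith
  filter_upwards [Metric.tendsto_nhds.1 (hlim g hg hgc) (ε / 3) (by positivity), hfin, hM₁']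
    with i h1 hi hiM
  have h2 := abs_le.1 (hclose (m i) (hiM.trans (ENNReal.ofReal_le_ofReal (le_max_left _ _))))
  have h3 := abs_le.1 (hclose m₀ hM₀)
  rw [Real.dist_eq] at h1 ⊢
  have h4 := abs_lt.1 h1
  rw [abs_lt]
  constructor <;> linarith [h2.1, h2.2, h3.1, h3.2, h4.1, h4.2]

/-- Finite action confines `μ_t` to the support of `γ` for almost every `t`; weak* continuity
extends this to all times, since the support is closed. -/
lemma ContinuityEqOn.support_subset {p : ℝ} {φ : ℝ → Space d → ℝ} (hφ : IsActionDensity p φ)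
    (hp : 1 < p) {γ : Measure (Space d)} [IsLocallyFiniteMeasure γ] {a b : ℝ} (hab : a < b)
    {μ : ℝ → Measure (Space d)} {ν : ℝ → RadonVectorMeasure d} (h : ContinuityEqOn a b μ ν)
    (hL : (∫⁻ t in Ioo a b, action φ γ (μ t) (ν t) ^ (1 / p)) ≠ ⊤) {t : ℝ} (ht : t ∈ Icc a b) :
    (μ t).support ⊆ γ.support := by
  have hΦm : AEMeasurable (fun r => action φ γ (μ r) (ν r) ^ (1 / p)) (volume.restrict (Ioo a b)) :=
    (h.aemeasurable_action hφ hp γ).pow_const _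
  have hae : ∀ᵐ r ∂(volume.restrict (Ioo a b)), μ r γ.supportᶜ = 0 := by
    filter_upwards [ae_lt_top' hΦm hL] with r hr
    refine support_subset_iff_measure_compl.1 (support_subset_of_action_ne_top
      (φ := φ) (ν := ν r) fun h' => ?_).1
    rw [h', ENNReal.top_rpow_of_pos (by positivity)] at hr
    exact lt_irrefl _ hr
  have hopen : IsOpen (γ.supportᶜ) := Measure.isClosed_support.isOpen_compl
  have := h.locallyFinite t ht
  obtain ⟨F, hF⟩ := exists_isBumpFamily d
  rw [support_subset_iff_measure_compl, hopen.measure_eq_iSup_isCompact]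
  simp only [ENNReal.iSup_eq_zero]
  intro K hKU hK
  obtain ⟨j, hj, hjs⟩ := hF.exists_of_subset K _ hK hopen hKU
  have hcont := h.weakStar_continuous _ (hF.continuous j) (hF.hasCompactSupport j)
  have hzero : (fun r => ∫ x, F j x ∂(μ r)) =ᵐ[volume.restrict (Icc a b)] fun _ => 0 := by
    rw [← restrict_Ioo_eq_restrict_Icc]
    filter_upwards [hae] with r hr
    refine integral_eq_zero_of_ae ?_
    filter_upwards [measure_eq_zero_iff_ae_notMem.1 hr] with x hx
    exact image_eq_zero_of_notMem_tsupport fun h' => hx (hjs h')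
  have h0 := Measure.eqOn_Icc_of_ae_eq volume hab.ne hzero hcont continuousOn_const ht
  have h1 := measure_le_ofReal_integral (m := μ t) (hF.continuous j) (hF.hasCompactSupport j)
    (fun x => (hF.mem_Icc j x).1) hK.measurableSet fun x hx => (hj x hx).ge
  simp only at h0
  rw [h0, ENNReal.ofReal_zero] at h1
  exact le_antisymm h1 (zero_le)

/-! ### Metric derivatives -/

lemma lintegral_Ioo_eq_ofReal_integral {a b : ℝ} {m : ℝ → ℝ≥0∞}
    (hm : AEMeasurable m (volume.restrict (Ioo a b))) (hfin : ∫⁻ t in Ioo a b, m t < ⊤) {s t : ℝ}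
    (has : a ≤ s) (hst : s ≤ t) (htb : t ≤ b) :
    ∫⁻ r in Ioo s t, m r = ENNReal.ofReal (∫ r in s..t, (m r).toReal) := by
  have hle : volume.restrict (Ioo s t) ≤ volume.restrict (Ioo a b) :=
    Measure.restrict_mono (Ioo_subset_Ioo has htb) le_rfl
  have hm' := hm.mono_measure hle
  have hfin' : ∫⁻ r in Ioo s t, m r ≠ ⊤ := ((lintegral_mono' hle le_rfl).trans_lt hfin).ne
  rw [intervalIntegral.integral_of_le hst, integral_Ioc_eq_integral_Ioo,
    integral_toReal hm' (ae_lt_top' hm' hfin'), ENNReal.ofReal_toReal hfin']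

lemma intervalIntegrable_toReal {a b : ℝ} (hab : a ≤ b) {m : ℝ → ℝ≥0∞}
    (hm : AEMeasurable m (volume.restrict (Ioo a b))) (hfin : ∫⁻ t in Ioo a b, m t < ⊤) :
    IntervalIntegrable (fun t => (m t).toReal) volume a b :=
  (intervalIntegrable_iff_integrableOn_Ioo_of_le hab).2
    (integrable_toReal_of_lintegral_ne_top hm hfin.ne)

/-- A function whose increments are bounded by those of a primitive is absolutely continuous. -/
lemma absolutelyContinuousOnInterval_of_abs_sub_le {a b : ℝ} (hab : a ≤ b) {m f : ℝ → ℝ}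
    (hm : IntervalIntegrable m volume a b)
    (h : ∀ s t, a ≤ s → s < t → t ≤ b → |f t - f s| ≤ ∫ r in s..t, m r) :
    AbsolutelyContinuousOnInterval f a b := by
  have hP := hm.absolutelyContinuousOnInterval_intervalIntegral (c := a) left_mem_uIcc
  have hPsub : ∀ s ∈ Icc a b, ∀ t ∈ Icc a b,
      (∫ r in a..t, m r) - (∫ r in a..s, m r) = ∫ r in s..t, m r := fun s hs t ht => by
    refine intervalIntegral.integral_interval_sub_left (hm.mono_set ?_) (hm.mono_set ?_)
    · rw [uIcc_of_le ht.1, uIcc_of_le hab]; exact Icc_subset_Icc_right ht.2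
    · rw [uIcc_of_le hs.1, uIcc_of_le hab]; exact Icc_subset_Icc_right hs.2
  have key : ∀ s ∈ Icc a b, ∀ t ∈ Icc a b,
      dist (f s) (f t) ≤ dist (∫ r in a..s, m r) (∫ r in a..t, m r) := by
    intro s hs t ht
    rcases lt_trichotomy s t with hlt | rfl | hlt
    · rw [dist_comm, dist_comm (∫ r in a..s, m r), Real.dist_eq, Real.dist_eq, hPsub s hs t ht]
      exact (h s t hs.1 hlt ht.2).trans (le_abs_self _)
    · simp
    · rw [Real.dist_eq, Real.dist_eq, hPsub t ht s hs]
      exact (h t s ht.1 hlt hs.2).trans (le_abs_self _)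
  rw [absolutelyContinuousOnInterval_iff] at hP ⊢
  intro ε hε
  obtain ⟨δ, hδ, hδ'⟩ := hP ε hε
  refine ⟨δ, hδ, fun E hE hEδ => lt_of_le_of_lt (Finset.sum_le_sum fun i hi => ?_) (hδ' E hE hEδ)⟩
  have := hE.1 i hi
  rw [uIcc_of_le hab] at this
  exact key _ this.1 _ this.2

section MetricDerivative

variable {T : ℝ} {D : ℝ → ℝ → ℝ≥0∞} {m : ℝ → ℝ≥0∞}

/-- An integrable bound on the speed bounds the upper limit of the difference quotients. -/
lemma ae_limsup_quotient_le (hT : 0 < T) (hsymm : ∀ s t, D s t = D t s)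
    (hm : AEMeasurable m (volume.restrict (Ioo 0 T))) (hfin : ∫⁻ t in Ioo 0 T, m t < ⊤)
    (hD : ∀ s t, 0 ≤ s → s < t → t ≤ T → D t s ≤ ∫⁻ r in Ioo s t, m r) :
    ∀ᵐ t ∂(volume.restrict (Ioo 0 T)),
      limsup (fun h => D (t + h) t / ENNReal.ofReal |h|) (𝓝[≠] 0) ≤ m t := by
  have hmi := intervalIntegrable_toReal hT.le hm hfin
  have hder := hmi.ae_hasDerivAt_integral
  filter_upwards [ae_restrict_of_ae hder, ae_lt_top' hm hfin.ne, ae_restrict_mem measurableSet_Ioo]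
    with t ht hmt htI
  have htI' : t ∈ Icc 0 T := Ioo_subset_Icc_self htI
  have ht' := ht (by rwa [uIcc_of_le hT.le]) 0 left_mem_uIcc
  set P : ℝ → ℝ := fun x => ∫ r in (0 : ℝ)..x, (m r).toReal with hP
  have hPsub : ∀ s ∈ Icc 0 T, ∀ t ∈ Icc 0 T, P t - P s = ∫ r in s..t, (m r).toReal :=
    fun s hs t ht => by
    refine intervalIntegral.integral_interval_sub_left (hmi.mono_set ?_) (hmi.mono_set ?_)
    · rw [uIcc_of_le ht.1, uIcc_of_le hT.le]; exact Icc_subset_Icc_right ht.2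
    · rw [uIcc_of_le hs.1, uIcc_of_le hT.le]; exact Icc_subset_Icc_right hs.2
  have hlim : Tendsto (fun h => ENNReal.ofReal |h⁻¹ • (P (t + h) - P t)|) (𝓝[≠] 0) (𝓝 (m t)) := by
    have h1 := (hasDerivAt_iff_tendsto_slope_zero.1 ht').abs
    have h2 := ENNReal.tendsto_ofReal h1
    rwa [abs_of_nonneg ENNReal.toReal_nonneg, ENNReal.ofReal_toReal hmt.ne] at h2
  rw [← hlim.limsup_eq]
  refine limsup_le_limsup ?_
  have hmem : ∀ᶠ h in 𝓝[≠] (0 : ℝ), t + h ∈ Icc 0 T := by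
    have : Tendsto (fun h : ℝ => t + h) (𝓝 0) (𝓝 t) := by
      simpa using (by fun_prop : Continuous fun h : ℝ => t + h).tendsto 0
    exact (this.mono_left nhdsWithin_le_nhds).eventually (Icc_mem_nhds htI.1 htI.2)
  filter_upwards [hmem, self_mem_nhdsWithin] with h hh h0
  have h0' : 0 < |h| := abs_pos.2 h0
  have key : D (t + h) t ≤ ENNReal.ofReal |P (t + h) - P t| := by
    rcases lt_or_gt_of_ne (show h ≠ 0 from h0) with hneg | hpos
    · rw [hsymm, abs_sub_comm, hPsub _ hh _ htI']
      refine (hD _ _ hh.1 (by linarith) htI'.2).trans ?_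
      rw [lintegral_Ioo_eq_ofReal_integral hm hfin hh.1 (by linarith) htI'.2]
      exact ENNReal.ofReal_le_ofReal (le_abs_self _)
    · rw [hPsub _ htI' _ hh]
      refine (hD _ _ htI'.1 (by linarith) hh.2).trans ?_
      rw [lintegral_Ioo_eq_ofReal_integral hm hfin htI'.1 (by linarith) hh.2]
      exact ENNReal.ofReal_le_ofReal (le_abs_self _)
  rw [smul_eq_mul, abs_mul, abs_inv, mul_comm, ← div_eq_mul_inv, ENNReal.ofReal_div_of_pos h0']
  gcongr

/-- Existence of the metric derivative: it is the supremum of the absolute values of the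
derivatives of the distances to the points of a countable dense part of the curve. -/
theorem exists_metric_derivative (hT : 0 < T) (hsymm : ∀ s t, D s t = D t s)
    (htri : ∀ r s t, D r t ≤ D r s + D s t)
    (hm : AEMeasurable m (volume.restrict (Ioo 0 T))) (hfin : ∫⁻ t in Ioo 0 T, m t < ⊤)
    (hD : ∀ s t, 0 ≤ s → s < t → t ≤ T → D t s ≤ ∫⁻ r in Ioo s t, m r) :
    ∃ v : ℝ → ℝ≥0∞, Measurable v ∧ (∀ᵐ t ∂(volume.restrict (Ioo 0 T)), v t ≤ m t) ∧
      (∀ s t, 0 ≤ s → s < t → t ≤ T → D t s ≤ ∫⁻ r in Ioo s t, v r) ∧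
      ∀ᵐ t ∂(volume.restrict (Ioo 0 T)),
        Tendsto (fun h => D (t + h) t / ENNReal.ofReal |h|) (𝓝[≠] 0) (𝓝 (v t)) := by
  have hmi := intervalIntegrable_toReal hT.le hm hfin
  have hDlt : ∀ s ∈ Icc 0 T, ∀ t ∈ Icc 0 T, s ≠ t → D s t < ⊤ := by
    have : ∀ s t, 0 ≤ s → s < t → t ≤ T → D t s < ⊤ := fun s t hs hst ht =>
      (hD s t hs hst ht).trans_lt ((lintegral_mono_set (Ioo_subset_Ioo hs ht)).trans_lt hfin)
    intro s hs t ht hst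
    rcases lt_or_gt_of_ne hst with hlt | hlt
    · rw [hsymm]; exact this s t hs.1 hlt ht.2
    · exact this t s ht.1 hlt hs.2
  -- `D s s` need not vanish, but it is finite by the triangle inequality
  have hDtop : ∀ s ∈ Icc 0 T, ∀ t ∈ Icc 0 T, D s t ≠ ⊤ := by
    intro s hs t ht
    rcases eq_or_ne s t with rfl | hne
    · obtain ⟨r, hr, hrs⟩ : ∃ r ∈ Icc 0 T, s ≠ r := by
        rcases eq_or_ne s 0 with rfl | h0
        · exact ⟨T, ⟨hT.le, le_rfl⟩, hT.ne⟩
        · exact ⟨0, ⟨le_rfl, hT.le⟩, h0⟩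
      exact ((htri s r s).trans_lt
        (ENNReal.add_lt_top.2 ⟨hDlt s hs r hr hrs, hDlt r hr s hs hrs.symm⟩)).ne
    · exact (hDlt s hs t ht hne).ne
  set f : ℚ → ℝ → ℝ := fun q t => (D q t).toReal with hf
  have hfD : ∀ q : ℚ, (q : ℝ) ∈ Icc 0 T → ∀ s ∈ Icc 0 T, ∀ t ∈ Icc 0 T,
      |f q t - f q s| ≤ (D t s).toReal := by
    intro q hq s hs t ht
    have h1 := ENNReal.toReal_mono (ENNReal.add_ne_top.2 ⟨hDtop q hq s hs, hDtop s hs t ht⟩)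
      (htri q s t)
    have h2 := ENNReal.toReal_mono (ENNReal.add_ne_top.2 ⟨hDtop q hq t ht, hDtop t ht s hs⟩)
      (htri q t s)
    rw [ENNReal.toReal_add (hDtop q hq s hs) (hDtop s hs t ht), hsymm s t] at h1
    rw [ENNReal.toReal_add (hDtop q hq t ht) (hDtop t ht s hs)] at h2
    rw [abs_le]
    constructor <;> linarith
  have hac : ∀ q : ℚ, (q : ℝ) ∈ Icc 0 T → AbsolutelyContinuousOnInterval (f q) 0 T := by
    intro q hq
    refine absolutelyContinuousOnInterval_of_abs_sub_le hT.le hmi fun s t hs hst ht => ?_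
    have hsI : s ∈ Icc 0 T := ⟨hs, hst.le.trans ht⟩
    have htI : t ∈ Icc 0 T := ⟨hs.trans hst.le, ht⟩
    refine (hfD q hq s hsI t htI).trans ?_
    have := hD s t hs hst ht
    rw [lintegral_Ioo_eq_ofReal_integral hm hfin hs hst.le ht] at this
    exact ENNReal.toReal_le_of_le_ofReal
      (intervalIntegral.integral_nonneg hst.le fun _ _ => ENNReal.toReal_nonneg) this
  set v : ℝ → ℝ≥0∞ := fun t => ⨆ (q : ℚ) (_ : (q : ℝ) ∈ Icc 0 T), ‖deriv (f q) t‖ₑ with hv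
  have hvm : Measurable v := Measurable.iSup fun q => Measurable.iSup_Prop _
    (measurable_deriv (f q)).enorm
  have hDv : ∀ s t, 0 ≤ s → s < t → t ≤ T → D t s ≤ ∫⁻ r in Ioo s t, v r := by
    intro s t hs hst ht
    have hsI : s ∈ Icc 0 T := ⟨hs, hst.le.trans ht⟩
    have htI : t ∈ Icc 0 T := ⟨hs.trans hst.le, ht⟩
    refine ENNReal.le_of_forall_pos_le_add fun ε hε _ => ?_
    -- the primitive of `m` is continuous, so points `q > s` close to `s` have small distance to `s`
    have hPc : ContinuousOn (fun x => ∫ r in s..x, (m r).toReal) (Icc s t) := by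
      have hmi' : IntervalIntegrable (fun r => (m r).toReal) volume s t := hmi.mono_set (by
        rw [uIcc_of_le hst.le, uIcc_of_le hT.le]; exact Icc_subset_Icc hs ht)
      have := (hmi'.absolutelyContinuousOnInterval_intervalIntegral (c := s)
        left_mem_uIcc).continuousOn
      rwa [uIcc_of_le hst.le] at this
    have hnear := (hPc s (left_mem_Icc.2 hst.le)).mono Ioo_subset_Icc_self
    rw [ContinuousWithinAt, nhdsWithin_Ioo_eq_nhdsGT hst, intervalIntegral.integral_same] at hnear
    have hev := (hnear.eventually (gt_mem_nhds (show (0 : ℝ) < ε / 2 by positivity))).and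
      (Ioo_mem_nhdsGT hst)
    obtain ⟨u, hu, hsub⟩ := (mem_nhdsGT_iff_exists_Ioo_subset.1 hev)
    obtain ⟨q, hsq, hqu⟩ := exists_rat_btwn (show s < u from hu)
    obtain ⟨hqε, hq⟩ := hsub ⟨hsq, hqu⟩
    have hqI : (q : ℝ) ∈ Icc 0 T := ⟨hs.trans hsq.le, hq.2.le.trans ht⟩
    have hDq : D q s ≤ ENNReal.ofReal (ε / 2) := by
      refine (hD s q hs hsq hqI.2).trans ?_
      rw [lintegral_Ioo_eq_ofReal_integral hm hfin hs hsq.le hqI.2]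
      exact ENNReal.ofReal_le_ofReal hqε.le
    have hac' : AbsolutelyContinuousOnInterval (f q) s t := (hac q hqI).mono (by
      rw [uIcc_of_le hst.le, uIcc_of_le hT.le]; exact Icc_subset_Icc hs ht)
    have hftc := hac'.integral_deriv_eq_sub
    have hincr : ENNReal.ofReal (f q t - f q s) ≤ ∫⁻ r in Ioo s t, v r := by
      rw [← hftc, intervalIntegral.integral_of_le hst.le, integral_Ioc_eq_integral_Ioo]
      refine (ENNReal.ofReal_le_ofReal (le_abs_self _)).trans ?_
      rw [← Real.norm_eq_abs, ofReal_norm]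
      refine (enorm_integral_le_lintegral_enorm _).trans (lintegral_mono fun r => ?_)
      exact le_iSup₂_of_le q hqI le_rfl
    have hqt : D q t ≤ ENNReal.ofReal (f q t - f q s) + D q s := by
      rw [← ENNReal.ofReal_toReal (hDtop q hqI t htI), ← ENNReal.ofReal_toReal (hDtop q hqI s hsI)]
      refine le_trans (ENNReal.ofReal_le_ofReal ?_) ENNReal.ofReal_add_le
      simp only [hf]; linarith
    calc D t s ≤ D t q + D q s := htri _ _ _
      _ = D q t + D q s := by rw [hsymm t]
      _ ≤ (∫⁻ r in Ioo s t, v r) + ENNReal.ofReal (ε / 2) + ENNReal.ofReal (ε / 2) := by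
          refine add_le_add (hqt.trans (add_le_add hincr hDq)) hDq
      _ = (∫⁻ r in Ioo s t, v r) + ε := by
          rw [add_assoc, ← ENNReal.ofReal_add (by positivity) (by positivity), add_halves,
            ENNReal.ofReal_coe_nnreal]
  have hdiff : ∀ᵐ t : ℝ, ∀ q : ℚ, (q : ℝ) ∈ Icc 0 T → t ∈ uIcc 0 T → DifferentiableAt ℝ (f q) t := by
    rw [ae_all_iff]
    intro q
    by_cases hq : (q : ℝ) ∈ Icc 0 T
    · filter_upwards [(hac q hq).ae_differentiableAt] with t ht _ using ht
    · exact Eventually.of_forall fun t h => absurd h hq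
  have hlow : ∀ᵐ t ∂(volume.restrict (Ioo 0 T)),
      v t ≤ liminf (fun h => D (t + h) t / ENNReal.ofReal |h|) (𝓝[≠] 0) := by
    filter_upwards [ae_restrict_of_ae hdiff, ae_restrict_mem measurableSet_Ioo] with t ht htI
    refine iSup₂_le fun q hq => ?_
    have hd := (ht q hq (by rw [uIcc_of_le hT.le]; exact Ioo_subset_Icc_self htI)).hasDerivAt
    have hlim := (hasDerivAt_iff_tendsto_slope_zero.1 hd).enorm
    rw [← hlim.liminf_eq]
    refine liminf_le_liminf ?_
    have hmem : ∀ᶠ h in 𝓝[≠] (0 : ℝ), t + h ∈ Icc 0 T := by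
      have : Tendsto (fun h : ℝ => t + h) (𝓝 0) (𝓝 t) := by
        simpa using (by fun_prop : Continuous fun h : ℝ => t + h).tendsto 0
      exact (this.mono_left nhdsWithin_le_nhds).eventually (Icc_mem_nhds htI.1 htI.2)
    filter_upwards [hmem, self_mem_nhdsWithin] with h hh h0
    have h0' : 0 < |h| := abs_pos.2 h0
    rw [← ofReal_norm, smul_eq_mul, Real.norm_eq_abs, abs_mul, abs_inv, mul_comm,
      ← div_eq_mul_inv, ENNReal.ofReal_div_of_pos h0']
    gcongr
    have := hfD q hq t (Ioo_subset_Icc_self htI) (t + h) hh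
    exact (ENNReal.ofReal_le_ofReal this).trans ENNReal.ofReal_toReal_le
  have hvm_le : ∀ᵐ t ∂(volume.restrict (Ioo 0 T)), v t ≤ m t := by
    filter_upwards [hlow, ae_limsup_quotient_le hT hsymm hm hfin hD] with t h1 h2
    exact h1.trans ((liminf_le_limsup).trans h2)
  have hvfin : ∫⁻ t in Ioo 0 T, v t < ⊤ := (lintegral_mono_ae hvm_le).trans_lt hfin
  refine ⟨v, hvm, hvm_le, hDv, ?_⟩
  filter_upwards [hlow, ae_limsup_quotient_le hT hsymm hvm.aemeasurable hvfin hDv] with t h1 h2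
  exact tendsto_of_le_liminf_of_limsup_le h1 h2

end MetricDerivative

/-! ### Regularity of absolutely continuous curves -/

lemma lintegral_Ioo_mono {m : ℝ → ℝ≥0∞} {a b s t : ℝ} (hs : a ≤ s) (ht : t ≤ b) :
    ∫⁻ r in Ioo s t, m r ≤ ∫⁻ r in Ioo a b, m r :=
  lintegral_mono_set (Ioo_subset_Ioo hs ht)

section Curve

variable {p q : ℝ} {φ : ℝ → Space d → ℝ} {γ : Measure (Space d)} {T : ℝ}
  {μ : ℝ → Measure (Space d)} {m : ℝ → ℝ≥0∞}

/-- `m ∈ L¹(0,T)` is an upper bound for the speed of the curve `t ∈ [0,T] ↦ μ_t`. -/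
structure IsSpeedBound (p : ℝ) (φ : ℝ → Space d → ℝ) (γ : Measure (Space d)) (T : ℝ)
    (μ : ℝ → Measure (Space d)) (m : ℝ → ℝ≥0∞) : Prop where
  measurable : Measurable m
  lintegral_lt_top : ∫⁻ t in Ioo 0 T, m t < ⊤
  wDist_le : ∀ s t : ℝ, 0 ≤ s → s < t → t ≤ T → wDist p φ γ (μ t) (μ s) ≤ ∫⁻ r in Ioo s t, m r

lemma absContCurve_iff : AbsContCurve p φ γ T μ ↔ ∃ m, IsSpeedBound p φ γ T μ m :=
  ⟨fun ⟨m, h1, h2, h3⟩ => ⟨m, h1, h2, h3⟩, fun ⟨m, h⟩ => ⟨m, h.1, h.2, h.3⟩⟩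

variable [IsLocallyFiniteMeasure γ]

/-- Each `μ_t` is joined to `μ_0` by a solution of bounded length, which bounds its local mass. -/
lemma IsSpeedBound.exists_integral_cutoff_le (hpq : p.HolderConjugate q) (hφ : IsActionDensity p φ)
    (h : IsSpeedBound p φ γ T μ m) {ζ : Space d → ℝ} (hζ : IsCutoff q ζ) :
    ∃ M : ℝ, 0 ≤ M ∧ ∀ t ∈ Icc 0 T, ∫ x, ζ x ∂(μ t) ≤ M := by
  obtain ⟨B, hB, hbound⟩ := hζ.exists_integral_le hpq hφ γ
  have hp0 : 0 < p := hpq.pos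
  have hm0 : ∀ r, 0 ≤ ∫ x, ζ x ∂(μ r) := fun r => integral_nonneg hζ.nonneg
  have hγ0 : 0 ≤ ∫ x, ζ x ∂γ := integral_nonneg hζ.nonneg
  set L := ∫⁻ t in Ioo 0 T, m t
  have hL : L ≠ ⊤ := h.lintegral_lt_top.ne
  have h0 := hm0 0
  refine ⟨2 * (∫ x, ζ x ∂(μ 0) + ∫ x, ζ x ∂γ) + (B * (L + 1).toReal) ^ p, by positivity,
    fun t ht => ?_⟩
  rcases ht.1.eq_or_lt with rfl | ht0
  · have : 0 ≤ (B * (L + 1).toReal) ^ p := by positivity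
    linarith
  · have hW : wDist p φ γ (μ 0) (μ t) < L + 1 := by
      rw [wDist_symm hφ hpq.lt]
      exact ((h.wDist_le 0 t le_rfl ht0 ht.2).trans (lintegral_Ioo_mono le_rfl ht.2)).trans_lt
        (ENNReal.lt_add_right hL one_ne_zero)
    obtain ⟨μ', ν', hc, e0, e1, hlen⟩ := exists_length_lt hφ hpq.lt (one_pos : (0 : ℝ) < 1) hW
    have h1 := hbound 0 1 μ' ν' zero_le_one hc hlen.ne_top 1 (right_mem_Icc.2 zero_le_one)
    rw [e0, e1] at h1
    refine h1.trans ?_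
    have : (∫⁻ t in Ioo (0 : ℝ) 1, action φ γ (μ' t) (ν' t) ^ (1 / p)).toReal ≤ (L + 1).toReal :=
      ENNReal.toReal_mono (by simp [hL]) hlen.le
    gcongr

lemma IsSpeedBound.exists_measure_le (hpq : p.HolderConjugate q) (hφ : IsActionDensity p φ)
    (h : IsSpeedBound p φ γ T μ m) (hμ : ∀ t ∈ Icc 0 T, IsLocallyFiniteMeasure (μ t))
    {K : Set (Space d)} (hK : IsCompact K) :
    ∃ M : ℝ, 0 ≤ M ∧ ∀ t ∈ Icc 0 T, μ t K ≤ ENNReal.ofReal M := by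
  obtain ⟨ζ, hζ, hζK⟩ := exists_isCutoff hpq hK
  obtain ⟨M, hM0, hM⟩ := h.exists_integral_cutoff_le hpq hφ hζ
  refine ⟨M, hM0, fun t ht => ?_⟩
  have := hμ t ht
  exact (measure_le_ofReal_integral hζ.contDiff.continuous hζ.hasCompactSupport hζ.nonneg
    hK.measurableSet fun x hx => (hζK x hx).ge).trans (ENNReal.ofReal_le_ofReal (hM t ht))

lemma exists_isCutoff_norm_gradient_le (hpq : p.HolderConjugate q) {ξ : Space d → ℝ}
    (hξ : ContDiff ℝ 1 ξ) (hξc : HasCompactSupport ξ) :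
    ∃ ζ : Space d → ℝ, IsCutoff q ζ ∧ ∃ C : ℝ, 0 ≤ C ∧ ∀ x, ‖gradient ξ x‖ ^ q ≤ C * ζ x := by
  have hgc := hasCompactSupport_gradient hξc
  obtain ⟨ζ, hζ, hζK⟩ := exists_isCutoff hpq hgc.isCompact
  obtain ⟨C, hC⟩ := hgc.exists_bound_of_continuous (continuous_gradient hξ)
  have hC0 : 0 ≤ C := (norm_nonneg _).trans (hC 0)
  refine ⟨ζ, hζ, C ^ q, by positivity, fun x => ?_⟩
  by_cases hx : x ∈ tsupport (gradient ξ)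
  · rw [hζK x hx, mul_one]
    exact Real.rpow_le_rpow (norm_nonneg _) (hC x) hpq.symm.nonneg
  · rw [image_eq_zero_of_notMem_tsupport hx, norm_zero, Real.zero_rpow hpq.symm.ne_zero]
    exact mul_nonneg (by positivity) (hζ.nonneg x)

/-- The increments of `t ↦ ∫ ξ dμ_t` are bounded by those of a primitive of the speed: `μ_s` and
`μ_t` are joined by a solution whose length is almost their distance. -/
lemma IsSpeedBound.exists_abs_integral_sub_le (hpq : p.HolderConjugate q)
    (hφ : IsActionDensity p φ) (h : IsSpeedBound p φ γ T μ m) {ξ : Space d → ℝ}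
    (hξ : ContDiff ℝ 1 ξ) (hξc : HasCompactSupport ξ) :
    ∃ C : ℝ, 0 ≤ C ∧ ∀ s t : ℝ, 0 ≤ s → s < t → t ≤ T →
      ENNReal.ofReal |∫ x, ξ x ∂(μ t) - ∫ x, ξ x ∂(μ s)| ≤
        ENNReal.ofReal C * ∫⁻ r in Ioo s t, m r := by
  obtain ⟨ζ, hζ, C₁, hC₁, hξζ⟩ := exists_isCutoff_norm_gradient_le hpq hξ hξc
  obtain ⟨B, hB, hmod⟩ := WeightedTransport.exists_abs_integral_sub_le hpq hφ γ hξ hξc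
    hζ.contDiff.continuous hζ.hasCompactSupport hζ.nonneg hC₁ hξζ
  obtain ⟨B', hB', hbound⟩ := hζ.exists_integral_le hpq hφ γ
  obtain ⟨M, hM0, hM⟩ := h.exists_integral_cutoff_le hpq hφ hζ
  have hp0 : 0 < p := hpq.pos
  have hγ0 : 0 ≤ ∫ x, ζ x ∂γ := integral_nonneg hζ.nonneg
  set L := ∫⁻ t in Ioo 0 T, m t
  have hL : L ≠ ⊤ := h.lintegral_lt_top.ne
  set M' := 2 * (M + ∫ x, ζ x ∂γ) + (B' * (L + 1).toReal) ^ p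
  have hM' : 0 ≤ M' := by positivity
  refine ⟨B * ((∫ x, ζ x ∂γ) + M') ^ (1 / q), by positivity, fun s t hs hst ht => ?_⟩
  set C := B * ((∫ x, ζ x ∂γ) + M') ^ (1 / q)
  have hlt : ∫⁻ r in Ioo s t, m r ≠ ⊤ := ((lintegral_Ioo_mono hs ht).trans_lt h.lintegral_lt_top).ne
  have key : ∀ ε : ℝ≥0∞, ε ≠ 0 → ε ≤ 1 →
      ENNReal.ofReal |∫ x, ξ x ∂(μ t) - ∫ x, ξ x ∂(μ s)| ≤
        ENNReal.ofReal C * ((∫⁻ r in Ioo s t, m r) + ε) := by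
    intro ε hε hε1
    have hW : wDist p φ γ (μ s) (μ t) < (∫⁻ r in Ioo s t, m r) + ε := by
      rw [wDist_symm hφ hpq.lt]
      exact (h.wDist_le s t hs hst ht).trans_lt (ENNReal.lt_add_right hlt hε)
    obtain ⟨μ', ν', hc, e0, e1, hlen⟩ := exists_length_lt hφ hpq.lt (one_pos : (0 : ℝ) < 1) hW
    have hlen' : ∫⁻ t in Ioo (0 : ℝ) 1, action φ γ (μ' t) (ν' t) ^ (1 / p) ≤ L + 1 :=
      hlen.le.trans (add_le_add (lintegral_Ioo_mono hs ht) hε1)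
    have h1 := hmod 0 1 μ' ν' hc hlen.ne_top 0 1 le_rfl zero_le_one le_rfl M' hM' fun r hr => by
      refine (hbound 0 1 μ' ν' zero_le_one hc hlen.ne_top r (Ioo_subset_Icc_self hr)).trans ?_
      have h2 : ∫ x, ζ x ∂(μ' 0) ≤ M := by rw [e0]; exact hM s ⟨hs, hst.le.trans ht⟩
      have h3 : (∫⁻ t in Ioo (0 : ℝ) 1, action φ γ (μ' t) (ν' t) ^ (1 / p)).toReal ≤
          (L + 1).toReal := ENNReal.toReal_mono (by simp [hL]) hlen'
      change _ ≤ 2 * (M + ∫ x, ζ x ∂γ) + (B' * (L + 1).toReal) ^ p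
      gcongr
    rw [e0, e1] at h1
    exact h1.trans (mul_le_mul_right hlen.le _)
  have hlim : Tendsto (fun ε : ℝ≥0∞ => ENNReal.ofReal C * ((∫⁻ r in Ioo s t, m r) + ε)) (𝓝[>] 0)
      (𝓝 (ENNReal.ofReal C * ((∫⁻ r in Ioo s t, m r) + 0))) := by
    refine Tendsto.mono_left ?_ nhdsWithin_le_nhds
    exact ENNReal.Tendsto.const_mul (tendsto_const_nhds.add tendsto_id)
      (Or.inr ENNReal.ofReal_ne_top)
  rw [add_zero] at hlim
  refine ge_of_tendsto hlim ?_
  filter_upwards [Ioc_mem_nhdsGT (zero_lt_one' ℝ≥0∞)] with ε hε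
  exact key ε hε.1.ne' hε.2

/-- Absolutely continuous curves are weakly* continuous. -/
lemma IsSpeedBound.continuousOn_integral (hpq : p.HolderConjugate q)
    (hφ : IsActionDensity p φ) (hT : 0 < T) (h : IsSpeedBound p φ γ T μ m)
    (hμ : ∀ t ∈ Icc 0 T, IsLocallyFiniteMeasure (μ t)) {f : Space d → ℝ} (hf : Continuous f)
    (hfc : HasCompactSupport f) : ContinuousOn (fun t => ∫ x, f x ∂(μ t)) (Icc 0 T) := by
  intro t₀ ht₀
  have := hμ t₀ ht₀
  have hmem : ∀ᶠ t in 𝓝[Icc 0 T] t₀, t ∈ Icc 0 T := self_mem_nhdsWithin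
  refine tendsto_integral_of_contDiff (hmem.mono hμ) (fun K hK => ?_) (fun ξ hξ hξc => ?_) hf hfc
  · obtain ⟨M, hM0, hM⟩ := h.exists_measure_le hpq hφ hμ hK
    exact ⟨M, hM0, hmem.mono hM⟩
  obtain ⟨C, hC, hmod⟩ := h.exists_abs_integral_sub_le hpq hφ hξ hξc
  have hmi := intervalIntegrable_toReal hT.le h.measurable.aemeasurable h.lintegral_lt_top
  have hac := absolutelyContinuousOnInterval_of_abs_sub_le hT.le (hmi.const_mul C)
    (f := fun t => ∫ x, ξ x ∂(μ t)) fun s t hs hst ht => by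
      have h1 := hmod s t hs hst ht
      rw [lintegral_Ioo_eq_ofReal_integral h.measurable.aemeasurable h.lintegral_lt_top hs hst.le ht,
        ← ENNReal.ofReal_mul hC, ← intervalIntegral.integral_const_mul] at h1
      refine (ENNReal.ofReal_le_ofReal_iff (intervalIntegral.integral_nonneg hst.le fun _ _ =>
        mul_nonneg hC ENNReal.toReal_nonneg)).1 h1
  have hcont := hac.continuousOn
  rw [uIcc_of_le hT.le] at hcont
  exact hcont t₀ ht₀

lemma IsSpeedBound.support_subset (hφ : IsActionDensity p φ) (hp : 1 < p) (hT : 0 < T)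
    (h : IsSpeedBound p φ γ T μ m) {t : ℝ} (ht : t ∈ Icc 0 T) : (μ t).support ⊆ γ.support := by
  have key : ∀ s t : ℝ, 0 ≤ s → s < t → t ≤ T →
      (μ s).support ⊆ γ.support ∧ (μ t).support ⊆ γ.support := by
    intro s t hs hst ht
    have hW : wDist p φ γ (μ t) (μ s) < ⊤ := (h.wDist_le s t hs hst ht).trans_lt
      ((lintegral_Ioo_mono hs ht).trans_lt h.lintegral_lt_top)
    obtain ⟨μ', ν', hc, e0, e1, hlen⟩ := exists_length_lt hφ hp (one_pos : (0 : ℝ) < 1) hW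
    rw [← e0, ← e1]
    exact ⟨hc.support_subset hφ hp one_pos hlen.ne (right_mem_Icc.2 zero_le_one),
      hc.support_subset hφ hp one_pos hlen.ne (left_mem_Icc.2 zero_le_one)⟩
  rcases ht.1.eq_or_lt with rfl | h0
  · exact (key 0 T le_rfl hT le_rfl).1
  · exact (key 0 t le_rfl h0 ht.2).2

end Curve

/-! ### Limits of positive functionals -/

section Limit

open CompactlySupported

variable {Y : Type*} [MetricSpace Y] [ProperSpace Y] [MeasurableSpace Y] [BorelSpace Y]

/-- Positive functionals that are asymptotically bounded by an `L^q(Θ)`-norm have a limit along an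
ultrafilter, which is the integral against a locally `Θ`-integrable density. The representing
measure comes from the Riesz–Markov–Kakutani theorem; it charges no `Θ`-null set since a compact
`Θ`-null set is contained in open sets of small `Θ`-measure. -/
theorem exists_density_tendsto_hyperfilter (Θ : Measure Y) [IsLocallyFiniteMeasure Θ] {q C : ℝ}
    (hq : 0 < q) (hC : 0 ≤ C) (L : ℕ → C_c(Y, ℝ) →ₗ[ℝ] ℝ)
    (hpos : ∀ n f, (∀ y, 0 ≤ f y) → 0 ≤ L n f)
    (hbound : ∀ f : C_c(Y, ℝ), (∀ y, 0 ≤ f y) → ∀ ε : ℝ, 0 < ε → ∀ᶠ n in atTop,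
      L n f ≤ C * (∫ y, f y ^ q ∂Θ) ^ (1 / q) + ε) :
    ∃ v : Y → ℝ, Measurable v ∧ (∀ y, 0 ≤ v y) ∧ LocallyIntegrable v Θ ∧
      ∀ f : C_c(Y, ℝ), Tendsto (fun n => L n f) (hyperfilter ℕ : Filter ℕ)
        (𝓝 (∫ y, f y * v y ∂Θ)) := by
  -- by positivity, `|L f| ≤ L |f|`
  have hbdd : ∀ f : C_c(Y, ℝ), ∃ B : ℝ, ∀ᶠ n in atTop, L n f ∈ Icc (-B) B := by
    intro f
    set g : C_c(Y, ℝ) := ⟨⟨fun y => |f y|, f.continuous.abs⟩,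
      f.hasCompactSupport.comp_left (g := fun s : ℝ => |s|) abs_zero⟩ with hg
    have hgf : ∀ y, g y = |f y| := fun y => rfl
    refine ⟨C * (∫ y, g y ^ q ∂Θ) ^ (1 / q) + 1, ?_⟩
    filter_upwards [hbound g (fun y => abs_nonneg _) 1 one_pos] with n hn
    have h1 := hpos n (g - f) fun y => by
      change 0 ≤ g y - f y
      rw [hgf]; linarith [le_abs_self (f y)]
    have h2 := hpos n (g + f) fun y => by
      change 0 ≤ g y + f y
      rw [hgf]; linarith [neg_abs_le (f y)]
    rw [map_sub] at h1
    rw [map_add] at h2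
    constructor <;> linarith
  have hlim : ∀ f : C_c(Y, ℝ), ∃ l : ℝ,
      Tendsto (fun n => L n f) (hyperfilter ℕ : Filter ℕ) (𝓝 l) := by
    intro f
    obtain ⟨B, hB⟩ := hbdd f
    obtain ⟨l, -, hl⟩ := isCompact_Icc.ultrafilter_le_nhds
      ((hyperfilter ℕ).map fun n => L n f) (le_principal_iff.2 (Nat.hyperfilter_le_atTop hB))
    exact ⟨l, hl⟩
  choose l hl using hlim
  set Λ₀ : C_c(Y, ℝ) →ₗ[ℝ] ℝ :=
    { toFun := l
      map_add' := fun f g => tendsto_nhds_unique (hl (f + g))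
        (by simpa only [map_add] using (hl f).add (hl g))
      map_smul' := fun c f => tendsto_nhds_unique (hl (c • f))
        (by simpa only [map_smul, smul_eq_mul, RingHom.id_apply] using (hl f).const_mul c) }
  have hl0 : ∀ f : C_c(Y, ℝ), (∀ y, 0 ≤ f y) → 0 ≤ l f := fun f hf =>
    ge_of_tendsto' (hl f) fun n => hpos n f hf
  set Λ : C_c(Y, ℝ) →ₚ[ℝ] ℝ := PositiveLinearMap.mk₀ Λ₀ fun f hf => hl0 f fun y => hf y
  have hΛ : ∀ f, Λ f = l f := fun f => rfl
  have hlbound : ∀ f : C_c(Y, ℝ), (∀ y, 0 ≤ f y) → l f ≤ C * (∫ y, f y ^ q ∂Θ) ^ (1 / q) := by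
    intro f hf
    refine le_of_forall_pos_le_add fun ε hε => ?_
    exact le_of_tendsto (hl f) (Nat.hyperfilter_le_atTop (hbound f hf ε hε))
  set m := RealRMK.rieszMeasure Λ
  have hac : m ≪ Θ := by
    refine Measure.AbsolutelyContinuous.mk fun s hs hΘs => ?_
    rw [hs.measure_eq_iSup_isCompact]
    simp only [ENNReal.iSup_eq_zero]
    intro K hKs hK
    have hΘK : Θ K = 0 := measure_mono_null hKs hΘs
    have key : ∀ δ : ℝ, 0 < δ → m K ≤ ENNReal.ofReal (C * δ ^ (1 / q)) := by
      intro δ hδ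
      obtain ⟨U, hKU, hU, hΘU⟩ := K.exists_isOpen_lt_of_lt (μ := Θ) (ENNReal.ofReal δ)
        (by rw [hΘK]; simpa using hδ)
      obtain ⟨f, hf1, hf0, hfc, hf⟩ := exists_continuous_one_zero_of_isCompact hK hU.isClosed_compl
        (disjoint_compl_right_iff_subset.2 hKU)
      refine (RealRMK.rieszMeasure_le_of_eq_one Λ (f := ⟨f, hfc⟩) (fun y => (hf y).1) hK
        fun y hy => hf1 hy).trans (ENNReal.ofReal_le_ofReal ?_)
      rw [hΛ]
      refine (hlbound _ fun y => (hf y).1).trans ?_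
      gcongr
      · exact integral_nonneg fun y => Real.rpow_nonneg (hf y).1 q
      calc ∫ y, f y ^ q ∂Θ ≤ ∫ y, U.indicator (fun _ => (1 : ℝ)) y ∂Θ := by
            refine integral_mono_of_nonneg (Eventually.of_forall fun y =>
              Real.rpow_nonneg (hf y).1 q) ?_ (Eventually.of_forall fun y => ?_)
            · exact (integrableOn_const (by exact (hΘU.trans ENNReal.ofReal_lt_top).ne)).integrable_indicator
                hU.measurableSet
            · by_cases hy : y ∈ U
              · simpa [hy] using Real.rpow_le_one (hf y).1 (hf y).2 hq.le
              · have := hf0 hy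
                simp only [Pi.zero_apply] at this
                simp [hy, this, Real.zero_rpow hq.ne']
        _ = (Θ U).toReal := by
            rw [integral_indicator hU.measurableSet]; simp [Measure.real]
        _ ≤ δ := ENNReal.toReal_le_of_le_ofReal hδ.le hΘU.le
    have hlim : Tendsto (fun δ : ℝ => ENNReal.ofReal (C * δ ^ (1 / q))) (𝓝[>] 0) (𝓝 0) := by
      have h1 : Tendsto (fun δ : ℝ => C * δ ^ (1 / q)) (𝓝 0) (𝓝 (C * 0 ^ (1 / q))) :=
        ((Real.continuous_rpow_const (by positivity)).tendsto 0).const_mul C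
      rw [Real.zero_rpow (by positivity), mul_zero] at h1
      have h2 := (ENNReal.tendsto_ofReal h1).mono_left (nhdsWithin_le_nhds (s := Ioi 0))
      rwa [ENNReal.ofReal_zero] at h2
    refine le_antisymm (ge_of_tendsto hlim ?_) (zero_le)
    filter_upwards [self_mem_nhdsWithin] with δ hδ using key δ hδ
  refine ⟨fun y => (m.rnDeriv Θ y).toReal, (Measure.measurable_rnDeriv m Θ).ennreal_toReal,
    fun y => ENNReal.toReal_nonneg, ?_, fun f => ?_⟩
  · refine (locallyIntegrable_iff).2 fun K hK => ?_
    exact Measure.integrableOn_toReal_rnDeriv hK.measure_lt_top.ne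
  · simp only [mul_comm (f _)]
    rw [integral_toReal_rnDeriv_mul hac, RealRMK.integral_rieszMeasure]
    exact hl f

end Limit

/-! ### Approximation of a curve by piecewise almost optimal solutions -/

/-- Concatenation of finitely many solutions on consecutive intervals. -/
lemma exists_glue {s : ℕ → ℝ} (hs : StrictMono s) {x : ℕ → Measure (Space d)}
    {μ' : ℕ → ℝ → Measure (Space d)} {ν' : ℕ → ℝ → RadonVectorMeasure d}
    (N : ℕ) (h : ∀ i ≤ N, ContinuityEqOn (s i) (s (i + 1)) (μ' i) (ν' i) ∧ μ' i (s i) = x i ∧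
      μ' i (s (i + 1)) = x (i + 1)) :
    ∃ (μ : ℝ → Measure (Space d)) (ν : ℝ → RadonVectorMeasure d),
      ContinuityEqOn (s 0) (s (N + 1)) μ ν ∧ ∀ i ≤ N,
        (∀ t ∈ Icc (s i) (s (i + 1)), μ t = μ' i t) ∧ ∀ t ∈ Ioo (s i) (s (i + 1)), ν t = ν' i t := by
  induction N with
  | zero =>
    refine ⟨μ' 0, ν' 0, (h 0 le_rfl).1, fun i hi => ?_⟩
    obtain rfl : i = 0 := by omega
    exact ⟨fun _ _ => rfl, fun _ _ => rfl⟩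
  | succ N ih =>
    obtain ⟨μ, ν, hc, hi⟩ := ih fun i hi => h i (hi.trans (Nat.le_succ N))
    have hlt : s (N + 1) < s (N + 1 + 1) := hs (by omega)
    have hle : s 0 ≤ s (N + 1) := hs.monotone (by omega)
    have heq : μ (s (N + 1)) = μ' (N + 1) (s (N + 1)) := by
      rw [(hi N le_rfl).1 _ ⟨hs.monotone (by omega), le_rfl⟩,
        (h N (Nat.le_succ N)).2.2, (h (N + 1) le_rfl).2.1]
    refine ⟨_, _, hc.glue hle hlt.le (h (N + 1) le_rfl).1 heq, fun i hiN => ?_⟩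
    rcases Nat.lt_or_ge N i with hlt' | hge
    · obtain rfl : i = N + 1 := by omega
      refine ⟨fun t ht => ?_, fun t ht => by simp [ht.1.not_gt]⟩
      rcases ht.1.eq_or_lt with rfl | h'
      · simpa using heq
      · simp [not_le.2 h']
    · have hsi : s (i + 1) ≤ s (N + 1) := hs.monotone (by omega)
      refine ⟨fun t ht => ?_, fun t ht => ?_⟩
      · rw [if_pos (ht.2.trans hsi)]; exact (hi i hge).1 t ht
      · rw [if_pos (ht.2.trans_le hsi)]; exact (hi i hge).2 t ht

lemma lintegral_Ioo_eq_sum {s : ℕ → ℝ} (hs : StrictMono s) (F : ℝ → ℝ≥0∞) (N : ℕ) :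
    ∫⁻ t in Ioo (s 0) (s N), F t =
      ∑ i ∈ Finset.range N, ∫⁻ t in Ioo (s i) (s (i + 1)), F t := by
  induction N with
  | zero => simp
  | succ N ih =>
    rw [Finset.sum_range_succ, ← ih, ← Ioc_union_Ioo_eq_Ioo (hs.monotone (Nat.zero_le N))
      (hs (Nat.lt_succ_self N)), lintegral_union measurableSet_Ioo,
      restrict_Ioo_eq_restrict_Ioc (a := s 0)]
    exact disjoint_left.2 fun t h1 h2 => absurd h2.1 (not_lt.2 h1.2)

section

variable {p q : ℝ} {φ : ℝ → Space d → ℝ} {γ : Measure (Space d)} [IsLocallyFiniteMeasure γ] {T : ℝ}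
  {μ : ℝ → Measure (Space d)} {m : ℝ → ℝ≥0∞}

/-- A sequence of solutions of the continuity equation approximating the curve `μ`, with action
asymptotically bounded by `m ^ p`. -/
structure IsApproximation (p : ℝ) (φ : ℝ → Space d → ℝ) (γ : Measure (Space d)) (T : ℝ)
    (μ : ℝ → Measure (Space d)) (m : ℝ → ℝ≥0∞) (μ' : ℕ → ℝ → Measure (Space d))
    (ν' : ℕ → ℝ → RadonVectorMeasure d) : Prop where
  continuityEqOn : ∀ n, ContinuityEqOn 0 T (μ' n) (ν' n)
  exists_measure_le : ∀ K : Set (Space d), IsCompact K →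
    ∃ M : ℝ, 0 ≤ M ∧ ∀ n, ∀ t ∈ Icc 0 T, μ' n t K ≤ ENNReal.ofReal M
  tendsto : ∀ t ∈ Icc 0 T, ∀ f : Space d → ℝ, Continuous f → HasCompactSupport f →
    Tendsto (fun n => ∫ x, f x ∂(μ' n t)) atTop (𝓝 (∫ x, f x ∂(μ t)))
  eventually_action_le : ∀ η : ℝ → ℝ, Continuous η → (∀ t, 0 ≤ η t) → ∀ ε : ℝ, 0 < ε →
    ∀ᶠ n in atTop, ∫⁻ t in Ioo 0 T, ENNReal.ofReal (η t) * action φ γ (μ' n t) (ν' n t) ≤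
      (∫⁻ t in Ioo 0 T, ENNReal.ofReal (η t) * m t ^ p) + ENNReal.ofReal ε

/-- Almost optimal solutions between two points of the curve, with an action bound. -/
lemma IsSpeedBound.exists_cell (hpq : p.HolderConjugate q) (hφ : IsActionDensity p φ)
    (h : IsSpeedBound p φ γ T μ m) (hm1 : ∀ t, m t ≤ 1) {a b : ℝ} (ha : 0 ≤ a) (hab : a < b)
    (hb : b ≤ T) {ε : ℝ} (hε : 0 < ε) :
    ∃ (μ' : ℝ → Measure (Space d)) (ν' : ℝ → RadonVectorMeasure d), ContinuityEqOn a b μ' ν' ∧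
      μ' a = μ a ∧ μ' b = μ b ∧
      ∫⁻ t in Ioo a b, action φ γ (μ' t) (ν' t) ≤
        (∫⁻ t in Ioo a b, m t ^ p) + ENNReal.ofReal ε := by
  have hp0 : 0 < p := hpq.pos
  have hba : 0 < b - a := sub_pos.2 hab
  set I := ∫⁻ t in Ioo a b, m t ^ p with hI
  have hIfin : I ≠ ⊤ := by
    have : I ≤ ∫⁻ t in Ioo a b, 1 := lintegral_mono fun t => by
      simpa using ENNReal.rpow_le_rpow (hm1 t) hp0.le
    refine (this.trans_lt ?_).ne
    simp
  -- Hölder's inequality in time; the power of `b - a` cancels when the solutions on `[0,1]` are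
  -- transported to `[a,b]`
  have hW : wDist p φ γ (μ a) (μ b) ^ p ≤ ENNReal.ofReal ((b - a) ^ (p - 1)) * I := by
    rw [wDist_symm hφ hpq.lt]
    have h1 := setLIntegral_rpow_inv_le hpq (a := a) (b := b) (f := fun t => m t ^ p)
      (h.measurable.pow_const p).aemeasurable
    simp only [← ENNReal.rpow_mul, mul_one_div_cancel hp0.ne', ENNReal.rpow_one] at h1
    refine (ENNReal.rpow_le_rpow ((h.wDist_le a b ha hab hb).trans h1) hp0.le).trans_eq ?_
    rw [ENNReal.mul_rpow_of_nonneg _ _ hp0.le, ← ENNReal.rpow_mul, one_div_mul_cancel hp0.ne',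
      ENNReal.rpow_one, ← ENNReal.rpow_mul, ENNReal.ofReal_rpow_of_pos hba, mul_comm]
    congr 3
    have := hpq.inv_add_inv_eq_one
    have hq0 := hpq.symm.ne_zero
    field_simp at this ⊢
    linarith
  have hc : wDist p φ γ (μ a) (μ b) ^ p <
      ENNReal.ofReal ((b - a) ^ (p - 1)) * I + ENNReal.ofReal ((b - a) ^ (p - 1) * ε) := by
    refine hW.trans_lt (ENNReal.lt_add_right (ENNReal.mul_ne_top ENNReal.ofReal_ne_top hIfin) ?_)
    rw [Ne, ENNReal.ofReal_eq_zero, not_le]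
    positivity
  obtain ⟨μ', ν', hce, h0, h1, hle⟩ := exists_lintegral_action_le hφ hpq.lt hab hc
  refine ⟨μ', ν', hce, h0, h1, hle.trans_eq ?_⟩
  rw [mul_add, ← mul_assoc, ← ENNReal.ofReal_mul (by positivity), ← ENNReal.ofReal_mul
    (by positivity), ← mul_assoc, ← Real.rpow_add hba]
  simp

/-- A curve with speed at most one is approximated by interpolating its values at equidistant times
by almost optimal solutions. -/
theorem IsSpeedBound.exists_isApproximation (hpq : p.HolderConjugate q) (hφ : IsActionDensity p φ)
    (hT : 0 < T) (h : IsSpeedBound p φ γ T μ m) (hm1 : ∀ t, m t ≤ 1)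
    (hμ : ∀ t ∈ Icc 0 T, IsLocallyFiniteMeasure (μ t)) :
    ∃ (μ' : ℕ → ℝ → Measure (Space d)) (ν' : ℕ → ℝ → RadonVectorMeasure d),
      IsApproximation p φ γ T μ m μ' ν' := by
  have hp0 : 0 < p := hpq.pos
  have hq0 : 0 < q := hpq.symm.pos
  set δ : ℕ → ℝ := fun n => T / (n + 1) with hδ
  have hδpos : ∀ n, 0 < δ n := fun n => by positivity
  have hδlim : Tendsto δ atTop (𝓝 0) := by
    have := (tendsto_one_div_add_atTop_nhds_zero_nat (𝕜 := ℝ)).const_mul T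
    rw [mul_zero] at this
    exact this.congr fun n => by rw [hδ]; ring
  set s : ℕ → ℕ → ℝ := fun n i => i * δ n with hs
  have hsmono : ∀ n, StrictMono (s n) := fun n i j hij => by
    have : (i : ℝ) < j := by exact_mod_cast hij
    exact mul_lt_mul_of_pos_right this (hδpos n)
  have hs0 : ∀ n, s n 0 = 0 := fun n => by simp [hs]
  have hsT : ∀ n, s n (n + 1) = T := fun n => by simp only [hs, hδ]; push_cast; field_simp
  have hstep : ∀ n i, s n (i + 1) - s n i = δ n := fun n i => by simp only [hs]; push_cast; ring
  have hs_nonneg : ∀ n i, 0 ≤ s n i := fun n i => by rw [← hs0 n]; exact (hsmono n).monotone (by omega)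
  have hs_le : ∀ n i, i ≤ n → s n (i + 1) ≤ T := fun n i hi => by
    rw [← hsT n]; exact (hsmono n).monotone (by omega)
  -- almost optimal solutions on the cells `[s i, s (i+1)]`, with error `δ_n / (n+1)` in the action
  set ε : ℕ → ℝ := fun n => δ n / (n + 1) with hε
  have hεpos : ∀ n, 0 < ε n := fun n => div_pos (hδpos n) (by positivity)
  have hεδ : ∀ n, ε n ≤ δ n := fun n => div_le_self (hδpos n).le (by
    have : (0 : ℝ) ≤ n := n.cast_nonneg
    linarith)
  have hex : ∀ n i, ∃ (μ' : ℝ → Measure (Space d)) (ν' : ℝ → RadonVectorMeasure d), i ≤ n →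
      ContinuityEqOn (s n i) (s n (i + 1)) μ' ν' ∧ μ' (s n i) = μ (s n i) ∧
      μ' (s n (i + 1)) = μ (s n (i + 1)) ∧
      ∫⁻ t in Ioo (s n i) (s n (i + 1)), action φ γ (μ' t) (ν' t) ≤
        (∫⁻ t in Ioo (s n i) (s n (i + 1)), m t ^ p) + ENNReal.ofReal (ε n) := by
    intro n i
    by_cases hi : i ≤ n
    · obtain ⟨μ', ν', h1⟩ := h.exists_cell hpq hφ hm1 (hs_nonneg n i) (hsmono n i.lt_succ_self)
        (hs_le n i hi) (hεpos n)
      exact ⟨μ', ν', fun _ => h1⟩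
    · obtain ⟨μ', ν', h1⟩ := h.exists_cell hpq hφ hm1 le_rfl hT le_rfl hT
      exact ⟨μ', ν', fun h' => absurd h' hi⟩
  choose μ₁ ν₁ hcell using hex
  have hglue : ∀ n, ∃ (μ' : ℝ → Measure (Space d)) (ν' : ℝ → RadonVectorMeasure d),
      ContinuityEqOn 0 T μ' ν' ∧ ∀ i ≤ n, μ' (s n i) = μ (s n i) ∧
      ∫⁻ t in Ioo (s n i) (s n (i + 1)), action φ γ (μ' t) (ν' t) ≤
        (∫⁻ t in Ioo (s n i) (s n (i + 1)), m t ^ p) + ENNReal.ofReal (ε n) := by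
    intro n
    obtain ⟨μ', ν', hc, hi⟩ := exists_glue (hsmono n) (x := fun i => μ (s n i)) n
      fun i hi => ⟨(hcell n i hi).1, (hcell n i hi).2.1, (hcell n i hi).2.2.1⟩
    rw [hs0, hsT] at hc
    refine ⟨μ', ν', hc, fun i hin => ⟨?_, ?_⟩⟩
    · rw [(hi i hin).1 _ (left_mem_Icc.2 (hsmono n i.lt_succ_self).le), (hcell n i hin).2.1]
    · refine le_trans (le_of_eq ?_) (hcell n i hin).2.2.2
      refine setLIntegral_congr_fun measurableSet_Ioo fun t ht => ?_
      rw [(hi i hin).1 t (Ioo_subset_Icc_self ht), (hi i hin).2 t ht]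
  choose μ' ν' hce hnode using hglue
  have hloc : ∀ n, ∀ t ∈ Icc 0 T, ∃ i ≤ n, t ∈ Icc (s n i) (s n (i + 1)) := by
    intro n t ht
    rcases ht.2.eq_or_lt with rfl | hlt
    · exact ⟨n, le_rfl, by rw [← hsT n]; exact right_mem_Icc.2 (hsmono n n.lt_succ_self).le⟩
    · have h1 := Nat.floor_le (div_nonneg ht.1 (hδpos n).le)
      have h2 := Nat.lt_floor_add_one (t / δ n)
      rw [le_div_iff₀ (hδpos n)] at h1
      rw [div_lt_iff₀ (hδpos n)] at h2
      refine ⟨⌊t / δ n⌋₊, ?_, h1, by simp only [hs]; push_cast; exact h2.le⟩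
      by_contra! hgt
      have h3 : s n (n + 1) ≤ s n ⌊t / δ n⌋₊ := (hsmono n).monotone hgt
      rw [hsT] at h3
      have h4 : s n ⌊t / δ n⌋₊ ≤ t := h1
      linarith
  have hcellm : ∀ n i, ∫⁻ t in Ioo (s n i) (s n (i + 1)), m t ^ p ≤ ENNReal.ofReal (δ n) := by
    intro n i
    rw [← hstep n i, ← Real.volume_Ioo, ← setLIntegral_one]
    exact lintegral_mono fun t => by simpa using ENNReal.rpow_le_rpow (hm1 t) hp0.le
  have hcellc : ∀ n i, i ≤ n → ContinuityEqOn (s n i) (s n (i + 1)) (μ' n) (ν' n) := fun n i hi =>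
    (hce n).restrict (hs_nonneg n i) (hs_le n i hi)
  -- on each cell the approximation has length `O(δ_n)`, so it stays close to the curve
  have hlen : ∀ n i, i ≤ n → ∫⁻ t in Ioo (s n i) (s n (i + 1)),
      action φ γ (μ' n t) (ν' n t) ^ (1 / p) ≤ ENNReal.ofReal (2 * δ n) := by
    intro n i hi
    refine (setLIntegral_rpow_inv_le hpq
      ((hcellc n i hi).aemeasurable_action hφ hpq.lt γ)).trans ?_
    have h1 : ∫⁻ t in Ioo (s n i) (s n (i + 1)), action φ γ (μ' n t) (ν' n t) ≤
        ENNReal.ofReal (2 * δ n) := by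
      refine ((hnode n i hi).2.trans (add_le_add (hcellm n i)
        (ENNReal.ofReal_le_ofReal (hεδ n)))).trans_eq ?_
      rw [← ENNReal.ofReal_add (hδpos n).le (hδpos n).le]; congr 1; ring
    have h2 : ENNReal.ofReal (s n (i + 1) - s n i) ≤ ENNReal.ofReal (2 * δ n) := by
      rw [hstep]; exact ENNReal.ofReal_le_ofReal (by linarith [hδpos n])
    refine (mul_le_mul' (ENNReal.rpow_le_rpow h1 (by positivity))
      (ENNReal.rpow_le_rpow h2 (by positivity))).trans_eq ?_
    rw [← ENNReal.rpow_add_of_nonneg _ _ (by positivity) (by positivity), one_div, one_div,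
      hpq.inv_add_inv_eq_one, ENNReal.rpow_one]
  have hδT : ∀ n, δ n ≤ T := fun n => div_le_self hT.le (by
    have : (0 : ℝ) ≤ n := n.cast_nonneg
    linarith)
  have hcut : ∀ ζ : Space d → ℝ, IsCutoff q ζ → ∃ M : ℝ, 0 ≤ M ∧ ∀ n, ∀ t ∈ Icc 0 T,
      ∫ x, ζ x ∂(μ' n t) ≤ M := by
    intro ζ hζ
    obtain ⟨B, hB, hbound⟩ := hζ.exists_integral_le hpq hφ γ
    obtain ⟨M, hM0, hM⟩ := h.exists_integral_cutoff_le hpq hφ hζ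
    have hγ0 : 0 ≤ ∫ x, ζ x ∂γ := integral_nonneg hζ.nonneg
    refine ⟨2 * (M + ∫ x, ζ x ∂γ) + (B * (2 * T)) ^ p, by positivity, fun n t ht => ?_⟩
    obtain ⟨i, hi, hti⟩ := hloc n t ht
    refine (hbound _ _ _ _ (hsmono n i.lt_succ_self).le (hcellc n i hi)
      ((hlen n i hi).trans_lt ENNReal.ofReal_lt_top).ne t hti).trans ?_
    have h1 : ∫ x, ζ x ∂(μ' n (s n i)) ≤ M := by
      rw [(hnode n i hi).1]
      exact hM _ ⟨hs_nonneg n i, (hsmono n i.lt_succ_self).le.trans (hs_le n i hi)⟩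
    have h2 : (∫⁻ t in Ioo (s n i) (s n (i + 1)), action φ γ (μ' n t) (ν' n t) ^ (1 / p)).toReal ≤
        2 * T := ENNReal.toReal_le_of_le_ofReal (by positivity) ((hlen n i hi).trans
          (ENNReal.ofReal_le_ofReal (by linarith [hδT n])))
    gcongr
  have hmass : ∀ K : Set (Space d), IsCompact K →
      ∃ M : ℝ, 0 ≤ M ∧ ∀ n, ∀ t ∈ Icc 0 T, μ' n t K ≤ ENNReal.ofReal M := by
    intro K hK
    obtain ⟨ζ, hζ, hζK⟩ := exists_isCutoff hpq hK
    obtain ⟨M, hM0, hM⟩ := hcut ζ hζ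
    refine ⟨M, hM0, fun n t ht => ?_⟩
    have := (hce n).locallyFinite t ht
    exact (measure_le_ofReal_integral hζ.contDiff.continuous hζ.hasCompactSupport hζ.nonneg
      hK.measurableSet fun x hx => (hζK x hx).ge).trans (ENNReal.ofReal_le_ofReal (hM n t ht))
  refine ⟨μ', ν', hce, hmass, fun t ht f hf hfc => ?_, fun η hη hη0 ε₀ hε₀ => ?_⟩
  -- at time `t` both curves are compared with their common value at the preceding node
  · have := hμ t ht
    refine tendsto_integral_of_contDiff (Eventually.of_forall fun n => (hce n).locallyFinite t ht)
      (fun K hK => ?_) (fun ξ hξ hξc => ?_) hf hfc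
    · obtain ⟨M, hM0, hM⟩ := hmass K hK
      exact ⟨M, hM0, Eventually.of_forall fun n => hM n t ht⟩
    obtain ⟨ζ, hζ, C₁, hC₁, hξζ⟩ := exists_isCutoff_norm_gradient_le hpq hξ hξc
    obtain ⟨B, hB, hmod⟩ := WeightedTransport.exists_abs_integral_sub_le hpq hφ γ hξ hξc
      hζ.contDiff.continuous hζ.hasCompactSupport hζ.nonneg hC₁ hξζ
    obtain ⟨M, hM0, hM⟩ := hcut ζ hζ
    obtain ⟨C, hC, hmod'⟩ := h.exists_abs_integral_sub_le hpq hφ hξ hξc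
    have hγ0 : 0 ≤ ∫ x, ζ x ∂γ := integral_nonneg hζ.nonneg
    set C' := B * ((∫ x, ζ x ∂γ) + M) ^ (1 / q)
    have hC' : 0 ≤ C' := by positivity
    rw [tendsto_iff_dist_tendsto_zero]
    refine squeeze_zero (g := fun n => (C' * 2 + C) * δ n) (fun n => dist_nonneg) (fun n => ?_)
      (by simpa using hδlim.const_mul (C' * 2 + C))
    obtain ⟨i, hi, hti⟩ := hloc n t ht
    have hsI : s n i ≤ T := (hsmono n i.lt_succ_self).le.trans (hs_le n i hi)
    have h1 : |∫ x, ξ x ∂(μ' n t) - ∫ x, ξ x ∂(μ' n (s n i))| ≤ C' * (2 * δ n) := by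
      have h2 := hmod _ _ _ _ (hcellc n i hi) ((hlen n i hi).trans_lt ENNReal.ofReal_lt_top).ne
        (s n i) t le_rfl hti.1 hti.2 M hM0 fun r hr =>
          hM n r ⟨(hs_nonneg n i).trans hr.1.le, hr.2.le.trans ht.2⟩
      have h3 := h2.trans (mul_le_mul_right
        ((lintegral_mono_set (Ioo_subset_Ioo_right hti.2)).trans (hlen n i hi)) _)
      rw [← ENNReal.ofReal_mul hC'] at h3
      exact (ENNReal.ofReal_le_ofReal_iff (mul_nonneg hC' (by linarith [hδpos n]))).1 h3
    have h4 : |∫ x, ξ x ∂(μ t) - ∫ x, ξ x ∂(μ (s n i))| ≤ C * δ n := by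
      rcases hti.1.eq_or_lt with heq | hlt
      · rw [← heq, sub_self, abs_zero]; exact mul_nonneg hC (hδpos n).le
      · have h5 := hmod' (s n i) t (hs_nonneg n i) hlt ht.2
        have h6 : ∫⁻ r in Ioo (s n i) t, m r ≤ ENNReal.ofReal (δ n) := by
          refine (lintegral_mono hm1).trans ?_
          rw [setLIntegral_const, one_mul, Real.volume_Ioo]
          exact ENNReal.ofReal_le_ofReal (by linarith [hstep n i, hti.2])
        have h7 := h5.trans (mul_le_mul_right h6 _)
        rw [← ENNReal.ofReal_mul hC] at h7
        exact (ENNReal.ofReal_le_ofReal_iff (mul_nonneg hC (hδpos n).le)).1 h7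
    rw [(hnode n i hi).1] at h1
    rw [Real.dist_eq]
    refine (abs_sub_le _ (∫ x, ξ x ∂(μ (s n i))) _).trans ?_
    rw [abs_sub_comm (∫ x, ξ x ∂(μ (s n i)))]
    linarith
  · -- on a small cell the weight `η` is almost constant
    obtain ⟨H, hH⟩ := (isCompact_Icc.image_of_continuousOn (hη.continuousOn (s := Icc 0 T))).bddAbove
    have hH' : ∀ t ∈ Icc 0 T, η t ≤ H := fun t ht => hH ⟨t, ht, rfl⟩
    have hH0 : 0 ≤ H := (hη0 0).trans (hH' 0 ⟨le_rfl, hT.le⟩)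
    set τ := min 1 (ε₀ / (4 * T)) with hτ
    have hτ0 : 0 < τ := by positivity
    have hτT : 2 * τ * T ≤ ε₀ / 2 := by
      have h1 : τ ≤ ε₀ / (4 * T) := min_le_right _ _
      have h2 : ε₀ / (4 * T) * T = ε₀ / 4 := by field_simp
      nlinarith
    obtain ⟨κ, hκ, hunif⟩ := Metric.uniformContinuousOn_iff.1
      (isCompact_Icc.uniformContinuousOn_of_continuous (hη.continuousOn (s := Icc 0 T))) τ hτ0
    have hev1 : ∀ᶠ n in atTop, δ n < κ := hδlim.eventually (gt_mem_nhds hκ)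
    have hev2 : ∀ᶠ n in atTop, (H + 1) * δ n < ε₀ / 2 := by
      have := hδlim.const_mul (H + 1)
      rw [mul_zero] at this
      exact this.eventually (gt_mem_nhds (by positivity))
    filter_upwards [hev1, hev2] with n hn1 hn2
    have hcellη : ∀ i ∈ Finset.range (n + 1), ∫⁻ t in Ioo (s n i) (s n (i + 1)),
        ENNReal.ofReal (η t) * action φ γ (μ' n t) (ν' n t) ≤
        (∫⁻ t in Ioo (s n i) (s n (i + 1)), (ENNReal.ofReal (η t) * m t ^ p +
          ENNReal.ofReal (2 * τ))) + ENNReal.ofReal ((H + 1) * ε n) := by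
      intro i hi
      have hi' : i ≤ n := Nat.lt_succ_iff.1 (Finset.mem_range.1 hi)
      have hsiI : s n i ∈ Icc 0 T :=
        ⟨hs_nonneg n i, (hsmono n i.lt_succ_self).le.trans (hs_le n i hi')⟩
      have hclose : ∀ t ∈ Ioo (s n i) (s n (i + 1)), |η t - η (s n i)| < τ := fun t ht =>
        hunif t ⟨hsiI.1.trans ht.1.le, ht.2.le.trans (hs_le n i hi')⟩ _ hsiI (by
          rw [Real.dist_eq, abs_of_pos (by linarith [ht.1])]
          linarith [ht.2, hstep n i])
      calc ∫⁻ t in Ioo (s n i) (s n (i + 1)), ENNReal.ofReal (η t) * action φ γ (μ' n t) (ν' n t)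
          ≤ ∫⁻ t in Ioo (s n i) (s n (i + 1)),
              ENNReal.ofReal (η (s n i) + τ) * action φ γ (μ' n t) (ν' n t) := by
            refine setLIntegral_mono' measurableSet_Ioo fun t ht => ?_
            gcongr
            linarith [(abs_lt.1 (hclose t ht)).2]
        _ = ENNReal.ofReal (η (s n i) + τ) *
              ∫⁻ t in Ioo (s n i) (s n (i + 1)), action φ γ (μ' n t) (ν' n t) :=
            lintegral_const_mul' _ _ ENNReal.ofReal_ne_top
        _ ≤ ENNReal.ofReal (η (s n i) + τ) *
              ((∫⁻ t in Ioo (s n i) (s n (i + 1)), m t ^ p) + ENNReal.ofReal (ε n)) := by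
            gcongr
            exact (hnode n i hi').2
        _ ≤ _ := by
            rw [mul_add, ← lintegral_const_mul' _ _ ENNReal.ofReal_ne_top]
            refine add_le_add (setLIntegral_mono' measurableSet_Ioo fun t ht => ?_) ?_
            · have hmp : m t ^ p ≤ 1 := by simpa using ENNReal.rpow_le_rpow (hm1 t) hp0.le
              calc ENNReal.ofReal (η (s n i) + τ) * m t ^ p
                  ≤ (ENNReal.ofReal (η t) + ENNReal.ofReal (2 * τ)) * m t ^ p := by
                    rw [← ENNReal.ofReal_add (hη0 t) (by positivity)]
                    refine mul_le_mul_left (ENNReal.ofReal_le_ofReal ?_) _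
                    linarith [(abs_lt.1 (hclose t ht)).1]
                _ ≤ ENNReal.ofReal (η t) * m t ^ p + ENNReal.ofReal (2 * τ) := by
                    rw [add_mul]
                    gcongr
                    exact mul_le_of_le_one_right' hmp
            · have := hη0 (s n i)
              rw [← ENNReal.ofReal_mul (by positivity)]
              refine ENNReal.ofReal_le_ofReal (mul_le_mul_of_nonneg_right ?_ (hεpos n).le)
              have h1 : τ ≤ 1 := min_le_left _ _
              linarith [hH' _ hsiI]
    have hsum : ∀ F : ℝ → ℝ≥0∞, ∫⁻ t in Ioo 0 T, F t =
        ∑ i ∈ Finset.range (n + 1), ∫⁻ t in Ioo (s n i) (s n (i + 1)), F t := fun F => by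
      rw [← lintegral_Ioo_eq_sum (hsmono n), hs0, hsT]
    rw [hsum]
    refine (Finset.sum_le_sum hcellη).trans ?_
    rw [Finset.sum_add_distrib, ← hsum, lintegral_add_right _ measurable_const, setLIntegral_const,
      Real.volume_Ioo, Finset.sum_const, Finset.card_range, add_assoc]
    gcongr
    rw [← ENNReal.ofReal_mul (by positivity), nsmul_eq_mul, ← ENNReal.ofReal_natCast,
      ← ENNReal.ofReal_mul (by positivity), ← ENNReal.ofReal_add (mul_nonneg (by positivity)
        (by linarith)) (mul_nonneg (by positivity) (mul_nonneg (by positivity) (hεpos n).le))]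
    refine ENNReal.ofReal_le_ofReal ?_
    have h1 : ((n + 1 : ℕ) : ℝ) * ((H + 1) * ε n) = (H + 1) * δ n := by
      simp only [hε]; push_cast; field_simp
    rw [h1, sub_zero]
    linarith

end

/-! ### Space-time functionals -/

open ProbabilityTheory in
lemma isSFiniteKernel_of_forall_ball {α : Type*} [MeasurableSpace α] (κ : Kernel α (Space d))
    (h : ∀ R : ℝ, ∃ M : ℝ, ∀ a, κ a (Metric.ball 0 R) ≤ ENNReal.ofReal M) : IsSFiniteKernel κ := by
  set A : ℕ → Set (Space d) := disjointed fun n : ℕ => Metric.ball 0 n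
  have hA : ∀ n, MeasurableSet (A n) := fun n =>
    MeasurableSet.disjointed (fun n => Metric.isOpen_ball.measurableSet) n
  have hUn : ⋃ n, A n = univ := by
    rw [iUnion_disjointed, Metric.iUnion_ball_nat]
  refine ⟨fun n => κ.restrict (hA n), fun n => ?_, ?_⟩
  · obtain ⟨M, hM⟩ := h n
    refine ⟨ENNReal.ofReal M, ENNReal.ofReal_lt_top, fun a => ?_⟩
    rw [Kernel.restrict_apply, Measure.restrict_apply_univ]
    exact (measure_mono (disjointed_subset _ n)).trans (hM a)
  · ext a s hs
    rw [Kernel.sum_apply' _ _ hs]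
    simp only [Kernel.restrict_apply, Measure.restrict_apply hs]
    rw [← measure_iUnion (fun i j hij => (disjoint_disjointed _ hij).mono inter_subset_right
      inter_subset_right) fun n => hs.inter (hA n), ← inter_iUnion, hUn, inter_univ]

open ProbabilityTheory in
/-- A weakly* continuous curve with local mass bounds as an s-finite kernel on `(0,T)`. -/
lemma exists_kernel (γ : Measure (Space d)) [IsLocallyFiniteMeasure γ] {T : ℝ}
    {μ : ℝ → Measure (Space d)} (hμ : ∀ t ∈ Icc 0 T, IsLocallyFiniteMeasure (μ t))
    (hcont : ∀ ζ : Space d → ℝ, Continuous ζ → HasCompactSupport ζ →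
      ContinuousOn (fun t => ∫ x, ζ x ∂(μ t)) (Icc 0 T)) :
    ∃ κ : Kernel ℝ (Space d), IsSFiniteKernel κ ∧ (∀ t ∈ Ioo 0 T, κ t = γ + μ t) ∧
      ∀ R : ℝ, ∃ M : ℝ, 0 ≤ M ∧ ∀ t, κ t (Metric.ball 0 R) ≤ ENNReal.ofReal M := by
  obtain ⟨F, hF⟩ := exists_isBumpFamily d
  have hfin : ∀ t : Ioo 0 T, IsLocallyFiniteMeasure (μ t) := fun t => hμ t (Ioo_subset_Icc_self t.2)
  have hm : Measurable fun t : Ioo 0 T => μ t := by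
    refine measurable_measure_of_integral hF hfin fun j => ?_
    have := (hcont _ (hF.continuous j) (hF.hasCompactSupport j)).mono Ioo_subset_Icc_self
    exact (continuousOn_iff_continuous_domRestrict.1 this).measurable
  have hm' : Measurable fun t : Ioo 0 T => γ + μ t := by
    refine Measure.measurable_of_measurable_coe _ fun s hs => ?_
    simp only [Measure.add_apply]
    exact measurable_const.add ((Measure.measurable_coe hs).comp hm)
  set κ : Kernel ℝ (Space d) := ⟨(Ioo 0 T).indicator fun t => γ + μ t,
    measurable_indicator_of_subtype (f := fun t => γ + μ t) measurableSet_Ioo hm'⟩ with hκ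
  have hκt : ∀ t ∈ Ioo 0 T, κ t = γ + μ t := fun t ht =>
    indicator_of_mem ht fun t => γ + μ t
  have hb : ∀ R : ℝ, ∃ M : ℝ, 0 ≤ M ∧ ∀ t, κ t (Metric.ball 0 R) ≤ ENNReal.ofReal M := by
    intro R
    obtain ⟨M, hM0, hM⟩ := exists_forall_measure_le isCompact_Icc hμ
      (fun ζ hζ => hcont ζ hζ.continuous) (isCompact_closedBall (0 : Space d) R)
    refine ⟨(γ (Metric.ball 0 R)).toReal + M, by positivity, fun t => ?_⟩
    by_cases ht : t ∈ Ioo 0 T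
    · rw [hκt t ht, Measure.add_apply, ENNReal.ofReal_add ENNReal.toReal_nonneg hM0,
        ENNReal.ofReal_toReal measure_ball_lt_top.ne]
      gcongr
      exact (measure_mono Metric.ball_subset_closedBall).trans (hM t (Ioo_subset_Icc_self ht))
    · have : κ t = 0 := indicator_of_notMem ht fun t => γ + μ t
      simp [this]
  exact ⟨κ, isSFiniteKernel_of_forall_ball κ fun R => (hb R).imp fun M hM => hM.2, hκt, hb⟩

lemma continuousOn_integral_slice {a b : ℝ} {μ : ℝ → Measure (Space d)}
    (hfin : ∀ t ∈ Icc a b, IsLocallyFiniteMeasure (μ t))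
    (hcont : ∀ ζ : Space d → ℝ, Continuous ζ → HasCompactSupport ζ →
      ContinuousOn (fun t => ∫ x, ζ x ∂(μ t)) (Icc a b))
    {f : ℝ × Space d → ℝ} (hf : Continuous f) (hfc : HasCompactSupport f) :
    ContinuousOn (fun t => ∫ x, f (t, x) ∂(μ t)) (Icc a b) := by
  have h := continuousOn_integral_prod isCompact_Icc hfin hcont (G := fun z => f (z.2, z.1))
    (by fun_prop) (hfc.comp_homeomorph (Homeomorph.prodComm (Space d) ℝ))
  exact h.comp (f := fun t => (t, t)) (by fun_prop) fun t ht => ⟨mem_univ _, ht⟩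

lemma hasCompactSupport_slice {E : Type*} [Zero E] {f : ℝ × Space d → E}
    (hfc : HasCompactSupport f) (t : ℝ) : HasCompactSupport fun x => f (t, x) :=
  HasCompactSupport.intro (hfc.isCompact.image continuous_snd) fun _ hx =>
    image_eq_zero_of_notMem_tsupport fun h => hx ⟨_, h, rfl⟩

namespace RadonVectorMeasure

/-- The integral of `g` against the measure `|ν| + u · ν`, which is nonnegative for `|u| ≤ 1`. -/
def tilted (ν : RadonVectorMeasure d) (u : Space d) (g : Space d → ℝ) : ℝ :=
  ∫ x, g x * (1 + inner ℝ u (ν.dir x)) ∂ν.var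

variable (ν : RadonVectorMeasure d) {u : Space d} {g g' : Space d → ℝ}

lemma ae_one_add_inner_mem (hu : ‖u‖ ≤ 1) :
    ∀ᵐ x ∂ν.var, 1 + inner ℝ u (ν.dir x) ∈ Icc (0 : ℝ) 2 := by
  filter_upwards [ν.norm_dir] with x hx
  have h := abs_le.1 (abs_real_inner_le_norm u (ν.dir x))
  rw [hx, mul_one] at h
  constructor <;> linarith [h.1, h.2]

lemma integrable_tilted (hu : ‖u‖ ≤ 1) (hg : Continuous g) (hc : HasCompactSupport g) :
    Integrable (fun x => g x * (1 + inner ℝ u (ν.dir x))) ν.var := by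
  refine ((hg.integrable_of_hasCompactSupport hc (μ := ν.var)).norm.const_mul 2).mono'
    (hg.measurable.mul (measurable_const.add
      (measurable_const.inner ν.measurable_dir))).aestronglyMeasurable ?_
  filter_upwards [ν.ae_one_add_inner_mem hu] with x hx
  rw [norm_mul, Real.norm_of_nonneg hx.1, mul_comm]
  exact mul_le_mul_of_nonneg_right hx.2 (norm_nonneg _)

lemma tilted_add (hu : ‖u‖ ≤ 1) (hg : Continuous g) (hc : HasCompactSupport g)
    (hg' : Continuous g') (hc' : HasCompactSupport g') :
    ν.tilted u (fun x => g x + g' x) = ν.tilted u g + ν.tilted u g' := by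
  simp only [tilted, add_mul]
  exact integral_add (ν.integrable_tilted hu hg hc) (ν.integrable_tilted hu hg' hc')

lemma tilted_sub (hu : ‖u‖ ≤ 1) (hg : Continuous g) (hc : HasCompactSupport g)
    (hg' : Continuous g') (hc' : HasCompactSupport g') :
    ν.tilted u (fun x => g x - g' x) = ν.tilted u g - ν.tilted u g' := by
  simp only [tilted, sub_mul]
  exact integral_sub (ν.integrable_tilted hu hg hc) (ν.integrable_tilted hu hg' hc')

lemma tilted_const_mul (c : ℝ) : ν.tilted u (fun x => c * g x) = c * ν.tilted u g := by
  simp only [tilted, mul_assoc, integral_const_mul]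

lemma tilted_nonneg (hu : ‖u‖ ≤ 1) (hg : ∀ x, 0 ≤ g x) : 0 ≤ ν.tilted u g :=
  integral_nonneg_of_ae ((ν.ae_one_add_inner_mem hu).mono fun x hx => mul_nonneg (hg x) hx.1)

lemma enorm_tilted_le (hu : ‖u‖ ≤ 1) : ‖ν.tilted u g‖ₑ ≤ 2 * ∫⁻ x, ‖g x‖ₑ ∂ν.var := by
  refine (enorm_integral_le_lintegral_enorm _).trans ?_
  rw [← lintegral_const_mul' _ _ (by simp)]
  refine lintegral_mono_ae ?_
  filter_upwards [ν.ae_one_add_inner_mem hu] with x hx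
  rw [enorm_mul, mul_comm]
  gcongr
  rw [Real.enorm_eq_ofReal hx.1]
  exact (ENNReal.ofReal_le_ofReal hx.2).trans_eq (by simp)

lemma tilted_eq (hg : Continuous g) (hc : HasCompactSupport g) :
    ν.tilted u g = ν.tilted 0 g + ν.pairing fun x => g x • u := by
  have h1 := ν.integrable_tilted (u := 0) (by simp) hg hc
  have h2 := ν.integrable_inner (ζ := fun x => g x • u) (hg.smul continuous_const) hc.smul_right
  rw [tilted, tilted, pairing, ← integral_add h1 h2]
  refine integral_congr_ae (Eventually.of_forall fun x => ?_)
  simp only [inner_zero_left, real_inner_smul_left]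
  ring

lemma pairing_eq_sum_tilted {ζ : Space d → Space d} (hζ : Continuous ζ)
    (hc : HasCompactSupport ζ) :
    ν.pairing ζ = ∑ i, (ν.tilted (EuclideanSpace.single i 1) (fun x => ζ x i) -
      ν.tilted 0 fun x => ζ x i) := by
  have hci : ∀ i, Continuous fun x => ζ x i := fun i => by fun_prop
  have hcc : ∀ i, HasCompactSupport fun x => ζ x i := fun i =>
    hc.comp_left (g := fun y : Space d => y i) rfl
  have h1 : ∀ i, ν.tilted (EuclideanSpace.single i 1) (fun x => ζ x i) -
      ν.tilted 0 (fun x => ζ x i) = ∫ x, ζ x i * ν.dir x i ∂ν.var := fun i => by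
    rw [ν.tilted_eq (hci i) (hcc i), add_sub_cancel_left, pairing]
    refine integral_congr_ae (Eventually.of_forall fun x => ?_)
    simp [real_inner_smul_left, EuclideanSpace.inner_single_left]
  simp only [h1]
  rw [← integral_finsetSum]
  · refine integral_congr_ae (Eventually.of_forall fun x => ?_)
    simp [PiLp.inner_apply, mul_comm]
  · intro i _
    have := ν.integrable_inner (ζ := fun x => ζ x i • EuclideanSpace.single i (1 : ℝ))
      ((hci i).smul continuous_const) (hcc i).smul_right
    refine this.congr (Eventually.of_forall fun x => ?_)
    simp [real_inner_smul_left, EuclideanSpace.inner_single_left]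

end RadonVectorMeasure

lemma measurable_tilted {α : Type*} [MeasurableSpace α] {ν : α → RadonVectorMeasure d}
    (hν : ∀ B : Set (Space d), MeasurableSet B → Bornology.IsBounded B →
      Measurable fun a => (ν a).value B) (u : Space d)
    {g : Space d → ℝ} (hg : Continuous g) (hc : HasCompactSupport g) :
    Measurable fun a => (ν a).tilted u g := by
  simp only [fun a => (ν a).tilted_eq (u := u) hg hc]
  refine Measurable.add ?_ (measurable_pairing hν (hg.smul continuous_const) hc.smul_right)
  have hvar := measurable_var hν
  have h1 : ∀ a, (ν a).tilted 0 g = (∫⁻ x, ENNReal.ofReal (g x) ∂(ν a).var).toReal -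
      (∫⁻ x, ENNReal.ofReal (-g x) ∂(ν a).var).toReal := fun a => by
    rw [← integral_eq_lintegral_pos_part_sub_lintegral_neg_part
      (hg.integrable_of_hasCompactSupport hc)]
    simp [RadonVectorMeasure.tilted]
  simp only [h1]
  exact ((Measure.measurable_lintegral hg.measurable.ennreal_ofReal).comp hvar).ennreal_toReal.sub
    ((Measure.measurable_lintegral hg.measurable.neg.ennreal_ofReal).comp hvar).ennreal_toReal

lemma ContinuityEqOn.integrableOn_tilted {a b : ℝ} {μ : ℝ → Measure (Space d)}
    {ν : ℝ → RadonVectorMeasure d} (h : ContinuityEqOn a b μ ν) {u : Space d} (hu : ‖u‖ ≤ 1)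
    {f : ℝ × Space d → ℝ} (hf : Continuous f) (hfc : HasCompactSupport f) :
    IntegrableOn (fun t => (ν t).tilted u fun x => f (t, x)) (Ioo a b) := by
  have hK : IsCompact (Prod.snd '' tsupport f) := hfc.isCompact.image continuous_snd
  have hfK : ∀ t x, x ∉ Prod.snd '' tsupport f → f (t, x) = 0 := fun t x hx =>
    image_eq_zero_of_notMem_tsupport fun h => hx ⟨_, h, rfl⟩
  obtain ⟨R₀, hR₀⟩ := hK.isBounded.subset_ball (0 : Space d)
  set R := max R₀ 1
  have hR : 0 < R := by positivity
  have hfR : ∀ t x, x ∉ Metric.ball (0 : Space d) R → f (t, x) = 0 := fun t x hx =>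
    hfK t x fun h' => hx (Metric.ball_subset_ball (le_max_left _ _) (hR₀ h'))
  set V : ℝ → ℝ := fun r => ((ν r).var (Metric.ball 0 R)).toReal with hV
  have hVi : IntegrableOn V (Ioo a b) := h.integrableOn_var hR
  have hbound : ∀ (r : ℝ) (g : Space d → ℝ) (C : ℝ), 0 ≤ C → (∀ x, |g x| ≤ C) →
      (∀ x, x ∉ Metric.ball (0 : Space d) R → g x = 0) → |(ν r).tilted u g| ≤ 2 * C * V r := by
    intro r g C hC0 hC hg
    have h1 : ‖(ν r).tilted u g‖ₑ ≤ 2 * (ENNReal.ofReal C * (ν r).var (Metric.ball 0 R)) := by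
      refine ((ν r).enorm_tilted_le hu).trans ?_
      gcongr
      rw [← lintegral_indicator_const Metric.isOpen_ball.measurableSet]
      refine lintegral_mono fun x => ?_
      by_cases hx : x ∈ Metric.ball (0 : Space d) R
      · rw [indicator_of_mem hx, ← ofReal_norm]
        exact ENNReal.ofReal_le_ofReal (hC x)
      · simp [hg x hx]
    have h2 := ENNReal.toReal_mono (ENNReal.mul_ne_top (by simp) (ENNReal.mul_ne_top
      ENNReal.ofReal_ne_top measure_ball_lt_top.ne)) h1
    rw [toReal_enorm, ENNReal.toReal_mul, ENNReal.toReal_mul, ENNReal.toReal_ofReal hC0] at h2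
    rw [mul_assoc]
    exact h2
  obtain ⟨C, hC⟩ := hfc.exists_bound_of_continuous hf
  have hC0 : 0 ≤ C := (norm_nonneg _).trans (hC 0)
  refine (hVi.const_mul (2 * C)).mono' ?_ (Eventually.of_forall fun r =>
    hbound r _ C hC0 (fun x => hC _) fun x hx => hfR r x hx)
  refine AEMeasurable.aestronglyMeasurable
    (aemeasurable_restrict_of_measurable_subtype measurableSet_Ioo ?_)
  have hs : ∀ s, Continuous fun x => f (s, x) := fun s => by fun_prop
  have hsc := hasCompactSupport_slice hfc
  -- the functional is measurable in time for a fixed test function, and continuous in the latter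
  have := measurable_uncurry_of_continuous_of_measurable
    (u := fun (s : ℝ) (r : Ioo a b) => (ν r).tilted u fun x => f (s, x)) (fun r => ?_)
    (fun s => measurable_tilted (ν := fun t : Ioo a b => ν t) h.borel u (hs s) (hsc s))
  · exact this.comp (measurable_subtype_coe.prodMk measurable_id)
  · refine Metric.continuous_iff.2 fun s₀ ε hε => ?_
    have hVr : 0 ≤ V r := ENNReal.toReal_nonneg
    obtain ⟨δ, hδ, hδ'⟩ := Metric.uniformContinuous_iff.1
      (hfc.uniformContinuous_of_continuous hf) (ε / (2 * (V r + 1))) (by positivity)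
    refine ⟨δ, hδ, fun s hs' => ?_⟩
    rw [Real.dist_eq, ← (ν r).tilted_sub hu (hs s) (hsc s) (hs s₀) (hsc s₀)]
    refine (hbound r _ (ε / (2 * (V r + 1))) (by positivity) (fun x => ?_)
      fun x hx => ?_).trans_lt ?_
    · rw [← Real.dist_eq]
      refine (hδ' ?_).le
      rw [Prod.dist_eq]; simpa [hδ] using hs'
    · rw [hfR _ x hx, hfR _ x hx, sub_zero]
    · rw [← mul_div_assoc, div_mul_eq_mul_div, div_lt_iff₀ (by positivity)]
      nlinarith

lemma continuous_rpow_comp {Y : Type*} [TopologicalSpace Y] {q : ℝ} (hq : 0 < q) {f : Y → ℝ}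
    (hf : Continuous f) : Continuous fun y => f y ^ q :=
  hf.rpow_const fun _ => Or.inr hq.le

lemma hasCompactSupport_rpow_comp {Y : Type*} [TopologicalSpace Y] {q : ℝ} (hq : 0 < q) {f : Y → ℝ}
    (hf : HasCompactSupport f) : HasCompactSupport fun y => f y ^ q :=
  hf.comp_left (g := fun s : ℝ => s ^ q) (Real.zero_rpow hq.ne')

/-- Space-time Hölder inequality for the flux. -/
lemma exists_integral_tilted_le {p q : ℝ} (hpq : p.HolderConjugate q) {φ : ℝ → Space d → ℝ}
    (hφ : IsActionDensity p φ) (γ : Measure (Space d)) [IsLocallyFiniteMeasure γ] :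
    ∃ C : ℝ, 0 < C ∧ ∀ (a b : ℝ) (μ : ℝ → Measure (Space d)) (ν : ℝ → RadonVectorMeasure d),
      ContinuityEqOn a b μ ν → ∫⁻ t in Ioo a b, action φ γ (μ t) (ν t) ≠ ⊤ →
      ∀ u : Space d, ‖u‖ ≤ 1 → ∀ f : ℝ × Space d → ℝ, Continuous f → HasCompactSupport f →
      (∀ y, 0 ≤ f y) →
      ∫ t in Ioo a b, (ν t).tilted u (fun x => f (t, x)) ≤
        C * (∫⁻ t in Ioo a b, action φ γ (μ t) (ν t)).toReal ^ (1 / p) *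
          (∫ t in Ioo a b, ((∫ x, f (t, x) ^ q ∂γ) + ∫ x, f (t, x) ^ q ∂(μ t))) ^ (1 / q) := by
  obtain ⟨C, hC, hvar⟩ := exists_lintegral_var_le (d := d) hpq hφ
  have hp0 : 0 < p := hpq.pos
  have hq0 : 0 < q := hpq.symm.pos
  refine ⟨2 * C, by positivity, fun a b μ ν h hE u hu f hf hfc hf0 => ?_⟩
  set E := ∫⁻ t in Ioo a b, action φ γ (μ t) (ν t)
  have hfq := continuous_rpow_comp hq0 hf
  have hfqc := hasCompactSupport_rpow_comp hq0 hfc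
  set A : ℝ → ℝ := fun t => (∫ x, f (t, x) ^ q ∂γ) + ∫ x, f (t, x) ^ q ∂(μ t) with hA
  have hA0 : ∀ t, 0 ≤ A t := fun t => add_nonneg
    (integral_nonneg fun x => Real.rpow_nonneg (hf0 _) q)
    (integral_nonneg fun x => Real.rpow_nonneg (hf0 _) q)
  have hAc : ContinuousOn A (Icc a b) :=
    (continuousOn_integral_slice (μ := fun _ => γ) (fun _ _ => inferInstance)
      (fun _ _ _ => continuousOn_const) hfq hfqc).add
    (continuousOn_integral_slice h.locallyFinite h.weakStar_continuous hfq hfqc)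
  have hAi : IntegrableOn A (Ioo a b) :=
    (hAc.integrableOn_compact isCompact_Icc).mono_set Ioo_subset_Icc_self
  have hΦm := h.aemeasurable_action hφ hpq.lt γ
  have hslice : ∀ᵐ t ∂(volume.restrict (Ioo a b)), ‖(ν t).tilted u (fun x => f (t, x))‖ₑ ≤
      2 * ENNReal.ofReal C * (action φ γ (μ t) (ν t) ^ (1 / p) *
        ENNReal.ofReal (A t) ^ (1 / q)) := by
    filter_upwards [ae_lt_top' hΦm hE, ae_restrict_mem measurableSet_Ioo] with t ht htI
    have := h.locallyFinite t (Ioo_subset_Icc_self htI)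
    have hft : Continuous fun x => f (t, x) := by fun_prop
    refine ((ν t).enorm_tilted_le hu).trans ?_
    rw [mul_assoc]
    gcongr
    refine (hvar γ (μ t) (ν t) ht.ne _ hft.enorm.measurable).trans_eq ?_
    rw [mul_assoc]
    congr 3
    have hi1 : Integrable (fun x => f (t, x) ^ q) γ :=
      (continuous_rpow_comp hq0 hft).integrable_of_hasCompactSupport
        (hasCompactSupport_rpow_comp hq0 (hasCompactSupport_slice hfc t))
    have hi2 : Integrable (fun x => f (t, x) ^ q) (μ t) :=
      (continuous_rpow_comp hq0 hft).integrable_of_hasCompactSupport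
        (hasCompactSupport_rpow_comp hq0 (hasCompactSupport_slice hfc t))
    rw [hA]
    simp only
    rw [← integral_add_measure hi1 hi2, ofReal_integral_eq_lintegral_ofReal (hi1.add_measure hi2)
      (Eventually.of_forall fun x => Real.rpow_nonneg (hf0 _) q)]
    refine lintegral_congr fun x => ?_
    rw [Real.enorm_eq_ofReal (hf0 _), ENNReal.ofReal_rpow_of_nonneg (hf0 _) hq0.le]
  have hHolder := ENNReal.lintegral_mul_le_Lp_mul_Lq (volume.restrict (Ioo a b)) hpq
    (hΦm.pow_const (1 / p)) ((hAi.aestronglyMeasurable.aemeasurable.ennreal_ofReal).pow_const (1 / q))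
  simp only [Pi.mul_apply, ← ENNReal.rpow_mul, one_div_mul_cancel hp0.ne',
    one_div_mul_cancel hq0.ne', ENNReal.rpow_one] at hHolder
  rw [← ofReal_integral_eq_lintegral_ofReal hAi (Eventually.of_forall hA0)] at hHolder
  have hIA : 0 ≤ ∫ t in Ioo a b, A t := integral_nonneg hA0
  have hfinal : ENNReal.ofReal (∫ t in Ioo a b, (ν t).tilted u (fun x => f (t, x))) ≤
      ENNReal.ofReal (2 * C * E.toReal ^ (1 / p) * (∫ t in Ioo a b, A t) ^ (1 / q)) := by
    have h1 : ENNReal.ofReal (∫ t in Ioo a b, (ν t).tilted u (fun x => f (t, x))) ≤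
        ∫⁻ t in Ioo a b, ‖(ν t).tilted u (fun x => f (t, x))‖ₑ := by
      refine le_trans ?_ (enorm_integral_le_lintegral_enorm _)
      rw [← ofReal_norm]
      exact ENNReal.ofReal_le_ofReal (le_abs_self _)
    refine h1.trans ((lintegral_mono_ae hslice).trans ?_)
    rw [lintegral_const_mul' _ _ (ENNReal.mul_ne_top (by simp) ENNReal.ofReal_ne_top), mul_assoc,
      mul_assoc, mul_assoc, ENNReal.ofReal_mul (by norm_num : (0 : ℝ) ≤ 2), ENNReal.ofReal_ofNat,
      ENNReal.ofReal_mul hC.le, ENNReal.ofReal_mul (by positivity),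
      ← ENNReal.ofReal_rpow_of_nonneg ENNReal.toReal_nonneg (by positivity),
      ENNReal.ofReal_toReal hE, ← ENNReal.ofReal_rpow_of_nonneg hIA (by positivity)]
    gcongr
  exact (ENNReal.ofReal_le_ofReal_iff (by positivity)).1 hfinal

/-! ### The limit flux -/

section LimitFlux

open ProbabilityTheory CompactlySupported

lemma isLocallyFiniteMeasure_compProd {T : ℝ} {κ : Kernel ℝ (Space d)} [IsSFiniteKernel κ]
    (hκ : ∀ R : ℝ, ∃ M : ℝ, 0 ≤ M ∧ ∀ t, κ t (Metric.ball 0 R) ≤ ENNReal.ofReal M) :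
    IsLocallyFiniteMeasure ((volume.restrict (Ioo 0 T)) ⊗ₘ κ) := by
  refine ⟨fun y => ⟨univ ×ˢ Metric.ball 0 (‖y.2‖ + 1), ?_, ?_⟩⟩
  · exact (isOpen_univ.prod Metric.isOpen_ball).mem_nhds ⟨mem_univ _, by simp⟩
  · obtain ⟨M, -, hM⟩ := hκ (‖y.2‖ + 1)
    rw [Measure.compProd_apply_prod MeasurableSet.univ Metric.isOpen_ball.measurableSet,
      Measure.restrict_univ]
    refine (lintegral_mono hM).trans_lt ?_
    rw [setLIntegral_const, Real.volume_Ioo]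
    exact ENNReal.mul_lt_top ENNReal.ofReal_lt_top ENNReal.ofReal_lt_top

variable {p q : ℝ} {φ : ℝ → Space d → ℝ} {γ : Measure (Space d)} {T : ℝ}
  {μ : ℝ → Measure (Space d)} {m : ℝ → ℝ≥0∞} {μ' : ℕ → ℝ → Measure (Space d)}
  {ν' : ℕ → ℝ → RadonVectorMeasure d}

lemma IsApproximation.tendsto_setIntegral_slice (hA : IsApproximation p φ γ T μ m μ' ν')
    {f : ℝ × Space d → ℝ} (hf : Continuous f) (hfc : HasCompactSupport f) :
    Tendsto (fun n => ∫ t in Ioo 0 T, ∫ x, f (t, x) ∂(μ' n t)) atTop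
      (𝓝 (∫ t in Ioo 0 T, ∫ x, f (t, x) ∂(μ t))) := by
  obtain ⟨C, hC⟩ := hfc.exists_bound_of_continuous hf
  have hC0 : 0 ≤ C := (norm_nonneg _).trans (hC 0)
  obtain ⟨M, hM0, hM⟩ := hA.exists_measure_le _ (hfc.isCompact.image continuous_snd)
  refine tendsto_integral_of_dominated_convergence (fun _ => C * M) (fun n => ?_)
    (integrable_const _) (fun n => ?_) ?_
  · exact ((continuousOn_integral_slice (hA.continuityEqOn n).locallyFinite
      (hA.continuityEqOn n).weakStar_continuous hf hfc).mono Ioo_subset_Icc_self).aestronglyMeasurable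
      measurableSet_Ioo
  · filter_upwards [ae_restrict_mem measurableSet_Ioo] with t ht
    exact abs_integral_le_of_abs_le hM0 (hM n t (Ioo_subset_Icc_self ht)) hC0 (fun x => hC _)
      fun x hx => image_eq_zero_of_notMem_tsupport fun h => hx ⟨_, h, rfl⟩
  · filter_upwards [ae_restrict_mem measurableSet_Ioo] with t ht
    exact hA.tendsto t (Ioo_subset_Icc_self ht) _ (by fun_prop) (hasCompactSupport_slice hfc t)

/-- The integral in space-time against `(|ν_t| + u · ν_t) dt`. -/
def ContinuityEqOn.tiltedFunctional {a b : ℝ} {μ : ℝ → Measure (Space d)}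
    {ν : ℝ → RadonVectorMeasure d} (h : ContinuityEqOn a b μ ν) {u : Space d} (hu : ‖u‖ ≤ 1) :
    C_c(ℝ × Space d, ℝ) →ₗ[ℝ] ℝ where
  toFun f := ∫ t in Ioo a b, (ν t).tilted u fun x => f (t, x)
  map_add' f g := by
    refine Eq.trans ?_ (integral_add (h.integrableOn_tilted hu f.continuous f.hasCompactSupport)
      (h.integrableOn_tilted hu g.continuous g.hasCompactSupport))
    refine integral_congr_ae (Eventually.of_forall fun t => ?_)
    exact (ν t).tilted_add hu (f.continuous.comp (by fun_prop))
      (hasCompactSupport_slice f.hasCompactSupport t) (g.continuous.comp (by fun_prop))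
      (hasCompactSupport_slice g.hasCompactSupport t)
  map_smul' c f := by
    rw [RingHom.id_apply, smul_eq_mul, ← integral_const_mul]
    exact integral_congr_ae (Eventually.of_forall fun t => (ν t).tilted_const_mul c)

variable [IsLocallyFiniteMeasure γ]

/-- The fluxes of an approximation converge, along an ultrafilter and as measures in space-time, to
a flux that is absolutely continuous with respect to `(γ + μ_t) dt`. -/
theorem IsApproximation.exists_tendsto_pairing (hpq : p.HolderConjugate q)
    (hφ : IsActionDensity p φ) (hm1 : ∀ t, m t ≤ 1) (hA : IsApproximation p φ γ T μ m μ' ν')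
    (hμ : ∀ t ∈ Icc 0 T, IsLocallyFiniteMeasure (μ t))
    (hcont : ∀ ζ : Space d → ℝ, Continuous ζ → HasCompactSupport ζ →
      ContinuousOn (fun t => ∫ x, ζ x ∂(μ t)) (Icc 0 T))
    {κ : Kernel ℝ (Space d)} [IsSFiniteKernel κ] (hκ : ∀ t ∈ Ioo 0 T, κ t = γ + μ t)
    (hκb : ∀ R : ℝ, ∃ M : ℝ, 0 ≤ M ∧ ∀ t, κ t (Metric.ball 0 R) ≤ ENNReal.ofReal M) :
    ∃ w : ℝ × Space d → Space d, Measurable w ∧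
      LocallyIntegrable w ((volume.restrict (Ioo 0 T)) ⊗ₘ κ) ∧
      ∀ c : ℝ × Space d → Space d, Continuous c → HasCompactSupport c →
        Tendsto (fun n => ∫ t in Ioo 0 T, (ν' n t).pairing fun x => c (t, x))
          (hyperfilter ℕ : Filter ℕ)
          (𝓝 (∫ y, inner ℝ (c y) (w y) ∂((volume.restrict (Ioo 0 T)) ⊗ₘ κ))) := by
  have hp0 : 0 < p := hpq.pos
  have hq0 : 0 < q := hpq.symm.pos
  set Θ := (volume.restrict (Ioo 0 T)) ⊗ₘ κ with hΘ
  have : IsLocallyFiniteMeasure Θ := isLocallyFiniteMeasure_compProd hκb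
  obtain ⟨C, hC, hHolder⟩ := exists_integral_tilted_le hpq hφ γ
  -- the actions are bounded
  set E₀ : ℝ≥0∞ := (∫⁻ t in Ioo 0 T, ENNReal.ofReal 1 * m t ^ p) + ENNReal.ofReal 1 with hE₀
  have hE₀top : E₀ ≠ ⊤ := by
    refine (ENNReal.add_lt_top.2 ⟨?_, ENNReal.ofReal_lt_top⟩).ne
    refine (lintegral_mono (g := fun _ => (1 : ℝ≥0∞)) fun t => ?_).trans_lt ?_
    · rw [ENNReal.ofReal_one, one_mul]
      exact (ENNReal.rpow_le_rpow (hm1 t) hp0.le).trans_eq (ENNReal.one_rpow p)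
    · rw [setLIntegral_const, Real.volume_Ioo, one_mul]
      exact ENNReal.ofReal_lt_top
  have hE : ∀ᶠ n in atTop, ∫⁻ t in Ioo 0 T, action φ γ (μ' n t) (ν' n t) ≤ E₀ := by
    filter_upwards [hA.eventually_action_le (fun _ => 1) continuous_const (fun _ => zero_le_one) 1
      one_pos] with n hn
    simpa only [ENNReal.ofReal_one, one_mul, hE₀] using hn
  have key : ∀ u : Space d, ‖u‖ ≤ 1 → ∃ v : ℝ × Space d → ℝ, Measurable v ∧
      LocallyIntegrable v Θ ∧ ∀ f : ℝ × Space d → ℝ, Continuous f → HasCompactSupport f →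
        Tendsto (fun n => ∫ t in Ioo 0 T, (ν' n t).tilted u fun x => f (t, x))
          (hyperfilter ℕ : Filter ℕ) (𝓝 (∫ y, f y * v y ∂Θ)) := by
    intro u hu
    suffices hbound : ∀ f : C_c(ℝ × Space d, ℝ), (∀ y, 0 ≤ f y) → ∀ ε : ℝ, 0 < ε → ∀ᶠ n in atTop,
        (hA.continuityEqOn n).tiltedFunctional hu f ≤
          C * E₀.toReal ^ (1 / p) * (∫ y, f y ^ q ∂Θ) ^ (1 / q) + ε by
      obtain ⟨v, hv, -, hvi, hvt⟩ := exists_density_tendsto_hyperfilter Θ (q := q)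
        (C := C * E₀.toReal ^ (1 / p)) hq0 (by positivity)
        (fun n => (hA.continuityEqOn n).tiltedFunctional hu)
        (fun n f hf => integral_nonneg fun t => (ν' n t).tilted_nonneg hu fun x => hf _) hbound
      exact ⟨v, hv, hvi, fun f hf hfc => hvt ⟨⟨f, hf⟩, hfc⟩⟩
    intro f hf ε hε
    have hfq : Continuous fun y => f y ^ q := continuous_rpow_comp hq0 f.continuous
    have hfqc : HasCompactSupport fun y => f y ^ q :=
      hasCompactSupport_rpow_comp hq0 f.hasCompactSupport
    set A : ℕ → ℝ := fun n =>
      ∫ t in Ioo 0 T, ((∫ x, f (t, x) ^ q ∂γ) + ∫ x, f (t, x) ^ q ∂(μ' n t)) with hAdef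
    have hγi : IntegrableOn (fun t => ∫ x, f (t, x) ^ q ∂γ) (Ioo 0 T) :=
      ((continuousOn_integral_slice (μ := fun _ => γ) (a := 0) (b := T) (fun _ _ => inferInstance)
        (fun _ _ _ => continuousOn_const) hfq hfqc).integrableOn_compact isCompact_Icc).mono_set
        Ioo_subset_Icc_self
    have hslice : ∀ {μ : ℝ → Measure (Space d)}
        (_ : ∀ t ∈ Icc 0 T, IsLocallyFiniteMeasure (μ t))
        (_ : ∀ ζ : Space d → ℝ, Continuous ζ → HasCompactSupport ζ →
          ContinuousOn (fun t => ∫ x, ζ x ∂(μ t)) (Icc 0 T)),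
        IntegrableOn (fun t => ∫ x, f (t, x) ^ q ∂(μ t)) (Ioo 0 T) := fun h1 h2 =>
      ((continuousOn_integral_slice h1 h2 hfq hfqc).integrableOn_compact isCompact_Icc).mono_set
        Ioo_subset_Icc_self
    have hAt : Tendsto A atTop (𝓝 (∫ y, f y ^ q ∂Θ)) := by
      have h1 : ∀ n, A n = (∫ t in Ioo 0 T, ∫ x, f (t, x) ^ q ∂γ) +
          ∫ t in Ioo 0 T, ∫ x, f (t, x) ^ q ∂(μ' n t) := fun n =>
        integral_add hγi (hslice (hA.continuityEqOn n).locallyFinite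
          (hA.continuityEqOn n).weakStar_continuous)
      have h2 : ∫ y, f y ^ q ∂Θ = (∫ t in Ioo 0 T, ∫ x, f (t, x) ^ q ∂γ) +
          ∫ t in Ioo 0 T, ∫ x, f (t, x) ^ q ∂(μ t) := by
        rw [← integral_add hγi (hslice hμ hcont), hΘ,
          Measure.integral_compProd (hfq.integrable_of_hasCompactSupport hfqc)]
        refine setIntegral_congr_fun measurableSet_Ioo fun t ht => ?_
        have := hμ t (Ioo_subset_Icc_self ht)
        have hft : Continuous fun x => f (t, x) ^ q := hfq.comp (by fun_prop)
        have hftc := hasCompactSupport_slice hfqc t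
        simp only [hκ t ht]
        exact integral_add_measure (hft.integrable_of_hasCompactSupport hftc)
          (hft.integrable_of_hasCompactSupport hftc)
      rw [show A = _ from funext h1, h2]
      exact tendsto_const_nhds.add (hA.tendsto_setIntegral_slice hfq hfqc)
    have hlim : Tendsto (fun n => C * E₀.toReal ^ (1 / p) * A n ^ (1 / q)) atTop
        (𝓝 (C * E₀.toReal ^ (1 / p) * (∫ y, f y ^ q ∂Θ) ^ (1 / q))) :=
      tendsto_const_nhds.mul (hAt.rpow_const (Or.inr (by positivity)))
    filter_upwards [hE, hlim.eventually (gt_mem_nhds (lt_add_of_pos_right _ hε))] with n hn hn'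
    refine (hHolder 0 T (μ' n) (ν' n) (hA.continuityEqOn n) (ne_top_of_le_ne_top hE₀top hn) u hu f
      f.continuous f.hasCompactSupport hf).trans (le_trans ?_ hn'.le)
    have hA0 : 0 ≤ A n := integral_nonneg fun t => add_nonneg
      (integral_nonneg fun x => Real.rpow_nonneg (hf _) q)
      (integral_nonneg fun x => Real.rpow_nonneg (hf _) q)
    gcongr
  -- the components of the limit are recovered from the directions `u = e_i` and `u = 0`
  obtain ⟨v₀, hv₀, hv₀i, hv₀t⟩ := key 0 (by simp)
  choose v hv hvi hvt using fun i : Fin d => key (EuclideanSpace.single i 1) (by simp)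
  refine ⟨fun y => ∑ i, (v i y - v₀ y) • EuclideanSpace.single i (1 : ℝ),
    Finset.measurable_sum _ fun i _ => ((hv i).sub hv₀).smul_const _, ?_, ?_⟩
  · intro y
    choose s hs hsi using fun i => hvi i y
    obtain ⟨s₀, hs₀, hs₀i⟩ := hv₀i y
    refine ⟨(⋂ i, s i) ∩ s₀, inter_mem (iInter_mem.2 hs) hs₀, integrable_finsetSum _ fun i _ => ?_⟩
    exact (((hsi i).mono_set (inter_subset_left.trans (iInter_subset _ i))).sub
      (hs₀i.mono_set inter_subset_right)).smul_const _
  · intro c hc hcc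
    have hci : ∀ i, Continuous fun y => c y i := fun i => by fun_prop
    have hcci : ∀ i, HasCompactSupport fun y => c y i := fun i =>
      hcc.comp_left (g := fun y : Space d => y i) rfl
    have e1 : ∀ n, ∫ t in Ioo 0 T, (ν' n t).pairing (fun x => c (t, x)) =
        ∑ i, ((∫ t in Ioo 0 T, (ν' n t).tilted (EuclideanSpace.single i 1) fun x => c (t, x) i) -
          ∫ t in Ioo 0 T, (ν' n t).tilted 0 fun x => c (t, x) i) := by
      intro n
      have hi1 : ∀ i, IntegrableOn (fun t => (ν' n t).tilted (EuclideanSpace.single i 1)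
          fun x => c (t, x) i) (Ioo 0 T) := fun i =>
        (hA.continuityEqOn n).integrableOn_tilted (by simp) (hci i) (hcci i)
      have hi2 : ∀ i, IntegrableOn (fun t => (ν' n t).tilted 0
          fun x => c (t, x) i) (Ioo 0 T) := fun i =>
        (hA.continuityEqOn n).integrableOn_tilted (by simp) (hci i) (hcci i)
      simp only [fun i => (integral_sub (hi1 i) (hi2 i)).symm]
      refine Eq.trans ?_ (integral_finsetSum _ fun i _ => (hi1 i).sub (hi2 i))
      refine integral_congr_ae (Eventually.of_forall fun t => ?_)
      exact (ν' n t).pairing_eq_sum_tilted (ζ := fun x => c (t, x)) (by fun_prop)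
        (hasCompactSupport_slice hcc t)
    have i1 : ∀ i, Integrable (fun y => c y i * v i y) Θ := fun i =>
      (hvi i).integrable_smul_left_of_hasCompactSupport (hci i) (hcci i)
    have i2 : ∀ i, Integrable (fun y => c y i * v₀ y) Θ := fun i =>
      hv₀i.integrable_smul_left_of_hasCompactSupport (hci i) (hcci i)
    have e2 : ∫ y, inner ℝ (c y) (∑ i, (v i y - v₀ y) • EuclideanSpace.single i (1 : ℝ)) ∂Θ =
        ∑ i, ((∫ y, c y i * v i y ∂Θ) - ∫ y, c y i * v₀ y ∂Θ) := by
      simp only [fun i => (integral_sub (i1 i) (i2 i)).symm]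
      refine Eq.trans ?_ (integral_finsetSum _ fun i _ => (i1 i).sub (i2 i))
      refine integral_congr_ae (Eventually.of_forall fun y => ?_)
      simp only [inner_sum, inner_smul_right, EuclideanSpace.inner_single_right]
      refine Finset.sum_congr rfl fun i _ => ?_
      simp
      ring
    simp only [e1, e2]
    exact tendsto_finsetSum _ fun i _ => (hvt i _ (hci i) (hcci i)).sub (hv₀t _ (hci i) (hcci i))

/-- A locally integrable vector field in space-time can be modified on a null set of times such that
all its time slices are locally integrable. -/
lemma exists_isLocallyFiniteMeasure_slice {κ : Kernel ℝ (Space d)} [IsSFiniteKernel κ]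
    {w : ℝ × Space d → Space d} (hw : Measurable w)
    (hwi : LocallyIntegrable w ((volume.restrict (Ioo 0 T)) ⊗ₘ κ)) :
    ∃ w' : ℝ × Space d → Space d, Measurable w' ∧ w' =ᵐ[(volume.restrict (Ioo 0 T)) ⊗ₘ κ] w ∧
      (∀ t, IsLocallyFiniteMeasure ((κ t).withDensity fun x => ‖w' (t, x)‖ₑ)) ∧
      ∀ R : ℝ, ∫⁻ t in Ioo 0 T, ∫⁻ x in Metric.ball 0 R, ‖w' (t, x)‖ₑ ∂(κ t) < ⊤ := by
  set W : ℝ → ℝ → ℝ≥0∞ := fun R t => ∫⁻ x in Metric.ball 0 R, ‖w (t, x)‖ₑ ∂(κ t) with hW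
  have hWm : ∀ R, Measurable (W R) := fun R =>
    Measurable.setLIntegral_kernel_prod_right (f := fun t x => ‖w (t, x)‖ₑ) hw.enorm
      Metric.isOpen_ball.measurableSet
  have hWi : ∀ R, ∫⁻ t in Ioo 0 T, W R t < ⊤ := by
    intro R
    have h1 := (hwi.integrableOn_isCompact
      (isCompact_Icc (a := 0) (b := T) |>.prod (isCompact_closedBall (0 : Space d) R))).mono_set
      (prod_mono Ioo_subset_Icc_self Metric.ball_subset_closedBall)
    have h2 := h1.2
    rw [hasFiniteIntegral_iff_enorm, Measure.setLIntegral_compProd hw.enorm measurableSet_Ioo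
      Metric.isOpen_ball.measurableSet, Measure.restrict_restrict measurableSet_Ioo,
      inter_self] at h2
    exact h2
  -- the vector field is set to zero at the times outside `G`
  set G : Set ℝ := {t | ∀ n : ℕ, W n t < ⊤} with hG
  have hGm : MeasurableSet G := by
    rw [hG, ofPred_forall]
    exact MeasurableSet.iInter fun n => measurableSet_lt (hWm n) measurable_const
  have hGae : ∀ᵐ t ∂(volume.restrict (Ioo 0 T)), t ∈ G :=
    ae_all_iff.2 fun n => ae_lt_top (hWm n) (hWi n).ne
  have hslice : ∀ t ∈ G, ∀ x, (G ×ˢ univ).indicator w (t, x) = w (t, x) := fun t ht x =>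
    indicator_of_mem (mem_prod.2 ⟨ht, mem_univ _⟩) _
  have hslice' : ∀ t ∉ G, ∀ x, (G ×ˢ univ).indicator w (t, x) = 0 := fun t ht x =>
    indicator_of_notMem (fun h => ht h.1) _
  have hle : ∀ y, ‖(G ×ˢ univ).indicator w y‖ₑ ≤ ‖w y‖ₑ := fun y =>
    enorm_indicator_le_enorm_self _ _
  refine ⟨(G ×ˢ univ).indicator w, hw.indicator (hGm.prod MeasurableSet.univ), ?_, fun t => ?_,
    fun R => (lintegral_mono fun t => lintegral_mono fun x => hle _).trans_lt (hWi R)⟩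
  · filter_upwards [Measure.ae_compProd_of_ae_fst κ hGm hGae] with y hy
    exact hslice _ hy _
  · refine ⟨fun x => ?_⟩
    obtain ⟨n, hn⟩ := exists_nat_gt ‖x‖
    refine ⟨Metric.ball 0 n, Metric.isOpen_ball.mem_nhds (by simpa using hn), ?_⟩
    rw [withDensity_apply _ Metric.isOpen_ball.measurableSet]
    by_cases ht : t ∈ G
    · exact (lintegral_mono fun x => hle _).trans_lt (ht n)
    · simp only [hslice' t ht, enorm_zero, lintegral_zero]
      exact ENNReal.zero_lt_top

end LimitFlux

lemma HasDensities.of_ofDensity {m γ μ : Measure (Space d)} {g r : Space d → ℝ}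
    {n : Space d → Space d} (hn : Measurable n)
    (hloc : IsLocallyFiniteMeasure (m.withDensity fun x => ‖n x‖ₑ))
    (hg : Measurable g) (hr : Measurable r) (hg0 : ∀ x, 0 ≤ g x) (hr0 : ∀ x, 0 ≤ r x)
    (hγ : γ = m.withDensity fun x => ENNReal.ofReal (g x))
    (hμ : μ = m.withDensity fun x => ENNReal.ofReal (r x)) :
    HasDensities m γ μ (RadonVectorMeasure.ofDensity m n hn hloc) g r n where
  measurable_g := hg
  measurable_r := hr
  measurable_n := hn
  g_nonneg := hg0
  r_nonneg := hr0
  gamma_eq := hγ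
  mu_eq := hμ
  var_eq := rfl
  dir_eq := Eventually.of_forall fun x => by
    change n x = ‖n x‖ • ‖n x‖⁻¹ • n x
    rcases eq_or_ne (n x) 0 with h | h
    · simp [h]
    · rw [smul_inv_smul₀ (norm_ne_zero_iff.2 h)]

namespace RadonVectorMeasure

variable {m : Measure (Space d)} {n : Space d → Space d} (hn : Measurable n)
  (hloc : IsLocallyFiniteMeasure (m.withDensity fun x => ‖n x‖ₑ))

lemma hasDensities_zero_ofDensity : HasDensities m 0 0 (ofDensity m n hn hloc) 0 0 n :=
  .of_ofDensity hn hloc measurable_const measurable_const (fun _ => le_rfl) (fun _ => le_rfl)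
    (by simp) (by simp)

lemma pairing_ofDensity (ζ : Space d → Space d) :
    (ofDensity m n hn hloc).pairing ζ = ∫ x, inner ℝ (ζ x) (n x) ∂m :=
  (hasDensities_zero_ofDensity hn hloc).pairing_eq ζ

lemma value_ofDensity {B : Set (Space d)} (hB : MeasurableSet B) :
    (ofDensity m n hn hloc).value B = ∫ x in B, n x ∂m :=
  (hasDensities_zero_ofDensity hn hloc).value_eq hB

end RadonVectorMeasure

lemma hasCompactSupport_smul_prod {E : Type*} [NormedAddCommGroup E] [NormedSpace ℝ E]
    {η : ℝ → ℝ} (hη : HasCompactSupport η) {g : Space d → E} (hg : HasCompactSupport g) :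
    HasCompactSupport fun y : ℝ × Space d => η y.1 • g y.2 := by
  refine HasCompactSupport.intro (hη.isCompact.prod hg.isCompact) fun y hy => ?_
  by_cases h : y.1 ∈ tsupport η
  · rw [image_eq_zero_of_notMem_tsupport (f := g) fun h' => hy ⟨h, h'⟩, smul_zero]
  · rw [image_eq_zero_of_notMem_tsupport h, zero_smul]

/-- A function with nonnegative integrals against nonnegative test functions is nonnegative. -/
lemma ae_nonneg_of_forall_integral_mul_nonneg {m : Measure ℝ} {g : ℝ → ℝ} (hg : Integrable g m)
    (h : ∀ η : ℝ → ℝ, Continuous η → HasCompactSupport η → (∀ t, 0 ≤ η t) →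
      0 ≤ ∫ t, η t * g t ∂m) : 0 ≤ᵐ[m] g := by
  refine ae_nonneg_of_forall_setIntegral_nonneg hg fun s hs _ => ?_
  have hfin : IsFiniteMeasure (m.withDensity fun t => ‖g t‖ₑ) :=
    isFiniteMeasure_withDensity hg.2.ne
  refine le_of_forall_pos_le_add fun ε hε => ?_
  obtain ⟨η, hηc, hηε, hη, -⟩ := Integrable.exists_hasCompactSupport_integral_sub_le
    (μ := m.withDensity fun t => ‖g t‖ₑ) (f := s.indicator fun _ => (1 : ℝ))
    ((integrable_const 1).indicator hs) hε
  rw [integral_withDensity_eq_integral_toReal_smul₀ hg.1.enorm (by simp)] at hηε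
  simp only [toReal_enorm, smul_eq_mul] at hηε
  have hη' : Continuous fun t => max (η t) 0 := hη.max continuous_const
  have hηc' : HasCompactSupport fun t => max (η t) 0 :=
    hηc.comp_left (g := fun r : ℝ => max r 0) (by simp)
  have h0 := h _ hη' hηc' fun t => le_max_right _ _
  have hi1 : Integrable (fun t => max (η t) 0 * g t) m := by
    obtain ⟨C, hC⟩ := hηc'.exists_bound_of_continuous hη'
    exact hg.bdd_mul hη'.aestronglyMeasurable (Eventually.of_forall hC)
  have hi2 : Integrable (fun t => ‖g t‖ * ‖s.indicator (fun _ => (1 : ℝ)) t - η t‖) m := by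
    obtain ⟨C, hC⟩ := hηc.exists_bound_of_continuous hη
    refine hg.norm.mul_bdd (c := 1 + C) ?_ (Eventually.of_forall fun t => ?_)
    · exact ((measurable_const.indicator hs).sub hη.measurable).norm.aestronglyMeasurable
    · rw [norm_norm]
      refine (norm_sub_le _ _).trans (add_le_add ?_ (hC t))
      exact (norm_indicator_le_norm_self _ _).trans (by simp)
  have h1 : ∫ t in s, g t ∂m ≥ (∫ t, max (η t) 0 * g t ∂m) -
      ∫ t, ‖g t‖ * ‖s.indicator (fun _ => (1 : ℝ)) t - η t‖ ∂m := by
    rw [← integral_indicator hs, ← integral_sub hi1 hi2]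
    refine integral_mono (hi1.sub hi2) (hg.indicator hs) fun t => ?_
    have hind : s.indicator g t = s.indicator (fun _ => (1 : ℝ)) t * g t := by
      by_cases ht : t ∈ s <;> simp [ht]
    have hmem : 0 ≤ s.indicator (fun _ => (1 : ℝ)) t := indicator_nonneg (fun _ _ => zero_le_one) t
    rw [hind]
    have h2 : |max (η t) 0 - s.indicator (fun _ => (1 : ℝ)) t| ≤
        |s.indicator (fun _ => (1 : ℝ)) t - η t| := by
      rw [abs_sub_comm (s.indicator _ t)]
      conv_lhs => rw [← max_eq_left hmem]
      exact abs_max_sub_max_le_abs _ _ _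
    have h3 : (max (η t) 0 - s.indicator (fun _ => (1 : ℝ)) t) * g t ≤
        |g t| * |s.indicator (fun _ => (1 : ℝ)) t - η t| := by
      refine (le_abs_self _).trans ?_
      rw [abs_mul, mul_comm]
      exact mul_le_mul_of_nonneg_left h2 (abs_nonneg _)
    simp only [Real.norm_eq_abs]
    linarith
  linarith

section LimitFlux

open ProbabilityTheory CompactlySupported

variable {p q : ℝ} {φ : ℝ → Space d → ℝ} {γ : Measure (Space d)} [IsLocallyFiniteMeasure γ] {T : ℝ}
  {μ : ℝ → Measure (Space d)} {m : ℝ → ℝ≥0∞} {μ' : ℕ → ℝ → Measure (Space d)}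
  {ν' : ℕ → ℝ → RadonVectorMeasure d}

/-- The limit flux, disintegrated with respect to time. -/
theorem IsApproximation.exists_flux (hpq : p.HolderConjugate q)
    (hφ : IsActionDensity p φ) (hm1 : ∀ t, m t ≤ 1) (hA : IsApproximation p φ γ T μ m μ' ν')
    (hμ : ∀ t ∈ Icc 0 T, IsLocallyFiniteMeasure (μ t))
    (hcont : ∀ ζ : Space d → ℝ, Continuous ζ → HasCompactSupport ζ →
      ContinuousOn (fun t => ∫ x, ζ x ∂(μ t)) (Icc 0 T)) :
    ∃ ν : ℝ → RadonVectorMeasure d,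
      (∀ B : Set (Space d), MeasurableSet B → Bornology.IsBounded B →
        Measurable fun t : Ioo 0 T => (ν t).value B) ∧
      (∀ R : ℝ, 0 < R → ∫⁻ t in Ioo 0 T, (ν t).var (Metric.ball 0 R) < ⊤) ∧
      (∀ t ∈ Ioo 0 T, (ν t).var ≪ γ + μ t) ∧
      ∀ c : ℝ × Space d → Space d, Continuous c → HasCompactSupport c →
        Tendsto (fun n => ∫ t in Ioo 0 T, (ν' n t).pairing fun x => c (t, x))
          (hyperfilter ℕ : Filter ℕ) (𝓝 (∫ t in Ioo 0 T, (ν t).pairing fun x => c (t, x))) := by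
  obtain ⟨κ, hκs, hκ, hκb⟩ := exists_kernel γ hμ hcont
  obtain ⟨w, hw, hwi, hwt⟩ := hA.exists_tendsto_pairing hpq hφ hm1 hμ hcont hκ hκb
  obtain ⟨w', hw', hww', hloc, hint⟩ := exists_isLocallyFiniteMeasure_slice hw hwi
  have hwt' : ∀ t, Measurable fun x => w' (t, x) := fun t => by fun_prop
  refine ⟨fun t => .ofDensity (κ t) (fun x => w' (t, x)) (hwt' t) (hloc t), fun B hB _ => ?_,
    fun R _ => ?_, fun t ht => ?_, fun c hc hcc => ?_⟩
  · have h1 : ∀ t : ℝ, (RadonVectorMeasure.ofDensity (κ t) (fun x => w' (t, x)) (hwt' t)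
        (hloc t)).value B = ∫ x, (univ ×ˢ B).indicator w' (t, x) ∂(κ t) := fun t => by
      rw [RadonVectorMeasure.value_ofDensity _ _ hB, ← integral_indicator hB]
      refine integral_congr_ae (Eventually.of_forall fun x => ?_)
      by_cases hx : x ∈ B <;> simp [hx, indicator]
    simp only [h1]
    exact ((hw'.indicator (MeasurableSet.univ.prod
      hB)).stronglyMeasurable.integral_kernel_prod_right' (κ := κ)).measurable.comp
      measurable_subtype_coe
  · refine lt_of_eq_of_lt (lintegral_congr fun t => ?_) (hint R)
    exact withDensity_apply _ Metric.isOpen_ball.measurableSet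
  · rw [← hκ t ht]
    exact withDensity_absolutelyContinuous _ _
  · convert hwt c hc hcc using 2
    have hci : Integrable (fun y => inner ℝ (c y) (w' y)) ((volume.restrict (Ioo 0 T)) ⊗ₘ κ) := by
      have hi : ∀ y, ‖inner ℝ (c y) (w y)‖ ≤ ‖‖c y‖ • w y‖ := fun y => by
        rw [norm_smul, norm_norm]; exact norm_inner_le_norm _ _
      have h1 : Integrable (fun y => inner ℝ (c y) (w y)) ((volume.restrict (Ioo 0 T)) ⊗ₘ κ) :=
        (hwi.integrable_smul_left_of_hasCompactSupport hc.norm hcc.norm).mono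
          (hc.measurable.inner hw).aestronglyMeasurable (Eventually.of_forall hi)
      exact h1.congr (hww'.mono fun y hy => by simp only [hy])
    have h2 : ∫ y, inner ℝ (c y) (w y) ∂((volume.restrict (Ioo 0 T)) ⊗ₘ κ) =
        ∫ y, inner ℝ (c y) (w' y) ∂((volume.restrict (Ioo 0 T)) ⊗ₘ κ) :=
      integral_congr_ae (hww'.mono fun y hy => by simp only [hy])
    rw [h2, Measure.integral_compProd hci]
    exact integral_congr_ae (Eventually.of_forall fun t =>
      RadonVectorMeasure.pairing_ofDensity (hwt' t) (hloc t) _)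

/-- Each admissible test value is a lower bound for the action, without any condition on supports.
-/
lemma ofReal_testValue_le_action (hφ : IsActionDensity p φ) (hp : 1 < p) {F : ℕ → Space d → ℝ}
    (hF : IsBumpFamily F) {k : ℕ → ℝ × ℝ × Space d}
    (hk : ∀ g r n, perspective φ g r n = ⨆ i, ENNReal.ofReal (affineForm (k i) g r n))
    {μ : Measure (Space d)} [IsLocallyFiniteMeasure μ] (ν : RadonVectorMeasure d)
    {s : Finset (ℕ × ℕ)} (hs : Admissible F univ s) :
    ENNReal.ofReal (testValue F k γ μ ν s) ≤ action φ γ μ ν := by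
  by_cases h : μ.support ⊆ γ.support ∧ ν.var.support ⊆ γ.support
  · rw [action_eq_iSup_testValue hφ hp hF hk h]
    exact le_iSup₂ (f := fun (s : Finset (ℕ × ℕ)) (_ : Admissible F univ s) =>
      ENNReal.ofReal (testValue F k γ μ ν s)) s hs
  · rw [action, if_neg h]
    exact le_top

lemma ContinuityEqOn.integrableOn_testValue {a b : ℝ} {ν : ℝ → RadonVectorMeasure d}
    (h : ContinuityEqOn a b μ ν) {F : ℕ → Space d → ℝ} (hF : IsBumpFamily F)
    (k : ℕ → ℝ × ℝ × Space d) (γ : Measure (Space d)) (s : Finset (ℕ × ℕ)) :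
    IntegrableOn (fun t => testValue F k γ (μ t) (ν t) s) (Ioo a b) := by
  refine integrable_finsetSum _ fun q _ => ((integrable_const _).add ?_).add ?_
  · exact (((h.weakStar_continuous _ (hF.continuous _)
      (hF.hasCompactSupport _)).integrableOn_compact isCompact_Icc).mono_set
      Ioo_subset_Icc_self).const_mul _
  · exact h.integrableOn_pairing ((hF.continuous _).smul continuous_const)
      (hF.hasCompactSupport _).smul_right

lemma ContinuityEqOn.integral_mul_testValue {a b : ℝ} {ν : ℝ → RadonVectorMeasure d}
    (h : ContinuityEqOn a b μ ν) {F : ℕ → Space d → ℝ} (hF : IsBumpFamily F)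
    (k : ℕ → ℝ × ℝ × Space d) (γ : Measure (Space d)) (s : Finset (ℕ × ℕ)) {η : ℝ → ℝ}
    (hη : Continuous η) (hηc : HasCompactSupport η) :
    ∫ t in Ioo a b, η t * testValue F k γ (μ t) (ν t) s = ∑ q ∈ s,
      ((∫ t in Ioo a b, η t * ((k q.1).1 * ∫ x, F q.2 x ∂γ)) +
        (k q.1).2.1 * (∫ t in Ioo a b, ∫ x, η t • F q.2 x ∂(μ t)) +
        ∫ t in Ioo a b, (ν t).pairing (fun x => η t • F q.2 x • (k q.1).2.2)) := by
  obtain ⟨C, hC⟩ := hηc.exists_bound_of_continuous hη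
  have hb : ∀ {f : ℝ → ℝ}, IntegrableOn f (Ioo a b) → IntegrableOn (fun t => η t * f t) (Ioo a b) :=
    fun hf => hf.bdd_mul hη.aestronglyMeasurable (Eventually.of_forall hC)
  have i1 : ∀ q : ℕ × ℕ, IntegrableOn (fun t => η t * ((k q.1).1 * ∫ x, F q.2 x ∂γ)) (Ioo a b) :=
    fun q => hb (integrable_const _)
  have i2 : ∀ q : ℕ × ℕ, IntegrableOn (fun t => η t * ((k q.1).2.1 * ∫ x, F q.2 x ∂(μ t)))
      (Ioo a b) := fun q => hb ((((h.weakStar_continuous _ (hF.continuous _)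
      (hF.hasCompactSupport _)).integrableOn_compact isCompact_Icc).mono_set
      Ioo_subset_Icc_self).const_mul _)
  have i3 : ∀ q : ℕ × ℕ, IntegrableOn (fun t => η t *
      (ν t).pairing (fun x => F q.2 x • (k q.1).2.2)) (Ioo a b) := fun q =>
    hb (h.integrableOn_pairing ((hF.continuous _).smul continuous_const)
      (hF.hasCompactSupport _).smul_right)
  simp only [testValue, Finset.mul_sum, mul_add]
  refine (integral_finsetSum _ fun q _ => ((i1 q).add (i2 q)).add (i3 q)).trans ?_
  refine Finset.sum_congr rfl fun q _ => ?_
  refine (integral_add ((i1 q).add (i2 q)) (i3 q)).trans ?_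
  refine congrArg₂ _ ((integral_add (i1 q) (i2 q)).trans (congrArg₂ _ rfl ?_)) ?_
  · rw [← integral_const_mul]
    refine integral_congr_ae (Eventually.of_forall fun t => ?_)
    simp only [smul_eq_mul, integral_const_mul]
    ring
  · exact integral_congr_ae (Eventually.of_forall fun t =>
      ((ν t).pairing_smul (η t) fun x => F q.2 x • (k q.1).2.2).symm)

/-- A curve of speed at most one is driven by a flux whose action is at most the `p`-th power of the
speed. -/
theorem IsApproximation.exists_continuityEqOn (hpq : p.HolderConjugate q)
    (hφ : IsActionDensity p φ) (hT : 0 < T) (hm : Measurable m) (hm1 : ∀ t, m t ≤ 1)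
    (hA : IsApproximation p φ γ T μ m μ' ν')
    (hμ : ∀ t ∈ Icc 0 T, IsLocallyFiniteMeasure (μ t))
    (hcont : ∀ ζ : Space d → ℝ, Continuous ζ → HasCompactSupport ζ →
      ContinuousOn (fun t => ∫ x, ζ x ∂(μ t)) (Icc 0 T))
    (hsupp : ∀ t ∈ Ioo 0 T, (μ t).support ⊆ γ.support) :
    ∃ ν : ℝ → RadonVectorMeasure d, ContinuityEqOn 0 T μ ν ∧
      ∀ᵐ t ∂(volume.restrict (Ioo 0 T)), action φ γ (μ t) (ν t) ≤ m t ^ p := by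
  have hp0 : 0 < p := hpq.pos
  obtain ⟨ν, hborel, hloc, hac, hlim⟩ := hA.exists_flux hpq hφ hm1 hμ hcont
  have hce : ContinuityEqOn 0 T μ ν :=
    { locallyFinite := hμ
      weakStar_continuous := hcont
      borel := hborel
      locally_integrable := hloc
      balance := by
        intro ζ hζ hc s t hs hst ht
        have hgc := continuous_gradient hζ
        have hgs := hasCompactSupport_gradient hc
        refine sub_eq_setIntegral_of_weak_deriv hT (hcont ζ hζ.continuous hc)
          (integrableOn_pairing_of_borel hborel hloc hgc hgs) (fun η hη hηc hηs => ?_) hs hst ht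
        have hη' : Continuous (deriv η) := hη.continuous_deriv le_rfl
        have hηc' : HasCompactSupport (deriv η) := hηc.deriv
        have l1 := (hA.tendsto_setIntegral_slice (f := fun y => deriv η y.1 • ζ y.2)
          ((hη'.comp continuous_fst).smul (hζ.continuous.comp continuous_snd))
          (hasCompactSupport_smul_prod hηc' hc)).mono_left Nat.hyperfilter_le_atTop
        have l2 := hlim (fun y => η y.1 • gradient ζ y.2)
          ((hη.continuous.comp continuous_fst).smul (hgc.comp continuous_snd))
          (hasCompactSupport_smul_prod hηc hgs)
        have l3 := l1.add l2
        simp only [smul_eq_mul, integral_const_mul, RadonVectorMeasure.pairing_smul] at l3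
        refine tendsto_nhds_unique l3 (tendsto_const_nhds.congr fun n => ?_)
        exact (((hA.continuityEqOn n).continuityEq hT).integral_deriv_mul_add hζ hc hη hηc hηs).symm }
  refine ⟨ν, hce, ?_⟩
  obtain ⟨F, hF⟩ := exists_isBumpFamily d
  obtain ⟨k, -, hk⟩ := hφ.exists_seq_perspective_eq
  have hmp : ∀ t, m t ^ p ≤ 1 := fun t =>
    (ENNReal.rpow_le_rpow (hm1 t) hp0.le).trans_eq (ENNReal.one_rpow p)
  have hmt : ∀ t, m t ^ p ≠ ⊤ := fun t => ne_top_of_le_ne_top ENNReal.one_ne_top (hmp t)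
  set M : ℝ → ℝ := fun t => (m t ^ p).toReal with hM
  have hM0 : ∀ t, 0 ≤ M t := fun t => ENNReal.toReal_nonneg
  have hMi : IntegrableOn M (Ioo 0 T) := by
    refine (integrable_const (1 : ℝ)).mono' (hm.pow_const p).ennreal_toReal.aestronglyMeasurable
      (Eventually.of_forall fun t => ?_)
    rw [Real.norm_of_nonneg (hM0 t)]
    exact ENNReal.toReal_le_of_le_ofReal zero_le_one (by simpa using hmp t)
  -- each of the countably many test values is at most `m ^ p` almost everywhere
  have hae : ∀ s : Finset (ℕ × ℕ), Admissible F univ s → ∀ᵐ t ∂(volume.restrict (Ioo 0 T)),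
      testValue F k γ (μ t) (ν t) s ≤ M t := by
    intro s hs
    have hti := hce.integrableOn_testValue hF k γ s
    have := ae_nonneg_of_forall_integral_mul_nonneg (hMi.sub hti) fun η hη hηc hη0 => ?_
    · filter_upwards [this] with t ht
      exact sub_nonneg.1 ht
    obtain ⟨C, hC⟩ := hηc.exists_bound_of_continuous hη
    have hb : ∀ {f : ℝ → ℝ}, IntegrableOn f (Ioo 0 T) →
        IntegrableOn (fun t => η t * f t) (Ioo 0 T) :=
      fun hf => hf.bdd_mul hη.aestronglyMeasurable (Eventually.of_forall hC)
    have hsub : ∫ t in Ioo 0 T, η t * (M - fun t => testValue F k γ (μ t) (ν t) s) t =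
        (∫ t in Ioo 0 T, η t * M t) - ∫ t in Ioo 0 T, η t * testValue F k γ (μ t) (ν t) s := by
      rw [← integral_sub (hb hMi) (hb hti)]
      simp only [Pi.sub_apply, mul_sub]
    rw [hsub, sub_nonneg]
    have hηM0 : 0 ≤ ∫ t in Ioo 0 T, η t * M t := integral_nonneg fun t => mul_nonneg (hη0 t) (hM0 t)
    -- the test values converge, and those of the approximations are bounded by their actions
    have hconv : Tendsto (fun n => ∫ t in Ioo 0 T, η t * testValue F k γ (μ' n t) (ν' n t) s)
        (hyperfilter ℕ : Filter ℕ) (𝓝 (∫ t in Ioo 0 T, η t * testValue F k γ (μ t) (ν t) s)) := by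
      rw [hce.integral_mul_testValue hF k γ s hη hηc]
      simp only [fun n => (hA.continuityEqOn n).integral_mul_testValue hF k γ s hη hηc]
      refine tendsto_finsetSum _ fun q _ => (tendsto_const_nhds.add (Tendsto.const_mul _ ?_)).add ?_
      · exact (hA.tendsto_setIntegral_slice (f := fun y => η y.1 • F q.2 y.2)
          ((hη.comp continuous_fst).smul ((hF.continuous _).comp continuous_snd))
          (hasCompactSupport_smul_prod hηc (hF.hasCompactSupport _))).mono_left
          Nat.hyperfilter_le_atTop
      · exact hlim (fun y => η y.1 • F q.2 y.2 • (k q.1).2.2)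
          ((hη.comp continuous_fst).smul (((hF.continuous _).comp continuous_snd).smul
            continuous_const)) (hasCompactSupport_smul_prod (g := fun x => F q.2 x • (k q.1).2.2)
            hηc (hF.hasCompactSupport _).smul_right)
    refine le_of_forall_pos_le_add fun ε hε => le_of_tendsto hconv ?_
    filter_upwards [(hA.eventually_action_le η hη hη0 ε hε).filter_mono
      Nat.hyperfilter_le_atTop] with n hn
    refine (ENNReal.ofReal_le_ofReal_iff (by positivity)).1 ?_
    have h1 : ∫⁻ t in Ioo 0 T, ENNReal.ofReal (η t) * m t ^ p =
        ENNReal.ofReal (∫ t in Ioo 0 T, η t * M t) := by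
      rw [ofReal_integral_eq_lintegral_ofReal (hb hMi)
        (Eventually.of_forall fun t => mul_nonneg (hη0 t) (hM0 t))]
      refine lintegral_congr fun t => ?_
      rw [ENNReal.ofReal_mul (hη0 t), ENNReal.ofReal_toReal (hmt t)]
    rw [ENNReal.ofReal_add hηM0 hε.le, ← h1]
    refine le_trans (ofReal_integral_le_lintegral_ofReal
      (hb ((hA.continuityEqOn n).integrableOn_testValue hF k γ s))) (le_trans ?_ hn)
    refine lintegral_mono_ae ?_
    filter_upwards [ae_restrict_mem measurableSet_Ioo] with t ht
    have := (hA.continuityEqOn n).locallyFinite t (Ioo_subset_Icc_self ht)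
    rw [ENNReal.ofReal_mul (hη0 t)]
    gcongr
    exact ofReal_testValue_le_action hφ hpq.lt hF hk _ hs
  have hall : ∀ᵐ t ∂(volume.restrict (Ioo 0 T)), ∀ s : Finset (ℕ × ℕ), Admissible F univ s →
      testValue F k γ (μ t) (ν t) s ≤ M t := by
    refine ae_all_iff.2 fun s => ?_
    by_cases hs : Admissible F univ s
    · exact (hae s hs).mono fun t ht _ => ht
    · exact Eventually.of_forall fun t h => absurd h hs
  filter_upwards [hall, ae_restrict_mem measurableSet_Ioo] with t ht htI
  have := hμ t (Ioo_subset_Icc_self htI)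
  have hνsupp : (ν t).var.support ⊆ γ.support := by
    refine support_subset_iff_measure_compl.2 (hac t htI ?_)
    rw [Measure.add_apply, Measure.measure_compl_support, zero_add]
    exact support_subset_iff_measure_compl.1 (hsupp t htI)
  rw [action_eq_iSup_testValue hφ hpq.lt hF hk ⟨hsupp t htI, hνsupp⟩]
  refine iSup₂_le fun s hs => ?_
  rw [← ENNReal.ofReal_toReal (hmt t)]
  exact ENNReal.ofReal_le_ofReal (ht s hs)

end LimitFlux

/-! ### Fluxes of absolutely continuous curves -/

/-- Preimages of null sets under a change of time are null, since its derivative is positive. -/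
lemma IsTimeChange.ae_comp {e : ℝ ≃o ℝ} {k : ℝ → ℝ} (hk : IsTimeChange e k) {a b : ℝ}
    {P : ℝ → Prop} (h : ∀ᵐ s ∂(volume.restrict (Ioo (e a) (e b))), P s) :
    ∀ᵐ t ∂(volume.restrict (Ioo a b)), P (e t) := by
  rw [ae_restrict_iff' measurableSet_Ioo] at h ⊢
  have h1 := hk.measurePreserving.quasiMeasurePreserving.ae h
  rw [ae_withDensity_iff hk.measurable.ennreal_ofReal] at h1
  filter_upwards [h1] with t ht htI
  exact ht (by simpa using hk.pos t) ⟨e.strictMono htI.1, e.strictMono htI.2⟩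

section Flux

variable {p q : ℝ} {φ : ℝ → Space d → ℝ} {γ : Measure (Space d)} [IsLocallyFiniteMeasure γ] {T : ℝ}
  {μ : ℝ → Measure (Space d)} {m : ℝ → ℝ≥0∞}

/-- A curve with integrable speed is driven by a flux whose action is at most the `p`-th power of
the speed. -/
theorem IsSpeedBound.exists_continuityEqOn (hpq : p.HolderConjugate q) (hφ : IsActionDensity p φ)
    (hT : 0 < T) (h : IsSpeedBound p φ γ T μ m)
    (hμ : ∀ t ∈ Icc 0 T, IsLocallyFiniteMeasure (μ t)) :
    ∃ ν : ℝ → RadonVectorMeasure d, ContinuityEqOn 0 T μ ν ∧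
      ∀ᵐ t ∂(volume.restrict (Ioo 0 T)), action φ γ (μ t) (ν t) ≤ m t ^ p := by
  have hp0 : 0 < p := hpq.pos
  have hmfin : ∀ᵐ t ∂(volume.restrict (Ioo 0 T)), m t < ⊤ :=
    ae_lt_top h.measurable h.lintegral_lt_top.ne
  -- in the new time `s` with `ds/dt = 1 + m` the curve has speed at most `m / (1 + m)`
  obtain ⟨e, k, hk, hkm, he0, heT⟩ := IsTimeChange.exists_of_integrableOn hT.le
    (h := fun t => 1 + (m t).toReal) (h.measurable.ennreal_toReal.const_add 1)
    (fun t => by positivity) ((integrable_const (1 : ℝ)).add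
      (integrable_toReal_of_lintegral_ne_top h.measurable.aemeasurable h.lintegral_lt_top.ne))
  have hS : 0 < e T := by rw [← he0]; exact e.strictMono hT
  set m' : ℝ → ℝ≥0∞ := fun s =>
    min 1 (ENNReal.ofReal ((m (e.symm s)).toReal / (1 + (m (e.symm s)).toReal))) with hm'
  have hm'm : Measurable m' := by
    have h1 : Measurable fun s => (m (e.symm s)).toReal :=
      (h.measurable.comp e.symm.toHomeomorph.continuous.measurable).ennreal_toReal
    exact measurable_const.min (h1.div (h1.const_add 1)).ennreal_ofReal
  have hkm' : ∀ᵐ t ∂(volume.restrict (Ioo 0 T)), ENNReal.ofReal (k t) * m' (e t) = m t := by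
    filter_upwards [hmfin, ae_restrict_mem measurableSet_Ioo] with t ht htI
    have h0 : 0 ≤ (m t).toReal := ENNReal.toReal_nonneg
    have h1 : (m t).toReal / (1 + (m t).toReal) ≤ 1 := by
      rw [div_le_one (by positivity)]; linarith
    simp only [hm', OrderIso.symm_apply_apply]
    rw [min_eq_right (ENNReal.ofReal_le_one.2 h1), hkm t htI, ← ENNReal.ofReal_mul (by positivity),
      mul_div_cancel₀ _ (by positivity), ENNReal.ofReal_toReal ht.ne]
  have hmem : ∀ s ∈ Icc 0 (e T), e.symm s ∈ Icc 0 T := fun s hs =>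
    ⟨by rw [← he0] at hs; simpa using e.symm.monotone hs.1, by simpa using e.symm.monotone hs.2⟩
  have h' : IsSpeedBound p φ γ (e T) (fun s => μ (e.symm s)) m' := by
    refine ⟨hm'm, ?_, fun s t hs hst ht => ?_⟩
    · refine (lintegral_mono fun s => min_le_left _ _).trans_lt ?_
      rw [setLIntegral_const, Real.volume_Ioo, one_mul]
      exact ENNReal.ofReal_lt_top
    · have hs' := (hmem s ⟨hs, hst.le.trans ht⟩).1
      have ht' := (hmem t ⟨hs.trans hst.le, ht⟩).2
      refine (h.wDist_le _ _ hs' (e.symm.strictMono hst) ht').trans_eq ?_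
      have h1 := hk.setLIntegral_comp m' (e.symm s) (e.symm t)
      rw [e.apply_symm_apply, e.apply_symm_apply] at h1
      rw [← h1]
      exact lintegral_congr_ae ((ae_restrict_of_ae_restrict_of_subset (Ioo_subset_Ioo hs' ht')
        hkm').mono fun r hr => hr.symm)
  have hμ' : ∀ s ∈ Icc 0 (e T), IsLocallyFiniteMeasure (μ (e.symm s)) := fun s hs =>
    hμ _ (hmem s hs)
  have hm1 : ∀ s, m' s ≤ 1 := fun s => min_le_left _ _
  obtain ⟨μ'', ν'', hA⟩ := h'.exists_isApproximation hpq hφ hS hm1 hμ'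
  obtain ⟨ν, hν, hact⟩ := hA.exists_continuityEqOn hpq hφ hS hm'm hm1 hμ'
    (fun ζ hζ hc => h'.continuousOn_integral hpq hφ hS hμ' hζ hc)
    (fun s hs => h'.support_subset hφ hpq.lt hS (Ioo_subset_Icc_self hs))
  rw [← he0] at hν hact
  have hν' := hν.comp_timeChange hk
  simp only [e.symm_apply_apply] at hν'
  refine ⟨_, hν', ?_⟩
  filter_upwards [hk.ae_comp hact, hkm', ae_restrict_mem measurableSet_Ioo] with t ht htm htI
  have h1 := hν.action_comp_timeChange hφ hpq.lt (γ := γ) hk (Ioo_subset_Icc_self htI)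
  simp only [e.symm_apply_apply] at h1 ht
  rw [h1, ← htm, ENNReal.mul_rpow_of_nonneg _ _ hp0.le,
    ENNReal.ofReal_rpow_of_nonneg (hk.pos t).le hp0.le]
  gcongr

/-- The action of a flux, to the power `1/p`, bounds the speed of the curve. The bound is replaced
by an almost everywhere equal Borel function since the action is only known to be a.e.-measurable in
time. -/
lemma ContinuityEqOn.exists_isSpeedBound (hφ : IsActionDensity p φ) (hp : 1 < p)
    {ν : ℝ → RadonVectorMeasure d} (h : ContinuityEqOn 0 T μ ν)
    (hL : actionLength p φ γ T μ ν < ⊤) :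
    ∃ m, IsSpeedBound p φ γ T μ m ∧
      ∀ᵐ t ∂(volume.restrict (Ioo 0 T)), m t = action φ γ (μ t) (ν t) ^ (1 / p) := by
  have hae := (h.aemeasurable_action hφ hp γ).pow_const (1 / p)
  refine ⟨hae.mk _, ⟨hae.measurable_mk, ?_, fun s t hs hst ht => ?_⟩, hae.ae_eq_mk.symm⟩
  · exact (lintegral_congr_ae hae.ae_eq_mk.symm).trans_lt hL
  · rw [wDist_symm hφ hp]
    refine (wDist_le_length hφ hp hst (h.restrict hs ht)).trans_eq (lintegral_congr_ae ?_)
    exact ae_restrict_of_ae_restrict_of_subset (Ioo_subset_Ioo hs ht) hae.ae_eq_mk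

end Flux

/-! ### Uniqueness of the optimal flux -/

section Midpoint

variable {p : ℝ} {φ : ℝ → Space d → ℝ} {γ : Measure (Space d)}

/-- `ν''` is the midpoint of `ν` and `ν'`, by way of densities with respect to a common reference
measure. -/
def IsMidpoint (γ μ : Measure (Space d)) (ν ν' ν'' : RadonVectorMeasure d) : Prop :=
  ∃ (m : Measure (Space d)) (g r : Space d → ℝ) (n n' : Space d → Space d),
    HasDensities m γ μ ν g r n ∧ HasDensities m γ μ ν' g r n' ∧
      HasDensities m γ μ ν'' g r fun x => (1 / 2 : ℝ) • n x + (1 / 2 : ℝ) • n' x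

lemma enorm_midpoint_le (a b : Space d) :
    ‖(1 / 2 : ℝ) • a + (1 / 2 : ℝ) • b‖ₑ ≤ ‖a‖ₑ + ‖b‖ₑ := by
  have h : ∀ c : Space d, ‖(1 / 2 : ℝ) • c‖ₑ ≤ ‖c‖ₑ := fun c => by
    refine enorm_le_iff_norm_le.2 ?_
    rw [norm_smul, Real.norm_of_nonneg (by norm_num)]
    linarith [norm_nonneg c]
  exact (enorm_add_le _ _).trans (add_le_add (h a) (h b))

/-- The densities of `ν` and `ν'` are taken with respect to `γ + μ + |ν| + |ν'|`. -/
lemma exists_isMidpoint (γ μ : Measure (Space d)) [IsLocallyFiniteMeasure γ]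
    [IsLocallyFiniteMeasure μ] (ν ν' : RadonVectorMeasure d) : ∃ ν'', IsMidpoint γ μ ν ν' ν'' := by
  set m := γ + μ + (ν.var + ν'.var)
  have hm : ν.var + ν'.var ≤ m := Measure.le_add_left le_rfl
  obtain ⟨g, r, n, h⟩ := exists_hasDensities m γ μ ν
    (Measure.absolutelyContinuous_of_le ((Measure.le_add_right le_rfl).trans
      (Measure.le_add_right le_rfl)))
    (Measure.absolutelyContinuous_of_le ((Measure.le_add_left le_rfl).trans
      (Measure.le_add_right le_rfl)))
    (Measure.absolutelyContinuous_of_le ((Measure.le_add_right le_rfl).trans hm))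
  obtain ⟨n', hn', hvar', hdir'⟩ := exists_vector_density (m := m) ν'
    (Measure.absolutelyContinuous_of_le ((Measure.le_add_left le_rfl).trans hm))
  have hn := h.measurable_n
  have hmid : Measurable fun x => (1 / 2 : ℝ) • n x + (1 / 2 : ℝ) • n' x := by fun_prop
  have hle : m.withDensity (fun x => ‖(1 / 2 : ℝ) • n x + (1 / 2 : ℝ) • n' x‖ₑ) ≤
      ν.var + ν'.var := by
    rw [h.var_eq, hvar', ← withDensity_add_left hn.enorm]
    exact withDensity_mono (Eventually.of_forall fun x => enorm_midpoint_le _ _)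
  exact ⟨.ofDensity m _ hmid (Measure.isLocallyFiniteMeasure_of_le hle), m, g, r, n, n', h,
    ⟨h.measurable_g, h.measurable_r, hn', h.g_nonneg, h.r_nonneg, h.gamma_eq, h.mu_eq, hvar', hdir'⟩,
    .of_ofDensity hmid _ h.measurable_g h.measurable_r h.g_nonneg h.r_nonneg h.gamma_eq h.mu_eq⟩

lemma perspective_midpoint_le (φ : ℝ → Space d → ℝ) (g r : ℝ) (n n' : Space d) :
    perspective φ g r ((1 / 2 : ℝ) • n + (1 / 2 : ℝ) • n') ≤
      ENNReal.ofReal (1 / 2) * perspective φ g r n +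
        ENNReal.ofReal (1 / 2) * perspective φ g r n' := by
  rw [← perspective_smul φ (by norm_num), ← perspective_smul φ (by norm_num)]
  refine le_trans (le_of_eq ?_) (perspective_add_le φ _ _ _ _ _ _)
  congr 1 <;> ring

namespace IsMidpoint

variable {μ : Measure (Space d)} {ν ν' ν'' : RadonVectorMeasure d}

lemma var_le (h : IsMidpoint γ μ ν ν' ν'') : ν''.var ≤ ν.var + ν'.var := by
  obtain ⟨m, g, r, n, n', h, h', h''⟩ := h
  rw [h.var_eq, h'.var_eq, h''.var_eq, ← withDensity_add_left h.measurable_n.enorm]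
  exact withDensity_mono (Eventually.of_forall fun x => enorm_midpoint_le _ _)

lemma value_eq (h : IsMidpoint γ μ ν ν' ν'') {B : Set (Space d)} (hB : MeasurableSet B)
    (hBb : Bornology.IsBounded B) :
    ν''.value B = (1 / 2 : ℝ) • ν.value B + (1 / 2 : ℝ) • ν'.value B := by
  obtain ⟨m, g, r, n, n', h, h', h''⟩ := h
  have hi : ∀ {n : Space d → Space d}, LocallyIntegrable n m → IntegrableOn n B m := fun hn =>
    (hn.integrableOn_isCompact hBb.isCompact_closure).mono_set subset_closure
  rw [h.value_eq hB, h'.value_eq hB, h''.value_eq hB, ← integral_smul, ← integral_smul]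
  exact integral_add ((hi h.locallyIntegrable_n).smul (1 / 2 : ℝ))
    ((hi h'.locallyIntegrable_n).smul (1 / 2 : ℝ))

lemma pairing_eq (h : IsMidpoint γ μ ν ν' ν'') {ζ : Space d → Space d} (hζ : Continuous ζ)
    (hc : HasCompactSupport ζ) :
    ν''.pairing ζ = 1 / 2 * ν.pairing ζ + 1 / 2 * ν'.pairing ζ := by
  obtain ⟨m, g, r, n, n', h, h', h''⟩ := h
  have hi : ∀ {n : Space d → Space d}, Measurable n → LocallyIntegrable n m →
      Integrable (fun x => inner ℝ (ζ x) (n x)) m := fun {n} hn hn' => by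
    refine (hn'.integrable_smul_left_of_hasCompactSupport hζ.norm hc.norm).mono
      (hζ.measurable.inner hn).aestronglyMeasurable (Eventually.of_forall fun x => ?_)
    rw [norm_smul, norm_norm]
    exact norm_inner_le_norm _ _
  rw [h.pairing_eq, h'.pairing_eq, h''.pairing_eq, ← integral_const_mul, ← integral_const_mul,
    ← integral_add ((hi h.measurable_n h.locallyIntegrable_n).const_mul _)
      ((hi h'.measurable_n h'.locallyIntegrable_n).const_mul _)]
  simp only [inner_add_right, inner_smul_right]

lemma support_subset (h : IsMidpoint γ μ ν ν' ν'') (hν : ν.var.support ⊆ γ.support)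
    (hν' : ν'.var.support ⊆ γ.support) : ν''.var.support ⊆ γ.support := by
  rw [support_subset_iff_measure_compl] at *
  refine nonpos_iff_eq_zero.1 ((h.var_le _).trans ?_)
  rw [Measure.add_apply, hν, hν', add_zero]

variable [IsLocallyFiniteMeasure γ] [IsLocallyFiniteMeasure μ]

/-- The action is convex in the flux. -/
lemma action_le (h : IsMidpoint γ μ ν ν' ν'') (hφ : IsActionDensity p φ) (hp : 1 < p)
    (hν : action φ γ μ ν ≠ ⊤) (hν' : action φ γ μ ν' ≠ ⊤) :
    action φ γ μ ν'' ≤ ENNReal.ofReal (1 / 2) * action φ γ μ ν +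
      ENNReal.ofReal (1 / 2) * action φ γ μ ν' := by
  have hs := support_subset_of_action_ne_top hν
  have hs' := support_subset_of_action_ne_top hν'
  have hs'' := h.support_subset hs.2 hs'.2
  obtain ⟨m, g, r, n, n', h, h', h''⟩ := h
  rw [action_eq_lintegral_perspective hφ hp h hs, action_eq_lintegral_perspective hφ hp h' hs',
    action_eq_lintegral_perspective hφ hp h'' ⟨hs.1, hs''⟩,
    ← lintegral_const_mul' _ _ ENNReal.ofReal_ne_top,
    ← lintegral_const_mul' _ _ ENNReal.ofReal_ne_top,
    ← lintegral_add_left ((hφ.measurable_perspective h.measurable_g h.measurable_r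
      h.measurable_n).const_mul _)]
  exact lintegral_mono fun x => perspective_midpoint_le φ _ _ _ _

/-- Strict convexity: if the midpoint has at least the common action of `ν` and `ν'`, then
`ν = ν'`. -/
lemma sameMeasure (h : IsMidpoint γ μ ν ν' ν'') (hφ : IsActionDensity p φ) (hp : 1 < p)
    (hs : StrictlyConvexInFlux φ) (hν : action φ γ μ ν ≠ ⊤)
    (hνν' : action φ γ μ ν = action φ γ μ ν') (hmid : action φ γ μ ν ≤ action φ γ μ ν'') :
    ν.SameMeasure ν' := by
  have hν' : action φ γ μ ν' ≠ ⊤ := hνν' ▸ hν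
  have hs1 := support_subset_of_action_ne_top hν
  have hs2 := support_subset_of_action_ne_top hν'
  have hs3 := h.support_subset hs1.2 hs2.2
  obtain ⟨m, g, r, n, n', h, h', h''⟩ := h
  set P := fun x => perspective φ (g x) (r x) (n x) with hP
  set P' := fun x => perspective φ (g x) (r x) (n' x) with hP'
  set P'' := fun x => perspective φ (g x) (r x) ((1 / 2 : ℝ) • n x + (1 / 2 : ℝ) • n' x) with hP''
  have hPm : Measurable P := hφ.measurable_perspective h.measurable_g h.measurable_r h.measurable_n
  have hPm' : Measurable P' :=
    hφ.measurable_perspective h.measurable_g h.measurable_r h'.measurable_n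
  have e1 : action φ γ μ ν = ∫⁻ x, P x ∂m := action_eq_lintegral_perspective hφ hp h hs1
  have e2 : action φ γ μ ν' = ∫⁻ x, P' x ∂m := action_eq_lintegral_perspective hφ hp h' hs2
  have e3 : action φ γ μ ν'' = ∫⁻ x, P'' x ∂m :=
    action_eq_lintegral_perspective hφ hp h'' ⟨hs1.1, hs3⟩
  have hsum : ∫⁻ x, (ENNReal.ofReal (1 / 2) * P x + ENNReal.ofReal (1 / 2) * P' x) ∂m =
      action φ γ μ ν := by
    rw [lintegral_add_left (hPm.const_mul _), lintegral_const_mul' _ _ ENNReal.ofReal_ne_top,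
      lintegral_const_mul' _ _ ENNReal.ofReal_ne_top, ← e1, ← e2, ← hνν', ← add_mul,
      ← ENNReal.ofReal_add (by norm_num) (by norm_num), add_halves, ENNReal.ofReal_one, one_mul]
  have hle : P'' ≤ᵐ[m] fun x => ENNReal.ofReal (1 / 2) * P x + ENNReal.ofReal (1 / 2) * P' x :=
    Eventually.of_forall fun x => perspective_midpoint_le φ _ _ _ _
  have hP''fin : ∫⁻ x, P'' x ∂m ≠ ⊤ :=
    ne_top_of_le_ne_top hν ((lintegral_mono_ae hle).trans_eq hsum)
  -- the pointwise convexity inequality is an equality almost everywhere, as the integrals agree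
  have heq := ae_eq_of_ae_le_of_lintegral_le hle hP''fin
    ((hPm.const_mul _).add (hPm'.const_mul _)).aemeasurable (by rw [hsum, ← e3]; exact hmid)
  have hnn' : n =ᵐ[m] n' := by
    filter_upwards [heq, ae_lt_top hPm (e1 ▸ hν), ae_lt_top hPm' (e2 ▸ hν')] with x hx hx1 hx2
    by_contra hne
    exact (hφ.perspective_midpoint_lt hp hs (h.g_nonneg x) (h.r_nonneg x) hx1.ne hx2.ne hne).ne hx
  intro B hB _
  rw [h.value_eq hB, h'.value_eq hB]
  exact integral_congr_ae (ae_restrict_of_ae hnn')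

end IsMidpoint

/-- The continuity equation is affine in the flux. -/
lemma ContinuityEqOn.midpoint {a b : ℝ} {μ : ℝ → Measure (Space d)}
    {ν ν' ν'' : ℝ → RadonVectorMeasure d} (h : ContinuityEqOn a b μ ν)
    (h' : ContinuityEqOn a b μ ν') (hm : ∀ t ∈ Ioo a b, IsMidpoint γ (μ t) (ν t) (ν' t) (ν'' t)) :
    ContinuityEqOn a b μ ν'' where
  locallyFinite := h.locallyFinite
  weakStar_continuous := h.weakStar_continuous
  borel B hB hBb := by
    simp only [fun t : Ioo a b => (hm t t.2).value_eq hB hBb]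
    exact ((h.borel B hB hBb).const_smul (1 / 2 : ℝ)).add
      ((h'.borel B hB hBb).const_smul (1 / 2 : ℝ))
  locally_integrable R hR := by
    have hle : ∫⁻ t in Ioo a b, (ν'' t).var (Metric.ball 0 R) ≤
        ∫⁻ t in Ioo a b, ((ν t).var (Metric.ball 0 R) + (ν' t).var (Metric.ball 0 R)) :=
      setLIntegral_mono' measurableSet_Ioo fun t ht => (hm t ht).var_le _
    rw [lintegral_add_left' (h.aemeasurable_var Metric.isOpen_ball.measurableSet)] at hle
    exact hle.trans_lt (ENNReal.add_lt_top.2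
      ⟨h.locally_integrable R hR, h'.locally_integrable R hR⟩)
  balance ζ hζ hc s t hs hst ht := by
    have hgc := continuous_gradient hζ
    have hgs := hasCompactSupport_gradient hc
    have hsub := Ioo_subset_Ioo hs ht
    have e : ∫ r in Ioo s t, (ν'' r).pairing (gradient ζ) =
        ∫ r in Ioo s t, (1 / 2 * (ν r).pairing (gradient ζ) +
          1 / 2 * (ν' r).pairing (gradient ζ)) :=
      setIntegral_congr_fun measurableSet_Ioo fun r hr => (hm r (hsub hr)).pairing_eq hgc hgs
    rw [e, integral_add (((h.integrableOn_pairing hgc hgs).mono_set hsub).const_mul _)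
      (((h'.integrableOn_pairing hgc hgs).mono_set hsub).const_mul _), integral_const_mul,
      integral_const_mul, ← h.balance ζ hζ hc s t hs hst ht, ← h'.balance ζ hζ hc s t hs hst ht]
    ring

end Midpoint

/-! ### Metric derivative and action -/

section MetricDeriv

variable {p : ℝ} {φ : ℝ → Space d → ℝ} {γ : Measure (Space d)} {T : ℝ}
  {μ : ℝ → Measure (Space d)} {m : ℝ → ℝ≥0∞}

lemma actionLength_lt_top (hp : 1 < p) (h : IsSpeedBound p φ γ T μ m)
    {ν : ℝ → RadonVectorMeasure d}
    (hν : ∀ᵐ t ∂(volume.restrict (Ioo 0 T)), action φ γ (μ t) (ν t) ≤ m t ^ p) :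
    actionLength p φ γ T μ ν < ⊤ := by
  have hp0 : 0 < p := by linarith
  refine (lintegral_mono_ae ?_).trans_lt h.lintegral_lt_top
  filter_upwards [hν] with t ht
  refine (ENNReal.rpow_le_rpow ht (by positivity)).trans_eq ?_
  rw [← ENNReal.rpow_mul, mul_one_div_cancel hp0.ne', ENNReal.rpow_one]

variable [IsLocallyFiniteMeasure γ]

/-- The metric derivative exists almost everywhere and is the smallest speed bound. -/
lemma IsSpeedBound.exists_metricDeriv (hφ : IsActionDensity p φ) (hp : 1 < p) (hT : 0 < T)
    (h : IsSpeedBound p φ γ T μ m) :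
    ∃ v, IsSpeedBound p φ γ T μ v ∧ ∀ᵐ t ∂(volume.restrict (Ioo 0 T)),
      metricDeriv p φ γ μ t = v t ∧ v t < ⊤ ∧
        Tendsto (speedQuotient p φ γ μ t) (𝓝[≠] 0) (𝓝 (v t)) := by
  obtain ⟨v, hv, hvm, hvD, hvt⟩ := exists_metric_derivative (D := fun s t => wDist p φ γ (μ s) (μ t))
    hT (fun s t => wDist_symm hφ hp _ _) (fun r s t => wDist_triangle hφ hp _ _ _)
    h.measurable.aemeasurable h.lintegral_lt_top h.wDist_le
  have hfin := (lintegral_mono_ae hvm).trans_lt h.lintegral_lt_top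
  refine ⟨v, ⟨hv, hfin, hvD⟩, ?_⟩
  filter_upwards [hvt, ae_lt_top hv hfin.ne] with t ht hfin
  exact ⟨ht.limsup_eq, hfin, ht⟩

/-- The metric derivative is at most any speed bound, in particular the one given by the action. -/
lemma ContinuityEqOn.metricDeriv_rpow_le (hφ : IsActionDensity p φ) (hp : 1 < p) (hT : 0 < T)
    {ν : ℝ → RadonVectorMeasure d} (h : ContinuityEqOn 0 T μ ν)
    (hL : actionLength p φ γ T μ ν < ⊤) :
    ∀ᵐ t ∂(volume.restrict (Ioo 0 T)), metricDeriv p φ γ μ t ^ p ≤ action φ γ (μ t) (ν t) := by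
  obtain ⟨m, hm, hma⟩ := h.exists_isSpeedBound hφ hp hL
  filter_upwards [ae_limsup_quotient_le (D := fun s t => wDist p φ γ (μ s) (μ t)) hT
    (fun s t => wDist_symm hφ hp _ _) hm.measurable.aemeasurable hm.lintegral_lt_top hm.wDist_le,
    hma] with t ht hmt
  have hp0 : 0 < p := by linarith
  calc metricDeriv p φ γ μ t ^ p ≤ m t ^ p := ENNReal.rpow_le_rpow ht hp0.le
    _ = action φ γ (μ t) (ν t) := by
      rw [hmt, ← ENNReal.rpow_mul, one_div_mul_cancel hp0.ne', ENNReal.rpow_one]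

/-- Uniqueness of the optimal flux: the midpoint of two optimal fluxes drives the same curve, so its
action is at least the `p`-th power of the metric derivative, which contradicts strict convexity
unless the fluxes agree. -/
lemma IsSpeedBound.ae_sameMeasure (hφ : IsActionDensity p φ) (hp : 1 < p) (hT : 0 < T)
    (h : IsSpeedBound p φ γ T μ m) (hs : StrictlyConvexInFlux φ)
    (hm : ∀ᵐ t ∂(volume.restrict (Ioo 0 T)), metricDeriv p φ γ μ t = m t)
    {ν ν' : ℝ → RadonVectorMeasure d} (hν : ContinuityEqOn 0 T μ ν)
    (hν' : ContinuityEqOn 0 T μ ν')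
    (ha : ∀ᵐ t ∂(volume.restrict (Ioo 0 T)),
      metricDeriv p φ γ μ t ^ p = action φ γ (μ t) (ν t))
    (ha' : ∀ᵐ t ∂(volume.restrict (Ioo 0 T)),
      metricDeriv p φ γ μ t ^ p = action φ γ (μ t) (ν' t)) :
    ∀ᵐ t ∂(volume.restrict (Ioo 0 T)), (ν t).SameMeasure (ν' t) := by
  have hp0 : 0 < p := by linarith
  have hex : ∀ t, ∃ ν'', t ∈ Ioo 0 T → IsMidpoint γ (μ t) (ν t) (ν' t) ν'' := fun t => by
    by_cases ht : t ∈ Ioo 0 T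
    · have := hν.locallyFinite t (Ioo_subset_Icc_self ht)
      exact (exists_isMidpoint γ (μ t) (ν t) (ν' t)).imp fun _ h _ => h
    · exact ⟨ν t, fun h => absurd h ht⟩
  choose ν'' hν'' using hex
  have hce := hν.midpoint hν' hν''
  have hfin : ∀ᵐ t ∂(volume.restrict (Ioo 0 T)), m t ^ p ≠ ⊤ := by
    filter_upwards [ae_lt_top h.measurable h.lintegral_lt_top.ne] with t ht
    exact ENNReal.rpow_ne_top_of_nonneg hp0.le ht.ne
  have hle : ∀ᵐ t ∂(volume.restrict (Ioo 0 T)), action φ γ (μ t) (ν'' t) ≤ m t ^ p := by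
    filter_upwards [hm, ha, ha', hfin, ae_restrict_mem measurableSet_Ioo] with t h1 h2 h3 h4 ht
    have := hν.locallyFinite t (Ioo_subset_Icc_self ht)
    rw [h1] at h2 h3
    refine ((hν'' t ht).action_le hφ hp (h2 ▸ h4) (h3 ▸ h4)).trans_eq ?_
    rw [← h2, ← h3, ← add_mul, ← ENNReal.ofReal_add (by norm_num) (by norm_num), add_halves,
      ENNReal.ofReal_one, one_mul]
  filter_upwards [hce.metricDeriv_rpow_le hφ hp hT (actionLength_lt_top hp h hle), hm, ha, ha',
    hfin, ae_restrict_mem measurableSet_Ioo] with t h0 h1 h2 h3 h4 ht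
  have := hν.locallyFinite t (Ioo_subset_Icc_self ht)
  exact (hν'' t ht).sameMeasure hφ hp hs (by rw [← h2, h1]; exact h4) (h2.symm.trans h3) (h2 ▸ h0)

end MetricDeriv

end WeightedTransport

end

theorem mainTheorem10 {d : ℕ} (p : ℝ) (hp : 1 < p)
    (φ : ℝ → Space d → ℝ) (hφ : IsActionDensity p φ)
    (γ : Measure (Space d)) [IsLocallyFiniteMeasure γ]
    (T : ℝ) (hT : 0 < T)
    (μ : ℝ → Measure (Space d)) (hμ : ∀ t ∈ Icc 0 T, IsLocallyFiniteMeasure (μ t)) :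
    (AbsContCurve p φ γ T μ ↔
      ∃ ν : ℝ → RadonVectorMeasure d, ContinuityEq T μ ν ∧ actionLength p φ γ T μ ν < ⊤) ∧
    (AbsContCurve p φ γ T μ →
      -- the metric derivative exists, as a finite limit, at almost every time
      (∀ᵐ t ∂(volume.restrict (Ioo 0 T)),
        Tendsto (speedQuotient p φ γ μ t) (𝓝[≠] 0) (𝓝 (metricDeriv p φ γ μ t)) ∧
          metricDeriv p φ γ μ t < ⊤) ∧
      -- it is bounded by the action of every admissible flux
      (∀ ν : ℝ → RadonVectorMeasure d, ContinuityEq T μ ν → actionLength p φ γ T μ ν < ⊤ →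
        ∀ᵐ t ∂(volume.restrict (Ioo 0 T)),
          metricDeriv p φ γ μ t ^ p ≤ action φ γ (μ t) (ν t)) ∧
      -- there is an optimal flux, unique when the density is strictly convex in the flux
      ∃ νopt : ℝ → RadonVectorMeasure d,
        ContinuityEq T μ νopt ∧ actionLength p φ γ T μ νopt < ⊤ ∧
        (∀ᵐ t ∂(volume.restrict (Ioo 0 T)),
          metricDeriv p φ γ μ t ^ p = action φ γ (μ t) (νopt t)) ∧
        (StrictlyConvexInFlux φ →
          ∀ ν : ℝ → RadonVectorMeasure d, ContinuityEq T μ ν →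
            (∀ᵐ t ∂(volume.restrict (Ioo 0 T)),
              metricDeriv p φ γ μ t ^ p = action φ γ (μ t) (ν t)) →
            ∀ᵐ t ∂(volume.restrict (Ioo 0 T)), (ν t).SameMeasure (νopt t))) := by
  have hpq := Real.HolderConjugate.conjExponent hp
  have key : ∀ m, IsSpeedBound p φ γ T μ m → ∃ ν : ℝ → RadonVectorMeasure d,
      ContinuityEq T μ ν ∧ actionLength p φ γ T μ ν < ⊤ ∧
        ∀ᵐ t ∂(volume.restrict (Ioo 0 T)), action φ γ (μ t) (ν t) ≤ m t ^ p := by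
    intro m hm
    obtain ⟨ν, hν, hνm⟩ := hm.exists_continuityEqOn hpq hφ hT hμ
    exact ⟨ν, hν.continuityEq hT, actionLength_lt_top hp hm hνm, hνm⟩
  refine ⟨⟨fun h => ?_, fun ⟨ν, hν, hL⟩ => ?_⟩, fun h => ?_⟩
  · obtain ⟨m, hm⟩ := absContCurve_iff.1 h
    obtain ⟨ν, hν, hL, -⟩ := key m hm
    exact ⟨ν, hν, hL⟩
  · obtain ⟨m, hm, -⟩ := (hν.continuityEqOn hT).exists_isSpeedBound hφ hp hL
    exact absContCurve_iff.2 ⟨m, hm⟩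
  · obtain ⟨m, hm⟩ := absContCurve_iff.1 h
    obtain ⟨v, hv, hder⟩ := hm.exists_metricDeriv hφ hp hT
    have hbound : ∀ ν : ℝ → RadonVectorMeasure d, ContinuityEq T μ ν →
        actionLength p φ γ T μ ν < ⊤ → ∀ᵐ t ∂(volume.restrict (Ioo 0 T)),
          metricDeriv p φ γ μ t ^ p ≤ action φ γ (μ t) (ν t) := fun ν hν hL =>
      (hν.continuityEqOn hT).metricDeriv_rpow_le hφ hp hT hL
    -- the metric derivative is itself a speed bound, and the flux it yields is optimal
    obtain ⟨ν, hν, hL, hνv⟩ := key v hv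
    have hopt : ∀ᵐ t ∂(volume.restrict (Ioo 0 T)),
        metricDeriv p φ γ μ t ^ p = action φ γ (μ t) (ν t) := by
      filter_upwards [hbound ν hν hL, hνv, hder] with t h1 h2 h3
      exact le_antisymm h1 (h2.trans_eq (by rw [h3.1]))
    refine ⟨?_, hbound, ν, hν, hL, hopt, fun hs ν' hν' hopt' => ?_⟩
    · filter_upwards [hder] with t ht
      rw [ht.1]
      exact ⟨ht.2.2, ht.2.1⟩
    · exact hv.ae_sameMeasure hφ hp hT hs (hder.mono fun t ht => ht.1) (hν'.continuityEqOn hT)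
        (hν.continuityEqOn hT) hopt' hopt
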